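/- **Setting.** Let $M$ be a compact connected smooth $n$-manifold without boundary with a smooth positive volume density $\mu$, $\int_M\mu=1$ (for oriented $M$: a volume form). All objects are $C^\infty$. Let $G=\mathrm{Diff}(M)$, let $N=\mathrm{Diff}_\mu(M)=\{\varphi\in G:\varphi_*\mu=\mu\}$, and let $V=C^\infty(M)$ be the space of densities relative to $\mu$, on which $G$ acts by $\varphi\cdot\rho=|\mathrm{Det}(D\varphi^{-1})|\,\rho\circ\varphi^{-1}$, the density of $\varphi_*(\rho\mu)$; $|\mathrm{Det}|$ is taken with respect to $\mu$. On $V^*=C^\infty(M)$ the group $G$ acts by $a\mapsto a\circ\varphi^{-1}$. Let $S=G\ltimes V^*$ with $(\varphi,a)(\chi,b)=(\varphi\circ\chi,\,a+b\circ\varphi^{-1})$. Its Lie algebra is $\mathfrak s=\mathfrak X(M)\ltimes C^\infty(M)$ with $$[(v,\alpha),(w,\beta)]=-\big([v,w],\,v\beta-w\alpha\big),$$ where $[v,w]$ is the commutator of vector fields. Its regular dual is $\mathfrak s^*=\Omega^1(M)\times C^\infty(M)$ with $\langle(m,\rho),(v,\alpha)\rangle=\int_M(m(v)+\rho\alpha)\,\mu$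 and the Lie–Poisson bracket $\{F,H\}(x)=\langle x,[\delta F(x),\delta H(x)]\rangle$. Smoothness and derivatives in these spaces are tested along smooth curves, i.e. families depending smoothly on $(t,x)\in\mathbb R\times M$. Put $\mathrm{Dens}(M)=\{\rho\in C^\infty(M):\rho>0,\ \int\rho\,\mu=1\}$ and $T^*\mathrm{Dens}(M)=\mathrm{Dens}(M)\times C^\infty(M)/\mathbb R$, with the canonical symplectic form $\int(\dot\theta_1\dot\rho_2-\dot\theta_2\dot\rho_1)\mu$. Write $T^*G=G\times\Omega^1(M)$ in the right trivialization, with canonical symplectic form $\int(\dot m_1(v_2)-\dot m_2(v_1)-m([v_1,v_2]))\mu$; $N$ acts on $T^*G$ by $(\varphi,m)\cdot\eta=(\varphi\circ\eta,m)$. The Hamiltonian vector $V_f$ of $f$ is defined by $df(Y)=\Omega(Y,V_f)$, and $\{f,h\}=df(V_h)$. **Theorem.** 1. The orbit map $\gamma:G/N\to V$, $[\varphi]\mapsto\varphi\cdot1$, is well defined, injective and $G$-equivariant, with image $\mathrm{Dens}(M)$. It sends smooth curves of diffeomorphisms to smooth curves, and every smooth curve $\mathbb R\to\mathrm{Dens}(M)$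 lifts to a smooth curve in $G$. So $T^*(G/N)\cong T^*\mathrm{Dens}(M)$. 2. The map $T^*G/N=G/N\times\Omega^1(M)\to\mathfrak s^*$, $([\varphi],m)\mapsto(m,\gamma([\varphi]))$, is injective with image $\Omega^1(M)\times\mathrm{Dens}(M)$, and it is Poisson: its lift to $T^*G$ is smooth and intertwines the canonical and the Lie–Poisson brackets. 3. $T^*(G/N)$ is the zero-momentum symplectic reduction of $T^*G$ by $N$. A point $(\varphi,m)$ satisfies $\int m(\varphi_*w)\mu=0$ for all $\mu$-divergence-free $w$ if and only if $m=\rho\,d\theta$ with $\rho=\gamma([\varphi])$ for some $\theta\in C^\infty(M)$. On this zero level the symplectic form of $T^*G$ is the pullback of that of $T^*\mathrm{Dens}(M)$ under $(\varphi,\rho\,d\theta)\mapsto(\rho,[\theta])$ (evaluated on velocities of smooth curves). 4. The map $\iota:T^*(G/N)\to\mathfrak s^*$, $\iota(\rho,[\theta])=(\rho\,d\theta,\rho)$, is an injective immersion, and a curve $c$ is smooth if and only if $\iota\circ c$ is smooth. It is Poisson. Its image is a single symplectic leaf of $\mathfrak s^*$ (the set of points reachable from any one of its points along integral curves of smoothly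 time-dependent Hamiltonian vector fields) and a single coadjoint orbit of $S$. 5. $\iota$ is the equivariant momentum map of the action $(\varphi,a)\cdot(\rho,[\theta])=(\varphi\cdot\rho,[\theta\circ\varphi^{-1}-a])$ of $S$. That is, $\iota(g\cdot p)=\mathrm{Ad}^*_g\,\iota(p)$, and for every $\xi\in\mathfrak s$ the infinitesimal action of $\xi$ is the Hamiltonian vector field of $\langle\iota,\xi\rangle$. Every $\xi\in\mathfrak s$ is the velocity of a smooth curve in $S$ through the identity. 6. The inverse Madelung transform $\mathbf M:C^\infty(M,\mathbb C)\to\mathfrak s^*$, $\mathbf M(\psi)=(2\,\mathrm{Im}(\bar\psi\,d\psi),\bar\psi\psi)$, is, up to scaling by $4$, the equivariant momentum map of the action $(\varphi,a)\circ\psi=\sqrt{|\mathrm{Det}(D\varphi^{-1})|}\,e^{-ia/2}\,\psi\circ\varphi^{-1}$ of $S$. That is, $\mathbf M(g\circ\psi)=\mathrm{Ad}^*_g\mathbf M(\psi)$, and with respect to the form $\int\mathrm{Im}(\chi_1\bar\chi_2)\mu$ the Hamiltonian vector field of $\langle\mathbf M,\xi\rangle$ is $4$ times the infinitesimal action of $\xi$.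 $\mathbf M$ is Poisson for $4$ times this form. 7. $\mathbf M$ is realized by the reduction map $\iota$. For the Madelung transform $\Phi(\rho,\theta)=\sqrt\rho\,e^{i\theta/2}$, with $\rho\in\mathrm{Dens}(M)$, $\theta\in C^\infty(M)$, one has $\mathbf M(\Phi(\rho,\theta))=\iota(\rho,[\theta])$. Moreover $\mathbf M(\psi)=\iota(\rho,[\theta])$ if and only if $\psi=e^{i\tau}\Phi(\rho,\theta)$ for some constant $\tau\in\mathbb R$. For $g=(\varphi,a)\in S$ one has $g\circ\Phi(\rho,\theta)=\Phi(\varphi\cdot\rho,\theta\circ\varphi^{-1}-a)$. -/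

import Mathlib

open scoped Manifold ContDiff Topology
open MeasureTheory Set

noncomputable section

namespace Madelung

/-! ## Functions, wave functions, diffeomorphisms, vector fields and one-forms

Everything is of class `C^∞`. The manifold `M` is modelled on `ℝⁿ`, hence has no boundary. -/

abbrev Model (n : ℕ) := EuclideanSpace ℝ (Fin n)

section

variable (n : ℕ) (M : Type*) [TopologicalSpace M] [ChartedSpace (Model n) M]

/-- `C^∞(M)`. -/
abbrev Fun := C^∞⟮𝓡 n, M; 𝓘(ℝ, ℝ), ℝ⟯

/-- `C^∞(M, ℂ)`, the space of wave functions. -/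
abbrev Wave := C^∞⟮𝓡 n, M; 𝓘(ℝ, ℂ), ℂ⟯

/-- `Diff(M)`. -/
abbrev Dif := M ≃ₘ^∞⟮𝓡 n, 𝓡 n⟯ M

variable [IsManifold (𝓡 n) ∞ M]

/-- `𝔛(M)`, the smooth vector fields. -/
abbrev VField := Cₛ^∞⟮𝓡 n; Model n, (TangentSpace (𝓡 n) : M → Type _)⟯

/-- `Ω¹(M)`, the smooth one-forms. -/
abbrev Form :=
  Cₛ^∞⟮𝓡 n; Model n →L[ℝ] ℝ, fun x : M => TangentSpace (𝓡 n) x →L[ℝ] Bundle.Trivial M ℝ x⟯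

end

variable {n : ℕ} {M : Type*} [TopologicalSpace M] [ChartedSpace (Model n) M]

/-- `Diff(M)` is a group under composition, `φ * ψ = φ ∘ ψ`. -/
instance : Group (Dif n M) where
  mul φ ψ := ψ.trans φ
  one := Diffeomorph.refl (𝓡 n) M ∞
  inv φ := φ.symm
  mul_assoc _ _ _ := rfl
  one_mul _ := rfl
  mul_one _ := rfl
  inv_mul_cancel φ := φ.self_trans_symm

/-- The pushforward `a ↦ φ_* a = a ∘ φ⁻¹` of functions. -/
def funPush (φ : Dif n M) : Fun n M →ₗ[ℝ] Fun n M where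
  toFun a := a.comp ⟨φ.symm, φ.symm.contMDiff⟩
  map_add' _ _ := rfl
  map_smul' _ _ := rfl

/-- The left action of `Diff(M)` on the additive group `C^∞(M)` by pushforward. -/
def pushHom : Dif n M →* MulAut (Multiplicative (Fun n M)) where
  toFun φ :=
    { toFun := fun a => .ofAdd (funPush φ a.toAdd)
      invFun := fun a => .ofAdd (funPush φ⁻¹ a.toAdd)
      left_inv := fun a => by
        apply Multiplicative.toAdd.injective
        ext x
        exact congrArg a.toAdd (φ.symm_apply_apply x)
      right_inv := fun a => by
        apply Multiplicative.toAdd.injective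
        ext x
        exact congrArg a.toAdd (φ.apply_symm_apply x)
      map_mul' := fun _ _ => rfl }
  map_one' := rfl
  map_mul' _ _ := rfl

variable (n M) in
/-- The semidirect product group `S = Diff(M) ⋉ C^∞(M)`, with the multiplication
`(φ, a) (ψ, b) = (φ ∘ ψ, a + φ_* b)`; the component `φ` is `g.right`, and `a` is `phase g`. -/
abbrev SGroup := Multiplicative (Fun n M) ⋊[pushHom (n := n) (M := M)] Dif n M

/-- The component `a ∈ C^∞(M)` of `(φ, a) ∈ S`. -/
def phase (g : SGroup n M) : Fun n M := g.left.toAdd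

variable (n M) in
/-- The constant functions. -/
def constants : Submodule ℝ (Fun n M) := Submodule.span ℝ {1}

/-- The coset `[θ] ∈ C^∞(M) / ℝ`. -/
def coset (θ : Fun n M) : Fun n M ⧸ constants n M := (constants n M).mkQ θ

/-- The pushforward `[θ] ↦ [θ ∘ φ⁻¹]` of cosets. -/
def cosetPush (φ : Dif n M) : (Fun n M ⧸ constants n M) →ₗ[ℝ] (Fun n M ⧸ constants n M) :=
  (constants n M).mapQ (constants n M) (funPush φ) (by
    rw [constants, Submodule.span_le, singleton_subset_iff]
    exact Submodule.subset_span rfl)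

/-- The wave function `√r e^{ia/2} ψ`, for `r > 0`. -/
def polar (r a : Fun n M) (hr : ∀ x, 0 < r x) (ψ : Wave n M) : Wave n M :=
  ⟨fun x => (Real.sqrt (r x) : ℂ) * Complex.exp (Complex.I * (a x : ℂ) / 2) * ψ x, by
    intro x
    have h1 : ContDiffAt ℝ ∞ (fun q : ℝ × ℝ × ℂ =>
        (Real.sqrt q.1 : ℂ) * Complex.exp (Complex.I * (q.2.1 : ℂ) / 2) * q.2.2)
        (r x, a x, ψ x) := by
      have e1 : ContDiffAt ℝ ∞ (fun q : ℝ × ℝ × ℂ => (Real.sqrt q.1 : ℂ)) (r x, a x, ψ x) :=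
        Complex.ofRealCLM.contDiff.contDiffAt.comp _ (contDiffAt_fst.sqrt (hr x).ne')
      have e2 : ContDiff ℝ ∞ (fun q : ℝ × ℝ × ℂ => (q.2.1 : ℂ)) :=
        Complex.ofRealCLM.contDiff.comp (contDiff_fst.comp contDiff_snd)
      have e3 : ContDiff ℝ ∞ (fun q : ℝ × ℝ × ℂ => Complex.exp (Complex.I * (q.2.1 : ℂ) / 2)) :=
        ((contDiff_const.mul e2).div_const 2).cexp
      exact (e1.mul e3.contDiffAt).mul (contDiff_snd.comp contDiff_snd).contDiffAt
    exact h1.contMDiffAt.comp x ((r.contMDiff x).prodMk_space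
      ((a.contMDiff x).prodMk_space (ψ.contMDiff x)))⟩

/-- The pushforward `ψ ∘ φ⁻¹` of a complex-valued function. -/
def wavePush (φ : Dif n M) (ψ : Wave n M) : Wave n M := ψ.comp ⟨φ.symm, φ.symm.contMDiff⟩

/-- The real and imaginary parts of a wave function. -/
def rePart (ψ : Wave n M) : Fun n M :=
  ⟨fun x => (ψ x).re, Complex.reCLM.contDiff.contMDiff.comp ψ.contMDiff⟩

def imPart (ψ : Wave n M) : Fun n M :=
  ⟨fun x => (ψ x).im, Complex.imCLM.contDiff.contMDiff.comp ψ.contMDiff⟩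

/-- `ψ ↦ ψ̄ ψ`. -/
def absSq (ψ : Wave n M) : Fun n M :=
  ⟨fun x => Complex.normSq (ψ x), by
    have h : (fun x => Complex.normSq (ψ x)) = ⇑(rePart ψ * rePart ψ + imPart ψ * imPart ψ) := by
      ext x
      exact Complex.normSq_apply (ψ x)
    rw [h]
    exact ContMDiffMap.contMDiff _⟩

variable [IsManifold (𝓡 n) ∞ M]

/-- The exterior derivative `d : C^∞(M) → Ω¹(M)`. -/
def differential : Fun n M →ₗ[ℝ] Form n M where
  toFun f :=
    { toFun := fun x => mfderiv (𝓡 n) 𝓘(ℝ, ℝ) f x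
      contMDiff_toFun := by
        intro x₀
        rw [contMDiffAt_hom_bundle]
        refine ⟨contMDiffAt_id, ?_⟩
        have := ContMDiffAt.mfderiv_const (m := ∞) (f.contMDiff x₀) (by simp)
        convert! this using 1
        ext x : 1
        simp only [inTangentCoordinates, ContinuousLinearMap.inCoordinates]
        ext v
        simp
        rfl }
  map_add' f g := by
    ext x v
    have := mfderiv_add ((f.contMDiff x).mdifferentiableAt (by simp)) ((g.contMDiff x).mdifferentiableAt (by simp))
    exact congrArg (fun L => L v) this
  map_smul' c f := by
    ext x v
    have := const_smul_mfderiv ((f.contMDiff x).mdifferentiableAt (by simp)) c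
    exact congrArg (fun L => L v) this

/-- `d` on cosets of functions modulo constants. -/
def differentialMod : (Fun n M ⧸ constants n M) →ₗ[ℝ] Form n M :=
  (constants n M).liftQ differential (by
    rw [constants, Submodule.span_le, singleton_subset_iff]
    change differential 1 = 0
    ext x v
    have : mfderiv (𝓡 n) 𝓘(ℝ, ℝ) (fun _ : M => (1:ℝ)) x = 0 := mfderiv_const
    exact congrArg (fun L => L v) this)

/-- The commutator `[v, w]` of vector fields, `[v, w] f = v (w f) - w (v f)`. -/
def bracket (v w : VField n M) : VField n M :=
  ⟨fun x => VectorField.mlieBracket (𝓡 n) v w x, by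
    intro x
    have : IsManifold (𝓡 n) (minSmoothness ℝ 2) M := by
      simp only [minSmoothness_of_isRCLikeNormedField]
      infer_instance
    have : IsManifold (𝓡 n) (((⊤ : ℕ∞) : WithTop ℕ∞) + 1) M := ‹IsManifold (𝓡 n) ∞ M›
    have h := ContMDiffAt.mlieBracket_vectorField (m := ⊤) (n := ⊤) (v.contMDiff x) (w.contMDiff x) (by simp)
    exact h⟩

/-- The pushforward `φ_* v = Dφ ∘ v ∘ φ⁻¹` of a vector field. -/
def push (φ : Dif n M) (v : VField n M) : VField n M :=
  ⟨VectorField.mpullback (𝓡 n) (𝓡 n) φ.symm v, by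
    refine ContMDiff.mpullback_vectorField (n := ∞) v.contMDiff φ.symm.contMDiff ?_ (by simp)
    intro x
    exact ⟨φ.symm.mfderivToContinuousLinearEquiv (by simp) x, rfl⟩⟩

/-- The function `m(v) = ι_v m`. -/
def contract (m : Form n M) (v : VField n M) : Fun n M :=
  ⟨fun x => m x (v x), by
    have := ContMDiff.clm_bundle_apply m.contMDiff v.contMDiff
    intro x
    have h := (Bundle.contMDiffAt_section _).1 (this x)
    simpa using h⟩

/-- The derivative `v f = ι_v df`. -/
def lie (v : VField n M) (f : Fun n M) : Fun n M := contract (differential f) v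

/-- The one-form `f m`. -/
def scale (f : Fun n M) (m : Form n M) : Form n M :=
  ⟨fun x => f x • m x, f.contMDiff.smul_section m.contMDiff⟩

/-- The one-form `2 Im (ψ̄ dψ)`. -/
def momentumForm (ψ : Wave n M) : Form n M :=
  ⟨fun x => (2 : ℝ) • (Complex.imCLM ∘L
      (ContinuousLinearMap.mul ℝ ℂ (star (ψ x)) ∘L mfderiv (𝓡 n) 𝓘(ℝ, ℂ) ψ x)), by
    have h := ((2 : ℝ) • (scale (rePart ψ) (differential (imPart ψ))
      - scale (imPart ψ) (differential (rePart ψ)))).contMDiff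
    convert h using 2 with x
    congr 1
    have hd : MDifferentiableAt (𝓡 n) 𝓘(ℝ, ℂ) ψ x :=
      (ψ.contMDiff x).mdifferentiableAt (by simp)
    have hre : mfderiv (𝓡 n) 𝓘(ℝ, ℝ) (rePart ψ) x
        = Complex.reCLM ∘L mfderiv (𝓡 n) 𝓘(ℝ, ℂ) ψ x := by
      have := (Complex.reCLM.hasFDerivAt (x := ψ x)).hasMFDerivAt.comp x hd.hasMFDerivAt
      exact this.mfderiv
    have him : mfderiv (𝓡 n) 𝓘(ℝ, ℝ) (imPart ψ) x
        = Complex.imCLM ∘L mfderiv (𝓡 n) 𝓘(ℝ, ℂ) ψ x := by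
      have := (Complex.imCLM.hasFDerivAt (x := ψ x)).hasMFDerivAt.comp x hd.hasMFDerivAt
      exact this.mfderiv
    ext u
    set L : TangentSpace (𝓡 n) x →L[ℝ] ℂ := mfderiv (𝓡 n) 𝓘(ℝ, ℂ) ψ x
    have hre' : (differential (rePart ψ) x u : ℝ) = (L u).re := congrArg (fun K => K u) hre
    have him' : (differential (imPart ψ) x u : ℝ) = (L u).im := congrArg (fun K => K u) him
    change (2 : ℝ) * (star (ψ x) * L u).im
      = (2 : ℝ) * ((ψ x).re * (differential (imPart ψ) x u : ℝ)
        - (ψ x).im * (differential (rePart ψ) x u : ℝ))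
    rw [hre', him']
    rw [Complex.mul_im]
    simp
    ring⟩

/-! ## Smooth volumes and the pushforward of densities -/

/-- `μ` is the measure of a smooth positive volume density: in each chart of the smooth structure it
has a smooth positive density with respect to the Lebesgue measure. If `M` is oriented, these are
the measures given by the volume forms on `M`. -/
class IsSmoothVolume (n : ℕ) {M : Type*} [TopologicalSpace M] [ChartedSpace (Model n) M]
    [IsManifold (𝓡 n) ∞ M] [MeasurableSpace M] (μ : Measure M) : Prop where
  exists_density : ∀ e ∈ IsManifold.maximalAtlas (𝓡 n) ∞ M, ∃ h : Model n → ℝ,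
    ContDiffOn ℝ ∞ h e.target ∧ (∀ y ∈ e.target, 0 < h y) ∧
      ∀ s : Set (Model n), MeasurableSet s →
        μ (e.source ∩ e ⁻¹' s) = ∫⁻ y in e.target ∩ s, ENNReal.ofReal (h y)

variable [MeasurableSpace M] [BorelSpace M]

lemma aemeasurable_chart {n : ℕ} {M : Type*} [TopologicalSpace M] [MeasurableSpace M] [BorelSpace M]
    (μ : Measure M) (e : OpenPartialHomeomorph M (Model n)) :
    AEMeasurable e (μ.restrict e.source) :=
  e.continuousOn.aemeasurable e.open_source.measurableSet

lemma map_chart {n : ℕ} {M : Type*} [TopologicalSpace M] [MeasurableSpace M] [BorelSpace M]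
    {μ : Measure M} {e : OpenPartialHomeomorph M (Model n)} {h : Model n → ℝ}
    (hs : ∀ s : Set (Model n), MeasurableSet s →
        μ (e.source ∩ e ⁻¹' s) = ∫⁻ y in e.target ∩ s, ENNReal.ofReal (h y)) :
    (μ.restrict e.source).map e
      = (volume.restrict e.target).withDensity (fun y => ENNReal.ofReal (h y)) := by
  ext s hsm
  rw [Measure.map_apply_of_aemeasurable (aemeasurable_chart μ e) hsm, withDensity_apply _ hsm,
    Measure.restrict_restrict hsm, inter_comm s, ← hs s hsm,
    Measure.restrict_apply₀ ((aemeasurable_chart μ e).nullMeasurable hsm), inter_comm]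

lemma measure_chart_eq {n : ℕ} {M : Type*} [TopologicalSpace M] [MeasurableSpace M]
    [BorelSpace M] {μ ν : Measure M} {e : OpenPartialHomeomorph M (Model n)}
    {h k : Model n → ℝ} (hc : ContinuousOn h e.target) (kc : ContinuousOn k e.target)
    (hpos : ∀ y ∈ e.target, 0 < h y)
    (hs : ∀ s : Set (Model n), MeasurableSet s →
        μ (e.source ∩ e ⁻¹' s) = ∫⁻ y in e.target ∩ s, ENNReal.ofReal (h y))
    (ks : ∀ s : Set (Model n), MeasurableSet s →
        ν (e.source ∩ e ⁻¹' s) = ∫⁻ y in e.target ∩ s, ENNReal.ofReal (k y))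
    {A : Set M} (hA : MeasurableSet A) (hAe : A ⊆ e.source) :
    ν A = ∫⁻ x in A, ENNReal.ofReal (k (e x) / h (e x)) ∂μ := by
  have tm := e.open_target.measurableSet
  -- a measurable set of chart coordinates whose preimage is the given set
  obtain ⟨s, hsm, hsA⟩ : ∃ s : Set (Model n), MeasurableSet s ∧ A = e.source ∩ e ⁻¹' s := by
    refine ⟨e.target ∩ e.symm ⁻¹' A, ?_, ?_⟩
    · have h1 : Measurable (e.target.domRestrict e.symm) :=
        (continuousOn_iff_continuous_domRestrict.1 e.continuousOn_symm).measurable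
      have h2 := tm.subtype_image (h1 hA)
      convert h2 using 1
      ext y
      constructor
      · rintro ⟨hy, hy'⟩
        exact ⟨⟨y, hy⟩, hy', rfl⟩
      · rintro ⟨⟨z, hz⟩, hz', rfl⟩
        exact ⟨hz, hz'⟩
    · ext x
      constructor
      · intro hx
        exact ⟨hAe hx, e.map_source (hAe hx), by simpa [e.left_inv (hAe hx)] using hx⟩
      · rintro ⟨hx, -, hx'⟩
        simpa [e.left_inv hx] using hx'
  have qm : AEMeasurable (fun y => ENNReal.ofReal (k y / h y)) (volume.restrict e.target) :=
    ((kc.div hc fun y hy => (hpos y hy).ne').aemeasurable tm).ennreal_ofReal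
  have hm : AEMeasurable (fun y => ENNReal.ofReal (h y)) (volume.restrict e.target) :=
    (hc.aemeasurable tm).ennreal_ofReal
  have key : ∫⁻ x in A, ENNReal.ofReal (k (e x) / h (e x)) ∂μ
      = ∫⁻ y in s, ENNReal.ofReal (k y / h y) ∂((μ.restrict e.source).map e) := by
    have : (μ.restrict A) = (μ.restrict e.source).restrict (e ⁻¹' s) := by
      rw [Measure.restrict_restrict₀ ((aemeasurable_chart μ e).nullMeasurable hsm),
        inter_comm, ← hsA]
    rw [this, Measure.restrict_map_of_aemeasurable (aemeasurable_chart μ e) hsm, lintegral_map']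
    · rw [← Measure.restrict_map_of_aemeasurable (aemeasurable_chart μ e) hsm, map_chart hs]
      exact (qm.mono_ac (withDensity_absolutelyContinuous _ _)).mono_measure
        Measure.restrict_le_self
    · exact (aemeasurable_chart μ e).mono_measure Measure.restrict_le_self
  rw [key, map_chart hs, hsA, ks s hsm, restrict_withDensity hsm,
    lintegral_withDensity_eq_lintegral_mul₀ (hm.mono_measure Measure.restrict_le_self)
      (qm.mono_measure Measure.restrict_le_self),
    Measure.restrict_restrict hsm, inter_comm s]
  refine setLIntegral_congr_fun (tm.inter hsm) fun y hy => ?_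
  have := hpos y hy.1
  simp only [Pi.mul_apply]
  rw [← ENNReal.ofReal_mul this.le, mul_div_cancel₀ _ this.ne']

instance isSmoothVolume_map (μ : Measure M) [hμ : IsSmoothVolume n μ] (φ : Dif n M) :
    IsSmoothVolume n (μ.map φ) where
  exists_density e he := by
    let f := φ.toHomeomorph.toOpenPartialHomeomorph.trans e
    have hf : f ∈ IsManifold.maximalAtlas (𝓡 n) ∞ M := by
      apply OpenPartialHomeomorph.mem_maximalAtlas_of_contMDiffOn
      · exact (contMDiffOn_of_mem_maximalAtlas he).comp φ.contMDiff.contMDiffOn (by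
          intro x hx; simpa [f] using hx)
      · exact φ.symm.contMDiff.comp_contMDiffOn
          ((contMDiffOn_symm_of_mem_maximalAtlas he).mono (by intro x hx; simpa [f] using hx))
    obtain ⟨h, h1, h2, h3⟩ := hμ.exists_density f hf
    have ht : f.target = e.target := by simp [f]
    rw [ht] at h1 h2 h3
    refine ⟨h, h1, h2, fun s hs => ?_⟩
    rw [← h3 s hs]
    change (μ.map φ.toHomeomorph) _ = _
    rw [φ.toHomeomorph.measurableEmbedding.map_apply]
    congr 1
    ext x
    simp [f]

/-- A smooth volume charges every nonempty open set. -/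
lemma isOpenPosMeasure (n : ℕ) {M : Type*} [TopologicalSpace M] [ChartedSpace (Model n) M]
    [IsManifold (𝓡 n) ∞ M] [MeasurableSpace M] [BorelSpace M] (μ : Measure M)
    [hμ : IsSmoothVolume n μ] : μ.IsOpenPosMeasure where
  open_pos U hU hne := by
    obtain ⟨x, hx⟩ := hne
    obtain ⟨h, h1, h2, h3⟩ := hμ.exists_density _
      (IsManifold.chart_mem_maximalAtlas (I := 𝓡 n) (n := ∞) x)
    set e := chartAt (Model n) x
    intro h0
    have hV : IsOpen (e.target ∩ e.symm ⁻¹' U) := e.isOpen_inter_preimage_symm hU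
    have := h3 _ hV.measurableSet
    have hz : μ (e.source ∩ e ⁻¹' (e.target ∩ e.symm ⁻¹' U)) = 0 := by
      refine measure_mono_null ?_ h0
      rintro y ⟨hy, -, hy'⟩
      simpa [e.left_inv hy] using hy'
    rw [hz, ← inter_assoc, inter_self, eq_comm,
      lintegral_eq_zero_iff' ((h1.continuousOn.mono inter_subset_left).aemeasurable
        hV.measurableSet).ennreal_ofReal, Filter.EventuallyEq,
      ae_restrict_iff' hV.measurableSet] at this
    have h5 : (volume : Measure (Model n)) (e.target ∩ e.symm ⁻¹' U) = 0 := by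
      refine measure_mono_null (fun y hy => ?_) this
      have := h2 y hy.1
      simp [hy.1, this]
      simpa using hy.2
    refine (hV.measure_ne_zero volume ⟨e x, ?_⟩) h5
    exact ⟨e.map_source (mem_chart_source _ x), by
      simpa [e, e.left_inv (mem_chart_source _ x)] using hx⟩

/-- Any smooth volume has a smooth positive density with respect to any other. -/
lemma exists_ratio [SecondCountableTopology M] (μ ν : Measure M) [IsFiniteMeasure ν]
    [hμ : IsSmoothVolume n μ] [hν : IsSmoothVolume n ν] :
    ∃ J : Fun n M, (∀ x, 0 < J x) ∧ ν = μ.withDensity (fun x => ENNReal.ofReal (J x)) := by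
  have := isOpenPosMeasure n μ
  have cm := fun x : M => IsManifold.chart_mem_maximalAtlas (I := 𝓡 n) (n := ∞) x
  choose h h1 h2 h3 using fun x : M => hμ.exists_density _ (cm x)
  choose k k1 k2 k3 using fun x : M => hν.exists_density _ (cm x)
  let Q : M → M → ℝ := fun x y => k x (chartAt (Model n) x y) / h x (chartAt (Model n) x y)
  have Qc : ∀ x, ContMDiffOn (𝓡 n) 𝓘(ℝ, ℝ) ∞ (Q x) (chartAt (Model n) x).source := by
    intro x
    have : ContDiffOn ℝ ∞ (fun y => k x y / h x y) (chartAt (Model n) x).target :=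
      (k1 x).div (h1 x) fun y hy => (h2 x y hy).ne'
    exact this.contMDiffOn.comp (contMDiffOn_of_mem_maximalAtlas (cm x))
      (fun y hy => (chartAt (Model n) x).map_source hy)
  have Qpos : ∀ x y, y ∈ (chartAt (Model n) x).source → 0 < Q x y := fun x y hy =>
    div_pos (k2 x _ ((chartAt (Model n) x).map_source hy))
      (h2 x _ ((chartAt (Model n) x).map_source hy))
  have Qm : ∀ x A, MeasurableSet A → A ⊆ (chartAt (Model n) x).source →
      ν A = ∫⁻ y in A, ENNReal.ofReal (Q x y) ∂μ := fun x A hA hAs =>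
    measure_chart_eq (h1 x).continuousOn (k1 x).continuousOn (h2 x) (h3 x) (k3 x) hA hAs
  have Qeq : ∀ x y z, z ∈ (chartAt (Model n) x).source → z ∈ (chartAt (Model n) y).source →
      Q x z = Q y z := by
    intro x y z hx hy
    set U := (chartAt (Model n) x).source ∩ (chartAt (Model n) y).source with hU
    have Uo : IsOpen U := (chartAt (Model n) x).open_source.inter (chartAt (Model n) y).open_source
    have cx : ContinuousOn (Q x) U := (Qc x).continuousOn.mono inter_subset_left
    have cy : ContinuousOn (Q y) U := (Qc y).continuousOn.mono inter_subset_right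
    have ae : (fun z => ENNReal.ofReal (Q x z)) =ᵐ[μ.restrict U]
        fun z => ENNReal.ofReal (Q y z) := by
      refine AEMeasurable.ae_eq_of_forall_setLIntegral_eq
        (cx.aemeasurable Uo.measurableSet).ennreal_ofReal
        (cy.aemeasurable Uo.measurableSet).ennreal_ofReal ?_ ?_ ?_
      · rw [← Qm x U Uo.measurableSet inter_subset_left]; exact measure_ne_top _ _
      · rw [← Qm y U Uo.measurableSet inter_subset_right]; exact measure_ne_top _ _
      · intro s hs _
        rw [Measure.restrict_restrict hs,
          ← Qm x _ (hs.inter Uo.measurableSet) (inter_subset_right.trans inter_subset_left),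
          ← Qm y _ (hs.inter Uo.measurableSet) (inter_subset_right.trans inter_subset_right)]
    have := Measure.eqOn_open_of_ae_eq ae Uo
      (ENNReal.continuous_ofReal.comp_continuousOn cx)
      (ENNReal.continuous_ofReal.comp_continuousOn cy) ⟨hx, hy⟩
    exact (ENNReal.ofReal_eq_ofReal_iff (Qpos x z hx).le (Qpos y z hy).le).1 this
  have loc : ∀ x, ∀ y ∈ (chartAt (Model n) x).source, Q y y = Q x y := fun x y hy =>
    Qeq y x y (mem_chart_source _ y) hy
  refine ⟨⟨fun x => Q x x, fun x => ?_⟩, fun x => Qpos x x (mem_chart_source _ x), ?_⟩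
  · have := (Qc x).contMDiffAt ((chartAt (Model n) x).open_source.mem_nhds (mem_chart_source _ x))
    refine this.congr_of_eventuallyEq ?_
    filter_upwards [(chartAt (Model n) x).open_source.mem_nhds (mem_chart_source _ x)] with y hy
    exact loc x y hy
  · obtain ⟨s, hs, hcov⟩ := TopologicalSpace.isOpen_iUnion_countable
      (fun x : M => (chartAt (Model n) x).source) (fun x => (chartAt (Model n) x).open_source)
    have hcov' : (⋃ x ∈ s, (chartAt (Model n) x).source) = univ := by
      rw [hcov]; exact iUnion_eq_univ_iff.2 fun x => ⟨x, mem_chart_source _ x⟩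
    refine (Measure.ext_iff_of_biUnion_eq_univ hs hcov').2 fun x _ => ?_
    ext A hA
    rw [Measure.restrict_apply hA, Measure.restrict_apply hA, withDensity_apply _
      (hA.inter (chartAt (Model n) x).open_source.measurableSet),
      Qm x _ (hA.inter (chartAt (Model n) x).open_source.measurableSet) inter_subset_right]
    refine setLIntegral_congr_fun (hA.inter (chartAt (Model n) x).open_source.measurableSet)
      fun y hy => ?_
    rw [← loc x y hy.2]
    rfl

section

variable [CompactSpace M] (μ : Measure M) [IsProbabilityMeasure μ] [IsSmoothVolume n μ]

lemma exists_jac (φ : Dif n M) : ∃ J : Fun n M, (∀ x, 0 < J x) ∧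
    μ.map φ = μ.withDensity (fun x => ENNReal.ofReal (J x)) := by
  have : SecondCountableTopology M := ChartedSpace.secondCountable_of_sigmaCompact (Model n) M
  have : IsFiniteMeasure (μ.map φ) := Measure.isFiniteMeasure_map μ φ
  exact exists_ratio μ (μ.map φ)

/-- The Jacobian `|Det(Dφ⁻¹)|` with respect to `μ`, that is, the smooth positive density of `φ_* μ`
with respect to `μ`. -/
def jac (φ : Dif n M) : Fun n M := (exists_jac μ φ).choose

lemma jac_pos (φ : Dif n M) (x : M) : 0 < jac μ φ x := (exists_jac μ φ).choose_spec.1 x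

lemma map_eq_withDensity_jac (φ : Dif n M) :
    μ.map φ = μ.withDensity (fun x => ENNReal.ofReal (jac μ φ x)) :=
  (exists_jac μ φ).choose_spec.2

lemma eq_jac {φ : Dif n M} {J : Fun n M} (hJ : ∀ x, 0 < J x)
    (h : μ.map φ = μ.withDensity (fun x => ENNReal.ofReal (J x))) : J = jac μ φ := by
  have := isOpenPosMeasure n μ
  have hc : Continuous J := J.contMDiff.continuous
  have hc' : Continuous (jac μ φ) := (jac μ φ).contMDiff.continuous
  rw [map_eq_withDensity_jac μ φ, withDensity_eq_iff
    hc'.measurable.ennreal_ofReal.aemeasurable hc.measurable.ennreal_ofReal.aemeasurable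
    (by rw [← setLIntegral_univ, ← withDensity_apply _ MeasurableSet.univ,
      ← map_eq_withDensity_jac μ φ]
        rw [Measure.map_apply φ.continuous.measurable MeasurableSet.univ]
        exact measure_ne_top _ _)] at h
  have h2 := (Continuous.ae_eq_iff_eq μ (ENNReal.continuous_ofReal.comp hc')
    (ENNReal.continuous_ofReal.comp hc)).1 h
  ext x
  exact ((ENNReal.ofReal_eq_ofReal_iff (jac_pos μ φ x).le (hJ x).le).1 (congrFun h2 x)).symm

/-- The representation of `Diff(M)` on the space `V = C^∞(M)` of densities (relative to `μ`):
`densityPush μ φ ρ = |Det(Dφ⁻¹)| ρ ∘ φ⁻¹` is the density of `φ_* (ρ μ)`. The dual action on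
`V* = C^∞(M)` is the pushforward of functions. -/
def densityPush (φ : Dif n M) (ρ : Fun n M) : Fun n M := funPush φ ρ * jac μ φ

/-- `Dens(M)`, the positive densities of total mass one. -/
def densities : Set (Fun n M) := {ρ | (∀ x, 0 < ρ x) ∧ ∫ x, ρ x ∂μ = 1}

lemma densityPush_mem {φ : Dif n M} {ρ : Fun n M} (h : ρ ∈ densities μ) :
    densityPush μ φ ρ ∈ densities μ := by
  refine ⟨fun x => mul_pos (h.1 _) (jac_pos μ φ x), ?_⟩
  have hm : Measurable fun x => ENNReal.ofReal (jac μ φ x) :=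
    (jac μ φ).contMDiff.continuous.measurable.ennreal_ofReal
  calc ∫ x, densityPush μ φ ρ x ∂μ
      = ∫ x, (ENNReal.ofReal (jac μ φ x)).toReal • ρ (φ.symm x) ∂μ := by
        refine integral_congr_ae (Filter.Eventually.of_forall fun x => ?_)
        simp only [ENNReal.toReal_ofReal (jac_pos μ φ x).le, smul_eq_mul]
        exact mul_comm _ _
    _ = ∫ x, ρ (φ.symm x) ∂(μ.map φ) := by
        rw [map_eq_withDensity_jac, integral_withDensity_eq_integral_toReal_smul hm
          (Filter.Eventually.of_forall fun x => ENNReal.ofReal_lt_top)]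
    _ = ∫ x, ρ (φ.symm (φ x)) ∂μ := φ.toHomeomorph.measurableEmbedding.integral_map _
    _ = 1 := by simpa using h.2

/-- `N = Diff_μ(M)`, the subgroup of volume-preserving diffeomorphisms. -/
def volumePreserving : Subgroup (Dif n M) where
  carrier := {φ | μ.map φ = μ}
  mul_mem' {φ ψ} hφ hψ := by
    have : μ.map (φ ∘ ψ) = (μ.map ψ).map φ :=
      (Measure.map_map φ.continuous.measurable ψ.continuous.measurable).symm
    exact this.trans (by rw [hψ, hφ])
  one_mem' := Measure.map_id
  inv_mem' {φ} hφ := by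
    have h : μ.map (φ.symm ∘ φ) = (μ.map φ).map φ.symm :=
      (Measure.map_map φ.symm.continuous.measurable φ.continuous.measurable).symm
    have hi : (φ.symm ∘ φ : M → M) = id := funext φ.symm_apply_apply
    rw [hφ, hi, Measure.map_id] at h
    exact h.symm

/-- The orbit map `γ : G/N → V`, `[φ] ↦ φ · 1`, the density of `φ_* μ`. -/
def orbitMap : (Dif n M ⧸ volumePreserving (n := n) μ) → Fun n M :=
  Quotient.lift (fun φ => densityPush μ φ 1) (by
    intro φ ψ h
    have h' : φ⁻¹ * ψ ∈ volumePreserving (n := n) μ := QuotientGroup.leftRel_apply.1 h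
    have hc : μ.map ψ = μ.map φ := by
      have e : (ψ : M → M) = φ ∘ (φ⁻¹ * ψ : Dif n M) :=
        funext fun x => (φ.apply_symm_apply (ψ x)).symm
      rw [e, ← Measure.map_map φ.continuous.measurable (φ⁻¹ * ψ).continuous.measurable,
        show μ.map (φ⁻¹ * ψ : Dif n M) = μ from h']
    have hj : jac μ φ = jac μ ψ :=
      eq_jac μ (jac_pos μ φ) (by rw [hc, map_eq_withDensity_jac])
    simp only [densityPush, hj]
    rfl)

/-! ## The Lie algebra `𝔰 = 𝔛(M) ⋉ C^∞(M)` of `S` and its (regular) dual `𝔰*` -/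

variable (n M) in
/-- `𝔰 = 𝔛(M) ⋉ C^∞(M)`. -/
abbrev SAlg := VField n M × Fun n M

/-- The Lie bracket of `𝔰`,
`[(v, α), (w, β)] = -([v, w], v β - w α)`, where `[v, w]` is the commutator of vector fields. (The
adjoint action of a diffeomorphism is the pushforward, so the bracket of the Lie algebra of
`Diff(M)` is minus the commutator; and `v` acts on functions by `β ↦ -v β`.) -/
def algBracket (ξ η : SAlg n M) : SAlg n M :=
  (-bracket ξ.1 η.1, -(lie ξ.1 η.2 - lie η.1 ξ.2))

/-- The adjoint action `Ad_{(φ, a)} (w, β) = (φ_* w, φ_* β + (φ_* w) a)`, the derivative at `t = 0`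
of `(φ, a) h_t (φ, a)⁻¹` for a curve `h_t` in `S` through the identity with velocity `(w, β)`. -/
def adjoint (g : SGroup n M) (ξ : SAlg n M) : SAlg n M :=
  (push g.right ξ.1, funPush g.right ξ.2 + lie (push g.right ξ.1) (phase g))

variable (n M) in
/-- The regular dual `𝔰* = Ω¹(M) × C^∞(M)`; the pair `(m, ρ)` stands for `(m ⊗ μ, ρ μ)`. -/
abbrev SDual := Form n M × Fun n M

/-- The pairing `⟨(m, ρ), (v, α)⟩ = ∫ (m(v) + ρ α) μ`. -/
def pairing (x : SDual n M) (ξ : SAlg n M) : ℝ :=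
  ∫ p, (contract x.1 ξ.1 p + x.2 p * ξ.2 p) ∂μ

/-- `y = Ad*_g x`, that is, `⟨y, Ad_g ξ⟩ = ⟨x, ξ⟩` for all `ξ`. -/
def IsCoadjoint (g : SGroup n M) (x y : SDual n M) : Prop :=
  ∀ ξ : SAlg n M, pairing μ y (adjoint g ξ) = pairing μ x ξ

/-- The coadjoint orbit of `x` under the group `S`. -/
def coadjointOrbit (x : SDual n M) : Set (SDual n M) := {y | ∃ g : SGroup n M, IsCoadjoint μ g x y}

/-! ## Smooth curves and differentials

A smooth curve in one of the spaces of this file is a family that depends smoothly on `(t, x)`.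
Smooth curves determine the smooth structure of Fréchet spaces and manifolds. -/

/-- The smooth curves `c : ℝ → X` of a space `X`, and the relation saying that a curve has a given
tangent vector as its velocity at time `0`. -/
structure Curves (X T : Type*) where
  smooth : (ℝ → X) → Prop
  velocity : (ℝ → X) → T → Prop

/-- The differential of `f : X → ℝ` at `x` exists and is `ℓ`: along every smooth curve through `x`,
`f` has the derivative `ℓ v`, where `v` is the velocity of the curve. -/
def HasDifferential {X T : Type*} (C : Curves X T) (f : X → ℝ) (x : X) (ℓ : T → ℝ) : Prop :=
  ∀ c, C.smooth c → c 0 = x → ∀ v, C.velocity c v → HasDerivAt (fun t => f (c t)) (ℓ v) 0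

end

section

variable {F : Type*} [NormedAddCommGroup F] [NormedSpace ℝ F]

/-- Smooth curves of functions. -/
def SmoothFun (c : ℝ → C^∞⟮𝓡 n, M; 𝓘(ℝ, F), F⟯) : Prop :=
  ContMDiff (𝓘(ℝ, ℝ).prod (𝓡 n)) 𝓘(ℝ, F) ∞ (fun p : ℝ × M => c p.1 p.2)

def VelocityFun (c : ℝ → C^∞⟮𝓡 n, M; 𝓘(ℝ, F), F⟯) (y : C^∞⟮𝓡 n, M; 𝓘(ℝ, F), F⟯) : Prop :=
  ∀ x, HasDerivAt (fun t => c t x) (y x) 0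

end

/-- Smooth curves of one-forms. -/
def SmoothForm (m : ℝ → Form n M) : Prop :=
  ContMDiff (𝓘(ℝ, ℝ).prod (𝓡 n)) ((𝓡 n).prod 𝓘(ℝ, Model n →L[ℝ] ℝ)) ∞
    (fun p : ℝ × M => (⟨p.2, m p.1 p.2⟩ : Bundle.TotalSpace (Model n →L[ℝ] ℝ)
      (fun x : M => TangentSpace (𝓡 n) x →L[ℝ] Bundle.Trivial M ℝ x)))

def VelocityForm (m : ℝ → Form n M) (y : Form n M) : Prop :=
  ∀ (x : M) (u : TangentSpace (𝓡 n) x),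
    HasDerivAt (fun t => (m t x u : ℝ)) (y x u : ℝ) 0

/-- Smooth curves of vector fields. -/
def SmoothField (v : ℝ → VField n M) : Prop :=
  ContMDiff (𝓘(ℝ, ℝ).prod (𝓡 n)) ((𝓡 n).prod 𝓘(ℝ, Model n)) ∞
    (fun p : ℝ × M => (⟨p.2, v p.1 p.2⟩ : Bundle.TotalSpace (Model n)
      (TangentSpace (𝓡 n) : M → Type _)))

/-- Smooth curves of diffeomorphisms. -/
def SmoothDif (φ : ℝ → Dif n M) : Prop :=
  ContMDiff (𝓘(ℝ, ℝ).prod (𝓡 n)) (𝓡 n) ∞ (fun p : ℝ × M => φ p.1 p.2)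

/-- The velocity of `φ_t` at `t = 0` is `v ∘ φ_0`. -/
def VelocityDif (φ : ℝ → Dif n M) (v : VField n M) : Prop :=
  ∀ x, HasMFDerivAt 𝓘(ℝ, ℝ) (𝓡 n) (fun t => φ t x) 0
    ((1 : ℝ →L[ℝ] ℝ).smulRight (v (φ 0 x)))

/-- Smooth curves in `𝔰`. -/
def SmoothAlg (ξ : ℝ → SAlg n M) : Prop :=
  SmoothField (fun t => (ξ t).1) ∧ SmoothFun (fun t => (ξ t).2)

/-- `g` is a smooth curve in `S` through the identity at time `0`, with velocity `ξ ∈ 𝔰`. -/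
def GroupCurve (g : ℝ → SGroup n M) (ξ : SAlg n M) : Prop :=
  (SmoothDif (fun t => (g t).right) ∧ SmoothFun (fun t => phase (g t))) ∧ g 0 = 1 ∧
    VelocityDif (fun t => (g t).right) ξ.1 ∧ VelocityFun (fun t => phase (g t)) ξ.2

/-- `V` is the value at `x` of the infinitesimal action of `ξ ∈ 𝔰`: the velocity of `g_t · x` for the
curves `g_t` in `S` through the identity with velocity `ξ`. -/
def IsGenerator {X T : Type*} (C : Curves X T) (act : SGroup n M → X → X) (ξ : SAlg n M) (x : X)
    (V : T) : Prop :=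
  ∀ g, GroupCurve g ξ → C.smooth (fun t => act (g t) x) ∧ C.velocity (fun t => act (g t) x) V

/-- `𝔰*`. -/
def dualCurves : Curves (SDual n M) (SDual n M) where
  smooth c := SmoothForm (fun t => (c t).1) ∧ SmoothFun (fun t => (c t).2)
  velocity c y := VelocityForm (fun t => (c t).1) y.1 ∧ VelocityFun (fun t => (c t).2) y.2

/-- The space of wave functions. -/
def waveCurves : Curves (Wave n M) (Wave n M) where
  smooth := SmoothFun
  velocity := VelocityFun

/-- `T*G`, for `G = Diff(M)`, in the right trivialization `T*G = G × 𝔤*` with `𝔤* = Ω¹(M)`, with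
tangent vectors in `𝔤 × 𝔤*`. The right action of `N` is `(φ, m) · η = (φ ∘ η, m)`, so that
`(T*G)/N = G/N × 𝔤*`. -/
def cotangentGroupCurves : Curves (Dif n M × Form n M) (VField n M × Form n M) where
  smooth c := SmoothDif (fun t => (c t).1) ∧ SmoothForm (fun t => (c t).2)
  velocity c Y := VelocityDif (fun t => (c t).1) Y.1 ∧ VelocityForm (fun t => (c t).2) Y.2

section

variable [CompactSpace M] (μ : Measure M) [IsProbabilityMeasure μ] [IsSmoothVolume n μ]

/-- The canonical symplectic form `dΘ` of `T*G` at `(φ, m)`, where `Θ (v, ṁ) = ⟨m, v⟩`, in the right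
trivialization: `∫ (ṁ₁(v₂) - ṁ₂(v₁) - m([v₁, v₂])) μ`. -/
def cotangentGroupForm (z : Dif n M × Form n M) (X Y : VField n M × Form n M) : ℝ :=
  ∫ p, (contract X.2 Y.1 p - contract Y.2 X.1 p - contract z.2 (bracket X.1 Y.1) p) ∂μ

/-- The zero level of the momentum map of `N` acting on `T*G`: `⟨m, φ_* w⟩ = 0` for all `w` in the
Lie algebra `𝔫` of divergence-free vector fields. -/
def zeroLevel : Set (Dif n M × Form n M) :=
  {z | ∀ w : VField n M, (∀ f : Fun n M, ∫ p, lie w f p ∂μ = 0) →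
    ∫ p, contract z.2 (push z.1 w) p ∂μ = 0}

/-! ## The cotangent bundle `T* Dens(M) = Dens(M) × C^∞(M)/ℝ`, identified with `T*(G/N)` -/

/-- `T* Dens(M)`; the pairing of `[θ]` with `ρ̇` is `∫ θ ρ̇ μ`. -/
abbrev CotangentDens := ↥(densities (n := n) μ) × (Fun n M ⧸ constants n M)

/-- The tangent space of `Dens(M)`, the functions of mean zero. -/
def zeroMean : Set (Fun n M) := {r | ∫ x, r x ∂μ = 0}

/-- The tangent vectors `(ρ̇, [θ̇])` of `T* Dens(M)`. -/
abbrev TangentCotangentDens := ↥(zeroMean (n := n) μ) × (Fun n M ⧸ constants n M)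

lemma integrable_fun {n : ℕ} {M : Type*} [TopologicalSpace M] [ChartedSpace (Model n) M]
    [MeasurableSpace M] [BorelSpace M] [CompactSpace M] (μ : Measure M) [IsFiniteMeasure μ]
    (f : Fun n M) : Integrable (fun x => f x) μ :=
  f.contMDiff.continuous.integrable_of_hasCompactSupport (HasCompactSupport.of_compactSpace _)

/-- The pairing `([θ], ρ̇) ↦ ∫ θ ρ̇ μ`. -/
def densPairing (r : zeroMean (n := n) μ) : (Fun n M ⧸ constants n M) →ₗ[ℝ] ℝ :=
  (constants n M).liftQ
    { toFun := fun θ => ∫ x, θ x * r.1 x ∂μ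
      map_add' := fun θ η => by
        refine Eq.trans ?_ (integral_add (integrable_fun μ (θ * r.1)) (integrable_fun μ (η * r.1)))
        exact integral_congr_ae (Filter.Eventually.of_forall fun x => add_mul _ _ _)
      map_smul' := fun c θ => by
        rw [RingHom.id_apply, smul_eq_mul, ← integral_const_mul]
        exact integral_congr_ae (Filter.Eventually.of_forall fun x => mul_assoc _ _ _) } (by
    rw [constants, Submodule.span_le, singleton_subset_iff]
    change ∫ x, (1 : ℝ) * r.1 x ∂μ = 0
    exact (integral_congr_ae (Filter.Eventually.of_forall fun x => one_mul _)).trans r.2)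

/-- The canonical symplectic form `∫ (θ̇₁ ρ̇₂ - θ̇₂ ρ̇₁) μ` of `T* Dens(M)`. -/
def cotangentDensForm (X Y : TangentCotangentDens (n := n) μ) : ℝ :=
  densPairing μ Y.1 X.2 - densPairing μ X.1 Y.2

/-- `T* Dens(M)`. -/
def cotangentDensCurves : Curves (CotangentDens (n := n) μ) (TangentCotangentDens (n := n) μ) where
  smooth c := SmoothFun (fun t => (c t).1.1) ∧
    ∃ θ : ℝ → Fun n M, SmoothFun θ ∧ ∀ t, coset (θ t) = (c t).2
  velocity c Y := VelocityFun (fun t => (c t).1.1) Y.1.1 ∧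
    ∃ θ : ℝ → Fun n M, SmoothFun θ ∧ (∀ t, coset (θ t) = (c t).2) ∧
      ∃ θ' : Fun n M, VelocityFun θ θ' ∧ coset θ' = Y.2

/-- The action `(φ, a) · (ρ, [θ]) = (φ_* ρ, [θ ∘ φ⁻¹ - a])` of `S` on `T* Dens(M)`. -/
def cotangentAct (g : SGroup n M) (p : CotangentDens (n := n) μ) : CotangentDens (n := n) μ :=
  (⟨densityPush μ g.right p.1.1, densityPush_mem μ p.1.2⟩, cosetPush g.right p.2 - coset (phase g))

/-- The map `T*G/N → 𝔰*`, `([φ], m) ↦ (m, γ([φ]))`. -/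
def semidirectMap (z : (Dif n M ⧸ volumePreserving (n := n) μ) × Form n M) : SDual n M :=
  (z.2, orbitMap μ z.1)

/-- The map `T*(G/N) → 𝔰*`, `(ρ, [θ]) ↦ (𝓜(θ, ρ), ρ)`, where `𝓜(θ, ρ) = ρ dθ` is the momentum map
of the cotangent lifted action of `G` on `V* × V`, `⟨𝓜(θ, ρ), v⟩ = ∫ ρ (v θ) μ`. -/
def reductionMap (p : CotangentDens (n := n) μ) : SDual n M :=
  (scale p.1.1 (differentialMod p.2), p.1.1)

/-! ## Poisson maps and symplectic leaves

The Lie-Poisson bracket on `𝔰*` is `{F, H}(x) = ⟨x, [ξ, η]⟩`, where `ξ, η ∈ 𝔰` are the functional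
derivatives of `F` and `H` at `x`. On a space with a symplectic form `Ω` the Hamiltonian vector `V`
of a function `f` at `x` is defined by `df(Y) = Ω(Y, V)`, and the Poisson bracket by
`{f, h}(x) = df(W) = Ω(W, V)`, where `W` is the Hamiltonian vector of `h`. (With `Ω = dp ∧ dq` these
are Hamilton's equations `q̇ = ∂h/∂p`, `ṗ = -∂h/∂q`.) -/

/-- `ξ ∈ 𝔰` is the functional derivative of `F : 𝔰* → ℝ` at `x`. -/
def HasGradient (F : SDual n M → ℝ) (x : SDual n M) (ξ : SAlg n M) : Prop :=
  HasDifferential dualCurves F x (fun y => pairing μ y ξ)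

/-- `V` is the Hamiltonian vector of `f` at `x` with respect to the symplectic form `Ω`. -/
def IsHamiltonian {X T : Type*} (C : Curves X T) (Ω : T → T → ℝ) (f : X → ℝ) (x : X) (V : T) :
    Prop :=
  HasDifferential C f x (fun Y => Ω Y V)

/-- `J : X → 𝔰*` is a Poisson map: it is smooth and `{F ∘ J, H ∘ J} = {F, H} ∘ J`. -/
def IsPoissonMap {X T : Type*} (C : Curves X T) (Ω : X → T → T → ℝ) (J : X → SDual n M) : Prop :=
  (∀ c, C.smooth c → dualCurves.smooth (fun t => J (c t))) ∧
  ∀ (x : X) (F H : SDual n M → ℝ) (ξ η : SAlg n M),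
    HasGradient μ F (J x) ξ → HasGradient μ H (J x) η →
      (∃ V, IsHamiltonian C (Ω x) (fun y => F (J y)) x V) ∧
      (∃ W, IsHamiltonian C (Ω x) (fun y => H (J y)) x W) ∧
      ∀ V W, IsHamiltonian C (Ω x) (fun y => F (J y)) x V →
        IsHamiltonian C (Ω x) (fun y => H (J y)) x W →
          Ω x W V = pairing μ (J x) (algBracket ξ η)

/-- The symplectic leaf of `x ∈ 𝔰*`: the points that can be reached from `x` along the integral
curves `c` of time-dependent Hamiltonian vector fields, `d/dt ⟨c(t), η⟩ = ⟨c(t), [η, ξ_t]⟩` for all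
`η ∈ 𝔰`, where `ξ_t` is the functional derivative of the Hamiltonian at `c(t)`. -/
def symplecticLeaf (x : SDual n M) : Set (SDual n M) :=
  {y | ∃ (c : ℝ → SDual n M) (ξ : ℝ → SAlg n M), dualCurves.smooth c ∧ SmoothAlg ξ ∧
    c 0 = x ∧ c 1 = y ∧ ∀ (t : ℝ) (η : SAlg n M),
      HasDerivAt (fun s => pairing μ (c s) η) (pairing μ (c t) (algBracket η (ξ t))) t}

/-! ## The Madelung transform and its inverse -/

/-- The Madelung transform `(ρ, θ) ↦ √ρ e^{iθ/2}`. -/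
def madelung (ρ : densities (n := n) μ) (θ : Fun n M) : Wave n M := polar ρ.1 θ ρ.2.1 1

/-- The action `(φ, a) ∘ ψ = √|Det(Dφ⁻¹)| e^{-ia/2} ψ ∘ φ⁻¹` of `S` on wave functions. -/
def waveAct (g : SGroup n M) (ψ : Wave n M) : Wave n M :=
  polar (jac μ g.right) (-phase g) (jac_pos μ g.right) (wavePush g.right ψ)

/-- The symplectic form `∫ Im(χ₁ χ̄₂) μ` on wave functions. The Hamiltonian vector of `H` with respect
to it is `-i ∇H`, where `∇H` is the `L²`-gradient: `dH(χ) = Re ∫ ∇H χ̄ μ`. -/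
def waveForm (χ₁ χ₂ : Wave n M) : ℝ := ∫ x, (χ₁ x * star (χ₂ x)).im ∂μ

end

/-- The inverse Madelung transform `𝐌(ψ) = (2 Im(ψ̄ dψ), ψ̄ ψ)`, with values in `𝔰*`. -/
def inverseMadelung (ψ : Wave n M) : SDual n M := (momentumForm ψ, absSq ψ)

end Madelung

end

open scoped Manifold ContDiff Topology
open MeasureTheory Set

noncomputable section

set_option linter.unusedSectionVars false

/-! The geometry rests on two facts about the divergence with respect to `μ` on a compact connected
manifold. (a) Every function of mean zero is a divergence, smoothly in a parameter
(`exists_divergence_eq`). (b) Dually, a one-form that annihilates all divergence-free fields is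
exact, again smoothly in a parameter (`exists_potential`).

From (a) comes Moser's theorem: a path of densities solves div(ρ_t v_t) = -ρ̇_t for some fields v_t,
and their flow carries ρ_0 to ρ_t. Hence `Diff(M)` is transitive on `Dens(M)`, paths of densities
lift, and `S` is transitive on `T* Dens(M)`, because the function component of `S` shifts θ at will.
By (a) a function with zero differential is also constant (`eq_const_of_lie_eq_zero`), which gives
the injectivity of `reductionMap` and the constant phase of the Madelung transform. From (b), zero
momentum says that m/ρ annihilates the divergence-free fields, so m = ρ dθ; and a curve with smooth
image under `reductionMap` has a smooth choice of θ.

For the symplectic statements the derivative of a linear function ⟨J, ξ⟩ is integrated by parts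
until it reads Ω(·, V_ξ) for an explicit vector V_ξ. Only first derivatives enter a Poisson bracket,
so checking linear functions suffices (`isPoissonMap_of_hamiltonian`). For wave functions the
bracket identity comes from equivariance, by differentiating ⟨J(g_t x), Ad_{g_t} ξ⟩ = ⟨J(x), ξ⟩
(`form_generator_eq`). If c is a Hamiltonian curve and g_t integrates the gradients of its
Hamiltonians, then ⟨c(t), Ad_{g_t} η⟩ is constant, so a leaf lies in a coadjoint orbit. The orbit
through a point of the image is the image, by equivariance and transitivity, and explicit
Hamiltonian paths join any two points of the image. So all three sets agree.

The Madelung statements follow from one gauge formula (`contract_momentumForm_polar`):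
multiplication of ψ by √r e^{ia/2} multiplies 2 Im(ψ̄ dψ) by r and adds r|ψ|² da. Applied to the
wave 1 it identifies the Madelung transform with `reductionMap`; applied to the action of `S` it
gives equivariance; applied to the quotient of ψ by a Madelung wave it leaves a unimodular wave of
zero momentum, which is constant.

The remaining work is smooth dependence on parameters. Flows come from the implicit function theorem
in a space of curves, Jacobians from an explicit exponential along the flow, and a finite global
system with ∑ db_k ⊗ X_k = id reduces questions about fields and forms to questions about functions.
-/

namespace Madelung

/-! ### Superposition operators on spaces of continuous maps. -/

section Superposition

variable {I : Type*} [TopologicalSpace I] [CompactSpace I]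

universe u

variable {A E F : Type u} [NormedAddCommGroup E] [NormedSpace ℝ E]
  [NormedAddCommGroup F] [NormedSpace ℝ F] [NormedAddCommGroup A] [NormedSpace ℝ A]

/-- Pointwise application of a bilinear map to continuous functions. -/
def pointwiseApply (I : Type*) [TopologicalSpace I] [CompactSpace I] (B : A →L[ℝ] E →L[ℝ] F) :
    C(I, A) →L[ℝ] C(I, E) →L[ℝ] C(I, F) :=
  LinearMap.mkContinuous₂ (LinearMap.mk₂ ℝ
    (fun (a : C(I, A)) (h : C(I, E)) =>
      (⟨fun s => B (a s) (h s), (B.continuous.comp a.continuous).clm_apply h.continuous⟩ : C(I, F)))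
    (fun a b h => by ext s; simp) (fun c a h => by ext s; simp)
    (fun a h k => by ext s; simp) (fun c a h => by ext s; simp)) ‖B‖ (fun a h => by
      rw [ContinuousMap.norm_le _ (by positivity)]
      intro s
      refine (B.le_opNorm₂ (a s) (h s)).trans ?_
      gcongr
      · exact a.norm_coe_le_norm s
      · exact h.norm_coe_le_norm s)

/-- The mean value inequality on the segment from `γ s` to `η s` works uniformly in `s`, because `γ
↦ f' ∘ γ` is continuous for the sup norm. The map `B` lets the derivative be stored in any space
`A`. -/
lemma hasFDerivAt_postcomp {B : A →L[ℝ] E →L[ℝ] F} (hB : ∀ a, ‖B a‖ ≤ ‖a‖) (f : C(E, F))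
    (f' : C(E, A)) (hf : ∀ x, HasFDerivAt f (B (f' x)) x) (γ : C(I, E)) :
    HasFDerivAt (fun γ : C(I, E) => f.comp γ) (pointwiseApply I B (f'.comp γ)) γ := by
  rw [hasFDerivAt_iff_isLittleO, Asymptotics.isLittleO_iff]
  intro ε hε
  have hc : Continuous fun γ : C(I, E) => f'.comp γ := ContinuousMap.continuous_postcomp _
  obtain ⟨δ, hδ, hball⟩ := Metric.mem_nhds_iff.1 (hc.tendsto γ (Metric.ball_mem_nhds _ hε))
  filter_upwards [Metric.ball_mem_nhds γ hδ] with η hη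
  rw [ContinuousMap.norm_le _ (by positivity)]
  intro s
  have key := (convex_segment (γ s) (η s)).norm_image_sub_le_of_norm_hasFDerivWithin_le'
    (f := f) (f' := fun x => B (f' x)) (φ := B (f' (γ s))) (C := ε)
    (fun z _ => (hf z).hasFDerivWithinAt)
    (fun z hz => by
      rw [segment_eq_image'] at hz
      obtain ⟨τ, hτ, rfl⟩ := hz
      -- A point of the segment is the value at `s` of the curve `γ + τ (η - γ)`, which is itself
      -- within `δ` of `γ`.
      have hd : dist (γ + τ • (η - γ)) γ < δ := by
        rw [dist_eq_norm, add_sub_cancel_left, norm_smul, Real.norm_of_nonneg hτ.1]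
        rw [Metric.mem_ball, dist_eq_norm] at hη
        exact (mul_le_of_le_one_left (norm_nonneg _) hτ.2).trans_lt hη
      have := hball (Metric.mem_ball.2 hd)
      rw [mem_preimage, Metric.mem_ball, dist_eq_norm] at this
      rw [← map_sub]
      exact (hB _).trans ((ContinuousMap.norm_coe_le_norm _ s).trans this.le))
    (left_mem_segment ℝ _ _) (right_mem_segment ℝ _ _)
  refine key.trans (mul_le_mul_of_nonneg_left ?_ hε.le)
  exact (η - γ).norm_coe_le_norm s

/-- The derivative is postcomposition with `fderiv ℝ f` followed by a bounded bilinear operation, so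
the order of smoothness rises by induction. The target space varies in the induction, since `fderiv
ℝ f` takes values in operators. -/
lemma contDiff_postcomp_nat (m : ℕ) : ∀ {F : Type u} [NormedAddCommGroup F] [NormedSpace ℝ F]
    (f : C(E, F)) (_ : ContDiff ℝ ∞ f), ContDiff ℝ m (fun γ : C(I, E) => f.comp γ) := by
  induction m with
  | zero =>
    intro F _ _ f hf
    exact contDiff_zero.2 (ContinuousMap.continuous_postcomp _)
  | succ m ih =>
    intro F _ _ f hf
    have h' : ContDiff ℝ ∞ (fderiv ℝ f) := hf.fderiv_right (by simp)
    rw [Nat.cast_succ, contDiff_succ_iff_hasFDerivAt]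
    exact ⟨_, (pointwiseApply I (.id ℝ (E →L[ℝ] F))).contDiff.comp (ih ⟨_, h'.continuous⟩ h'),
      fun γ => hasFDerivAt_postcomp (fun a => le_rfl) f ⟨_, h'.continuous⟩
        (fun x => (hf.differentiable (by simp) x).hasFDerivAt) γ⟩

/-- The superposition operator `γ ↦ f ∘ γ` on spaces of continuous functions is smooth. -/
theorem contDiff_postcomp {f : E → F} (hf : ContDiff ℝ ∞ f) :
    ContDiff ℝ ∞ (fun γ : C(I, E) => (⟨f, hf.continuous⟩ : C(E, F)).comp γ) :=
  contDiff_infty.2 fun m => contDiff_postcomp_nat m _ hf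

end Superposition

/-! ### Integrals depending on parameters. -/

section Integrals

universe u

variable {E : Type u} [NormedAddCommGroup E] [NormedSpace ℝ E] [CompleteSpace E]

/-- The extension of a continuous function on `[0, 1]` by constants. -/
def unitExtend (γ : C(Icc (0:ℝ) 1, E)) : C(ℝ, E) := γ.comp ⟨projIcc 0 1 zero_le_one, continuous_projIcc⟩

lemma norm_unitExtend_le (γ : C(Icc (0:ℝ) 1, E)) (s : ℝ) : ‖unitExtend γ s‖ ≤ ‖γ‖ :=
  γ.norm_coe_le_norm _

lemma unitExtend_apply (γ : C(Icc (0:ℝ) 1, E)) {s : ℝ} (hs : s ∈ Icc (0:ℝ) 1) :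
    unitExtend γ s = γ ⟨s, hs⟩ := by
  simp [unitExtend, projIcc_of_mem zero_le_one hs]

/-- The Volterra operator `γ ↦ ∫₀ˢ γ`. -/
def volterra (E : Type u) [NormedAddCommGroup E] [NormedSpace ℝ E] [CompleteSpace E] :
    C(Icc (0:ℝ) 1, E) →L[ℝ] C(Icc (0:ℝ) 1, E) :=
  LinearMap.mkContinuous
    { toFun := fun γ => ⟨fun s => ∫ r in (0:ℝ)..s, unitExtend γ r,
        (intervalIntegral.continuous_primitive (fun a b =>
          (unitExtend γ).continuous.intervalIntegrable a b) 0).comp continuous_subtype_val⟩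
      map_add' := fun γ η => by
        ext s
        exact intervalIntegral.integral_add ((unitExtend γ).continuous.intervalIntegrable _ _)
          ((unitExtend η).continuous.intervalIntegrable _ _)
      map_smul' := fun c γ => by
        ext s
        exact intervalIntegral.integral_smul c (fun r => unitExtend γ r) } 1 (fun γ => by
      rw [one_mul, ContinuousMap.norm_le _ (norm_nonneg _)]
      intro s
      refine (intervalIntegral.norm_integral_le_of_norm_le_const
        (fun r _ => norm_unitExtend_le γ r)).trans ?_
      rw [sub_zero, abs_of_nonneg s.2.1]
      exact mul_le_of_le_one_right (norm_nonneg _) s.2.2)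

/-- Integrals over `[0, 1]` depend smoothly on parameters. -/
theorem contDiff_integral_unit {P : Type u} [NormedAddCommGroup P] [NormedSpace ℝ P]
    {F : P × ℝ → E} (hF : ContDiff ℝ ∞ F) :
    ContDiff ℝ ∞ (fun p => ∫ s in (0:ℝ)..1, F (p, s)) := by
  -- The curve s ↦ (p, s) is `c p + d`, hence affine in p. The integral is the value at 1 of the
  -- Volterra operator applied to the superposition of `F` with this curve.
  let c : P →L[ℝ] C(Icc (0:ℝ) 1, P × ℝ) := LinearMap.mkContinuous
    { toFun := fun p => ⟨fun _ => (p, 0), continuous_const⟩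
      map_add' := fun p q => by ext s <;> simp
      map_smul' := fun c p => by ext s <;> simp } 1 (fun p => by
      rw [one_mul, ContinuousMap.norm_le _ (norm_nonneg _)]
      intro s
      simp)
  let d : C(Icc (0:ℝ) 1, P × ℝ) := ⟨fun s => (0, s), by fun_prop⟩
  have h := ((ContinuousMap.evalCLM ℝ (⟨1, by simp⟩ : Icc (0:ℝ) 1)).comp (volterra E)).contDiff.comp
    ((contDiff_postcomp hF).comp (c.contDiff.add (contDiff_const (c := d))))
  convert h using 1
  ext p
  change _ = ∫ r in (0:ℝ)..1, unitExtend _ r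
  refine intervalIntegral.integral_congr fun s hs => ?_
  rw [uIcc_of_le zero_le_one] at hs
  rw [unitExtend_apply _ hs]
  simp [c, d]

end Integrals

/-! ### The implicit function theorem with smoothness near the base point. -/

section ImplicitFunction

variable {A B : Type*} [NormedAddCommGroup A] [NormedSpace ℝ A] [CompleteSpace A]
  [NormedAddCommGroup B] [NormedSpace ℝ B] [CompleteSpace B]

/-- The point is smoothness of class `C^∞` at all nearby points and not only at `a₀`. Invertibility
of the partial derivative is an open condition, so there is an implicit function around each nearby
zero, and local uniqueness identifies it with `ψ`. -/
lemma exists_implicit {G : A × B → B} (hG : ContDiff ℝ ∞ G) {a₀ : A} {b₀ : B}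
    (h0 : G (a₀, b₀) = 0)
    (hinv : (fderiv ℝ G (a₀, b₀) ∘L .inr ℝ A B).IsInvertible) :
    ∃ ψ : A → B, ψ a₀ = b₀ ∧ (∀ᶠ a in 𝓝 a₀, G (a, ψ a) = 0) ∧
      (∀ᶠ v in 𝓝 (a₀, b₀), G v = 0 ↔ ψ v.1 = v.2) ∧ ∀ᶠ a in 𝓝 a₀, ContDiffAt ℝ ∞ ψ a := by
  have hn : (∞ : WithTop ℕ∞) ≠ 0 := by simp
  set ψ := hG.contDiffAt.implicitFunction hn hinv with hψ
  have e0 : ψ a₀ = b₀ := hG.contDiffAt.implicitFunction_apply_self hn hinv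
  have e1 : ∀ᶠ a in 𝓝 a₀, G (a, ψ a) = 0 := by
    simpa [h0] using hG.contDiffAt.eventually_apply_implicitFunction hn hinv
  have e2 : ∀ᶠ v in 𝓝 (a₀, b₀), G v = 0 ↔ ψ v.1 = v.2 := by
    simpa [h0] using hG.contDiffAt.eventually_apply_eq_iff_implicitFunction hn hinv
  have e3 : ∀ᶠ v in 𝓝 (a₀, b₀), (fderiv ℝ G v ∘L .inr ℝ A B).IsInvertible := by
    have hc : Continuous fun v => fderiv ℝ G v ∘L .inr ℝ A B :=
      (hG.continuous_fderiv hn).clm_comp continuous_const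
    obtain ⟨e, he⟩ := hinv
    have := (hc.continuousAt (x := (a₀, b₀))).eventually (he ▸ ContinuousLinearEquiv.nhds e)
    filter_upwards [this] with v hv
    exact hv
  have hct : ContinuousAt ψ a₀ := (hG.contDiffAt.contDiffAt_implicitFunction hn hinv).continuousAt
  have hct' : Filter.Tendsto (fun a => (a, ψ a)) (𝓝 a₀) (𝓝 (a₀, b₀)) := by
    have := continuousAt_id.prodMk hct
    rwa [ContinuousAt, e0] at this
  refine ⟨ψ, e0, e1, e2, ?_⟩
  filter_upwards [e1, hct'.eventually e2.eventually_nhds, hct'.eventually e3] with a h1 h2 h3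
  have s1 := hG.contDiffAt.eventually_apply_eq_iff_implicitFunction hn h3
  have s2 := hG.contDiffAt.eventually_apply_implicitFunction hn h3
  have s0 := hG.contDiffAt.implicitFunction_apply_self hn h3
  have s3 := hG.contDiffAt.contDiffAt_implicitFunction hn h3
  set ψ' := hG.contDiffAt.implicitFunction hn h3
  have hct2 : Filter.Tendsto (fun a => (a, ψ' a)) (𝓝 a) (𝓝 (a, ψ a)) := by
    have := continuousAt_id.prodMk s3.continuousAt
    rwa [ContinuousAt, s0] at this
  refine s3.congr_of_eventuallyEq ?_
  filter_upwards [hct2.eventually h2, s2] with a' h4 h5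
  exact h4.1 (by rw [h5, h1])

end ImplicitFunction

/-! ### Local flows on a Banach space. -/

section LocalFlow

universe u

variable {E : Type u} [NormedAddCommGroup E] [NormedSpace ℝ E] [CompleteSpace E]

/-- The reparametrisation `γ ↦ γ (σ ·)`. -/
def rescale (σ : Icc (0:ℝ) 1) (γ : C(Icc (0:ℝ) 1, E)) : C(Icc (0:ℝ) 1, E) :=
  γ.comp ⟨fun s => ⟨σ * s, mul_nonneg σ.2.1 s.2.1, mul_le_one₀ σ.2.2 s.2.1 s.2.2⟩, by fun_prop⟩

/-- The zeros `((ε, x), γ)` are the curves `γ` such that `γ (s) = x + ε ∫₀ˢ f (γ)`. -/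
def flowEquation (f : C(E, E)) (p : (ℝ × E) × C(Icc (0:ℝ) 1, E)) : C(Icc (0:ℝ) 1, E) :=
  p.2 - ContinuousMap.const _ p.1.2 - p.1.1 • volterra E (f.comp p.2)

lemma contDiff_flowEquation {f : E → E} (hf : ContDiff ℝ ∞ f) :
    ContDiff ℝ ∞ (flowEquation ⟨f, hf.continuous⟩) := by
  have hc : ContDiff ℝ ∞ fun x : E => ContinuousMap.const (Icc (0:ℝ) 1) x :=
    (LinearMap.mkContinuous
      { toFun := fun x : E => ContinuousMap.const (Icc (0:ℝ) 1) x
        map_add' := fun x y => rfl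
        map_smul' := fun c x => rfl } 1 (fun x => by
        rw [one_mul, ContinuousMap.norm_le _ (norm_nonneg _)]
        exact fun _ => le_rfl)).contDiff
  exact (contDiff_snd.sub (hc.comp (contDiff_snd.comp contDiff_fst))).sub
    ((contDiff_fst.comp contDiff_fst).smul
      ((volterra E).contDiff.comp ((contDiff_postcomp hf).comp contDiff_snd)))

lemma flowEquation_apply (f : C(E, E)) (ε : ℝ) (x : E) (γ : C(Icc (0:ℝ) 1, E)) (s : Icc (0:ℝ) 1) :
    flowEquation f ((ε, x), γ) s = γ s - x - ε • ∫ r in (0:ℝ)..s, unitExtend (f.comp γ) r := rfl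

/-- Running a solution at speed reduced by the factor `σ` is the substitution r ↦ σ r in the
integral equation. -/
lemma flowEquation_rescale {f : C(E, E)} {ε : ℝ} {x : E} {γ : C(Icc (0:ℝ) 1, E)}
    (h : flowEquation f ((ε, x), γ) = 0) (σ : Icc (0:ℝ) 1) :
    flowEquation f ((σ * ε, x), rescale σ γ) = 0 := by
  ext s
  have h1 := congrArg (fun g : C(Icc (0:ℝ) 1, E) => g
    ⟨σ * s, mul_nonneg σ.2.1 s.2.1, mul_le_one₀ σ.2.2 s.2.1 s.2.2⟩) h
  simp only [flowEquation_apply] at h1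
  rw [flowEquation_apply]
  refine Eq.trans ?_ h1
  congr 1
  rw [mul_comm (σ : ℝ) ε, mul_smul]
  congr 1
  have := intervalIntegral.smul_integral_comp_mul_left (a := 0) (b := s)
    (fun r => unitExtend (f.comp γ) r) (σ : ℝ)
  rw [mul_zero] at this
  rw [← this]
  congr 1
  refine intervalIntegral.integral_congr fun r hr => ?_
  rw [uIcc_of_le s.2.1] at hr
  have hr' : r ∈ Icc (0:ℝ) 1 := ⟨hr.1, hr.2.trans s.2.2⟩
  rw [unitExtend_apply _ hr', unitExtend_apply _
    ⟨mul_nonneg σ.2.1 hr'.1, mul_le_one₀ σ.2.2 hr'.1 hr'.2⟩]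
  rfl

/-- Smooth local flow of a smooth vector field on a Banach space. -/
theorem exists_local_flow {f : E → E} (hf : ContDiff ℝ ∞ f) (x₀ : E) :
    ∃ δ > 0, ∃ Φ : ℝ × E → E, (∀ p ∈ Metric.ball (0:ℝ) δ ×ˢ Metric.ball x₀ δ, ContDiffAt ℝ ∞ Φ p) ∧
      (∀ x ∈ Metric.ball x₀ δ, Φ (0, x) = x) ∧
      ∀ x ∈ Metric.ball x₀ δ, ∀ ε ∈ Metric.ball (0:ℝ) δ,
        HasDerivAt (fun τ => Φ (τ, x)) (f (Φ (ε, x))) ε := by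
  set F : C(E, E) := ⟨f, hf.continuous⟩
  set c₀ : C(Icc (0:ℝ) 1, E) := ContinuousMap.const _ x₀
  have hG := contDiff_flowEquation hf
  have h0 : flowEquation F ((0, x₀), c₀) = 0 := by
    ext s
    simp [flowEquation, c₀]
  -- At ε = 0 the equation is γ = const, so the partial derivative in the curve is the identity.
  have hD : fderiv ℝ (flowEquation F) ((0, x₀), c₀) ∘L .inr ℝ (ℝ × E) C(Icc (0:ℝ) 1, E)
      = .id ℝ _ := by
    have h1 : HasFDerivAt (fun γ => flowEquation F ((0, x₀), γ))
        (fderiv ℝ (flowEquation F) ((0, x₀), c₀) ∘L .inr ℝ (ℝ × E) C(Icc (0:ℝ) 1, E)) c₀ :=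
      ((hG.differentiable (by simp) _).hasFDerivAt).comp c₀ (hasFDerivAt_prodMk_right _ _)
    have h2 : HasFDerivAt (fun γ => flowEquation F ((0, x₀), γ)) (.id ℝ _) c₀ := by
      have : (fun γ => flowEquation F ((0, x₀), γ)) = fun γ => γ - c₀ := by
        ext γ
        simp [flowEquation, c₀]
      rw [this]
      exact (hasFDerivAt_id _).sub_const _
    exact h1.unique h2
  obtain ⟨ψ, ψ0, e1, e2, e3⟩ := exists_implicit hG h0
    (by rw [hD]; exact ⟨.refl ℝ _, rfl⟩)
  have hψc : ContinuousAt ψ (0, x₀) := e3.self_of_nhds.continuousAt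
  obtain ⟨δ', hδ', hb2⟩ := Metric.eventually_nhds_iff_ball.1 e2
  have e4 : ∀ᶠ a in 𝓝 ((0:ℝ), x₀), ψ a ∈ Metric.ball c₀ δ' :=
    hψc.eventually (by rw [ψ0]; exact Metric.ball_mem_nhds _ hδ')
  obtain ⟨δ₁, hδ₁, hb1⟩ := Metric.eventually_nhds_iff_ball.1 (e1.and (e3.and e4))
  set δ := min δ' δ₁
  have hδ : 0 < δ := lt_min hδ' hδ₁
  have hball : ∀ ε ∈ Metric.ball (0:ℝ) δ, ∀ x ∈ Metric.ball x₀ δ,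
      (ε, x) ∈ Metric.ball ((0:ℝ), x₀) δ₁ := by
    intro ε hε x hx
    rw [← ball_prod_same]
    exact ⟨Metric.ball_subset_ball (min_le_right _ _) hε,
      Metric.ball_subset_ball (min_le_right _ _) hx⟩
  -- Local uniqueness identifies the solution at speed σε with the rescaled solution. Thus the
  -- endpoints at time 1 for varying ε trace out the whole integral curve.
  have hscale : ∀ ε ∈ Metric.ball (0:ℝ) δ, ∀ x ∈ Metric.ball x₀ δ, ∀ σ : Icc (0:ℝ) 1,
      ψ (σ * ε, x) = rescale σ (ψ (ε, x)) := by
    intro ε hε x hx σ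
    obtain ⟨q1, -, q3⟩ := hb1 _ (hball ε hε x hx)
    refine (hb2 ((σ * ε, x), rescale σ (ψ (ε, x))) ?_).1 (flowEquation_rescale q1 σ)
    rw [← ball_prod_same, ← ball_prod_same]
    refine ⟨⟨?_, Metric.ball_subset_ball (min_le_left _ _) hx⟩, ?_⟩
    · rw [mem_ball_zero_iff, norm_mul] at *
      refine lt_of_le_of_lt ?_ (hε.trans_le (min_le_left _ _))
      refine mul_le_of_le_one_left (norm_nonneg _) ?_
      rw [Real.norm_of_nonneg σ.2.1]
      exact σ.2.2
    · rw [Metric.mem_ball, ContinuousMap.dist_lt_iff hδ'] at *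
      intro s
      exact q3 _
  have one_mem : (1:ℝ) ∈ Icc (0:ℝ) 1 := by simp
  have hev : ContDiff ℝ ∞ (fun γ : C(Icc (0:ℝ) 1, E) => γ ⟨1, one_mem⟩) :=
    (ContinuousMap.evalCLM ℝ (M := E) (⟨1, one_mem⟩ : Icc (0:ℝ) 1)).contDiff
  have hsm : ∀ p ∈ Metric.ball (0:ℝ) δ ×ˢ Metric.ball x₀ δ,
      ContDiffAt ℝ ∞ (fun p => ψ p ⟨1, one_mem⟩) p := fun p hp =>
    ContDiffAt.comp (g := fun γ : C(Icc (0:ℝ) 1, E) => γ ⟨1, one_mem⟩) p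
      hev.contDiffAt
      (hb1 _ (hball _ hp.1 _ hp.2)).2.1
  -- By `hscale` the equation at time 1 becomes the integral equation of the flow in the variable ε.
  have hint : ∀ x ∈ Metric.ball x₀ δ, ∀ ε ∈ Metric.ball (0:ℝ) δ,
      ψ (ε, x) ⟨1, one_mem⟩ = x + ∫ τ in (0:ℝ)..ε, f (ψ (τ, x) ⟨1, one_mem⟩) := by
    intro x hx ε hε
    have q := congrArg (fun g : C(Icc (0:ℝ) 1, E) => g ⟨1, one_mem⟩) (hb1 _ (hball ε hε x hx)).1
    simp only [flowEquation_apply] at q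
    have q' : ψ (ε, x) ⟨1, one_mem⟩ - x
        = ε • ∫ r in (0:ℝ)..1, unitExtend (F.comp (ψ (ε, x))) r := sub_eq_zero.1 q
    rw [← sub_eq_iff_eq_add', q']
    have := intervalIntegral.smul_integral_comp_mul_left (a := 0) (b := 1)
      (fun τ => f (ψ (τ, x) ⟨1, one_mem⟩)) ε
    rw [mul_zero, mul_one] at this
    rw [← this]
    congr 1
    refine intervalIntegral.integral_congr fun r hr => ?_
    rw [uIcc_of_le zero_le_one] at hr
    rw [unitExtend_apply _ hr, mul_comm ε r, hscale ε hε x hx ⟨r, hr⟩]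
    simp [rescale, F]
  refine ⟨δ, hδ, fun p => ψ p ⟨1, one_mem⟩, hsm, ?_, ?_⟩
  · intro x hx
    simpa using hint x hx 0 (by simpa using hδ)
  · intro x hx ε hε
    have hc : ContinuousOn (fun τ => f (ψ (τ, x) ⟨1, one_mem⟩)) (Metric.ball (0:ℝ) δ) := by
      intro τ hτ
      have := (hsm (τ, x) ⟨hτ, hx⟩).continuousAt
      exact (hf.continuous.continuousAt.comp
        (this.comp (f := fun τ => (τ, x)) (by fun_prop))).continuousWithinAt
    have hsub : uIcc 0 ε ⊆ Metric.ball (0:ℝ) δ :=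
      ((convex_ball (0:ℝ) δ).ordConnected).uIcc_subset (by simpa using hδ) hε
    have hd : HasDerivAt (fun s => x + ∫ τ in (0:ℝ)..s, f (ψ (τ, x) ⟨1, one_mem⟩))
        (f (ψ (ε, x) ⟨1, one_mem⟩)) ε :=
      (intervalIntegral.integral_hasDerivAt_right (hc.mono hsub).intervalIntegrable
        (hc.stronglyMeasurableAtFilter Metric.isOpen_ball ε hε)
        (hc.continuousAt (Metric.isOpen_ball.mem_nhds hε))).const_add x
    refine hd.congr_of_eventuallyEq ?_
    filter_upwards [Metric.isOpen_ball.mem_nhds hε] with s hs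
    exact hint x hx s hs

end LocalFlow

/-! ### Local flows on a manifold. -/

section ManifoldFlow

variable {E H N : Type*} [NormedAddCommGroup E] [NormedSpace ℝ E] [TopologicalSpace H]
  {I : ModelWithCorners ℝ E H} [TopologicalSpace N] [ChartedSpace H N] [IsManifold I ∞ N]

/-- The derivative is the fibre component of the tangent map, so it depends smoothly on any smooth
family of tangent vectors. -/
lemma contMDiffAt_mfderiv_apply {F : Type*} [NormedAddCommGroup F] [NormedSpace ℝ F]
    {E' H' P : Type*} [NormedAddCommGroup E'] [NormedSpace ℝ E'] [TopologicalSpace H']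
    {J : ModelWithCorners ℝ E' H'} [TopologicalSpace P] [ChartedSpace H' P]
    {f : N → F} {s : Set N} (hs : IsOpen s) (hf : ContMDiffOn I 𝓘(ℝ, F) ∞ f s)
    {z : P → TangentBundle I N} {p : P} (hz : ContMDiffAt J I.tangent ∞ z p) (hp : (z p).1 ∈ s) :
    ContMDiffAt J 𝓘(ℝ, F) ∞ (fun q => (mfderiv I 𝓘(ℝ, F) f (z q).1 (z q).2 : F)) p := by
  have h1 : ContMDiffAt I.tangent 𝓘(ℝ, F).tangent ∞ (tangentMapWithin I 𝓘(ℝ, F) f s) (z p) :=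
    (hf.contMDiffOn_tangentMapWithin (m := ∞) (by simp) hs.uniqueMDiffOn).contMDiffAt
      ((hs.preimage (FiberBundle.continuous_proj E (TangentSpace I))).mem_nhds hp)
  have h2 := (contMDiff_snd_tangentBundle_modelSpace F 𝓘(ℝ, F) (n := ∞)).contMDiffAt.comp _
    (h1.comp p hz)
  refine h2.congr_of_eventuallyEq ?_
  have : ∀ᶠ q in 𝓝 p, (z q).1 ∈ s :=
    ((FiberBundle.continuous_proj E (TangentSpace I)).continuousAt.comp hz.continuousAt).eventually
      (hs.mem_nhds hp)
  filter_upwards [this] with q hq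
  simp only [Function.comp, tangentMapWithin]
  rw [mfderivWithin_of_isOpen hs hq]

variable [I.Boundaryless] [CompleteSpace E]

/-- An integral curve of the coordinate representation gives one on the manifold, because the
derivative of the inverse chart undoes the derivative of the chart. -/
lemma hasMFDerivAt_symm_comp {v : (x : N) → TangentSpace I x} {x₀ : N} {c : ℝ → E} {t : ℝ}
    (ht : c t ∈ (extChartAt I x₀).target)
    (hc : HasDerivAt c (mfderiv I 𝓘(ℝ, E) (extChartAt I x₀) ((extChartAt I x₀).symm (c t))
      (v ((extChartAt I x₀).symm (c t)))) t) :
    HasMFDerivAt 𝓘(ℝ, ℝ) I (fun τ => (extChartAt I x₀).symm (c τ)) t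
      ((1 : ℝ →L[ℝ] ℝ).smulRight (v ((extChartAt I x₀).symm (c t)))) := by
  have : IsManifold I 1 N := IsManifold.of_le (n := ∞) (by simp)
  have h1 : HasMFDerivAt 𝓘(ℝ, E) I (extChartAt I x₀).symm (c t)
      (mfderiv 𝓘(ℝ, E) I (extChartAt I x₀).symm (c t)) := by
    have := mdifferentiableWithinAt_extChartAt_symm ht
    rw [I.range_eq_univ, mdifferentiableWithinAt_univ] at this
    exact this.hasMFDerivAt
  have h2 := h1.comp t hc.hasFDerivAt.hasMFDerivAt
  refine h2.congr_mfderiv ?_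
  have h3 := mfderivWithin_extChartAt_symm_comp_mfderiv_extChartAt (I := I) ht
  rw [I.range_eq_univ, mfderivWithin_univ] at h3
  ext
  have h4 := congrArg (fun L => L (v ((extChartAt I x₀).symm (c t)))) h3
  exact ((congrArg (mfderiv 𝓘(ℝ, E) I (extChartAt I x₀).symm (c t)) (one_smul ℝ (_ : E))).trans
    h4).trans (one_smul ℝ (_ : E)).symm

/-- The field in the chart is multiplied by a bump function, which makes it a smooth field on all of
`E`; its flow is the desired one as long as it stays where the bump function is 1. -/
theorem exists_local_flow_manifold [FiniteDimensional ℝ E] {v : (x : N) → TangentSpace I x}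
    (hv : ContMDiff I I.tangent ∞ (fun x => (⟨x, v x⟩ : TangentBundle I N))) (x₀ : N) :
    ∃ δ > 0, ∃ U ∈ 𝓝 x₀, ∃ Ψ : ℝ × N → N,
      (∀ p ∈ Metric.ball (0:ℝ) δ ×ˢ U, ContMDiffAt (𝓘(ℝ, ℝ).prod I) I ∞ Ψ p) ∧
      ∀ x ∈ U, Ψ (0, x) = x ∧ IsMIntegralCurveOn (fun t => Ψ (t, x)) v (Ioo (-δ) δ) := by
  set φ := extChartAt I x₀ with hφ
  have hopen : IsOpen φ.target := isOpen_extChartAt_target x₀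
  set g : E → E := fun y => mfderiv I 𝓘(ℝ, E) φ (φ.symm y) (v (φ.symm y)) with hg
  have hsm : ContMDiffOn 𝓘(ℝ, E) I ∞ φ.symm φ.target := contMDiffOn_extChartAt_symm x₀
  have hgs : ContDiffOn ℝ ∞ g φ.target := by
    rw [← contMDiffOn_iff_contDiffOn]
    intro y hy
    refine ContMDiffAt.contMDiffWithinAt ?_
    exact contMDiffAt_mfderiv_apply (chartAt H x₀).open_source contMDiffOn_extChartAt
      (z := fun y => ⟨φ.symm y, v (φ.symm y)⟩)
      ((hv.contMDiffAt).comp y (hsm.contMDiffAt (hopen.mem_nhds hy)))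
      (by rw [← extChartAt_source I]; exact φ.map_target hy)
  obtain ⟨r, hr, hball⟩ := Metric.isOpen_iff.1 hopen (φ x₀) (mem_extChartAt_target x₀)
  -- The bump function is 1 on the ball of radius r/4, where the flow will be kept, and vanishes
  -- outside radius r/2, strictly inside the ball of radius r in the chart.
  let b : ContDiffBump (φ x₀) := ⟨r / 4, r / 2, by positivity, by linarith⟩
  have hbs : ContDiff ℝ ∞ (fun y => b y • g y) := by
    rw [contDiff_iff_contDiffAt]
    intro y
    by_cases hy : y ∈ φ.target
    · exact b.contDiff.contDiffAt.smul (hgs.contDiffAt (hopen.mem_nhds hy))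
    · have : (fun y => b y • g y) =ᶠ[𝓝 y] fun _ => 0 := by
        have hcl : (Metric.closedBall (φ x₀) (r / 2))ᶜ ∈ 𝓝 y :=
          Metric.isClosed_closedBall.isOpen_compl.mem_nhds fun h =>
            hy (hball (Metric.closedBall_subset_ball (by linarith) h))
        filter_upwards [hcl] with z hz
        rw [b.zero_of_le_dist (le_of_not_ge hz), zero_smul]
      exact contDiffAt_const.congr_of_eventuallyEq this
  obtain ⟨δ, hδ, Φ, h1, h2, h3⟩ := exists_local_flow hbs (φ x₀)
  -- keep the flow inside the ball on which the cutoff is `1`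
  have hnear : ∀ᶠ p in 𝓝 ((0:ℝ), φ x₀), Φ p ∈ Metric.ball (φ x₀) (r / 4) := by
    have hc : ContinuousAt Φ (0, φ x₀) :=
      (h1 _ ⟨Metric.mem_ball_self hδ, Metric.mem_ball_self hδ⟩).continuousAt
    refine hc.eventually ?_
    rw [h2 _ (Metric.mem_ball_self hδ)]
    exact Metric.ball_mem_nhds _ (by positivity)
  obtain ⟨η, hη, hη'⟩ := Metric.eventually_nhds_iff_ball.1 hnear
  set ε := min δ η
  have hε : 0 < ε := lt_min hδ hη
  have hin : ∀ t ∈ Metric.ball (0:ℝ) ε, ∀ y ∈ Metric.ball (φ x₀) ε,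
      Φ (t, y) ∈ Metric.ball (φ x₀) (r / 4) := fun t ht y hy =>
    hη' _ (by
      rw [← ball_prod_same]
      exact ⟨Metric.ball_subset_ball (min_le_right _ _) ht,
        Metric.ball_subset_ball (min_le_right _ _) hy⟩)
  have hint : ∀ t ∈ Metric.ball (0:ℝ) ε, ∀ y ∈ Metric.ball (φ x₀) ε, Φ (t, y) ∈ φ.target :=
    fun t ht y hy => hball (Metric.ball_subset_ball (by linarith) (hin t ht y hy))
  refine ⟨ε, hε, φ.source ∩ φ ⁻¹' Metric.ball (φ x₀) ε, ?_, fun p => φ.symm (Φ (p.1, φ p.2)), ?_, ?_⟩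
  · exact Filter.inter_mem (extChartAt_source_mem_nhds x₀)
      ((continuousAt_extChartAt x₀).preimage_mem_nhds (Metric.ball_mem_nhds _ hε))
  · rintro ⟨t, x⟩ ⟨ht, hx, hx'⟩
    have hx'' : x ∈ (chartAt H x₀).source := by rwa [hφ, extChartAt_source] at hx
    have e1 : ContMDiffAt (𝓘(ℝ, ℝ).prod I) (𝓘(ℝ, ℝ).prod 𝓘(ℝ, E)) ∞
        (fun p : ℝ × N => (p.1, φ p.2)) (t, x) :=
      contMDiffAt_fst.prodMk (((contMDiffOn_extChartAt.contMDiffAt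
        ((chartAt H x₀).open_source.mem_nhds hx''))).comp _ contMDiffAt_snd)
    have e2 : ContMDiffAt (𝓘(ℝ, ℝ).prod 𝓘(ℝ, E)) 𝓘(ℝ, E) ∞ Φ (t, φ x) := by
      have := (h1 (t, φ x) ⟨Metric.ball_subset_ball (min_le_left _ _) ht,
        Metric.ball_subset_ball (min_le_left _ _) hx'⟩).contMDiffAt
      rwa [modelWithCornersSelf_prod, ← chartedSpaceSelf_prod] at this
    exact (hsm.contMDiffAt (hopen.mem_nhds (hint t ht _ hx'))).comp (t, x)
      (f := fun p : ℝ × N => Φ (p.1, φ p.2)) (e2.comp (t, x) e1)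
  · rintro x ⟨hx, hx'⟩
    have hδε : Metric.ball (φ x₀) ε ⊆ Metric.ball (φ x₀) δ := Metric.ball_subset_ball (min_le_left _ _)
    refine ⟨by dsimp only; rw [h2 _ (hδε hx'), φ.left_inv hx], fun t ht => ?_⟩
    have ht' : t ∈ Metric.ball (0:ℝ) ε := by rwa [Real.ball_eq_Ioo, zero_sub, zero_add]
    refine HasMFDerivAt.hasMFDerivWithinAt ?_
    refine hasMFDerivAt_symm_comp (hint t ht' _ hx') ?_
    have := h3 (φ x) (hδε hx') t (Metric.ball_subset_ball (min_le_left _ _) ht')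
    rwa [b.one_of_mem_closedBall (Metric.ball_subset_closedBall (hin t ht' _ hx')), one_smul] at this

end ManifoldFlow

/-! ### Smoothness of complete flows. -/

section GlobalFlow

variable {E H N : Type*} [NormedAddCommGroup E] [NormedSpace ℝ E] [TopologicalSpace H]
  {I : ModelWithCorners ℝ E H} [TopologicalSpace N] [ChartedSpace H N] [IsManifold I ∞ N]
  [I.Boundaryless] [CompleteSpace E] [FiniteDimensional ℝ E] [T2Space N]

/-- Both sides, as functions of `s`, are integral curves through `Θ (t, x)`, so uniqueness applies.
-/
lemma flow_add {v : (x : N) → TangentSpace I x}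
    (hv : ContMDiff I I.tangent ∞ (fun x => (⟨x, v x⟩ : TangentBundle I N))) {Θ : ℝ × N → N}
    (h0 : ∀ x, Θ (0, x) = x) (hc : ∀ x, IsMIntegralCurve (fun t => Θ (t, x)) v) (s t : ℝ) (x : N) :
    Θ (s + t, x) = Θ (s, Θ (t, x)) := by
  have : IsManifold I 1 N := IsManifold.of_le (n := ∞) (by simp)
  have h1 : IsMIntegralCurve (fun s => Θ (s + t, x)) v := (hc x).comp_add t
  refine congrFun (isMIntegralCurve_Ioo_eq_of_contMDiff_boundaryless (t₀ := 0)
    (hv.of_le (by simp)) h1 (hc (Θ (t, x))) ?_) s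
  rw [zero_add, h0]

/-- For short times uniqueness identifies `Θ` with a smooth local flow, with a uniform time bound
along any compact set. A compact piece of trajectory is then covered by finitely many short steps.
-/
theorem contMDiff_flow {v : (x : N) → TangentSpace I x}
    (hv : ContMDiff I I.tangent ∞ (fun x => (⟨x, v x⟩ : TangentBundle I N))) {Θ : ℝ × N → N}
    (h0 : ∀ x, Θ (0, x) = x) (hc : ∀ x, IsMIntegralCurve (fun t => Θ (t, x)) v) :
    ContMDiff (𝓘(ℝ, ℝ).prod I) I ∞ Θ := by
  have : IsManifold I 1 N := IsManifold.of_le (n := ∞) (by simp)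
  have hadd := flow_add hv h0 hc
  have loc : ∀ x₀ : N, ∃ U ∈ 𝓝 x₀, ∃ δ > 0, ∀ x ∈ U, ∀ t, |t| < δ →
      ContMDiffAt (𝓘(ℝ, ℝ).prod I) I ∞ Θ (t, x) := by
    intro x₀
    obtain ⟨δ, hδ, U, hU, Ψ, h1, h2⟩ := exists_local_flow_manifold hv x₀
    have agree : ∀ t, |t| < δ → ∀ x ∈ U, Θ (t, x) = Ψ (t, x) := fun t ht x hx =>
      isMIntegralCurveOn_Ioo_eqOn_of_contMDiff_boundaryless (t₀ := 0) ⟨by linarith, hδ⟩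
        (hv.of_le (by simp)) ((hc x).isMIntegralCurveOn _) (h2 x hx).2
        (by rw [h0, (h2 x hx).1]) (abs_lt.1 ht)
    refine ⟨interior U, interior_mem_nhds.2 hU, δ, hδ, fun x hx t ht => ?_⟩
    refine (h1 (t, x) ⟨by simpa using ht, interior_subset hx⟩).congr_of_eventuallyEq ?_
    have : Metric.ball (0:ℝ) δ ×ˢ interior U ∈ 𝓝 (t, x) :=
      (Metric.isOpen_ball.prod isOpen_interior).mem_nhds ⟨by simpa using ht, hx⟩
    filter_upwards [this] with p hp
    exact agree p.1 (by simpa using hp.1) p.2 (interior_subset hp.2)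
  have unif : ∀ K : Set N, IsCompact K → ∃ δ > 0, ∀ x ∈ K, ∀ t, |t| < δ →
      ContMDiffAt (𝓘(ℝ, ℝ).prod I) I ∞ Θ (t, x) := by
    intro K hK
    refine hK.induction_on (p := fun K => ∃ δ > 0, ∀ x ∈ K, ∀ t, |t| < δ →
      ContMDiffAt (𝓘(ℝ, ℝ).prod I) I ∞ Θ (t, x)) ⟨1, one_pos, by simp⟩ ?_ ?_ ?_
    · rintro s t hst ⟨δ, hδ, h⟩
      exact ⟨δ, hδ, fun x hx => h x (hst hx)⟩
    · rintro s t ⟨δ, hδ, h⟩ ⟨δ', hδ', h'⟩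
      refine ⟨min δ δ', lt_min hδ hδ', ?_⟩
      rintro x (hx | hx) τ hτ
      · exact h x hx τ (hτ.trans_le (min_le_left _ _))
      · exact h' x hx τ (hτ.trans_le (min_le_right _ _))
    · intro x _
      obtain ⟨U, hU, δ, hδ, h⟩ := loc x
      exact ⟨U, mem_nhdsWithin_of_mem_nhds hU, δ, hδ, h⟩
  rintro ⟨T, p⟩
  have hcont : Continuous fun t => Θ (t, p) :=
    continuous_iff_continuousAt.2 fun t => (hc p t).continuousAt
  obtain ⟨δ, hδ, hK⟩ := unif _ ((isCompact_Icc (a := -|T|) (b := |T|)).image hcont)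
  -- The time T is cut into m steps shorter than the uniform time δ of the trajectory.
  obtain ⟨m, hm⟩ := exists_nat_gt (|T| / δ)
  have hm0 : (0:ℝ) < m := lt_of_le_of_lt (by positivity) hm
  set τ := T / m with hτ
  have hτδ : |τ| < δ := by
    rw [hτ, abs_div, abs_of_pos hm0, div_lt_iff₀ hm0]
    rwa [div_lt_iff₀ hδ, mul_comm] at hm
  have hk : ∀ k : ℕ, k ≤ m → ContMDiffAt I I ∞ (fun q => Θ (k * τ, q)) p := by
    intro k
    induction k with
    | zero =>
      intro _
      have : (fun q => Θ (((0:ℕ):ℝ) * τ, q)) = fun q => q := by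
        funext q; rw [Nat.cast_zero, zero_mul, h0]
      rw [this]
      exact contMDiffAt_id
    | succ k ih =>
      intro hkm
      have e : (fun q => Θ (((k + 1 : ℕ):ℝ) * τ, q)) = fun q => Θ (τ, Θ (k * τ, q)) := by
        funext q
        rw [← hadd]
        push_cast
        ring_nf
      rw [e]
      have hmem : Θ (k * τ, p) ∈ (fun t => Θ (t, p)) '' Icc (-|T|) |T| := by
        refine ⟨k * τ, abs_le.1 ?_, rfl⟩
        rw [hτ, abs_mul, abs_div, abs_of_pos hm0, Nat.abs_cast, mul_div_assoc', div_le_iff₀ hm0,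
          mul_comm]
        have : (k:ℝ) ≤ m := by exact_mod_cast (Nat.le_succ k).trans hkm
        nlinarith [abs_nonneg T]
      exact (hK _ hmem τ hτδ).comp p (f := fun q => (τ, Θ (k * τ, q)))
        (contMDiffAt_const.prodMk (ih ((Nat.le_succ k).trans hkm)))
  have hT : ContMDiffAt I I ∞ (fun q => Θ (T, q)) p := by
    have := hk m le_rfl
    rwa [hτ, mul_div_cancel₀ _ hm0.ne'] at this
  -- The group law factors the flow near (T, p) into the fixed-time map at T, already smooth at p,
  -- and the flow for short times near `Θ (T, p)`.
  have e : Θ = fun q : ℝ × N => Θ (q.1 - T, Θ (T, q.2)) := by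
    funext q
    rw [← hadd, sub_add_cancel]
  rw [e]
  have hmem : Θ (T, p) ∈ (fun t => Θ (t, p)) '' Icc (-|T|) |T| :=
    ⟨T, ⟨neg_abs_le T, le_abs_self T⟩, rfl⟩
  have h3 : ContMDiffAt (𝓘(ℝ, ℝ).prod I) I ∞ Θ (T - T, Θ (T, p)) := hK _ hmem _ (by simpa using hδ)
  refine h3.comp (T, p) (f := fun q : ℝ × N => (q.1 - T, Θ (T, q.2))) ?_
  exact (contMDiffAt_fst.sub contMDiffAt_const).prodMk
    (hT.comp (T, p) (f := fun q : ℝ × N => q.2) contMDiffAt_snd)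

/-- Local integral curves that exist for a uniform time. -/
lemma exists_uniform_time {v : (x : N) → TangentSpace I x}
    (hv : ContMDiff I I.tangent ∞ (fun x => (⟨x, v x⟩ : TangentBundle I N))) {K : Set N}
    (hK : IsCompact K) : ∃ ε > 0, ∀ x ∈ K, ∃ γ : ℝ → N, γ 0 = x ∧
      IsMIntegralCurveOn γ v (Ioo (-ε) ε) := by
  refine hK.induction_on (p := fun K => ∃ ε > 0, ∀ x ∈ K, ∃ γ : ℝ → N, γ 0 = x ∧
      IsMIntegralCurveOn γ v (Ioo (-ε) ε)) ⟨1, one_pos, by simp⟩ ?_ ?_ ?_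
  · rintro s t hst ⟨δ, hδ, h⟩
    exact ⟨δ, hδ, fun x hx => h x (hst hx)⟩
  · rintro s t ⟨δ, hδ, h⟩ ⟨δ', hδ', h'⟩
    have l := min_le_left δ δ'
    have r := min_le_right δ δ'
    refine ⟨min δ δ', lt_min hδ hδ', ?_⟩
    rintro x (hx | hx)
    · obtain ⟨γ, h0, h1⟩ := h x hx
      exact ⟨γ, h0, h1.mono (Ioo_subset_Ioo (by linarith) l)⟩
    · obtain ⟨γ, h0, h1⟩ := h' x hx
      exact ⟨γ, h0, h1.mono (Ioo_subset_Ioo (by linarith) r)⟩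
  · intro x _
    obtain ⟨δ, hδ, U, hU, Ψ, -, h2⟩ := exists_local_flow_manifold hv x
    exact ⟨U, mem_nhdsWithin_of_mem_nhds hU, δ, hδ, fun y hy => ⟨fun t => Ψ (t, y), h2 y hy⟩⟩

end GlobalFlow

/-! ### Flows of time-dependent vector fields. -/

section TimeDependent

variable {n : ℕ} {M : Type*} [TopologicalSpace M] [ChartedSpace (Model n) M]
  [IsManifold (𝓡 n) ∞ M]

abbrev timeModel (n : ℕ) := 𝓘(ℝ, ℝ).prod (𝓡 n)

/-- The vector field `a(t, x) ∂_t + v_t` on `ℝ × M`. -/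
def spacetime (a : ℝ × M → ℝ) (v : ∀ p : ℝ × M, TangentSpace (𝓡 n) p.2) (p : ℝ × M) :
    TangentSpace (timeModel n) p := ((a p : ℝ), (v p : Model n))

lemma contMDiff_spacetime {a : ℝ × M → ℝ} {v : ∀ p : ℝ × M, TangentSpace (𝓡 n) p.2}
    (ha : ContMDiff (timeModel n) 𝓘(ℝ, ℝ) ∞ a)
    (hv : ContMDiff (timeModel n) (𝓡 n).tangent ∞
      (fun p : ℝ × M => (⟨p.2, v p⟩ : TangentBundle (𝓡 n) M))) :
    ContMDiff (timeModel n) (timeModel n).tangent ∞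
      (fun p => (⟨p, spacetime a v p⟩ : TangentBundle (timeModel n) (ℝ × M))) := by
  have h1 : ContMDiff (timeModel n) 𝓘(ℝ, ℝ).tangent ∞
      (fun p : ℝ × M => (⟨p.1, a p⟩ : TangentBundle 𝓘(ℝ, ℝ) ℝ)) := by
    intro p
    rw [Bundle.contMDiffAt_totalSpace]
    refine ⟨contMDiffAt_fst, ?_⟩
    simpa using ha p
  exact contMDiff_equivTangentBundleProd_symm.comp (h1.prodMk hv)

variable {a : ℝ × M → ℝ} {v : ∀ p : ℝ × M, TangentSpace (𝓡 n) p.2} {γ : ℝ → ℝ × M} {s : Set ℝ}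
  {t : ℝ}

lemma hasMFDerivAt_spacetime_fst
    (h : HasMFDerivAt 𝓘(ℝ, ℝ) (timeModel n) γ t ((1 : ℝ →L[ℝ] ℝ).smulRight (spacetime a v (γ t)))) :
    HasDerivAt (fun s => (γ s).1) (a (γ t)) t := by
  have h1 := (hasMFDerivAt_fst (I := 𝓘(ℝ, ℝ)) (I' := 𝓡 n) (γ t)).comp t h
  have h2 := h1.hasFDerivAt
  rw [hasDerivAt_iff_hasFDerivAt]
  refine h2.congr_fderiv ?_
  ext
  rfl

lemma hasMFDerivAt_spacetime_snd
    (h : HasMFDerivAt 𝓘(ℝ, ℝ) (timeModel n) γ t ((1 : ℝ →L[ℝ] ℝ).smulRight (spacetime a v (γ t)))) :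
    HasMFDerivAt 𝓘(ℝ, ℝ) (𝓡 n) (fun s => (γ s).2) t ((1 : ℝ →L[ℝ] ℝ).smulRight (v (γ t))) := by
  have h1 := (hasMFDerivAt_snd (I := 𝓘(ℝ, ℝ)) (I' := 𝓡 n) (γ t)).comp t h
  refine h1.congr_mfderiv ?_
  ext
  rfl

lemma hasMFDerivAt_spacetime (h1 : HasDerivAt (fun s => (γ s).1) (a (γ t)) t)
    (h2 : HasMFDerivAt 𝓘(ℝ, ℝ) (𝓡 n) (fun s => (γ s).2) t
      ((1 : ℝ →L[ℝ] ℝ).smulRight (v (γ t)))) :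
    HasMFDerivAt 𝓘(ℝ, ℝ) (timeModel n) γ t
      ((1 : ℝ →L[ℝ] ℝ).smulRight (spacetime a v (γ t))) := by
  have h3 := h1.hasFDerivAt.hasMFDerivAt.prodMk h2
  refine h3.congr_mfderiv ?_
  ext <;> rfl

/-- The field `∂_t + v_t` on `ℝ × M`. -/
def suspension (v : ℝ → VField n M) (p : ℝ × M) : TangentSpace (timeModel n) p :=
  spacetime (fun _ => 1) (fun p => v p.1 p.2) p

lemma fst_eq_of_deriv_one {c : ℝ → ℝ} (h : ∀ s, HasDerivAt c 1 s) (s : ℝ) : c s = c 0 + s := by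
  have : ∀ s, HasDerivAt (fun s => c s - s) 0 s := fun s => by
    simpa [Function.comp_def] using (h s).fun_sub (hasDerivAt_id' s)
  have := is_const_of_deriv_eq_zero (fun s => (this s).differentiableAt)
    (fun s => (this s).deriv) s 0
  simp only [sub_zero] at this
  linarith

variable [CompactSpace M] [T2Space M]

/-- The product ℝ × M is not compact, so the spatial part is cut off in time. The modified field has
a uniform existence time, hence is complete, and on any bounded interval it agrees with the given
one along the curve. -/
lemma exists_integralCurve_suspension {v : ℝ → VField n M} (hv : SmoothField v) (p : ℝ × M) :
    ∃ γ : ℝ → ℝ × M, γ 0 = p ∧ IsMIntegralCurve γ (suspension v) := by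
  have : IsManifold (timeModel n) 1 (ℝ × M) := IsManifold.of_le (n := ∞) (by simp)
  have hsus : ContMDiff (timeModel n) (timeModel n).tangent ∞
      (fun p => (⟨p, suspension v p⟩ : TangentBundle (timeModel n) (ℝ × M))) :=
    contMDiff_spacetime contMDiff_const hv
  rw [exists_isMIntegralCurve_iff_exists_isMIntegralCurveOn_Ioo (hsus.of_le (by simp))]
  intro b
  -- The time coordinate starts at `p.1` and moves at unit speed, so for parameters in (-b, b) it
  -- stays in the region |t| ≤ R where the cutoff is 1.
  set R := |p.1| + |b| + 1 with hR
  have hRpos : 0 < R := by positivity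
  let χ : ContDiffBump (0:ℝ) := ⟨R, R + 1, hRpos, by linarith⟩
  let w : ∀ p : ℝ × M, TangentSpace (𝓡 n) p.2 := fun p => χ p.1 • v p.1 p.2
  have hw : ContMDiff (timeModel n) (𝓡 n).tangent ∞
      (fun p : ℝ × M => (⟨p.2, w p⟩ : TangentBundle (𝓡 n) M)) := by
    intro q
    have h1 := hv q
    rw [Bundle.contMDiffAt_totalSpace] at h1 ⊢
    refine ⟨h1.1, ?_⟩
    have h2 : ContMDiffAt (timeModel n) 𝓘(ℝ, ℝ) ∞ (fun q : ℝ × M => χ q.1) q :=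
      (χ.contDiff.contMDiff).contMDiffAt.comp q contMDiffAt_fst
    refine (h2.smul h1.2).congr_of_eventuallyEq ?_
    have : ∀ᶠ z : ℝ × M in 𝓝 q, z.2 ∈ (trivializationAt (Model n) (TangentSpace (𝓡 n)) q.2).baseSet :=
      continuousAt_snd.eventually
        ((trivializationAt (Model n) (TangentSpace (𝓡 n)) q.2).open_baseSet.mem_nhds
          (FiberBundle.mem_baseSet_trivializationAt' q.2))
    filter_upwards [this] with z hz
    exact ((trivializationAt (Model n) (TangentSpace (𝓡 n)) q.2).linear ℝ hz).map_smul _ _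
  have hsw := contMDiff_spacetime (a := fun _ => 1) contMDiff_const hw
  obtain ⟨ε, hε, hK⟩ := exists_uniform_time hsw
    ((isCompact_Icc (a := -(R + 2)) (b := R + 2)).prod (isCompact_univ (X := M)))
  obtain ⟨γ, h0, hγ⟩ := exists_isMIntegralCurve_of_isMIntegralCurveOn (hsw.of_le (by simp))
    (lt_min hε one_pos) (fun q => by
      -- Beyond R + 2 a curve of duration at most 1 stays where the cutoff vanishes, so it only
      -- moves in time. The remaining starting points form a compact set.
      by_cases hq : |q.1| ≤ R + 2
      · obtain ⟨γ, h0, h1⟩ := hK q ⟨abs_le.1 hq, mem_univ _⟩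
        have l := min_le_left ε 1
        exact ⟨γ, h0, h1.mono (Ioo_subset_Ioo (by linarith) l)⟩
      · refine ⟨fun s => (q.1 + s, q.2), by simp, fun s hs => HasMFDerivAt.hasMFDerivWithinAt ?_⟩
        refine hasMFDerivAt_spacetime (by simpa using (hasDerivAt_id s).const_add q.1) ?_
        have hz : χ (q.1 + s) = 0 := by
          refine χ.zero_of_le_dist ?_
          have h1 := abs_lt.2 hs
          have h2 : |q.1| ≤ |q.1 + s| + |s| := by
            simpa using abs_sub (q.1 + s) s
          have r := min_le_right ε 1
          rw [Real.dist_eq, sub_zero]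
          change R + 1 ≤ _
          push Not at hq
          linarith
        refine (hasMFDerivAt_const q.2 s).congr_mfderiv ?_
        ext
        simp only [w, hz, zero_smul]
        exact (smul_zero (1:ℝ) : (1:ℝ) • (0 : Model n) = 0).symm) p
  refine ⟨γ, h0, fun s hs => HasMFDerivAt.hasMFDerivWithinAt ?_⟩
  have hfst : ∀ s, (γ s).1 = p.1 + s := fun s => by
    have := fst_eq_of_deriv_one (c := fun s => (γ s).1)
      (fun s => hasMFDerivAt_spacetime_fst (hγ s)) s
    rwa [h0] at this
  refine (hγ s).congr_mfderiv ?_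
  have hone : χ (γ s).1 = 1 := by
    refine χ.one_of_mem_closedBall ?_
    rw [mem_closedBall_zero_iff, Real.norm_eq_abs, hfst]
    change _ ≤ R
    have := abs_lt.2 hs
    have := abs_add_le p.1 s
    have := le_abs_self b
    linarith
  have : w (γ s) = v (γ s).1 (γ s).2 := by
    simp only [w, hone, one_smul]
  exact congrArg (fun u : Model n => (1 : ℝ →L[ℝ] ℝ).smulRight ((1:ℝ), u)) this

/-- The flow of a time-dependent vector field. -/
theorem exists_flow {v : ℝ → VField n M} (hv : SmoothField v) :
    ∃ φ : ℝ → Dif n M, SmoothDif φ ∧ SmoothDif (fun t => (φ t)⁻¹) ∧ φ 0 = 1 ∧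
      ∀ t x, HasMFDerivAt 𝓘(ℝ, ℝ) (𝓡 n) (fun s => φ s x) t
        ((1 : ℝ →L[ℝ] ℝ).smulRight (v t (φ t x))) := by
  have hsus : ContMDiff (timeModel n) (timeModel n).tangent ∞
      (fun p => (⟨p, suspension v p⟩ : TangentBundle (timeModel n) (ℝ × M))) :=
    contMDiff_spacetime contMDiff_const hv
  choose Γ h0 hΓ using exists_integralCurve_suspension hv
  let Θ : ℝ × ℝ × M → ℝ × M := fun q => Γ q.2 q.1
  have hadd := flow_add hsus (Θ := Θ) h0 hΓ
  have hsm := contMDiff_flow hsus (Θ := Θ) h0 hΓ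
  have hfst : ∀ s q, (Θ (s, q)).1 = q.1 + s := fun s q => by
    have := fst_eq_of_deriv_one (c := fun s => (Γ q s).1)
      (fun s => hasMFDerivAt_spacetime_fst (hΓ q s)) s
    rwa [h0] at this
  have s1 : ContMDiff (timeModel n) (𝓡 n) ∞ (fun p : ℝ × M => (Θ (p.1, (0, p.2))).2) :=
    contMDiff_snd.comp (hsm.comp (contMDiff_fst.prodMk (contMDiff_const.prodMk contMDiff_snd)))
  have s2 : ContMDiff (timeModel n) (𝓡 n) ∞ (fun p : ℝ × M => (Θ (-p.1, (p.1, p.2))).2) :=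
    contMDiff_snd.comp (hsm.comp (contMDiff_fst.neg.prodMk (contMDiff_fst.prodMk contMDiff_snd)))
  have k1 : ∀ t x, (Θ (-t, (t, (Θ (t, ((0:ℝ), x))).2))).2 = x := by
    intro t x
    have : ((t, (Θ (t, ((0:ℝ), x))).2) : ℝ × M) = Θ (t, (0, x)) :=
      Prod.ext (by rw [hfst, zero_add]) rfl
    rw [this, ← hadd, neg_add_cancel]
    exact congrArg Prod.snd (h0 _)
  have k2 : ∀ t x, (Θ (t, ((0:ℝ), (Θ (-t, (t, x))).2))).2 = x := by
    intro t x
    have : (((0:ℝ), (Θ (-t, (t, x))).2) : ℝ × M) = Θ (-t, (t, x)) :=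
      Prod.ext (by rw [hfst, add_neg_cancel]) rfl
    rw [this, ← hadd, add_neg_cancel]
    exact congrArg Prod.snd (h0 _)
  let φ : ℝ → Dif n M := fun t =>
    { toFun := fun x => (Θ (t, (0, x))).2
      invFun := fun x => (Θ (-t, (t, x))).2
      left_inv := k1 t
      right_inv := k2 t
      contMDiff_toFun := s1.comp (contMDiff_const.prodMk contMDiff_id)
      contMDiff_invFun := s2.comp (contMDiff_const.prodMk contMDiff_id) }
  refine ⟨φ, s1, s2, ?_, fun t x => ?_⟩
  · ext x
    exact congrArg Prod.snd (h0 _)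
  · have h := hasMFDerivAt_spacetime_snd (hΓ ((0:ℝ), x) t)
    refine h.congr_mfderiv ?_
    have e : (Γ ((0:ℝ), x) t).1 = t := (hfst t ((0:ℝ), x)).trans (zero_add t)
    exact congrArg (fun τ => (1 : ℝ →L[ℝ] ℝ).smulRight
      (v τ (Γ ((0:ℝ), x) t).2 : Model n)) e

end TimeDependent

/-! ### Differential calculus of smooth families. -/

section Calculus

variable {n : ℕ} {M : Type*} [TopologicalSpace M] [ChartedSpace (Model n) M]
  [IsManifold (𝓡 n) ∞ M] {F : Type*} [NormedAddCommGroup F] [NormedSpace ℝ F]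

abbrev Maps (n : ℕ) (M F : Type*) [TopologicalSpace M] [ChartedSpace (Model n) M]
    [NormedAddCommGroup F] [NormedSpace ℝ F] := C^∞⟮𝓡 n, M; 𝓘(ℝ, F), F⟯

lemma Maps.mdiff (f : Maps n M F) (x : M) : MDifferentiableAt (𝓡 n) 𝓘(ℝ, F) f x :=
  (f.contMDiff x).mdifferentiableAt (by simp)

/-- The derivative of a vector-valued function along a vector field. -/
def along (v : VField n M) (f : Maps n M F) : Maps n M F :=
  ⟨fun x => mfderiv (𝓡 n) 𝓘(ℝ, F) f x (v x), fun x =>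
    contMDiffAt_mfderiv_apply isOpen_univ f.contMDiff.contMDiffOn (z := fun x => ⟨x, v x⟩)
      (v.contMDiff x) (mem_univ _)⟩

lemma lie_eq_along (v : VField n M) (f : Fun n M) : lie v f = along v f := rfl

/-- `γ` has the velocity `u` at the time `t`. -/
def HasVelocityAt (γ : ℝ → M) (t : ℝ) {x : M} (u : TangentSpace (𝓡 n) x) : Prop :=
  γ t = x ∧ HasMFDerivAt 𝓘(ℝ, ℝ) (𝓡 n) γ t
    ((1 : ℝ →L[ℝ] ℝ).smulRight (show TangentSpace (𝓡 n) (γ t) from (u : Model n)))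

lemma hasVelocityAt_iff {γ : ℝ → M} {t : ℝ} {u : TangentSpace (𝓡 n) (γ t)} :
    HasVelocityAt γ t u ↔ HasMFDerivAt 𝓘(ℝ, ℝ) (𝓡 n) γ t ((1 : ℝ →L[ℝ] ℝ).smulRight u) :=
  ⟨fun h => h.2, fun h => ⟨rfl, h⟩⟩

lemma hasDerivAt_of_hasMFDerivAt {g : ℝ → F} {t : ℝ} {L : ℝ →L[ℝ] F}
    (h : HasMFDerivAt 𝓘(ℝ, ℝ) 𝓘(ℝ, F) g t L) {u : F} (hu : L 1 = u) : HasDerivAt g u t := by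
  subst hu
  have h2 : HasFDerivAt g L t := h.hasFDerivAt
  exact h2.hasDerivAt

lemma HasVelocityAt.comp_of_mdiff {γ : ℝ → M} {t : ℝ} {x : M} {u : TangentSpace (𝓡 n) x}
    (h : HasVelocityAt γ t u) {f : M → F} (hf : MDifferentiableAt (𝓡 n) 𝓘(ℝ, F) f x) :
    HasDerivAt (fun s => f (γ s)) (mfderiv (𝓡 n) 𝓘(ℝ, F) f x u) t := by
  obtain ⟨rfl, h⟩ := h
  exact hasDerivAt_of_hasMFDerivAt (hf.hasMFDerivAt.comp t h)
    (congrArg (mfderiv (𝓡 n) 𝓘(ℝ, F) f (γ t)) (one_smul ℝ (u : Model n)))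

lemma HasVelocityAt.comp {γ : ℝ → M} {t : ℝ} {x : M} {v : VField n M}
    (h : HasVelocityAt γ t (v x)) (f : Maps n M F) :
    HasDerivAt (fun s => f (γ s)) (along v f x) t :=
  h.comp_of_mdiff (f.mdiff x)

lemma mfderiv_slice {f : ℝ × M → F} (hf : ContMDiff (timeModel n) 𝓘(ℝ, F) ∞ f) (t : ℝ) (x : M)
    (u : TangentSpace (𝓡 n) x) : mfderiv (𝓡 n) 𝓘(ℝ, F) (fun y => f (t, y)) x u
      = mfderiv (timeModel n) 𝓘(ℝ, F) f (t, x) ((0 : ℝ), (u : Model n)) := by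
  have h1 := ((hf (t, x)).mdifferentiableAt (by simp)).hasMFDerivAt
  have h2 : HasMFDerivAt (𝓡 n) (timeModel n) (fun y : M => (t, y)) x _ :=
    (hasMFDerivAt_const t x).prodMk (hasMFDerivAt_id x)
  exact congrArg (fun L : Model n →L[ℝ] F => L u)
    (HasMFDerivAt.comp x (f := fun y => (t, y)) h1 h2).mfderiv

lemma hasDerivAt_along_curve {f : ℝ × M → F} (hf : ContMDiff (timeModel n) 𝓘(ℝ, F) ∞ f) {t : ℝ}
    {x : M} {γ : ℝ → M} {u : TangentSpace (𝓡 n) x} (hγ : HasVelocityAt γ t u) :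
    HasDerivAt (fun s => f (s, γ s))
      (mfderiv (timeModel n) 𝓘(ℝ, F) f (t, x) ((1 : ℝ), (u : Model n))) t := by
  obtain ⟨rfl, hγ⟩ := hγ
  have h1 := ((hf (t, γ t)).mdifferentiableAt (by simp)).hasMFDerivAt
  have h2 : HasMFDerivAt 𝓘(ℝ, ℝ) (timeModel n) (fun s => (s, γ s)) t _ :=
    (hasMFDerivAt_id t).prodMk hγ
  exact hasDerivAt_of_hasMFDerivAt (HasMFDerivAt.comp t (f := fun s => (s, γ s)) h1 h2)
    (congrArg (fun w : Model n => mfderiv (timeModel n) 𝓘(ℝ, F) f (t, γ t) ((1:ℝ), w))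
      (one_smul ℝ (u : Model n)))

lemma hasVelocityAt_const (x : M) (t : ℝ) :
    HasVelocityAt (fun _ => x) t (0 : TangentSpace (𝓡 n) x) := by
  refine ⟨rfl, (hasMFDerivAt_const x t).congr_mfderiv ?_⟩
  ext
  exact (smul_zero (1:ℝ) : (1:ℝ) • (0 : Model n) = 0).symm

lemma hasDerivAt_time {f : ℝ × M → F} (hf : ContMDiff (timeModel n) 𝓘(ℝ, F) ∞ f) (t : ℝ) (x : M) :
    HasDerivAt (fun s => f (s, x))
      (mfderiv (timeModel n) 𝓘(ℝ, F) f (t, x) ((1 : ℝ), (0 : Model n))) t :=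
  hasDerivAt_along_curve hf (hasVelocityAt_const x t)

/-- The time derivative of a smooth curve of functions. -/
def dot (c : ℝ → Maps n M F) (hc : SmoothFun c) (t : ℝ) : Maps n M F :=
  ⟨fun x => mfderiv (timeModel n) 𝓘(ℝ, F) (fun p : ℝ × M => c p.1 p.2) (t, x) ((1:ℝ), (0 : Model n)),
    fun x => contMDiffAt_mfderiv_apply isOpen_univ hc.contMDiffOn
      (z := fun x : M => (⟨(t, x), ((1:ℝ), (0 : Model n))⟩ : TangentBundle (timeModel n) (ℝ × M)))
      (((contMDiff_spacetime (a := fun _ => 1) contMDiff_const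
        ((Bundle.contMDiff_zeroSection ℝ (TangentSpace (𝓡 n) : M → Type _)).comp
          contMDiff_snd)).comp (contMDiff_const.prodMk contMDiff_id)) x)
      (mem_univ _)⟩

variable {c : ℝ → Maps n M F}

lemma SmoothFun.dot (hc : SmoothFun c) : SmoothFun (dot c hc) := fun p =>
  contMDiffAt_mfderiv_apply isOpen_univ hc.contMDiffOn
    (z := fun p : ℝ × M => (⟨p, ((1:ℝ), (0 : Model n))⟩ : TangentBundle (timeModel n) (ℝ × M)))
    ((contMDiff_spacetime (a := fun _ => 1) contMDiff_const
        ((Bundle.contMDiff_zeroSection ℝ (TangentSpace (𝓡 n) : M → Type _)).comp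
          contMDiff_snd)) p) (mem_univ _)

lemma SmoothFun.hasDerivAt (hc : SmoothFun c) (t : ℝ) (x : M) :
    HasDerivAt (fun s => c s x) (Madelung.dot c hc t x) t := hasDerivAt_time hc t x

/-- The derivative along `v t` is the derivative on ℝ × M in the direction (0, v_t), which makes it
smooth in both variables at once. -/
lemma SmoothFun.along (hc : SmoothFun c) {v : ℝ → VField n M} (hv : SmoothField v) :
    SmoothFun (fun t => along (v t) (c t)) := by
  have h : ContMDiff (timeModel n) 𝓘(ℝ, F) ∞ (fun p : ℝ × M =>
      mfderiv (timeModel n) 𝓘(ℝ, F) (fun p : ℝ × M => c p.1 p.2) p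
        ((0:ℝ), (v p.1 p.2 : Model n))) := fun p =>
    contMDiffAt_mfderiv_apply isOpen_univ hc.contMDiffOn
      (z := fun p : ℝ × M => (⟨p, ((0:ℝ), (v p.1 p.2 : Model n))⟩ :
        TangentBundle (timeModel n) (ℝ × M)))
      (contMDiff_spacetime (a := fun _ => 0) contMDiff_const hv p) (mem_univ _)
  refine h.congr fun p => ?_
  exact mfderiv_slice hc p.1 p.2 _

/-- The chain rule for a curve of functions along a curve in `M`. -/
lemma SmoothFun.hasDerivAt_comp (hc : SmoothFun c) {t : ℝ} {x : M} {γ : ℝ → M} {v : VField n M}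
    (hγ : HasVelocityAt γ t (v x)) :
    HasDerivAt (fun s => c s (γ s)) (Madelung.dot c hc t x + Madelung.along v (c t) x) t := by
  refine (hasDerivAt_along_curve hc hγ).congr_deriv ?_
  have h2 : ∀ w : Model n, (((1:ℝ), w) : ℝ × Model n) = ((1:ℝ), (0 : Model n)) + ((0:ℝ), w) :=
    fun w => by simp
  refine ((congrArg (mfderiv (timeModel n) 𝓘(ℝ, F) (fun p : ℝ × M => c p.1 p.2) (t, x)) (h2 (v x))).trans
    (map_add (mfderiv (timeModel n) 𝓘(ℝ, F) (fun p : ℝ × M => c p.1 p.2) (t, x)) _ _)).trans ?_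
  exact congrArg (fun z : F => Madelung.dot c hc t x + z) (mfderiv_slice hc t x (v x)).symm

lemma SmoothFun.velocity (hc : SmoothFun c) : VelocityFun c (Madelung.dot c hc 0) :=
  fun x => hc.hasDerivAt 0 x

lemma SmoothFun.dot_eq (hc : SmoothFun c) {y : Maps n M F} {t : ℝ}
    (h : ∀ x, HasDerivAt (fun s => c s x) (y x) t) : Madelung.dot c hc t = y := by
  ext x
  exact (hc.hasDerivAt t x).unique (h x)

lemma velocityFun_unique {y z : Maps n M F} (h : VelocityFun c y) (h' : VelocityFun c z) :
    y = z := by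
  ext x
  exact (h x).unique (h' x)

lemma smoothFun_const (f : Maps n M F) : SmoothFun (fun _ : ℝ => f) :=
  f.contMDiff.comp contMDiff_snd

lemma SmoothFun.add {d : ℝ → Maps n M F} (hc : SmoothFun c) (hd : SmoothFun d) :
    SmoothFun (fun t => c t + d t) := ContMDiff.add hc hd

lemma SmoothFun.sub {d : ℝ → Maps n M F} (hc : SmoothFun c) (hd : SmoothFun d) :
    SmoothFun (fun t => c t - d t) := ContMDiff.sub hc hd

lemma SmoothFun.neg (hc : SmoothFun c) : SmoothFun (fun t => -c t) := ContMDiff.neg hc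

lemma SmoothFun.mul {f g : ℝ → Fun n M} (hf : SmoothFun f) (hg : SmoothFun g) :
    SmoothFun (fun t => f t * g t) := ContMDiff.mul hf hg

lemma SmoothFun.smul {a : ℝ → ℝ} (ha : ContDiff ℝ ∞ a) (hc : SmoothFun c) :
    SmoothFun (fun t => a t • c t) := (ha.contMDiff.comp contMDiff_fst).smul hc

lemma SmoothFun.const_smul (a : ℝ) (hc : SmoothFun c) :
    SmoothFun (fun t => a • c t) := hc.smul contDiff_const

lemma SmoothFun.sum {ι : Type*} {s : Finset ι} {f : ι → ℝ → Fun n M}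
    (hf : ∀ i ∈ s, SmoothFun (f i)) : SmoothFun (fun t => ∑ i ∈ s, f i t) := by
  classical
  induction s using Finset.induction_on with
  | empty => simpa using smoothFun_const (0 : Fun n M)
  | insert i s hi ih =>
    simp only [Finset.sum_insert hi]
    exact (hf i (Finset.mem_insert_self _ _)).add
      (ih fun j hj => hf j (Finset.mem_insert_of_mem hj))

lemma SmoothFun.comp_dif (hc : SmoothFun c) {φ : ℝ → Dif n M} (hφ : SmoothDif φ) :
    ContMDiff (timeModel n) 𝓘(ℝ, F) ∞ (fun p : ℝ × M => c p.1 (φ p.1 p.2)) :=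
  ContMDiff.comp (g := fun p : ℝ × M => c p.1 p.2) hc (contMDiff_fst.prodMk hφ)

lemma SmoothFun.funPush {f : ℝ → Fun n M} (hf : SmoothFun f) {φ : ℝ → Dif n M}
    (hφ : SmoothDif fun t => (φ t)⁻¹) : SmoothFun (fun t => funPush (φ t) (f t)) :=
  hf.comp_dif hφ

lemma smoothField_const (v : VField n M) : SmoothField (fun _ : ℝ => v) :=
  v.contMDiff.comp contMDiff_snd

lemma smoothDif_const (φ : Dif n M) : SmoothDif (fun _ => φ) := φ.contMDiff.comp contMDiff_snd

lemma SmoothDif.mul {φ χ : ℝ → Dif n M} (hφ : SmoothDif φ) (hχ : SmoothDif χ) :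
    SmoothDif (fun t => φ t * χ t) :=
  ContMDiff.comp (g := fun p : ℝ × M => φ p.1 p.2) hφ (contMDiff_fst.prodMk hχ)

section Sections

variable {V : M → Type*} {G : Type*} [NormedAddCommGroup G] [NormedSpace ℝ G]
  [∀ x, AddCommGroup (V x)] [∀ x, Module ℝ (V x)] [∀ x, TopologicalSpace (V x)]
  [TopologicalSpace (Bundle.TotalSpace G V)] [FiberBundle G V] [VectorBundle ℝ G V]
  [ContMDiffVectorBundle ∞ G V (𝓡 n)]

/-- Trivializations are linear on fibres, so smooth coefficients depending on time can be multiplied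
into fixed smooth sections. -/
lemma contMDiff_sum_smul_section {ι : Type*} (s : Finset ι) {a : ι → ℝ × M → ℝ}
    (ha : ∀ i, ContMDiff (timeModel n) 𝓘(ℝ, ℝ) ∞ (a i)) (σ : ι → ∀ x, V x)
    (hσ : ∀ i, ContMDiff (𝓡 n) ((𝓡 n).prod 𝓘(ℝ, G)) ∞
      (fun x => (⟨x, σ i x⟩ : Bundle.TotalSpace G V))) :
    ContMDiff (timeModel n) ((𝓡 n).prod 𝓘(ℝ, G)) ∞
      (fun p : ℝ × M => (⟨p.2, ∑ i ∈ s, a i p • σ i p.2⟩ : Bundle.TotalSpace G V)) := by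
  intro q
  rw [Bundle.contMDiffAt_totalSpace]
  refine ⟨contMDiffAt_snd, ?_⟩
  have h2 : ContMDiffAt (timeModel n) 𝓘(ℝ, G) ∞ (fun p : ℝ × M => ∑ i ∈ s, a i p •
      ((trivializationAt G V q.2) (⟨p.2, σ i p.2⟩ : Bundle.TotalSpace G V)).2) q := by
    refine ContMDiffAt.sum fun i _ => ?_
    refine (ha i q).smul ?_
    have := (hσ i).comp (contMDiff_snd (I := 𝓘(ℝ, ℝ)) (J := 𝓡 n) (M := ℝ) (N := M)) q
    rw [Bundle.contMDiffAt_totalSpace] at this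
    exact this.2
  refine h2.congr_of_eventuallyEq ?_
  have : ∀ᶠ z : ℝ × M in 𝓝 q, z.2 ∈ (trivializationAt G V q.2).baseSet :=
    continuousAt_snd.eventually ((trivializationAt G V q.2).open_baseSet.mem_nhds
        (FiberBundle.mem_baseSet_trivializationAt' q.2))
  filter_upwards [this] with z hz
  have e' : ∀ y : V z.2, (trivializationAt G V q.2 ⟨z.2, y⟩).2
      = (trivializationAt G V q.2).continuousLinearMapAt ℝ z.2 y := by
    intro y
    rw [Bundle.Trivialization.continuousLinearMapAt_apply, Bundle.Trivialization.linearMapAt_apply,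
      if_pos hz]
  simp only [e', map_sum, map_smul]

end Sections

lemma SmoothForm.contract {m : ℝ → Form n M} (hm : SmoothForm m) {v : ℝ → VField n M}
    (hv : SmoothField v) : SmoothFun (fun t => contract (m t) (v t)) := by
  intro p
  have := ContMDiffAt.clm_bundle_apply (b := fun p : ℝ × M => p.2) (hm p) (hv p)
  rw [Bundle.contMDiffAt_totalSpace] at this
  exact this.2

end Calculus

/-! ### Vector fields and brackets in charts. -/

section Charts

variable {n : ℕ} {M : Type*} [TopologicalSpace M] [ChartedSpace (Model n) M]
  [IsManifold (𝓡 n) ∞ M] {F : Type*} [NormedAddCommGroup F] [NormedSpace ℝ F]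

/-- The derivative of the chart at `x₀`. -/
def chartDeriv (x₀ x : M) : TangentSpace (𝓡 n) x →L[ℝ] Model n :=
  mfderiv (𝓡 n) 𝓘(ℝ, Model n) (extChartAt (𝓡 n) x₀) x

lemma contDiffOn_chart {f : M → F} (hf : ContMDiff (𝓡 n) 𝓘(ℝ, F) ∞ f) (x₀ : M) :
    ContDiffOn ℝ ∞ (f ∘ (extChartAt (𝓡 n) x₀).symm) (extChartAt (𝓡 n) x₀).target := by
  rw [← contMDiffOn_iff_contDiffOn]
  exact hf.comp_contMDiffOn (contMDiffOn_extChartAt_symm x₀)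

lemma chart_mdiff {x₀ x : M} (hx : x ∈ (chartAt (Model n) x₀).source) :
    MDifferentiableAt (𝓡 n) 𝓘(ℝ, Model n) (extChartAt (𝓡 n) x₀) x :=
  ((contMDiffAt_extChartAt' (n := ∞) hx)).mdifferentiableAt (by simp)

lemma mfderiv_eq_chart {f : M → F} (hf : ContMDiff (𝓡 n) 𝓘(ℝ, F) ∞ f) {x₀ x : M}
    (hx : x ∈ (chartAt (Model n) x₀).source) (u : TangentSpace (𝓡 n) x) :
    mfderiv (𝓡 n) 𝓘(ℝ, F) f x u = fderiv ℝ (f ∘ (extChartAt (𝓡 n) x₀).symm)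
      (extChartAt (𝓡 n) x₀ x) (chartDeriv x₀ x u) := by
  have hx' : x ∈ (extChartAt (𝓡 n) x₀).source := by rwa [extChartAt_source]
  have h1 : HasFDerivAt (f ∘ (extChartAt (𝓡 n) x₀).symm) _ (extChartAt (𝓡 n) x₀ x) :=
    (((contDiffOn_chart hf x₀).contDiffAt ((isOpen_extChartAt_target x₀).mem_nhds
      ((extChartAt (𝓡 n) x₀).map_source hx'))).differentiableAt (by simp)).hasFDerivAt
  have h2 := HasMFDerivAt.comp x h1.hasMFDerivAt (chart_mdiff hx).hasMFDerivAt
  have e : f =ᶠ[𝓝 x] ((f ∘ (extChartAt (𝓡 n) x₀).symm) ∘ extChartAt (𝓡 n) x₀) := by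
    filter_upwards [(isOpen_extChartAt_source x₀).mem_nhds hx'] with z hz
    simp only [Function.comp, (extChartAt (𝓡 n) x₀).left_inv hz]
  have h3 := h2.congr_of_eventuallyEq e
  exact congrArg (fun L : Model n →L[ℝ] F => L u) h3.mfderiv

lemma chartDeriv_isInvertible {x₀ x : M} (hx : x ∈ (chartAt (Model n) x₀).source) :
    (chartDeriv (n := n) x₀ x).IsInvertible := by
  have : IsManifold (𝓡 n) 1 M := IsManifold.of_le (n := ∞) (by simp)
  exact isInvertible_mfderiv_extChartAt (by rwa [extChartAt_source])

/-- The Lie bracket is defined through pullbacks by inverse charts; this identifies these pullbacks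
with the images under the derivative of the chart. -/
lemma pullback_chart (v : VField n M) (x₀ : M) {y : Model n}
    (hy : y ∈ (extChartAt (𝓡 n) x₀).target) :
    (VectorField.mpullbackWithin 𝓘(ℝ, Model n) (𝓡 n) (extChartAt (𝓡 n) x₀).symm v (range (𝓡 n)) y
      : Model n) = chartDeriv x₀ ((extChartAt (𝓡 n) x₀).symm y)
        (v ((extChartAt (𝓡 n) x₀).symm y)) := by
  have : IsManifold (𝓡 n) 1 M := IsManifold.of_le (n := ∞) (by simp)
  obtain ⟨e, he⟩ := isInvertible_mfderivWithin_extChartAt_symm hy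
  have h1 := mfderivWithin_extChartAt_symm_comp_mfderiv_extChartAt hy
  have h2 := congrArg (fun L => L (v ((extChartAt (𝓡 n) x₀).symm y))) h1
  have h3 : (mfderivWithin 𝓘(ℝ, Model n) (𝓡 n) (extChartAt (𝓡 n) x₀).symm (range (𝓡 n)) y).inverse
      = (e.symm : _ →L[ℝ] _) := by
    rw [← he]; exact ContinuousLinearMap.inverse_equiv e
  have h4 : e (chartDeriv x₀ ((extChartAt (𝓡 n) x₀).symm y)
        (v ((extChartAt (𝓡 n) x₀).symm y))) = v ((extChartAt (𝓡 n) x₀).symm y) := by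
    refine Eq.trans ?_ h2
    exact congrArg (fun L : Model n →L[ℝ] TangentSpace (𝓡 n) ((extChartAt (𝓡 n) x₀).symm y) =>
      L (chartDeriv x₀ ((extChartAt (𝓡 n) x₀).symm y) (v ((extChartAt (𝓡 n) x₀).symm y)))) he
  exact (congrArg (fun L : TangentSpace (𝓡 n) ((extChartAt (𝓡 n) x₀).symm y) →L[ℝ] Model n =>
    L (v ((extChartAt (𝓡 n) x₀).symm y))) h3).trans ((ContinuousLinearEquiv.symm_apply_eq e).2 h4.symm)

/-- In a chart each iterated derivative is a second derivative of the function plus its first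
derivative applied to a derivative of a field. The second derivatives cancel by symmetry, and the
first-order terms form the bracket. -/
theorem along_bracket (v w : VField n M) (f : Maps n M F) :
    along (bracket v w) f = along v (along w f) - along w (along v f) := by
  have : IsManifold (𝓡 n) 2 M := IsManifold.of_le (n := ∞) (WithTop.coe_le_coe.2 le_top)
  ext x
  set φ := extChartAt (𝓡 n) x with hφ
  have hx := mem_chart_source (Model n) x
  set g : Model n → F := f ∘ φ.symm with hg
  have hgs := contDiffOn_chart f.contMDiff x
  have htn : φ.target ∈ 𝓝 (φ x) := (isOpen_extChartAt_target x).mem_nhds (mem_extChartAt_target x)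
  have hgat : ContDiffAt ℝ ∞ g (φ x) := hgs.contDiffAt htn
  let V : VField n M → Model n → Model n := fun v y =>
    VectorField.mpullbackWithin 𝓘(ℝ, Model n) (𝓡 n) φ.symm v (range (𝓡 n)) y
  have hVd : ∀ v : VField n M, DifferentiableAt ℝ (V v) (φ x) := by
    intro v
    have := MDifferentiableWithinAt.differentiableWithinAt_mpullbackWithin_vectorField (s := univ)
      (V := v) (x := x) ((v.contMDiff x).mdifferentiableAt (by simp)).mdifferentiableWithinAt
    rw [preimage_univ, univ_inter] at this
    have h2 : DifferentiableWithinAt ℝ (V v) (range (𝓡 n)) (φ x) := this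
    rwa [(𝓡 n).range_eq_univ, differentiableWithinAt_univ] at h2
  have key : ∀ v : VField n M, (along v f ∘ φ.symm) =ᶠ[𝓝 (φ x)] fun y => fderiv ℝ g y (V v y) := by
    intro v
    filter_upwards [htn] with y hy
    have hy' : φ.symm y ∈ (chartAt (Model n) x).source := by
      rw [← extChartAt_source (𝓡 n)]; exact φ.map_target hy
    refine (mfderiv_eq_chart f.contMDiff hy' (v (φ.symm y))).trans ?_
    have e1 : extChartAt (𝓡 n) x (φ.symm y) = y := φ.right_inv hy
    exact (congrArg (fun z => fderiv ℝ g z (chartDeriv x (φ.symm y) (v (φ.symm y)))) e1).trans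
      (congrArg (fderiv ℝ g y) (pullback_chart v x hy).symm)
  have hV0 : ∀ v : VField n M, V v (φ x) = chartDeriv x x (v x) := by
    intro v
    have h1 := pullback_chart v x (mem_extChartAt_target x)
    refine h1.trans ?_
    exact congrArg (fun z => (chartDeriv x z (v z) : Model n)) (extChartAt_to_inv x)
  have hdd : DifferentiableAt ℝ (fderiv ℝ g) (φ x) :=
    (hgat.fderiv_right (m := ∞) (by simp)).differentiableAt (by simp)
  have second : ∀ v w : VField n M, along v (along w f) x
      = fderiv ℝ (fderiv ℝ g) (φ x) (V v (φ x)) (V w (φ x))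
        + fderiv ℝ g (φ x) (fderiv ℝ (V w) (φ x) (V v (φ x))) := by
    intro v w
    refine (mfderiv_eq_chart (along w f).contMDiff hx (v x)).trans ?_
    rw [(key w).fderiv_eq, fderiv_clm_apply hdd (hVd w), ← hV0 v]
    exact add_comm _ _
  have hsymm : IsSymmSndFDerivAt ℝ g (φ x) := hgat.isSymmSndFDerivAt (by
    rw [minSmoothness_of_isRCLikeNormedField]; exact WithTop.coe_le_coe.2 le_top)
  have hbr : along (bracket v w) f x = fderiv ℝ g (φ x)
      (fderiv ℝ (V w) (φ x) (V v (φ x)) - fderiv ℝ (V v) (φ x) (V w (φ x))) := by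
    refine (mfderiv_eq_chart f.contMDiff hx (bracket v w x)).trans ?_
    refine congrArg (fderiv ℝ g (φ x)) ?_
    obtain ⟨e, he⟩ := chartDeriv_isInvertible hx
    have h0 : VectorField.mlieBracket (𝓡 n) v w x = (chartDeriv x x).inverse
      (VectorField.lieBracketWithin ℝ (V v) (V w) (φ.symm ⁻¹' univ ∩ range (𝓡 n)) (φ x)) := rfl
    rw [preimage_univ, (𝓡 n).range_eq_univ, univ_inter, VectorField.lieBracketWithin_univ] at h0
    have h1 : (bracket v w x : TangentSpace (𝓡 n) x) = e.symm
        (VectorField.lieBracket ℝ (V v) (V w) (φ x)) := by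
      refine h0.trans ?_
      rw [← he]
      exact congrArg (fun L : Model n →L[ℝ] TangentSpace (𝓡 n) x =>
        L (VectorField.lieBracket ℝ (V v) (V w) (φ x))) (ContinuousLinearMap.inverse_equiv e)
    rw [h1, ← he]
    exact e.apply_symm_apply _
  rw [hbr, map_sub]
  have e3 : (along v (along w f) - along w (along v f)) x
    = along v (along w f) x - along w (along v f) x := rfl
  rw [e3, second v w, second w v, hsymm.eq]
  abel

end Charts

/-! ### Cutoffs, partitions of unity and a global frame. -/

section Frames

variable {n : ℕ} {M : Type*} [TopologicalSpace M] [ChartedSpace (Model n) M]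
  [IsManifold (𝓡 n) ∞ M]

/-- The product of a function and a vector field. -/
def fieldSmul (a : Fun n M) (v : VField n M) : VField n M :=
  ⟨fun x => a x • v x, a.contMDiff.smul_section v.contMDiff⟩

lemma fieldSmul_apply (a : Fun n M) (v : VField n M) (x : M) : fieldSmul a v x = a x • v x := rfl

/-- The differential of a function at a point. -/
def dAt (f : Fun n M) (x : M) : TangentSpace (𝓡 n) x →L[ℝ] ℝ := mfderiv (𝓡 n) 𝓘(ℝ, ℝ) f x

lemma lie_apply (v : VField n M) (f : Fun n M) (x : M) : lie v f x = dAt f x (v x) := rfl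

lemma lie_mul (w : VField n M) (f g : Fun n M) : lie w (f * g) = f * lie w g + g * lie w f := by
  ext x
  have h := ((Maps.mdiff f x).hasMFDerivAt.mul (Maps.mdiff g x).hasMFDerivAt).mfderiv
  exact congrArg (fun L : Model n →L[ℝ] ℝ => L (w x)) h

lemma lie_add (w : VField n M) (f g : Fun n M) : lie w (f + g) = lie w f + lie w g := by
  ext x
  exact congrArg (fun m : Form n M => (m x (w x) : ℝ)) (differential.map_add f g)

lemma lie_smul (w : VField n M) (a : ℝ) (f : Fun n M) : lie w (a • f) = a • lie w f := by
  ext x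
  exact congrArg (fun m : Form n M => (m x (w x) : ℝ)) (differential.map_smul a f)

lemma lie_fieldSmul (a : Fun n M) (w : VField n M) (f : Fun n M) :
    lie (fieldSmul a w) f = a * lie w f := by
  ext x
  exact (dAt f x).map_smul (a x) (w x)

variable [T2Space M] [CompactSpace M]

lemma exists_cutoff {K U : Set M} (hK : IsClosed K) (hU : IsOpen U) (hKU : K ⊆ U) :
    ∃ χ : Fun n M, (∀ᶠ x in 𝓝ˢ K, χ x = 1) ∧ tsupport χ ⊆ U := by
  obtain ⟨V, hV, hKV, hVU⟩ := normal_exists_closure_subset hK hU hKU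
  obtain ⟨χ, h1, h2, -⟩ := exists_contMDiffMap_one_nhds_of_subset_interior (𝓡 n) (n := ⊤) hK
    (t := V) (by rwa [hV.interior_eq])
  refine ⟨χ, h1, (closure_mono ?_).trans hVU⟩
  intro x hx
  by_contra h
  exact hx (h2 x h)

lemma exists_bump {U : Set M} (hU : IsOpen U) {x : M} (hx : x ∈ U) :
    ∃ χ : Fun n M, (∀ᶠ y in 𝓝 x, χ y = 1) ∧ tsupport χ ⊆ U := by
  simpa using exists_cutoff (n := n) (K := {x}) isClosed_singleton hU (by simpa using hx)

lemma exists_partition {U : M → Set M} (hU : ∀ x, IsOpen (U x)) (hx : ∀ x, x ∈ U x) :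
    ∃ (s : Finset M) (ψ : s → Fun n M), (∀ i, tsupport (ψ i) ⊆ U i) ∧ ∀ x, ∑ i, ψ i x = 1 := by
  obtain ⟨s, hs⟩ := isCompact_univ.elim_finite_subcover U hU fun x _ => mem_iUnion.2 ⟨x, hx x⟩
  obtain ⟨f, hf⟩ := SmoothPartitionOfUnity.exists_isSubordinate (𝓡 n) isClosed_univ
    (fun i : s => U i) (fun i => hU i) (fun x hx => by
      have := hs hx
      simp only [mem_iUnion] at this ⊢
      obtain ⟨i, hi, h⟩ := this
      exact ⟨⟨i, hi⟩, h⟩)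
  refine ⟨s, fun i => f i, hf, fun x => ?_⟩
  rw [← f.sum_eq_one (mem_univ x), finsum_eq_sum_of_fintype]

variable (x₀ : M)

/-- A smooth family of functions on `ℝⁿ` with compact support in the target of a chart is a smooth
family of functions on `M`. -/
lemma exists_lift {A : ℝ × Model n → ℝ} {B : Set (Model n)} (hB : IsCompact B)
    (hBt : B ⊆ (extChartAt (𝓡 n) x₀).target)
    (hA : ContDiffOn ℝ ∞ A (univ ×ˢ (extChartAt (𝓡 n) x₀).target))
    (h0 : ∀ t, ∀ y ∉ B, A (t, y) = 0) :
    ∃ a : ℝ → Fun n M, SmoothFun a ∧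
      (∀ t, ∀ x ∈ (chartAt (Model n) x₀).source, a t x = A (t, extChartAt (𝓡 n) x₀ x)) ∧
      ∀ t, ∀ x ∉ (extChartAt (𝓡 n) x₀).symm '' B, a t x = 0 := by
  classical
  set φ := extChartAt (𝓡 n) x₀ with hφ
  have hsrc : φ.source = (chartAt (Model n) x₀).source := extChartAt_source _ _
  let f : ℝ × M → ℝ := fun p => if p.2 ∈ (chartAt (Model n) x₀).source then A (p.1, φ p.2) else 0
  have hK : IsClosed (φ.symm '' B) :=
    (hB.image_of_continuousOn ((continuousOn_extChartAt_symm x₀).mono hBt)).isClosed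
  have hz : ∀ t, ∀ x ∉ φ.symm '' B, f (t, x) = 0 := by
    intro t x hx
    simp only [f]
    split_ifs with h
    · exact h0 t _ fun hb => hx ⟨φ x, hb, φ.left_inv (by rwa [hsrc])⟩
    · rfl
  have hf : ContMDiff (timeModel n) 𝓘(ℝ, ℝ) ∞ f := by
    rintro ⟨t, x⟩
    by_cases hx : x ∈ (chartAt (Model n) x₀).source
    · have hx' : x ∈ φ.source := by rwa [hsrc]
      have e2 : ContMDiffAt (𝓘(ℝ, ℝ).prod 𝓘(ℝ, Model n)) 𝓘(ℝ, ℝ) ∞ A (t, φ x) := by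
        have := (hA.contDiffAt (x := (t, φ x)) ((isOpen_univ.prod (isOpen_extChartAt_target x₀)).mem_nhds
          ⟨mem_univ t, φ.map_source hx'⟩)).contMDiffAt
        rwa [modelWithCornersSelf_prod, ← chartedSpaceSelf_prod] at this
      have e1 : ContMDiffAt (timeModel n) (𝓘(ℝ, ℝ).prod 𝓘(ℝ, Model n)) ∞
          (fun p : ℝ × M => (p.1, φ p.2)) (t, x) :=
        contMDiffAt_fst.prodMk ((contMDiffAt_extChartAt' hx).comp _ contMDiffAt_snd)
      refine (e2.comp (t, x) e1).congr_of_eventuallyEq ?_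
      filter_upwards [continuousAt_snd.preimage_mem_nhds
        ((chartAt (Model n) x₀).open_source.mem_nhds hx)] with p hp
      exact if_pos hp
    · have hx' : x ∉ φ.symm '' B := by
        rintro ⟨y, hy, rfl⟩
        exact hx (by rw [← hsrc]; exact φ.map_target (hBt hy))
      refine contMDiffAt_const (c := (0:ℝ)) |>.congr_of_eventuallyEq ?_
      filter_upwards [continuousAt_snd.preimage_mem_nhds (hK.isOpen_compl.mem_nhds hx')] with p hp
      exact hz p.1 p.2 hp
  refine ⟨fun t => ⟨fun x => f (t, x), hf.comp (contMDiff_const.prodMk contMDiff_id)⟩, hf, ?_, hz⟩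
  intro t x hx
  exact if_pos hx

/-- The coordinate vector fields of a chart, multiplied by a function supported in the chart. -/
lemma exists_coordinate_fields {η : Fun n M} (hη : tsupport η ⊆ (chartAt (Model n) x₀).source) :
    ∃ E : Fin n → VField n M, ∀ j, (∀ x ∈ (chartAt (Model n) x₀).source,
      chartDeriv x₀ x (E j x) = η x • EuclideanSpace.single j (1:ℝ)) ∧
      ∀ x ∉ (chartAt (Model n) x₀).source, E j x = 0 := by
  have : IsManifold (𝓡 n) 1 M := IsManifold.of_le (n := ∞) (by simp)
  let e := trivializationAt (Model n) (TangentSpace (𝓡 n)) x₀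
  have hbase : e.baseSet = (chartAt (Model n) x₀).source := TangentBundle.trivializationAt_baseSet x₀
  let b := (EuclideanSpace.basisFun (Fin n) ℝ).toBasis
  refine ⟨fun j => ⟨(η : M → ℝ) • e.localFrame b j, ContMDiffOn.smul_section_of_tsupport
    (u := (chartAt (Model n) x₀).source) η.contMDiff.contMDiffOn
    (chartAt (Model n) x₀).open_source hη (by
      rw [← hbase]
      exact e.contMDiffOn_localFrame_baseSet ∞ b j)⟩, fun j => ⟨fun x hx => ?_, fun x hx => ?_⟩⟩
  · have hxb : x ∈ e.baseSet := by rwa [hbase]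
    have h1 : e.localFrame b j x = e.symmL ℝ x (b j) := by
      rw [e.localFrame_apply_of_mem_baseSet b hxb]
      simp [Bundle.Trivialization.basisAt, Bundle.Trivialization.symmL_apply, hxb]
    have h2 : chartDeriv x₀ x (e.localFrame b j x) = b j := by
      have h3 : e.continuousLinearMapAt ℝ x = chartDeriv x₀ x :=
        TangentBundle.continuousLinearMapAt_trivializationAt hx
      rw [h1, ← h3]
      exact e.continuousLinearMapAt_symmL hxb _
    refine ((chartDeriv x₀ x).map_smul (η x) (e.localFrame b j x)).trans ?_
    rw [h2]
    simp [b]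
  · change η x • e.localFrame b j x = 0
    rw [show η x = 0 from by_contra fun h => hx (hη (subset_tsupport _ h)), zero_smul]

/-- A finite system of functions `b k` and vector fields `X k` with `∑ db_k ⊗ X_k = id`. -/
theorem exists_chart_frames : ∃ (s : Finset M) (ψ η : s → Fun n M) (E : s → Fin n → VField n M)
    (b : s → Fin n → Fun n M), (∀ i, tsupport (η i) ⊆ (chartAt (Model n) (i : M)).source) ∧
      (∀ (i : s) j, (∀ x ∈ (chartAt (Model n) (i : M)).source,
        chartDeriv (i : M) x (E i j x) = η i x • EuclideanSpace.single j (1:ℝ)) ∧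
        ∀ x ∉ (chartAt (Model n) (i : M)).source, E i j x = 0) ∧
      ∀ (x : M) (u : TangentSpace (𝓡 n) x),
        ∑ i, ∑ j, dAt (b i j) x u • (ψ i x • E i j x) = u := by
  obtain ⟨s, ψ, hψ, hsum⟩ := exists_partition (n := n) (U := fun x : M => (chartAt (Model n) x).source)
    (fun x => (chartAt (Model n) x).open_source) (fun x => mem_chart_source _ x)
  choose η h1 h2 using fun i : s => exists_cutoff (n := n) (isClosed_tsupport (ψ i))
    (chartAt (Model n) (i : M)).open_source (hψ i)
  choose E hE using fun i : s => exists_coordinate_fields (i : M) (h2 i)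
  -- The j-th coordinate of the chart, cut off by η. Near the support of ψ its differential is the
  -- true coordinate differential.
  let b : s → Fin n → Fun n M := fun i j =>
    ⟨fun x => η i x • (extChartAt (𝓡 n) (i : M) x j), by
      have hc : ContMDiffOn (𝓡 n) 𝓘(ℝ, ℝ) ∞ (fun x => η i x • (extChartAt (𝓡 n) (i : M) x j))
          (chartAt (Model n) (i : M)).source :=
        η i |>.contMDiff.contMDiffOn.smul (((EuclideanSpace.proj j : Model n →L[ℝ] ℝ).contDiff.contMDiff).comp_contMDiffOn
          contMDiffOn_extChartAt)
      refine contMDiff_of_tsupport fun x hx => ?_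
      have : x ∈ (chartAt (Model n) (i : M)).source := h2 i (tsupport_smul_subset_left _ _ hx)
      exact hc.contMDiffAt ((chartAt (Model n) (i : M)).open_source.mem_nhds this)⟩
  refine ⟨s, ψ, η, E, b, h2, hE, fun x u => ?_⟩
  -- On the support of ψ_i, where η_i = 1, this is the expansion of u in coordinate vectors times
  -- ψ_i. Summing over the partition of unity recovers u.
  have key : ∀ i, ∑ j, dAt (b i j) x u • (ψ i x • E i j x) = ψ i x • u := by
    intro i
    by_cases hx : x ∈ tsupport (ψ i)
    · have hxs := hψ i hx
      have hη := Filter.Eventually.filter_mono (nhds_le_nhdsSet hx) (h1 i)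
      have hb : ∀ j, dAt (b i j) x u = chartDeriv (i : M) x u j := by
        intro j
        have e1 : (b i j : M → ℝ) =ᶠ[𝓝 x]
            (EuclideanSpace.proj j : Model n →L[ℝ] ℝ) ∘ (extChartAt (𝓡 n) (i : M)) := by
          filter_upwards [hη] with z hz
          change η i z • (extChartAt (𝓡 n) (i : M) z j) = extChartAt (𝓡 n) (i : M) z j
          rw [hz, one_smul]
        have e2 := (EuclideanSpace.proj j : Model n →L[ℝ] ℝ).hasFDerivAt.hasMFDerivAt.comp x
          (chart_mdiff hxs).hasMFDerivAt
        exact congrArg (fun L : Model n →L[ℝ] ℝ => L u) (e2.congr_of_eventuallyEq e1).mfderiv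
      simp only [hb]
      obtain ⟨e, he⟩ := chartDeriv_isInvertible (n := n) hxs
      apply e.injective
      have he' : ∀ w, e w = chartDeriv (i : M) x w := fun w => by rw [← he]; rfl
      rw [map_sum, map_smul]
      have h3 : ∀ j, e ((chartDeriv (i : M) x u j) • (ψ i x • E i j x))
          = ψ i x • ((chartDeriv (i : M) x u j) • EuclideanSpace.single j (1:ℝ)) := by
        intro j
        rw [map_smul, map_smul, he', (hE i j).1 x hxs, hη.self_of_nhds, one_smul, smul_comm]
      simp only [h3]
      rw [← Finset.smul_sum, he']
      congr 1
      have := (EuclideanSpace.basisFun (Fin n) ℝ).sum_repr (chartDeriv (i : M) x u)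
      simpa using this
    · have : ψ i x = 0 := by_contra fun h => hx (subset_tsupport _ h)
      simp [this]
  simp only [key]
  rw [← Finset.sum_smul, hsum, one_smul]

end Frames

/-! ### Integration in charts and the divergence. -/

section Integration

variable {n : ℕ} {M : Type*} [TopologicalSpace M] [ChartedSpace (Model n) M]
  [IsManifold (𝓡 n) ∞ M] [T2Space M] [CompactSpace M] [MeasurableSpace M] [BorelSpace M]

lemma contDiff_of_zero_off {E F : Type*} [NormedAddCommGroup E] [NormedSpace ℝ E]
    [NormedAddCommGroup F] [NormedSpace ℝ F] {A : E → F} {U B : Set E} (hU : IsOpen U)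
    (hB : IsClosed B) (hBU : B ⊆ U) (hA : ContDiffOn ℝ ∞ A U) (h0 : ∀ y ∉ B, A y = 0) :
    ContDiff ℝ ∞ A := by
  rw [contDiff_iff_contDiffAt]
  intro y
  by_cases hy : y ∈ U
  · exact hA.contDiffAt (hU.mem_nhds hy)
  · refine contDiffAt_const (c := (0 : F)) |>.congr_of_eventuallyEq ?_
    filter_upwards [hB.isOpen_compl.mem_nhds fun h => hy (hBU h)] with z hz
    exact h0 z hz

lemma fderiv_zero_off {E F : Type*} [NormedAddCommGroup E] [NormedSpace ℝ E]
    [NormedAddCommGroup F] [NormedSpace ℝ F] {A : E → F} {B : Set E} (hB : IsClosed B)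
    (h0 : ∀ y ∉ B, A y = 0) {y : E} (hy : y ∉ B) : fderiv ℝ A y = 0 := by
  have : A =ᶠ[𝓝 y] fun _ => 0 := by
    filter_upwards [hB.isOpen_compl.mem_nhds hy] with z hz
    exact h0 z hz
  rw [this.fderiv_eq]
  simp

/-- Integration by parts against the constant function 1. -/
lemma integral_fderiv_eq_zero {E : Type*} [NormedAddCommGroup E] [NormedSpace ℝ E]
    [MeasurableSpace E] [BorelSpace E] [FiniteDimensional ℝ E] (ν : Measure E) [ν.IsAddHaarMeasure]
    {P : E → ℝ} (hP : ContDiff ℝ ∞ P) (hc : HasCompactSupport P) (u : E) :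
    ∫ y, fderiv ℝ P y u ∂ν = 0 := by
  have h1 : Integrable (fun y => fderiv ℝ P y u) ν :=
    ((hP.continuous_fderiv (by simp)).clm_apply continuous_const).integrable_of_hasCompactSupport
      (hc.fderiv_apply ℝ u)
  have := integral_mul_fderiv_eq_neg_fderiv_mul_of_integrable (μ := ν) (f := fun _ : E => (1:ℝ))
    (g := P) (v := u) (by simp) (by simpa using h1)
    (by simpa using hP.continuous.integrable_of_hasCompactSupport hc)
    (fun _ _ => differentiableAt_const _) (fun _ _ => hP.contDiffAt.differentiableAt (by simp))
  simpa using this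

variable (μ : Measure M)

lemma integral_chart [IsProbabilityMeasure μ] {e : OpenPartialHomeomorph M (Model n)}
    {h : Model n → ℝ} (hc : ContDiffOn ℝ ∞ h e.target) (hpos : ∀ y ∈ e.target, 0 < h y)
    (hs : ∀ s : Set (Model n), MeasurableSet s →
        μ (e.source ∩ e ⁻¹' s) = ∫⁻ y in e.target ∩ s, ENNReal.ofReal (h y))
    {f : M → ℝ} (hf : Continuous f) (h0 : ∀ x ∉ e.source, f x = 0) :
    ∫ x, f x ∂μ = ∫ y in e.target, h y * f (e.symm y) := by
  have tm := e.open_target.measurableSet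
  have hm : AEMeasurable (fun y => ENNReal.ofReal (h y)) (volume.restrict e.target) :=
    (hc.continuousOn.aemeasurable tm).ennreal_ofReal
  have hfm : AEStronglyMeasurable (fun y => f (e.symm y)) (volume.restrict e.target) :=
    (hf.comp_continuousOn e.continuousOn_symm).aestronglyMeasurable tm
  calc ∫ x, f x ∂μ = ∫ x in e.source, f x ∂μ :=
        (setIntegral_eq_integral_of_forall_compl_eq_zero h0).symm
    _ = ∫ x in e.source, f (e.symm (e x)) ∂μ := by
        refine setIntegral_congr_fun e.open_source.measurableSet fun x hx => ?_
        simp only [e.left_inv hx]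
    _ = ∫ y, f (e.symm y) ∂((μ.restrict e.source).map e) := by
        rw [integral_map (aemeasurable_chart μ e)]
        rw [map_chart hs]
        exact hfm.mono_ac (withDensity_absolutelyContinuous _ _)
    _ = ∫ y in e.target, (ENNReal.ofReal (h y)).toReal • f (e.symm y) := by
        rw [map_chart hs, integral_withDensity_eq_integral_toReal_smul₀ hm
          (Filter.Eventually.of_forall fun x => ENNReal.ofReal_lt_top)]
    _ = ∫ y in e.target, h y * f (e.symm y) := by
        refine setIntegral_congr_fun tm fun y hy => ?_
        simp only [ENNReal.toReal_ofReal (hpos y hy).le, smul_eq_mul]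

/-- The integral of a smooth function, as a linear map. -/
def integ [IsProbabilityMeasure μ] : Fun n M →ₗ[ℝ] ℝ where
  toFun f := ∫ x, f x ∂μ
  map_add' f g := integral_add (integrable_fun μ f) (integrable_fun μ g)
  map_smul' c f := integral_const_mul c fun x => f x

lemma integ_apply [IsProbabilityMeasure μ] (f : Fun n M) : integ μ f = ∫ x, f x ∂μ := rfl

/-- `c` is the divergence of `w`. -/
def IsDiv [IsProbabilityMeasure μ] (w : VField n M) (c : Fun n M) : Prop :=
  ∀ f : Fun n M, integ μ (lie w f) = -integ μ (f * c)

/-- In the chart `w` is (G/h) u, with `h` the density of `μ`. The integrand h (w f + f c) is then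
the derivative of G f in the direction `u`, which integrates to zero. -/
lemma isDiv_chart [IsProbabilityMeasure μ] {x₀ : M} {h : Model n → ℝ}
    (hc : ContDiffOn ℝ ∞ h (chartAt (Model n) x₀).target)
    (hpos : ∀ y ∈ (chartAt (Model n) x₀).target, 0 < h y)
    (hs : ∀ s : Set (Model n), MeasurableSet s →
        μ ((chartAt (Model n) x₀).source ∩ chartAt (Model n) x₀ ⁻¹' s)
          = ∫⁻ y in (chartAt (Model n) x₀).target ∩ s, ENNReal.ofReal (h y))
    {G : Model n → ℝ} (hG : ContDiff ℝ ∞ G) {B : Set (Model n)} (hB : IsCompact B)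
    (hBt : B ⊆ (chartAt (Model n) x₀).target) (hG0 : ∀ y ∉ B, G y = 0) (u : Model n)
    {w : VField n M} (hw : ∀ x ∈ (chartAt (Model n) x₀).source, chartDeriv x₀ x (w x)
      = (G (chartAt (Model n) x₀ x) / h (chartAt (Model n) x₀ x)) • u)
    (hw0 : ∀ x ∉ (chartAt (Model n) x₀).source, w x = 0) {c : Fun n M}
    (hcx : ∀ x ∈ (chartAt (Model n) x₀).source,
      c x = fderiv ℝ G (chartAt (Model n) x₀ x) u / h (chartAt (Model n) x₀ x))
    (hc0 : ∀ x ∉ (chartAt (Model n) x₀).source, c x = 0) : IsDiv μ w c := by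
  intro f
  set e := chartAt (Model n) x₀ with he
  have hft := contDiffOn_chart f.contMDiff x₀
  have ht : (extChartAt (𝓡 n) x₀).target = e.target := by simp [he]
  have hsy : ((extChartAt (𝓡 n) x₀).symm : Model n → M) = e.symm := by ext; simp [he]
  have hfw : (extChartAt (𝓡 n) x₀ : M → Model n) = e := by ext; simp [he]
  rw [ht, hsy] at hft
  set P : Model n → ℝ := fun y => G y * f (e.symm y) with hP
  have hPs : ContDiff ℝ ∞ P := contDiff_of_zero_off e.open_target hB.isClosed hBt
    (hG.contDiffOn.mul hft) fun y hy => by simp only [hP, hG0 y hy, zero_mul]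
  have hP0 : ∀ y ∉ B, P y = 0 := fun y hy => by simp only [hP, hG0 y hy, zero_mul]
  have hint := integral_fderiv_eq_zero volume hPs (HasCompactSupport.intro hB hP0) u
  have e1 : integ μ (lie w f + f * c) = 0 := by
    have i1 : integ μ (lie w f + f * c)
        = ∫ y in e.target, h y * (lie w f (e.symm y) + f (e.symm y) * c (e.symm y)) :=
      integral_chart μ hc hpos hs ((lie w f + f * c).contMDiff.continuous) (fun x hx => by
        have : lie w f x = 0 := by rw [lie_apply, hw0 x hx, map_zero]
        change lie w f x + f x * c x = 0
        rw [this, hc0 x hx]; simp)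
    have i2 : ∫ y in e.target, fderiv ℝ P y u = ∫ y, fderiv ℝ P y u :=
      setIntegral_eq_integral_of_forall_compl_eq_zero (fun y hy => by
        rw [fderiv_zero_off hB.isClosed hP0 fun h => hy (hBt h)]; rfl)
    rw [i1, ← hint, ← i2]
    refine setIntegral_congr_fun e.open_target.measurableSet fun y hy => ?_
    have hys := e.map_target hy
    have hl : lie w f (e.symm y) = (G y / h y) * fderiv ℝ (f ∘ e.symm) y u := by
      have := mfderiv_eq_chart f.contMDiff hys (w (e.symm y))
      rw [hw _ hys, hfw, hsy, e.right_inv hy, map_smul] at this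
      exact this
    have hd : DifferentiableAt ℝ (f ∘ e.symm) y :=
      (hft.contDiffAt (e.open_target.mem_nhds hy)).differentiableAt (by simp)
    have hPd : fderiv ℝ P y u = G y * fderiv ℝ (f ∘ e.symm) y u + f (e.symm y) * fderiv ℝ G y u := by
      have := ((hG.contDiffAt (x := y)).differentiableAt (by simp)).hasFDerivAt.mul hd.hasFDerivAt
      rw [show P = G * (f ∘ e.symm) from rfl, this.fderiv]
      simp
    simp only [hl, hcx _ hys, hPd, e.right_inv hy]
    have := (hpos y hy).ne'
    field_simp
  rw [map_add] at e1
  linarith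

lemma hasDerivAt_integral [IsProbabilityMeasure μ] {f : ℝ → Fun n M} (hf : SmoothFun f) (t : ℝ) :
    HasDerivAt (fun s => integ μ (f s)) (integ μ (dot f hf t)) t := by
  have hcont : Continuous fun p : ℝ × M => dot f hf p.1 p.2 := hf.dot.continuous
  obtain ⟨C, hC⟩ := ((isCompact_Icc (a := t - 1) (b := t + 1)).prod
    (isCompact_univ (X := M))).exists_bound_of_continuousOn hcont.continuousOn
  refine (hasDerivAt_integral_of_dominated_loc_of_deriv_le (bound := fun _ => C)
    (F' := fun s x => dot f hf s x) (Metric.ball_mem_nhds t one_pos) ?_ ?_ ?_ ?_ ?_ ?_).2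
  · exact Filter.Eventually.of_forall fun s => (integrable_fun μ (f s)).aestronglyMeasurable
  · exact integrable_fun μ (f t)
  · exact (integrable_fun μ (dot f hf t)).aestronglyMeasurable
  · refine Filter.Eventually.of_forall fun x s hs => hC (s, x) ⟨?_, mem_univ _⟩
    rw [Real.ball_eq_Ioo] at hs
    exact ⟨hs.1.le, hs.2.le⟩
  · exact integrable_const C
  · exact Filter.Eventually.of_forall fun x s _ => hf.hasDerivAt s x

variable [IsProbabilityMeasure μ] [IsSmoothVolume n μ]

/-- The function is tested against itself, and `μ` charges every nonempty open set. All weak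
identities below are turned into pointwise ones in this way. -/
lemma eq_zero_of_integral {g : Fun n M} (h : ∀ f : Fun n M, integ μ (f * g) = 0) : g = 0 := by
  have := isOpenPosMeasure n μ
  have h1 := (integral_eq_zero_iff_of_nonneg (fun x => mul_self_nonneg (g x))
    (integrable_fun μ (g * g))).1 (h g)
  have h2 := (Continuous.ae_eq_iff_eq μ (g * g).contMDiff.continuous continuous_zero).1 h1
  ext x
  exact mul_self_eq_zero.1 (congrFun h2 x)

lemma eq_of_integral {g g' : Fun n M} (h : ∀ f : Fun n M, integ μ (f * g) = integ μ (f * g')) :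
    g = g' := by
  rw [← sub_eq_zero]
  refine eq_zero_of_integral μ fun f => ?_
  rw [mul_sub, map_sub, h, sub_self]

variable {μ}

lemma IsDiv.unique {w : VField n M} {c c' : Fun n M} (h : IsDiv μ w c) (h' : IsDiv μ w c') :
    c = c' :=
  eq_of_integral μ fun f => neg_injective ((h f).symm.trans (h' f))

lemma IsDiv.fieldSmul {w : VField n M} {c : Fun n M} (h : IsDiv μ w c) (a : Fun n M) :
    IsDiv μ (fieldSmul a w) (a * c + lie w a) := by
  intro f
  have h1 := h (a * f)
  rw [lie_mul, map_add] at h1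
  rw [lie_fieldSmul, mul_add, map_add, ← mul_assoc, mul_comm f a, neg_add, ← h1]
  ring

variable (μ) in
/-- Finitely many functions `b k` and vector fields `X k` such that `∑ db_k ⊗ X_k = id`. -/
theorem exists_frame : ∃ (s : Finset M) (b : s × Fin n → Fun n M) (X : s × Fin n → VField n M),
    (∀ (x : M) (u : TangentSpace (𝓡 n) x), ∑ k, dAt (b k) x u • X k x = u) ∧
      ∀ k, ∃ c, IsDiv μ (X k) c := by
  obtain ⟨s, ψ, η, E, b, hη, hE, hsum⟩ := exists_chart_frames (n := n) (M := M)
  refine ⟨s, fun k => b k.1 k.2, fun k => fieldSmul (ψ k.1) (E k.1 k.2), fun x u => ?_, ?_⟩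
  · rw [Fintype.sum_prod_type]
    exact hsum x u
  rintro ⟨i, j⟩
  suffices H : ∃ c, IsDiv μ (E i j) c by
    obtain ⟨c, hc⟩ := H
    exact ⟨_, hc.fieldSmul (ψ i)⟩
  obtain ⟨h, h1, h2, h3⟩ := IsSmoothVolume.exists_density (n := n) (μ := μ) _
    (IsManifold.chart_mem_maximalAtlas (I := 𝓡 n) (n := ∞) (i : M))
  set e := chartAt (Model n) (i : M) with he
  have ht : (extChartAt (𝓡 n) (i : M)).target = e.target := by simp [he]
  have hsy : ((extChartAt (𝓡 n) (i : M)).symm : Model n → M) = e.symm := by ext; simp [he]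
  have hfw : (extChartAt (𝓡 n) (i : M) : M → Model n) = e := by ext; simp [he]
  have hB : IsCompact (e '' tsupport (η i)) :=
    (isClosed_tsupport (η i)).isCompact.image_of_continuousOn (e.continuousOn.mono (hη i))
  have hBt : e '' tsupport (η i) ⊆ e.target := by
    rintro _ ⟨x, hx, rfl⟩
    exact e.map_source (hη i hx)
  have hηz : ∀ y ∈ e.target, y ∉ e '' tsupport (η i) → η i (e.symm y) = 0 := by
    intro y hy hyB
    by_contra hne
    exact hyB ⟨e.symm y, subset_tsupport _ hne, e.right_inv hy⟩
  -- The factor h cancels the division by h in `isDiv_chart`, which then applies to the plain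
  -- coordinate field η ∂_j.
  set G : Model n → ℝ := e.target.indicator fun y => h y * η i (e.symm y) with hG
  have hG0 : ∀ y ∉ e '' tsupport (η i), G y = 0 := by
    intro y hy
    by_cases hyt : y ∈ e.target
    · rw [hG, indicator_of_mem hyt, hηz y hyt hy, mul_zero]
    · rw [hG, indicator_of_notMem hyt]
  have hηs := contDiffOn_chart (η i).contMDiff (i : M)
  rw [ht, hsy] at hηs
  have hGs : ContDiff ℝ ∞ G := contDiff_of_zero_off e.open_target hB.isClosed hBt
    ((h1.mul hηs).congr fun y hy => indicator_of_mem hy _) hG0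
  have hfd0 : ∀ y ∉ e '' tsupport (η i), fderiv ℝ G y = 0 := fun y hy =>
    fderiv_zero_off hB.isClosed hG0 hy
  obtain ⟨a, -, ha, ha0⟩ := exists_lift (i : M) (A := fun p => fderiv ℝ G p.2
    (EuclideanSpace.single j (1:ℝ)) / h p.2) hB (by rwa [ht]) (by
      rw [ht]
      refine ContDiffOn.div ?_ (h1.comp contDiff_snd.contDiffOn fun p hp => hp.2)
        fun p hp => (h2 _ hp.2).ne'
      exact (((hGs.fderiv_right (m := ∞) (by simp)).comp contDiff_snd).clm_apply
        contDiff_const).contDiffOn)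
    (fun t y hy => by simp [hfd0 y hy])
  refine ⟨a 0, isDiv_chart μ h1 h2 h3 hGs hB hBt hG0 (EuclideanSpace.single j (1:ℝ))
    (fun x hx => ?_) (hE i j).2 (fun x hx => ?_) fun x hx => ?_⟩
  · rw [(hE i j).1 x hx, hG, indicator_of_mem (e.map_source hx), e.left_inv hx,
      mul_div_cancel_left₀ _ (h2 _ (e.map_source hx)).ne']
  · rw [ha 0 x hx, hfw]
  · refine ha0 0 x fun hxB => hx ?_
    obtain ⟨y, hy, rfl⟩ := hxB
    rw [hsy]
    exact e.map_target (hBt hy)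

end Integration

/-! ### Reduction of fields and forms to functions by the frame. -/

section Frame

variable {n : ℕ} {M : Type*} [TopologicalSpace M] [ChartedSpace (Model n) M]
  [IsManifold (𝓡 n) ∞ M]

lemma contract_apply (m : Form n M) (v : VField n M) (x : M) : contract m v x = m x (v x) := rfl

/-- The derivative of a function as a bilinear map. -/
def lieHom : VField n M →ₗ[ℝ] Fun n M →ₗ[ℝ] Fun n M :=
  LinearMap.mk₂ ℝ lie (fun v w f => by ext x; exact (dAt f x).map_add (v x) (w x))
    (fun c v f => by ext x; exact (dAt f x).map_smul c (v x))
    (fun v f g => by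
      ext x; exact congrArg (fun m : Form n M => (m x (v x) : ℝ)) (differential.map_add f g))
    (fun c v f => by
      ext x; exact congrArg (fun m : Form n M => (m x (v x) : ℝ)) (differential.map_smul c f))

lemma lie_eq_lieHom (v : VField n M) (f : Fun n M) : lie v f = lieHom v f := rfl

/-- The contraction as a bilinear map. -/
def contractHom : Form n M →ₗ[ℝ] VField n M →ₗ[ℝ] Fun n M :=
  LinearMap.mk₂ ℝ contract (fun _ _ _ => rfl) (fun _ _ _ => rfl)
    (fun m v w => by ext x; exact (m x).map_add (v x) (w x))
    (fun c m v => by ext x; exact (m x).map_smul c (v x))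

lemma contract_eq_contractHom (m : Form n M) (v : VField n M) : contract m v = contractHom m v := rfl

lemma contract_scale (a : Fun n M) (m : Form n M) (v : VField n M) :
    contract (scale a m) v = a * contract m v := rfl

lemma contract_fieldSmul (a : Fun n M) (m : Form n M) (v : VField n M) :
    contract m (fieldSmul a v) = a * contract m v := by
  ext x; exact (m x).map_smul (a x) (v x)

lemma contract_differential (f : Fun n M) (v : VField n M) :
    contract (differential f) v = lie v f := rfl

lemma field_sum_apply {ι : Type*} (s : Finset ι) (v : ι → VField n M) (x : M) :
    (∑ i ∈ s, v i) x = ∑ i ∈ s, v i x :=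
  map_sum (⟨⟨fun v : VField n M => v x, rfl⟩, fun _ _ => rfl⟩ :
    VField n M →+ TangentSpace (𝓡 n) x) v s

lemma form_sum_apply {ι : Type*} (s : Finset ι) (m : ι → Form n M) (x : M)
    (u : TangentSpace (𝓡 n) x) : ((∑ i ∈ s, m i) x u : ℝ) = ∑ i ∈ s, (m i x u : ℝ) :=
  map_sum (⟨⟨fun m : Form n M => (m x u : ℝ), rfl⟩, fun _ _ => rfl⟩ : Form n M →+ ℝ) m s

variable [T2Space M] [CompactSpace M]

variable (n M) in
/-- Finitely many functions `b k` and vector fields `X k` such that `∑ db_k ⊗ X_k = id`. -/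
structure Frame where
  centers : Finset M
  b : centers × Fin n → Fun n M
  X : centers × Fin n → VField n M
  sum_eq : ∀ (x : M) (u : TangentSpace (𝓡 n) x), ∑ k, dAt (b k) x u • X k x = u

variable (n M) in
lemma nonempty_frame : Nonempty (Frame n M) := by
  obtain ⟨s, ψ, η, E, b, hη, hE, hsum⟩ := exists_chart_frames (n := n) (M := M)
  refine ⟨⟨s, fun k => b k.1 k.2, fun k => fieldSmul (ψ k.1) (E k.1 k.2), fun x u => ?_⟩⟩
  rw [Fintype.sum_prod_type]
  exact hsum x u

variable (n M) in
/-- A choice of a frame. -/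
def theFrame : Frame n M := (nonempty_frame n M).some

/-- The linear map given by a one-form at a point is determined by the frame. -/
lemma form_frame (m : Form n M) (x : M) (u : TangentSpace (𝓡 n) x) :
    (m x u : ℝ) = ∑ k, dAt ((theFrame n M).b k) x u * contract m ((theFrame n M).X k) x := by
  conv_lhs => rw [← (theFrame n M).sum_eq x u]
  refine (map_sum (m x) _ _).trans (Finset.sum_congr rfl fun k _ => ?_)
  exact (m x).map_smul _ _

lemma contract_frame (m : Form n M) (v : VField n M) :
    contract m v = ∑ k, lie v ((theFrame n M).b k) * contract m ((theFrame n M).X k) := by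
  ext x
  rw [contract_apply, form_frame m x (v x)]
  simp only [← lie_apply, ← ContMDiffMap.coeFnAddMonoidHom_apply, map_sum, Finset.sum_apply]
  rfl

lemma field_frame (v : VField n M) :
    v = ∑ k, fieldSmul (lie v ((theFrame n M).b k)) ((theFrame n M).X k) := by
  ext x : 1
  rw [field_sum_apply]
  exact ((theFrame n M).sum_eq x (v x)).symm

lemma form_eq_frame (m : Form n M) :
    m = ∑ k, scale (contract m ((theFrame n M).X k)) (differential ((theFrame n M).b k)) := by
  ext x u
  refine (form_frame m x u).trans ?_
  refine Eq.trans ?_ (form_sum_apply _ _ x u).symm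
  exact Finset.sum_congr rfl fun k _ => mul_comm _ _

lemma field_ext {v w : VField n M} (h : ∀ f, lie v f = lie w f) : v = w := by
  rw [field_frame v, field_frame w]
  simp only [h]

lemma form_ext {m m' : Form n M} (h : ∀ v, contract m v = contract m' v) : m = m' := by
  rw [form_eq_frame m, form_eq_frame m']
  simp only [h]

/-- The frame writes the field as ∑ (v b_k) X_k, so smoothness in time is a question about the
coefficient functions. -/
lemma smoothField_of_lie {v : ℝ → VField n M} (h : ∀ f, SmoothFun fun t => lie (v t) f) :
    SmoothField v := by
  have h1 := contMDiff_sum_smul_section Finset.univ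
    (a := fun k p => lie (v p.1) ((theFrame n M).b k) p.2) (fun k => h _)
    (fun k x => (theFrame n M).X k x) (fun k => ((theFrame n M).X k).contMDiff)
  refine h1.congr fun p => ?_
  exact congrArg (fun u => (⟨p.2, u⟩ : Bundle.TotalSpace (Model n)
      (TangentSpace (𝓡 n) : M → Type _))) ((theFrame n M).sum_eq p.2 (v p.1 p.2)).symm

lemma smoothForm_of_contract {m : ℝ → Form n M} (h : ∀ v, SmoothFun fun t => contract (m t) v) :
    SmoothForm m := by
  have h1 := contMDiff_sum_smul_section Finset.univ
    (a := fun k p => contract (m p.1) ((theFrame n M).X k) p.2) (fun k => h _)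
    (fun k x => differential ((theFrame n M).b k) x)
    (fun k => (differential ((theFrame n M).b k)).contMDiff)
  refine h1.congr fun p => ?_
  refine congrArg (fun u => (⟨p.2, u⟩ : Bundle.TotalSpace (Model n →L[ℝ] ℝ)
      (fun x : M => TangentSpace (𝓡 n) x →L[ℝ] Bundle.Trivial M ℝ x))) ?_
  ext u
  refine (form_frame (m p.1) p.2 u).trans ?_
  refine Eq.trans ?_ (sum_apply _ _ _).symm
  exact Finset.sum_congr rfl fun k _ => mul_comm _ _

lemma SmoothForm.smoothFun {m : ℝ → Form n M} (h : SmoothForm m) (v : VField n M) :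
    SmoothFun fun t => Madelung.contract (m t) v := h.contract (smoothField_const v)

lemma SmoothField.lie {v : ℝ → VField n M} (h : SmoothField v) (f : Fun n M) :
    SmoothFun fun t => lie (v t) f := (smoothFun_const f).along h

lemma SmoothFun.lie {f : ℝ → Fun n M} (hf : SmoothFun f) {v : ℝ → VField n M} (h : SmoothField v) :
    SmoothFun fun t => Madelung.lie (v t) (f t) := hf.along h

/-- Pointwise velocities on tangent vectors and velocities tested on global fields agree, since a
covector is determined linearly by its values on the frame fields `X k`. -/
lemma velocityForm_iff {m : ℝ → Form n M} {y : Form n M} :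
    VelocityForm m y ↔ ∀ v, VelocityFun (fun t => contract (m t) v) (contract y v) := by
  refine ⟨fun h v x => h x (v x), fun h x u => ?_⟩
  have h1 : HasDerivAt (fun t => ∑ k, dAt ((theFrame n M).b k) x u *
      contract (m t) ((theFrame n M).X k) x)
      (∑ k, dAt ((theFrame n M).b k) x u * contract y ((theFrame n M).X k) x) 0 :=
    HasDerivAt.fun_sum fun k _ => (h _ x).const_mul _
  rw [← form_frame y x u] at h1
  simpa only [← form_frame] using h1

lemma velocityForm_unique {m : ℝ → Form n M} {y z : Form n M} (h : VelocityForm m y)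
    (h' : VelocityForm m z) : y = z :=
  form_ext fun v => velocityFun_unique (velocityForm_iff.1 h v) (velocityForm_iff.1 h' v)

lemma SmoothField.fieldSmul {a : ℝ → Fun n M} (ha : SmoothFun a) {v : ℝ → VField n M}
    (hv : SmoothField v) : SmoothField fun t => Madelung.fieldSmul (a t) (v t) :=
  smoothField_of_lie fun f => by
    simp only [lie_fieldSmul]
    exact ha.mul (hv.lie f)

lemma SmoothField.sum {ι : Type*} {s : Finset ι} {v : ι → ℝ → VField n M}
    (hv : ∀ i ∈ s, SmoothField (v i)) : SmoothField fun t => ∑ i ∈ s, v i t :=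
  smoothField_of_lie fun f => by
    have : (fun t => Madelung.lie (∑ i ∈ s, v i t) f) = fun t => ∑ i ∈ s, Madelung.lie (v i t) f := by
      funext t
      simp only [lie_eq_lieHom, map_sum, LinearMap.sum_apply]
    rw [this]
    exact SmoothFun.sum fun i hi => (hv i hi).lie f

lemma SmoothField.add {v w : ℝ → VField n M} (hv : SmoothField v) (hw : SmoothField w) :
    SmoothField fun t => v t + w t :=
  smoothField_of_lie fun f => by
    simp only [lie_eq_lieHom, map_add, LinearMap.add_apply]
    exact (hv.lie f).add (hw.lie f)

lemma SmoothField.neg {v : ℝ → VField n M} (hv : SmoothField v) : SmoothField fun t => -v t :=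
  smoothField_of_lie fun f => by
    simp only [lie_eq_lieHom, map_neg, LinearMap.neg_apply]
    exact (hv.lie f).neg

lemma SmoothField.sub {v w : ℝ → VField n M} (hv : SmoothField v) (hw : SmoothField w) :
    SmoothField fun t => v t - w t := by
  simp only [sub_eq_add_neg]
  exact hv.add hw.neg

lemma SmoothForm.add {m m' : ℝ → Form n M} (h : SmoothForm m) (h' : SmoothForm m') :
    SmoothForm fun t => m t + m' t :=
  smoothForm_of_contract fun v => by
    simp only [contract_eq_contractHom, map_add, LinearMap.add_apply]
    exact (h.smoothFun v).add (h'.smoothFun v)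

lemma SmoothForm.smul {a : ℝ → ℝ} (ha : ContDiff ℝ ∞ a) {m : ℝ → Form n M} (h : SmoothForm m) :
    SmoothForm fun t => a t • m t :=
  smoothForm_of_contract fun v => by
    simp only [contract_eq_contractHom, map_smul, LinearMap.smul_apply]
    exact (h.smoothFun v).smul ha

lemma SmoothForm.scale {a : ℝ → Fun n M} (ha : SmoothFun a) {m : ℝ → Form n M} (h : SmoothForm m) :
    SmoothForm fun t => scale (a t) (m t) :=
  smoothForm_of_contract fun v => ha.mul (h.smoothFun v)

lemma smoothForm_const (m : Form n M) : SmoothForm (fun _ : ℝ => m) :=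
  smoothForm_of_contract fun _ => smoothFun_const _

lemma SmoothFun.differential {f : ℝ → Fun n M} (hf : SmoothFun f) :
    SmoothForm fun t => differential (f t) :=
  smoothForm_of_contract fun v => hf.along (smoothField_const v)

lemma bracket_lie (v w : VField n M) (f : Fun n M) :
    lie (bracket v w) f = lie v (lie w f) - lie w (lie v f) := along_bracket v w f

section Divergence

variable [MeasurableSpace M] [BorelSpace M] (μ : Measure M) [IsProbabilityMeasure μ]
  [IsSmoothVolume n μ]

lemma IsDiv.sum {ι : Type*} {s : Finset ι} {v : ι → VField n M} {c : ι → Fun n M}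
    (h : ∀ i ∈ s, IsDiv μ (v i) (c i)) : IsDiv μ (∑ i ∈ s, v i) (∑ i ∈ s, c i) := by
  intro f
  simp only [lie_eq_lieHom, map_sum, LinearMap.sum_apply, Finset.mul_sum, ← Finset.sum_neg_distrib]
  exact Finset.sum_congr rfl fun i hi => h i hi f

/-- The frame fields have divergences by construction, and the product rule extends this to their
combinations with function coefficients. -/
lemma exists_isDiv (v : VField n M) : ∃ c, IsDiv μ v c := by
  obtain ⟨s, b, X, h, hd⟩ := exists_frame (n := n) μ
  choose c hc using hd
  have hv : v = ∑ k, fieldSmul (lie v (b k)) (X k) := by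
    ext x : 1
    rw [field_sum_apply]
    exact (h x (v x)).symm
  rw [hv]
  exact ⟨_, IsDiv.sum μ fun k _ => (hc k).fieldSmul _⟩

/-- The divergence of a vector field. -/
def divergence (v : VField n M) : Fun n M := (exists_isDiv μ v).choose

lemma isDiv_divergence (v : VField n M) : IsDiv μ v (divergence μ v) := (exists_isDiv μ v).choose_spec

variable {μ}

lemma IsDiv.eq_divergence {v : VField n M} {c : Fun n M} (h : IsDiv μ v c) : divergence μ v = c :=
  (isDiv_divergence μ v).unique h

lemma integ_lie (v : VField n M) (f : Fun n M) :
    integ μ (lie v f) = -integ μ (f * divergence μ v) := isDiv_divergence μ v f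

lemma divergence_fieldSmul (a : Fun n M) (v : VField n M) :
    divergence μ (fieldSmul a v) = a * divergence μ v + lie v a :=
  ((isDiv_divergence μ v).fieldSmul a).eq_divergence

lemma divergence_sum {ι : Type*} (s : Finset ι) (v : ι → VField n M) :
    divergence μ (∑ i ∈ s, v i) = ∑ i ∈ s, divergence μ (v i) :=
  (IsDiv.sum μ fun i _ => isDiv_divergence μ (v i)).eq_divergence

lemma divergence_add (v w : VField n M) :
    divergence μ (v + w) = divergence μ v + divergence μ w := by
  refine IsDiv.eq_divergence fun f => ?_
  simp only [lie_eq_lieHom, map_add, LinearMap.add_apply, mul_add]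
  rw [← lie_eq_lieHom, ← lie_eq_lieHom, integ_lie v f, integ_lie w f]
  ring

lemma divergence_smul (a : ℝ) (v : VField n M) :
    divergence μ (a • v) = a • divergence μ v := by
  refine IsDiv.eq_divergence fun f => ?_
  simp only [lie_eq_lieHom, map_smul, LinearMap.smul_apply, mul_smul_comm]
  rw [← lie_eq_lieHom, integ_lie v f]
  simp

lemma divergence_neg (v : VField n M) : divergence μ (-v) = -divergence μ v := by
  have := divergence_smul (μ := μ) (-1) v
  simpa using this

lemma integ_divergence (v : VField n M) : integ μ (divergence μ v) = 0 := by
  have h := integ_lie (μ := μ) v 1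
  have h1 : lie v 1 = 0 := by
    have := lie_mul v 1 1
    rw [one_mul, one_mul] at this
    exact left_eq_add.1 this
  rw [h1, map_zero, one_mul] at h
  linarith

/-- The divergence is chosen separately for each time. The frame expansion and uniqueness give a
formula for it that is visibly smooth in time. -/
lemma SmoothField.divergence {v : ℝ → VField n M} (hv : SmoothField v) :
    SmoothFun fun t => divergence μ (v t) := by
  have : (fun t => Madelung.divergence μ (v t)) = fun t => ∑ k,
      (Madelung.lie (v t) ((theFrame n M).b k) * Madelung.divergence μ ((theFrame n M).X k)
        + Madelung.lie ((theFrame n M).X k) (Madelung.lie (v t) ((theFrame n M).b k))) := by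
    funext t
    conv_lhs => rw [field_frame (v t), divergence_sum]
    simp only [divergence_fieldSmul]
  rw [this]
  exact SmoothFun.sum fun k _ => ((hv.lie _).mul (smoothFun_const _)).add
    ((hv.lie _).lie (smoothField_const _))

end Divergence

end Frame

/-! ### Inverses and integrals of smooth families. -/

section Families

variable {n : ℕ} {M : Type*} [TopologicalSpace M] [ChartedSpace (Model n) M]
  [IsManifold (𝓡 n) ∞ M]

/-- The inverses of a smooth curve of diffeomorphisms form a smooth curve. -/
theorem SmoothDif.inv {φ : ℝ → Dif n M} (hφ : SmoothDif φ) : SmoothDif fun t => (φ t)⁻¹ := by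
  rintro ⟨t₀, y₀⟩
  set x₀ := (φ t₀).symm y₀ with hx₀
  have hy₀ : φ t₀ x₀ = y₀ := (φ t₀).apply_symm_apply y₀
  set e := extChartAt (𝓡 n) x₀ with he
  set e' := extChartAt (𝓡 n) y₀ with he'
  have hes : ContMDiffAt 𝓘(ℝ, Model n) (𝓡 n) ∞ e.symm (e x₀) :=
    (contMDiffOn_extChartAt_symm x₀).contMDiffAt ((isOpen_extChartAt_target x₀).mem_nhds
      (mem_extChartAt_target x₀))
  have hes' : ContMDiffAt 𝓘(ℝ, Model n) (𝓡 n) ∞ e'.symm (e' y₀) :=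
    (contMDiffOn_extChartAt_symm y₀).contMDiffAt ((isOpen_extChartAt_target y₀).mem_nhds
      (mem_extChartAt_target y₀))
  have hee : e.symm (e x₀) = x₀ := extChartAt_to_inv x₀
  have hee' : e'.symm (e' y₀) = y₀ := extChartAt_to_inv y₀
  set a : ℝ × Model n := (t₀, e x₀) with ha
  let K : ℝ × Model n → M := fun p => φ p.1 (e.symm p.2)
  have hKa : K a = y₀ := by simp only [K, ha]; rw [hee, hy₀]
  have hK : ContMDiffAt (𝓘(ℝ, ℝ).prod 𝓘(ℝ, Model n)) (𝓡 n) ∞ K a :=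
    ContMDiffAt.comp a (g := fun p : ℝ × M => φ p.1 p.2) (hφ _)
      (contMDiffAt_fst.prodMk (hes.comp a contMDiffAt_snd))
  have hK' : ContDiffAt ℝ ∞ (fun p => e' (K p)) a := by
    have h : ContMDiffAt (𝓘(ℝ, ℝ).prod 𝓘(ℝ, Model n)) 𝓘(ℝ, Model n) ∞ (fun p => e' (K p)) a := by
      refine ContMDiffAt.comp a (g := e') ?_ hK
      rw [hKa]
      exact contMDiffAt_extChartAt
    rw [← contMDiffAt_iff_contDiffAt, modelWithCornersSelf_prod, ← chartedSpaceSelf_prod]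
    exact h
  -- The map (t, x) ↦ (t, φ_t(x)) in charts. Keeping the time as a component lets the inverse
  -- function theorem produce all the inverses at once.
  let G : ℝ × Model n → ℝ × Model n := fun p => (p.1, e' (K p))
  have hG : ContDiffAt ℝ ∞ G a := contDiffAt_fst.prodMk hK'
  have hGd : HasFDerivAt G (fderiv ℝ G a) a := (hG.differentiableAt (by simp)).hasFDerivAt
  -- the derivative is injective
  let r : Model n → Model n := fun z => e ((φ t₀).symm (e'.symm z))
  have hr : DifferentiableAt ℝ r (e' y₀) := by
    have : ContMDiffAt 𝓘(ℝ, Model n) 𝓘(ℝ, Model n) ∞ r (e' y₀) := by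
      refine ContMDiffAt.comp (e' y₀) (g := e) (f := fun z => (φ t₀).symm (e'.symm z)) ?_
        ((φ t₀).symm.contMDiff.contMDiffAt.comp _ hes')
      rw [hee']
      exact contMDiffAt_extChartAt
    exact this.contDiffAt.differentiableAt (by simp)
  have hslice : HasFDerivAt (fun w => e' (K (t₀, w)))
      (fderiv ℝ (fun p => e' (K p)) a ∘L ContinuousLinearMap.inr ℝ ℝ (Model n)) (e x₀) :=
    HasFDerivAt.comp (e x₀) (g := fun p => e' (K p)) (f := fun w => (t₀, w))
      (hK'.differentiableAt (by simp)).hasFDerivAt (hasFDerivAt_prodMk_right t₀ (e x₀))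
  have hKe : ContinuousAt (fun w => K (t₀, w)) (e x₀) :=
    (ContinuousAt.comp (x := e x₀) (g := K) (f := fun w => (t₀, w)) hK.continuousAt (by fun_prop))
  have hid : (fun w => r (e' (K (t₀, w)))) =ᶠ[𝓝 (e x₀)] fun w => w := by
    have h1 : ∀ᶠ w in 𝓝 (e x₀), K (t₀, w) ∈ e'.source :=
      hKe.eventually (by
        change ∀ᶠ z in 𝓝 (K a), z ∈ e'.source
        rw [hKa]; exact extChartAt_source_mem_nhds y₀)
    filter_upwards [h1, (isOpen_extChartAt_target x₀).mem_nhds (mem_extChartAt_target x₀)] with w h2 h3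
    simp only [r]
    rw [e'.left_inv h2]
    simp only [K]
    rw [(φ t₀).symm_apply_apply, e.right_inv h3]
  have hinj : Function.Injective (fderiv ℝ G a) := by
    refine (injective_iff_map_eq_zero (fderiv ℝ G a)).2 ?_
    -- The time component gives τ = 0; the chain rule for `r`, which inverts the slice at `t₀`, then
    -- gives w = 0.
    rintro ⟨τ, w⟩ h0
    have hGf : fderiv ℝ G a = (ContinuousLinearMap.fst ℝ ℝ (Model n)).prod
        (fderiv ℝ (fun p => e' (K p)) a) :=
      (hasFDerivAt_fst.prodMk (hK'.differentiableAt (by simp)).hasFDerivAt).fderiv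
    rw [hGf] at h0
    obtain ⟨h1, h2⟩ := Prod.ext_iff.1 h0
    have h1' : τ = 0 := h1
    subst h1'
    have h3 : HasFDerivAt (fun w => r (e' (K (t₀, w)))) _ (e x₀) :=
      HasFDerivAt.comp (e x₀) (g := r) (by
        change HasFDerivAt r (fderiv ℝ r (e' (K a))) (e' (K a))
        rw [hKa]; exact hr.hasFDerivAt) hslice
    have h4 := (h3.congr_of_eventuallyEq hid.symm).unique (hasFDerivAt_id _)
    have h5 := congrArg (fun L => L w) h4
    have h6 : fderiv ℝ r (e' (K a)) (fderiv ℝ (fun p => e' (K p)) a (0, w)) = w := h5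
    have h2' : fderiv ℝ (fun p => e' (K p)) a (0, w) = 0 := h2
    rw [h2', map_zero] at h6
    rw [← h6]
    rfl
  let A := (LinearEquiv.ofInjectiveEndo (fderiv ℝ G a).toLinearMap hinj).toContinuousLinearEquiv
  have hA : HasFDerivAt G (A : (ℝ × Model n) →L[ℝ] (ℝ × Model n)) a := by
    have : (A : (ℝ × Model n) →L[ℝ] (ℝ × Model n)) = fderiv ℝ G a :=
      ContinuousLinearMap.ext fun _ => rfl
    rw [this]
    exact hGd
  have hL := hG.to_localInverse hA (by simp)
  set L := hG.localInverse hA (by simp) with hLdef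
  have hLa : L (G a) = a := hG.localInverse_apply_image hA (by simp)
  have hright : ∀ᶠ q in 𝓝 (G a), G (L q) = q :=
    (hG.hasStrictFDerivAt' hA (by simp)).eventually_right_inverse
  have hGa : G a = (t₀, e' y₀) := by simp only [G]; rw [hKa]
  rw [hGa] at hL hright hLa
  -- express the inverse through the local inverse
  let ch : ℝ × M → ℝ × Model n := fun p => (p.1, e' p.2)
  have hch : ContMDiffAt (timeModel n) (𝓘(ℝ, ℝ).prod 𝓘(ℝ, Model n)) ∞ ch (t₀, y₀) :=
    contMDiffAt_fst.prodMk (contMDiffAt_extChartAt.comp (t₀, y₀) contMDiffAt_snd)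
  have hL' : ContMDiffAt (𝓘(ℝ, ℝ).prod 𝓘(ℝ, Model n)) 𝓘(ℝ, Model n) ∞ (fun q => (L q).2)
      (t₀, e' y₀) := by
    have : ContDiffAt ℝ ∞ (fun q => (L q).2) (t₀, e' y₀) := contDiff_snd.contDiffAt.comp _ hL
    rw [← contMDiffAt_iff_contDiffAt, modelWithCornersSelf_prod, ← chartedSpaceSelf_prod] at this
    exact this
  have hLc : ContinuousAt (fun p => L (ch p)) (t₀, y₀) :=
    ContinuousAt.comp (x := (t₀, y₀)) (g := L) (f := ch) hL.continuousAt hch.continuousAt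
  have hsnd : ContMDiffAt (timeModel n) 𝓘(ℝ, Model n) ∞ (fun p => (L (ch p)).2) (t₀, y₀) :=
    ContMDiffAt.comp (t₀, y₀) (g := fun q => (L q).2) hL' hch
  have hchv : L (ch (t₀, y₀)) = a := hLa
  have hfinal : ContMDiffAt (timeModel n) (𝓡 n) ∞ (fun p => e.symm (L (ch p)).2) (t₀, y₀) := by
    refine ContMDiffAt.comp (t₀, y₀) (g := e.symm) ?_ hsnd
    rw [hchv]
    exact hes
  refine hfinal.congr_of_eventuallyEq ?_
  have c1 : ∀ᶠ p in 𝓝 (t₀, y₀), G (L (ch p)) = ch p := hch.continuousAt.eventually hright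
  have c2 : ∀ᶠ p in 𝓝 (t₀, y₀), K (L (ch p)) ∈ e'.source := by
    refine (ContinuousAt.comp (x := (t₀, y₀)) (g := K) (f := fun p => L (ch p)) (by
      rw [hchv]; exact hK.continuousAt) hLc).eventually ?_
    change ∀ᶠ z in 𝓝 (K (L (ch (t₀, y₀)))), z ∈ e'.source
    rw [hchv, hKa]
    exact extChartAt_source_mem_nhds y₀
  have c3 : ∀ᶠ p : ℝ × M in 𝓝 (t₀, y₀), p.2 ∈ e'.source :=
    continuousAt_snd.eventually (extChartAt_source_mem_nhds y₀)
  filter_upwards [c1, c2, c3] with p h1 h2 h3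
  obtain ⟨h4, h5⟩ := Prod.ext_iff.1 h1
  have h6 : K (L (ch p)) = p.2 := e'.injOn h2 h3 h5
  have h7 : (L (ch p)).1 = p.1 := h4
  simp only [K, h7] at h6
  change (φ p.1).symm p.2 = _
  rw [← h6]
  exact (φ p.1).symm_apply_apply _

/-- Integration over a parameter preserves smoothness. -/
theorem contMDiff_parametric_integral [T2Space M] [CompactSpace M] {F : (ℝ × M) × ℝ → ℝ}
    (hF : ContMDiff ((timeModel n).prod 𝓘(ℝ, ℝ)) 𝓘(ℝ, ℝ) ∞ F) :
    ContMDiff (timeModel n) 𝓘(ℝ, ℝ) ∞ (fun p => ∫ s in (0:ℝ)..1, F (p, s)) := by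
  classical
  rintro ⟨t₀, x₀⟩
  set φ := extChartAt (𝓡 n) x₀ with hφ
  obtain ⟨χ, h1, h2⟩ := exists_bump (n := n) (chartAt (Model n) x₀).open_source
    (mem_chart_source (Model n) x₀)
  have hsrc : φ.source = (chartAt (Model n) x₀).source := extChartAt_source _ _
  rw [← hsrc] at h2
  -- A cutoff equal to 1 near `x₀` makes the chart representation globally smooth, so the theorem on
  -- vector spaces applies.
  let A : (ℝ × Model n) × ℝ → ℝ := fun q => if q.1.2 ∈ φ.target then
    χ (φ.symm q.1.2) * F ((q.1.1, φ.symm q.1.2), q.2) else 0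
  set B : Set (Model n) := φ '' tsupport χ with hB
  have hBc : IsClosed B := ((isClosed_tsupport χ).isCompact.image_of_continuousOn
    ((continuousOn_extChartAt x₀).mono h2)).isClosed
  have hBt : B ⊆ φ.target := by
    rintro _ ⟨x, hx, rfl⟩
    exact φ.map_source (h2 hx)
  have hA : ContDiff ℝ ∞ A := by
    refine contDiff_of_zero_off (U := (univ ×ˢ φ.target) ×ˢ univ) (B := (univ ×ˢ B) ×ˢ univ)
      ((isOpen_univ.prod (isOpen_extChartAt_target x₀)).prod isOpen_univ)
      ((isClosed_univ.prod hBc).prod isClosed_univ)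
      (prod_mono (prod_mono le_rfl hBt) le_rfl) ?_ ?_
    · refine ContDiffOn.congr (f := fun q => χ (φ.symm q.1.2) * F ((q.1.1, φ.symm q.1.2), q.2)) ?_
        fun q hq => if_pos hq.1.2
      rw [← contMDiffOn_iff_contDiffOn, modelWithCornersSelf_prod, ← chartedSpaceSelf_prod,
        modelWithCornersSelf_prod, ← chartedSpaceSelf_prod]
      have hs : ContMDiffOn ((𝓘(ℝ, ℝ).prod 𝓘(ℝ, Model n)).prod 𝓘(ℝ, ℝ)) (𝓡 n) ∞
          (fun q : (ℝ × Model n) × ℝ => φ.symm q.1.2) ((univ ×ˢ φ.target) ×ˢ univ) :=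
        (contMDiffOn_extChartAt_symm x₀).comp
          (contMDiff_snd.comp contMDiff_fst).contMDiffOn fun q hq => hq.1.2
      refine (χ.contMDiff.comp_contMDiffOn hs).mul (hF.comp_contMDiffOn ?_)
      exact ((contMDiff_fst.comp contMDiff_fst).contMDiffOn.prodMk hs).prodMk
        contMDiff_snd.contMDiffOn
    · rintro q hq
      simp only [A]
      split_ifs with h
      · have : χ (φ.symm q.1.2) = 0 := by
          by_contra hne
          exact hq ⟨⟨mem_univ _, φ.symm q.1.2, subset_tsupport _ hne, φ.right_inv h⟩, mem_univ _⟩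
        rw [this, zero_mul]
      · rfl
  have hI := (contDiff_integral_unit hA).contMDiff
  rw [modelWithCornersSelf_prod, ← chartedSpaceSelf_prod] at hI
  have hch : ContMDiffAt (timeModel n) (𝓘(ℝ, ℝ).prod 𝓘(ℝ, Model n)) ∞
      (fun p : ℝ × M => (p.1, φ p.2)) (t₀, x₀) :=
    contMDiffAt_fst.prodMk (contMDiffAt_extChartAt.comp (t₀, x₀) contMDiffAt_snd)
  have hI' : ContMDiffAt (𝓘(ℝ, ℝ).prod 𝓘(ℝ, Model n)) 𝓘(ℝ, ℝ) ∞
      (fun q => ∫ s in (0:ℝ)..1, A (q, s)) (t₀, φ x₀) := hI _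
  refine (ContMDiffAt.comp (t₀, x₀) (g := fun q => ∫ s in (0:ℝ)..1, A (q, s))
    (f := fun p : ℝ × M => (p.1, φ p.2)) hI' hch).congr_of_eventuallyEq ?_
  have c1 : ∀ᶠ p : ℝ × M in 𝓝 (t₀, x₀), p.2 ∈ φ.source :=
    continuousAt_snd.eventually (extChartAt_source_mem_nhds x₀)
  have c2 : ∀ᶠ p : ℝ × M in 𝓝 (t₀, x₀), χ p.2 = 1 :=
    (continuousAt_snd (p := (t₀, x₀))).eventually h1
  filter_upwards [c1, c2] with p hp1 hp2
  refine intervalIntegral.integral_congr fun s _ => ?_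
  rw [if_pos (φ.map_source hp1), φ.left_inv hp1, hp2, one_mul]

end Families

/-! ### Transport of functions and densities by curves of diffeomorphisms. -/

section Transport

variable {n : ℕ} {M : Type*} [TopologicalSpace M] [ChartedSpace (Model n) M]
  [IsManifold (𝓡 n) ∞ M]

lemma funPush_apply_apply (φ : Dif n M) (f : Fun n M) (x : M) : funPush φ f (φ x) = f x :=
  congrArg f (φ.symm_apply_apply x)

lemma funPush_mul (φ : Dif n M) (f g : Fun n M) :
    funPush φ (f * g) = funPush φ f * funPush φ g := rfl

lemma funPush_one (φ : Dif n M) : funPush φ (1 : Fun n M) = 1 := rfl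

lemma funPush_funPush (φ χ : Dif n M) (f : Fun n M) :
    funPush φ (funPush χ f) = funPush (φ * χ) f := rfl

lemma funPush_id (f : Fun n M) : funPush (1 : Dif n M) f = f := rfl

lemma funPush_push_inv (φ : Dif n M) (f : Fun n M) : funPush φ (funPush φ⁻¹ f) = f := by
  rw [funPush_funPush, mul_inv_cancel, funPush_id]

lemma funPush_inv_push (φ : Dif n M) (f : Fun n M) : funPush φ⁻¹ (funPush φ f) = f := by
  rw [funPush_funPush, inv_mul_cancel, funPush_id]

/-- The curve `φ` of diffeomorphisms has the velocity fields `v t`, `dφ_t/dt = v_t ∘ φ_t`. -/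
def FlowsBy (φ : ℝ → Dif n M) (v : ℝ → VField n M) : Prop :=
  ∀ t x, HasVelocityAt (fun s => φ s x) t (v t (φ t x))

lemma FlowsBy.velocityDif {φ : ℝ → Dif n M} {v : ℝ → VField n M} (h : FlowsBy φ v) :
    VelocityDif φ (v 0) := fun x => hasVelocityAt_iff.1 (h 0 x)

/-- The chain rule for g_t = G_t ∘ φ_t: Lagrangian derivative equals Eulerian derivative plus
advection. Both transport formulas below are read off from it. -/
lemma FlowsBy.push_eq {φ : ℝ → Dif n M} {v : ℝ → VField n M} (h : FlowsBy φ v)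
    {F : Type*} [NormedAddCommGroup F] [NormedSpace ℝ F] {G g : ℝ → Maps n M F}
    (hG : SmoothFun G) (hg : SmoothFun g) (hGg : ∀ t x, G t (φ t x) = g t x) (t : ℝ) (x : M) :
    dot g hg t x = dot G hG t (φ t x) + along (v t) (G t) (φ t x) := by
  have h1 := hG.hasDerivAt_comp (h t x)
  have h2 := hg.hasDerivAt t x
  simp only [hGg] at h1
  exact h2.unique h1

lemma SmoothFun.funPull {f : ℝ → Fun n M} (hf : SmoothFun f) {φ : ℝ → Dif n M}
    (hφ : SmoothDif φ) : SmoothFun (fun t => Madelung.funPush (φ t)⁻¹ (f t)) := hf.comp_dif hφ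

lemma FlowsBy.dot_funPush {φ : ℝ → Dif n M} {v : ℝ → VField n M} (h : FlowsBy φ v)
    {f : ℝ → Fun n M} (hf : SmoothFun f) (hφ : SmoothFun fun t => funPush (φ t) (f t)) (t : ℝ) :
    dot (fun t => funPush (φ t) (f t)) hφ t
      = funPush (φ t) (dot f hf t) - lie (v t) (funPush (φ t) (f t)) := by
  ext y
  obtain ⟨x, rfl⟩ := (φ t).surjective y
  have := h.push_eq hφ hf (fun t x => funPush_apply_apply (φ t) (f t) x) t x
  change _ = funPush (φ t) (dot f hf t) (φ t x) - lie (v t) (funPush (φ t) (f t)) (φ t x)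
  rw [funPush_apply_apply, this, lie_eq_along]
  exact (add_sub_cancel_right _ _).symm

lemma FlowsBy.dot_funPull {φ : ℝ → Dif n M} {v : ℝ → VField n M} (h : FlowsBy φ v)
    {f : ℝ → Fun n M} (hf : SmoothFun f) (hφ : SmoothFun fun t => funPush (φ t)⁻¹ (f t)) (t : ℝ) :
    dot (fun t => funPush (φ t)⁻¹ (f t)) hφ t
      = funPush (φ t)⁻¹ (dot f hf t + lie (v t) (f t)) := by
  ext x
  exact h.push_eq hf hφ (fun t x => rfl) t x

variable [T2Space M] [CompactSpace M]

/-- A smooth curve of diffeomorphisms has a smooth curve of velocity fields. -/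
theorem SmoothDif.exists_velocity {φ : ℝ → Dif n M} (hφ : SmoothDif φ) :
    ∃ v : ℝ → VField n M, SmoothField v ∧ FlowsBy φ v := by
  have hb : ∀ k, SmoothFun fun t => Madelung.funPush (φ t)⁻¹ ((theFrame n M).b k) := fun k =>
    (smoothFun_const _).funPull hφ
  -- The velocity field is assembled from the frame, with the time derivatives of b_k ∘ φ_t as
  -- coefficients, so its smoothness in (t, x) is immediate.
  refine ⟨fun t => ∑ k, fieldSmul (funPush (φ t) (dot _ (hb k) t)) ((theFrame n M).X k),
    SmoothField.sum fun k _ => SmoothField.fieldSmul ((hb k).dot.funPush hφ.inv)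
      (smoothField_const _), fun t x => ?_⟩
  have h1 : MDifferentiableAt 𝓘(ℝ, ℝ) (𝓡 n) (fun s => φ s x) t := by
    have : ContMDiff 𝓘(ℝ, ℝ) (𝓡 n) ∞ (fun s => φ s x) :=
      ContMDiff.comp (g := fun p : ℝ × M => φ p.1 p.2) hφ (contMDiff_id.prodMk contMDiff_const)
    exact this.contMDiffAt.mdifferentiableAt (by simp)
  let u : TangentSpace (𝓡 n) (φ t x) := mfderiv 𝓘(ℝ, ℝ) (𝓡 n) (fun s => φ s x) t (1:ℝ)
  have hu : HasVelocityAt (fun s => φ s x) t u := by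
    rw [hasVelocityAt_iff]
    have h1' := h1.hasMFDerivAt
    let L : ℝ →L[ℝ] Model n := mfderiv 𝓘(ℝ, ℝ) (𝓡 n) (fun s => φ s x) t
    change HasMFDerivAt _ _ _ _ L at h1'
    have hL : (1 : ℝ →L[ℝ] ℝ).smulRight (L 1) = L := by
      ext
      simp
    rw [← hL] at h1'
    exact h1'
  have key : (∑ k, fieldSmul (funPush (φ t) (dot _ (hb k) t)) ((theFrame n M).X k)) (φ t x) = u := by
    rw [field_sum_apply, ← (theFrame n M).sum_eq _ u]
    refine Finset.sum_congr rfl fun k _ => ?_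
    rw [fieldSmul_apply, funPush_apply_apply]
    have h2 := hu.comp_of_mdiff (f := (theFrame n M).b k) (Maps.mdiff _ _)
    have h3 := (hb k).hasDerivAt t x
    have h4 : dot _ (hb k) t x = dAt ((theFrame n M).b k) (φ t x) u := h3.unique h2
    rw [h4]
  rw [key]
  exact hu

theorem exists_flowsBy {v : ℝ → VField n M} (hv : SmoothField v) :
    ∃ φ : ℝ → Dif n M, SmoothDif φ ∧ φ 0 = 1 ∧ FlowsBy φ v := by
  obtain ⟨φ, h1, -, h2, h3⟩ := exists_flow hv
  exact ⟨φ, h1, h2, fun t x => hasVelocityAt_iff.2 (h3 t x)⟩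

lemma FlowsBy.mul_right {φ : ℝ → Dif n M} {v : ℝ → VField n M} (h : FlowsBy φ v) (χ : Dif n M) :
    FlowsBy (fun t => φ t * χ) v := fun t x => h t (χ x)

/-- Smooth curves of functions have smooth primitives. -/
theorem SmoothFun.exists_primitive {E : ℝ → Fun n M} (hE : SmoothFun E) :
    ∃ I : ℝ → Fun n M, ∃ hI : SmoothFun I, I 0 = 0 ∧ ∀ t, Madelung.dot I hI t = E t := by
  -- The primitive ∫₀ᵗ E, rescaled to the fixed interval [0, 1].
  let F : ℝ × M → ℝ := fun p => p.1 * ∫ s in (0:ℝ)..1, E (p.1 * s) p.2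
  have hF : ContMDiff (timeModel n) 𝓘(ℝ, ℝ) ∞ F := by
    refine contMDiff_fst.mul (contMDiff_parametric_integral
      (F := fun q : (ℝ × M) × ℝ => E (q.1.1 * q.2) q.1.2) ?_)
    exact ContMDiff.comp (g := fun p : ℝ × M => E p.1 p.2) hE
      (((contMDiff_fst.comp contMDiff_fst).mul contMDiff_snd).prodMk
        (contMDiff_snd.comp contMDiff_fst))
  let I : ℝ → Fun n M := fun t => ⟨fun x => F (t, x), hF.comp (contMDiff_const.prodMk contMDiff_id)⟩
  have hI : SmoothFun I := hF
  refine ⟨I, hI, ?_, fun t => hI.dot_eq fun x => ?_⟩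
  · ext x
    exact zero_mul _
  · have h1 : (fun s => I s x) = fun s => ∫ u in (0:ℝ)..s, E u x := by
      ext s
      have := intervalIntegral.mul_integral_comp_mul_left (f := fun u => E u x) (a := 0) (b := 1) s
      rw [mul_zero, mul_one] at this
      exact this
    have hc : Continuous fun s => E s x :=
      continuous_iff_continuousAt.2 fun s => (hE.hasDerivAt s x).continuousAt
    rw [h1]
    exact intervalIntegral.integral_hasDerivAt_right (hc.intervalIntegrable _ _)
      (hc.stronglyMeasurableAtFilter _ _) hc.continuousAt

/-- The exponential of a function. -/
def expFun (f : Fun n M) : Fun n M :=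
  ⟨fun x => Real.exp (f x), Real.contDiff_exp.contMDiff.comp f.contMDiff⟩

lemma SmoothFun.expFun {f : ℝ → Fun n M} (hf : SmoothFun f) : SmoothFun fun t => expFun (f t) :=
  Real.contDiff_exp.contMDiff.comp hf

/-- The reciprocal of a positive function. -/
def recip (f : Fun n M) (hf : ∀ x, 0 < f x) : Fun n M :=
  ⟨fun x => (f x)⁻¹, fun x => ContMDiffAt.comp x (g := fun y : ℝ => y⁻¹)
    ((contDiffAt_inv ℝ (hf x).ne').contMDiffAt) (f.contMDiff x)⟩

lemma mul_recip (f : Fun n M) (hf : ∀ x, 0 < f x) : f * recip f hf = 1 := by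
  ext x
  exact mul_inv_cancel₀ (hf x).ne'

lemma recip_mul (f : Fun n M) (hf : ∀ x, 0 < f x) : recip f hf * f = 1 := by
  ext x
  exact inv_mul_cancel₀ (hf x).ne'

lemma SmoothFun.recip {f : ℝ → Fun n M} (hf : SmoothFun f) (hp : ∀ t x, 0 < f t x) :
    SmoothFun fun t => recip (f t) (hp t) := fun p =>
  ContMDiffAt.comp p (g := fun y : ℝ => y⁻¹)
    ((contDiffAt_inv ℝ (hp p.1 p.2).ne').contMDiffAt) (hf p)

section Jacobian

variable [MeasurableSpace M] [BorelSpace M] (μ : Measure M) [IsProbabilityMeasure μ]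
  [IsSmoothVolume n μ]

lemma integ_funPush_mul_jac (φ : Dif n M) (f : Fun n M) :
    integ μ (funPush φ f * jac μ φ) = integ μ f := by
  have hm : Measurable fun x => ENNReal.ofReal (jac μ φ x) :=
    (jac μ φ).contMDiff.continuous.measurable.ennreal_ofReal
  calc ∫ x, (funPush φ f * jac μ φ) x ∂μ
      = ∫ x, (ENNReal.ofReal (jac μ φ x)).toReal • f (φ.symm x) ∂μ := by
        refine integral_congr_ae (Filter.Eventually.of_forall fun x => ?_)
        simp only [ENNReal.toReal_ofReal (jac_pos μ φ x).le, smul_eq_mul]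
        exact mul_comm _ _
    _ = ∫ x, f (φ.symm x) ∂(μ.map φ) := by
        rw [map_eq_withDensity_jac, integral_withDensity_eq_integral_toReal_smul hm
          (Filter.Eventually.of_forall fun x => ENNReal.ofReal_lt_top)]
    _ = ∫ x, f (φ.symm (φ x)) ∂μ := φ.toHomeomorph.measurableEmbedding.integral_map _
    _ = integ μ f := by simp [integ_apply]

lemma integ_densityPush_mul (φ : Dif n M) (r f : Fun n M) :
    integ μ (densityPush μ φ r * funPush φ f) = integ μ (r * f) := by
  rw [← integ_funPush_mul_jac μ φ (r * f), densityPush, funPush_mul]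
  congr 1
  ring

/-- The change of variables formula for all test functions determines the density of the image
measure. -/
lemma jac_eq_of_integ {φ : Dif n M} {J : Fun n M}
    (h : ∀ f, integ μ (funPush φ f * J) = integ μ f) : J = jac μ φ := by
  refine eq_of_integral μ fun f => ?_
  rw [← funPush_push_inv φ f, h, integ_funPush_mul_jac]

/-- Each Jacobian is chosen separately, so smoothness in time needs a formula. Pulled back by `φ t`
the Jacobian should satisfy the linear equation K' = -(div v_t ∘ φ_t) K, which an exponential
solves; conservation of integrals then shows that this solution is the Jacobian. -/
lemma SmoothDif.jac_aux {φ : ℝ → Dif n M} (hφ : SmoothDif φ) {v : ℝ → VField n M}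
    (hv : SmoothField v) (hφv : FlowsBy φ v) : ∃ hJ : SmoothFun fun t => jac μ (φ t),
      ∀ t, Madelung.dot _ hJ t = -(divergence μ (v t) * jac μ (φ t) + lie (v t) (jac μ (φ t))) := by
  have hE := SmoothFun.funPull (hv.divergence (μ := μ)) hφ
  obtain ⟨I, hI, hI0, hId⟩ := hE.exists_primitive
  -- The solution of the linear equation with the pulled-back Jacobian at time 0 as initial value.
  let K : ℝ → Fun n M := fun t => expFun (-I t) * funPush (φ 0)⁻¹ (jac μ (φ 0))
  have hK : SmoothFun K := hI.neg.expFun.mul (smoothFun_const _)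
  have hKd : ∀ t, dot K hK t = -(funPush (φ t)⁻¹ (divergence μ (v t)) * K t) := fun t => by
    refine hK.dot_eq fun x => ?_
    have h1 := (((hI.hasDerivAt t x).neg).exp).mul_const (funPush (φ 0)⁻¹ (jac μ (φ 0)) x)
    refine h1.congr_deriv ?_
    rw [hId]
    change _ = -(funPush (φ t)⁻¹ (divergence μ (v t)) x
      * (Real.exp (-I t x) * funPush (φ 0)⁻¹ (jac μ (φ 0)) x))
    change Real.exp (-I t x) * -funPush (φ t)⁻¹ (divergence μ (v t)) x * _ = _
    ring
  have h4 : K 0 = funPush (φ 0)⁻¹ (jac μ (φ 0)) := by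
    ext x
    change Real.exp (-(I 0 x)) * _ = _
    rw [hI0]
    change Real.exp (-0) * _ = _
    rw [neg_zero, Real.exp_zero, one_mul]
  clear_value K
  have hJ : SmoothFun fun t => funPush (φ t) (K t) := hK.funPush hφ.inv
  have hKJ : ∀ t, funPush (φ t) (K t) = jac μ (φ t) := fun t => by
    refine jac_eq_of_integ μ fun f => ?_
    have hfK : SmoothFun fun t => f * K t := (smoothFun_const f).mul hK
    have hP : SmoothFun fun t => funPush (φ t) (f * K t) := hfK.funPush hφ.inv
    -- The advection term, integrated by parts, produces a divergence term that cancels the one from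
    -- the equation for `K`.
    have hd : ∀ s, HasDerivAt (fun s => integ μ (funPush (φ s) (f * K s))) 0 s := fun s => by
      have h1 := hasDerivAt_integral μ hP s
      have h2 : dot _ hfK s = -(f * (funPush (φ s)⁻¹ (divergence μ (v s)) * K s)) := by
        refine hfK.dot_eq fun x => ?_
        refine ((hK.hasDerivAt s x).const_mul (f x)).congr_deriv ?_
        rw [hKd]
        exact mul_neg _ _
      rw [hφv.dot_funPush hfK hP, h2, map_sub, integ_lie, map_neg, funPush_mul, funPush_mul,
        funPush_push_inv, map_neg, funPush_mul] at h1
      refine h1.congr_deriv ?_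
      rw [neg_sub_neg, sub_eq_zero.2]
      congr 1
      ring
    have h3 := is_const_of_deriv_eq_zero (fun s => (hd s).differentiableAt)
      (fun s => (hd s).deriv) t 0
    rw [← funPush_mul, h3, h4, funPush_mul, funPush_push_inv, integ_funPush_mul_jac]
  have heq : (fun t => funPush (φ t) (K t)) = fun t => jac μ (φ t) := funext hKJ
  have hJ' : SmoothFun fun t => jac μ (φ t) := heq ▸ hJ
  refine ⟨hJ', fun t => hJ'.dot_eq fun x => ?_⟩
  have h1 := hJ.hasDerivAt t x
  rw [hφv.dot_funPush hK hJ, hKd, map_neg, funPush_mul, funPush_push_inv, hKJ, ← neg_add'] at h1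
  simp only [hKJ] at h1
  exact h1

variable {μ}

lemma SmoothDif.jac {φ : ℝ → Dif n M} (hφ : SmoothDif φ) : SmoothFun fun t => jac μ (φ t) := by
  obtain ⟨v, hv, hφv⟩ := hφ.exists_velocity
  exact (hφ.jac_aux μ hv hφv).1

lemma SmoothFun.densityPush {r : ℝ → Fun n M} (hr : SmoothFun r) {φ : ℝ → Dif n M}
    (hφ : SmoothDif φ) : SmoothFun fun t => densityPush μ (φ t) (r t) :=
  (hr.funPush hφ.inv).mul hφ.jac

/-- The velocity of `t ↦ |Det(Dφ_t⁻¹)|` is `-div (|Det(Dφ_t⁻¹)| v_t)`. -/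
lemma FlowsBy.dot_jac {φ : ℝ → Dif n M} {v : ℝ → VField n M} (h : FlowsBy φ v) (hφ : SmoothDif φ)
    (hv : SmoothField v) (t : ℝ) : dot _ (hφ.jac (μ := μ)) t
      = -(divergence μ (fieldSmul (jac μ (φ t)) (v t))) := by
  obtain ⟨_, h1⟩ := hφ.jac_aux μ hv h
  rw [h1 t, divergence_fieldSmul, mul_comm (divergence μ (v t))]

/-- The continuity equation for transported densities. -/
lemma FlowsBy.dot_densityPush {φ : ℝ → Dif n M} {v : ℝ → VField n M} (h : FlowsBy φ v)
    (hφ : SmoothDif φ) (hv : SmoothField v) {r : ℝ → Fun n M} (hr : SmoothFun r) (t : ℝ) :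
    dot _ (hr.densityPush (μ := μ) hφ) t = densityPush μ (φ t) (dot r hr t)
      - divergence μ (fieldSmul (densityPush μ (φ t) (r t)) (v t)) := by
  have hp := hr.funPush hφ.inv
  refine SmoothFun.dot_eq _ fun x => ?_
  have h1 := (hp.hasDerivAt t x).mul ((hφ.jac (μ := μ)).hasDerivAt t x)
  rw [h.dot_jac hφ hv, h.dot_funPush hr hp] at h1
  refine h1.congr_deriv ?_
  rw [divergence_fieldSmul, divergence_fieldSmul, densityPush, densityPush, lie_mul]
  refine Eq.symm ?_
  change funPush (φ t) (dot r hr t) x * jac μ (φ t) x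
    - ((funPush (φ t) (r t) x * jac μ (φ t) x) * divergence μ (v t) x
      + (funPush (φ t) (r t) x * lie (v t) (jac μ (φ t)) x
        + jac μ (φ t) x * lie (v t) (funPush (φ t) (r t)) x))
    = (funPush (φ t) (dot r hr t) x - lie (v t) (funPush (φ t) (r t)) x) * jac μ (φ t) x
      + funPush (φ t) (r t) x * (-(jac μ (φ t) x * divergence μ (v t) x
        + lie (v t) (jac μ (φ t)) x))
  ring

end Jacobian

end Transport

/-! ### The divergence equation in a cube of ℝⁿ. -/

section BoxPrimitives

/-- Replace the coordinate `i` of `y` by `σ`. -/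
def updCoord {n : ℕ} (i : Fin n) (σ : ℝ) (y : Model n) : Model n :=
  y + (σ - y i) • EuclideanSpace.single i (1:ℝ)

lemma updCoord_same {n : ℕ} (i : Fin n) (σ : ℝ) (y : Model n) : updCoord i σ y i = σ := by
  simp [updCoord]

lemma updCoord_of_ne {n : ℕ} {i j : Fin n} (h : j ≠ i) (σ : ℝ) (y : Model n) :
    updCoord i σ y j = y j := by
  simp [updCoord, h]

lemma updCoord_self {n : ℕ} (i : Fin n) (y : Model n) : updCoord i (y i) y = y := by
  simp [updCoord]

lemma add_single_apply_of_ne {n : ℕ} {i j : Fin n} (h : j ≠ i) (τ : ℝ) (y : Model n) :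
    (y + τ • EuclideanSpace.single i (1:ℝ)) j = y j := by
  simp [h]

lemma updCoord_add {n : ℕ} (i : Fin n) (σ τ : ℝ) (y : Model n) :
    updCoord i σ (y + τ • EuclideanSpace.single i (1:ℝ)) = updCoord i σ y := by
  ext j
  by_cases h : j = i
  · subst h
    rw [updCoord_same, updCoord_same]
  · rw [updCoord_of_ne h, updCoord_of_ne h, add_single_apply_of_ne h]

lemma contDiff_coord {n : ℕ} (i : Fin n) : ContDiff ℝ ∞ fun y : Model n => y i :=
  (EuclideanSpace.proj i : Model n →L[ℝ] ℝ).contDiff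

lemma contDiff_updCoord {n : ℕ} (i : Fin n) :
    ContDiff ℝ ∞ fun q : (ℝ × Model n) × ℝ => updCoord i q.2 q.1.2 := by
  unfold updCoord
  exact contDiff_fst.snd.add ((contDiff_snd.sub ((contDiff_coord i).comp contDiff_fst.snd)).smul
    contDiff_const)

/-- An affine substitution moves the variable endpoints into the integrand. -/
lemma contDiff_integral_endpoints {P : Type} [NormedAddCommGroup P] [NormedSpace ℝ P]
    {g : P × ℝ → ℝ} (hg : ContDiff ℝ ∞ g) {a b : P → ℝ} (ha : ContDiff ℝ ∞ a)
    (hb : ContDiff ℝ ∞ b) : ContDiff ℝ ∞ fun p => ∫ σ in (a p)..(b p), g (p, σ) := by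
  have h : (fun p => ∫ σ in (a p)..(b p), g (p, σ))
      = fun p => (b p - a p) * ∫ s in (0:ℝ)..1, g (p, a p + (b p - a p) * s) := by
    ext p
    rw [intervalIntegral.mul_integral_comp_add_mul (f := fun σ => g (p, σ)) (b p - a p) (a p)]
    simp
  rw [h]
  refine (hb.sub ha).mul (contDiff_integral_unit (F := fun q : P × ℝ =>
    g (q.1, a q.1 + (b q.1 - a q.1) * q.2)) ?_)
  exact hg.comp (contDiff_fst.prodMk ((ha.comp contDiff_fst).add
    (((hb.comp contDiff_fst).sub (ha.comp contDiff_fst)).mul contDiff_snd)))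

lemma exists_unit_bump (c : ℝ) {R : ℝ} (hR : 0 < R) : ∃ χ : ℝ → ℝ, ContDiff ℝ ∞ χ ∧
    (∀ s, R ≤ |s - c| → χ s = 0) ∧ ∫ s in (c - R)..(c + R), χ s = 1 := by
  let φ : ContDiffBump c := ⟨R / 2, R, by positivity, by linarith⟩
  have h0 : ∀ s, R ≤ |s - c| → φ.normed volume s = 0 := fun s hs => by
    rw [← Function.notMem_support, φ.support_normed_eq, Metric.mem_ball, Real.dist_eq, not_lt]
    exact hs
  refine ⟨φ.normed volume, φ.contDiff_normed, h0, ?_⟩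
  rw [intervalIntegral.integral_of_le (by linarith), ← φ.integral_normed (μ := volume)]
  refine setIntegral_eq_integral_of_forall_compl_eq_zero fun s hs => h0 s ?_
  by_contra hlt
  obtain ⟨h1, h2⟩ := abs_lt.1 (not_le.1 hlt)
  exact hs ⟨by linarith, by linarith⟩

/-- A smooth family of functions supported in an open cube is, up to a multiple of a fixed bump
function, a divergence of functions supported in the cube. -/
theorem exists_box_primitives {n : ℕ} (c : Model n) {R : ℝ} (hR : 0 < R) :
    ∃ B : Model n → ℝ, ContDiff ℝ ∞ B ∧ (∀ y, (∃ j, R ≤ |y j - c j|) → B y = 0) ∧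
      ∀ F : ℝ × Model n → ℝ, ContDiff ℝ ∞ F → (∀ t y, (∃ j, R ≤ |y j - c j|) → F (t, y) = 0) →
        ∃ (G : Fin n → ℝ × Model n → ℝ) (k : ℝ → ℝ), (∀ i, ContDiff ℝ ∞ (G i)) ∧
          (∀ i t y, (∃ j, R ≤ |y j - c j|) → G i (t, y) = 0) ∧ ContDiff ℝ ∞ k ∧
          ∀ t y, F (t, y) - k t * B y
            = ∑ i, fderiv ℝ (fun z => G i (t, z)) y (EuclideanSpace.single i (1:ℝ)) := by
  classical
  choose χ χs χ0 χ1 using fun i => exists_unit_bump (c i) hR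
  have prod_smooth : ∀ s : Finset (Fin n),
      ContDiff ℝ ∞ fun p : ℝ × Model n => ∏ j ∈ s, χ j (p.2 j) := fun s =>
    contDiff_prod fun j _ => (χs j).comp ((contDiff_coord j).comp contDiff_snd)
  refine ⟨fun y => ∏ j, χ j (y j), contDiff_prod fun j _ => (χs j).comp (contDiff_coord j),
    fun y ⟨j, hj⟩ => Finset.prod_eq_zero (Finset.mem_univ j) (χ0 j _ hj), fun F hF hF0 => ?_⟩
  -- The coordinates are integrated out one at a time. After those in s, the rest is a function `H`
  -- of the other coordinates times the product of the bump functions in s, up to a divergence.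
  have main : ∀ s : Finset (Fin n), ∃ (H : ℝ × Model n → ℝ) (G : Fin n → ℝ × Model n → ℝ),
      ContDiff ℝ ∞ H ∧ (∀ i, ContDiff ℝ ∞ (G i)) ∧
      (∀ i t y, (∃ j, R ≤ |y j - c j|) → G i (t, y) = 0) ∧
      (∀ t y, (∃ j ∉ s, R ≤ |y j - c j|) → H (t, y) = 0) ∧
      (∀ t y y', (∀ j ∉ s, y j = y' j) → H (t, y) = H (t, y')) ∧
      ∀ t y, F (t, y) - H (t, y) * ∏ j ∈ s, χ j (y j)
        = ∑ i, fderiv ℝ (fun z => G i (t, z)) y (EuclideanSpace.single i (1:ℝ)) := by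
    intro s
    induction s using Finset.induction_on with
    | empty =>
      refine ⟨F, fun _ _ => 0, hF, fun _ => contDiff_const, fun _ _ _ _ => rfl,
        fun t y ⟨j, _, hj⟩ => hF0 t y ⟨j, hj⟩, fun t y y' h => ?_, fun t y => by simp⟩
      have : y = y' := by
        ext j
        exact h j (by simp)
      rw [this]
    | insert i s his ih =>
      obtain ⟨H, G, hH, hG, hG0, hH0, hHi, hsum⟩ := ih
      let a : ℝ := c i - R
      let b : ℝ := c i + R
      let g₀ : (ℝ × Model n) × ℝ → ℝ := fun q => H (q.1.1, updCoord i q.2 q.1.2)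
      have hg₀ : ContDiff ℝ ∞ g₀ := hH.comp (contDiff_fst.fst.prodMk (contDiff_updCoord i))
      let H' : ℝ × Model n → ℝ := fun p => ∫ σ in a..b, g₀ (p, σ)
      have hH' : ContDiff ℝ ∞ H' := contDiff_integral_endpoints hg₀ contDiff_const contDiff_const
      -- Subtracting the integral `H'` times a bump of mass one leaves mass zero on every line in
      -- direction i. Its primitive therefore vanishes at both ends of the line, and `N` is
      -- supported in the cube.
      let g : (ℝ × Model n) × ℝ → ℝ := fun q => g₀ q - H' q.1 * χ i q.2
      have hg : ContDiff ℝ ∞ g :=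
        hg₀.sub ((hH'.comp contDiff_fst).mul ((χs i).comp contDiff_snd))
      have hgc : ∀ p, Continuous fun σ => g (p, σ) := fun p => hg.continuous.comp (by fun_prop)
      have hg₀c : ∀ p, Continuous fun σ => g₀ (p, σ) := fun p => hg₀.continuous.comp (by fun_prop)
      let N : ℝ × Model n → ℝ := fun p => (∏ j ∈ s, χ j (p.2 j)) * ∫ σ in a..(p.2 i), g (p, σ)
      have hN : ContDiff ℝ ∞ N := (prod_smooth s).mul
        (contDiff_integral_endpoints hg contDiff_const ((contDiff_coord i).comp contDiff_snd))
      have hH'0 : ∀ t y, (∃ j ∉ insert i s, R ≤ |y j - c j|) → H' (t, y) = 0 := by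
        rintro t y ⟨j, hj, hjR⟩
        have hji : j ≠ i := fun h => hj (h ▸ Finset.mem_insert_self _ _)
        have : ∀ σ, g₀ ((t, y), σ) = 0 := fun σ =>
          hH0 _ _ ⟨j, fun h => hj (Finset.mem_insert_of_mem h), by rwa [updCoord_of_ne hji]⟩
        simp only [H', this, intervalIntegral.integral_zero]
      have hgout : ∀ t y σ, R ≤ |σ - c i| → g ((t, y), σ) = 0 := fun t y σ hσ => by
        have h1 : g₀ ((t, y), σ) = 0 := hH0 _ _ ⟨i, his, by rwa [updCoord_same]⟩
        simp only [g, h1, χ0 i σ hσ, mul_zero, sub_zero]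
      have hgint : ∀ p, ∫ σ in a..b, g (p, σ) = 0 := fun p => by
        have h1 : ∫ σ in a..b, g (p, σ) = H' p - H' p * ∫ σ in a..b, χ i σ := by
          rw [← intervalIntegral.integral_const_mul, ← intervalIntegral.integral_sub]
          · exact (hg₀c p).intervalIntegrable _ _
          · exact (continuous_const.mul (χs i).continuous).intervalIntegrable _ _
        rw [h1, χ1 i, mul_one, sub_self]
      have hN0 : ∀ t y, (∃ j, R ≤ |y j - c j|) → N (t, y) = 0 := by
        rintro t y ⟨j, hj⟩
        by_cases hjs : j ∈ s
        · exact mul_eq_zero_of_left (Finset.prod_eq_zero hjs (χ0 j _ hj)) _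
        refine mul_eq_zero_of_right _ ?_
        change ∫ σ in a..(y i), g ((t, y), σ) = 0
        by_cases hji : j = i
        · subst hji
          rcases le_abs.1 hj with h | h
          · rw [← intervalIntegral.integral_add_adjacent_intervals
              ((hgc (t, y)).intervalIntegrable a b) ((hgc (t, y)).intervalIntegrable b (y j)),
              hgint, zero_add]
            refine intervalIntegral.integral_zero_ae (Filter.Eventually.of_forall fun σ hσ => ?_)
            rw [uIoc_of_le (by simp only [b]; linarith)] at hσ
            exact hgout t y σ (le_abs.2 (Or.inl (by have := hσ.1; simp only [b] at this; linarith)))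
          · refine intervalIntegral.integral_zero_ae (Filter.Eventually.of_forall fun σ hσ => ?_)
            rw [uIoc_of_ge (by simp only [a]; linarith)] at hσ
            exact hgout t y σ (le_abs.2 (Or.inr (by have := hσ.2; simp only [a] at this; linarith)))
        · have h1 : H' (t, y) = 0 := hH'0 t y ⟨j, by simp [hji, hjs], hj⟩
          have h2 : ∀ σ, g ((t, y), σ) = 0 := fun σ => by
            have : g₀ ((t, y), σ) = 0 := hH0 _ _ ⟨j, hjs, by rwa [updCoord_of_ne hji]⟩
            simp only [g, this, h1, zero_mul, sub_zero]
          simp only [h2, intervalIntegral.integral_zero]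
      have hNd : ∀ t y, fderiv ℝ (fun z => N (t, z)) y (EuclideanSpace.single i (1:ℝ))
          = (H (t, y) - H' (t, y) * χ i (y i)) * ∏ j ∈ s, χ j (y j) := by
        intro t y
        have hd : DifferentiableAt ℝ (fun z => N (t, z)) y :=
          (hN.comp (contDiff_const.prodMk contDiff_id)).contDiffAt.differentiableAt (by simp)
        have h1 := hd.hasFDerivAt.hasLineDerivAt (EuclideanSpace.single i (1:ℝ))
        have h2 : ∀ τ : ℝ, N (t, y + τ • EuclideanSpace.single i (1:ℝ))
            = (∏ j ∈ s, χ j (y j)) * ∫ σ in a..(y i + τ), g ((t, y), σ) := by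
          intro τ
          have e0 : ∀ σ, g₀ ((t, y + τ • EuclideanSpace.single i (1:ℝ)), σ) = g₀ ((t, y), σ) :=
            fun σ => by simp only [g₀, updCoord_add]
          have e1 : H' (t, y + τ • EuclideanSpace.single i (1:ℝ)) = H' (t, y) := by
            simp only [H', e0]
          have e2 : ∀ σ, g ((t, y + τ • EuclideanSpace.single i (1:ℝ)), σ) = g ((t, y), σ) :=
            fun σ => by simp only [g, e0, e1]
          have e3 : (y + τ • EuclideanSpace.single i (1:ℝ)) i = y i + τ := by simp
          have e4 : ∏ j ∈ s, χ j ((y + τ • EuclideanSpace.single i (1:ℝ)) j)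
              = ∏ j ∈ s, χ j (y j) := Finset.prod_congr rfl fun j hj => by
            have hji : j ≠ i := fun h => his (h ▸ hj)
            rw [add_single_apply_of_ne hji]
          simp only [N, e2, e3, e4]
        have h3 : HasDerivAt (fun τ : ℝ => N (t, y + τ • EuclideanSpace.single i (1:ℝ)))
            ((∏ j ∈ s, χ j (y j)) * g ((t, y), y i)) 0 := by
          simp only [h2]
          refine HasDerivAt.const_mul _ ?_
          have h4 := intervalIntegral.integral_hasDerivAt_right (a := a) (b := y i + 0)
            ((hgc (t, y)).intervalIntegrable _ _)
            ((hgc (t, y)).stronglyMeasurableAtFilter _ _) (hgc (t, y)).continuousAt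
          have h5 := h4.comp_const_add (y i) 0
          rwa [add_zero] at h5
        have h4 := HasDerivAt.unique h1 h3
        rw [h4]
        simp only [g, g₀, updCoord_self]
        ring
      refine ⟨H', fun k => G k + if k = i then N else 0, hH', fun k => ?_, ?_, hH'0, ?_, ?_⟩
      · by_cases h : k = i
        · simp only [h, if_true]; exact (hG i).add hN
        · simp only [h, if_false, add_zero]; exact hG k
      · intro k t y hy
        by_cases h : k = i
        · simp [h, hG0 i t y hy, hN0 t y hy]
        · simp [h, hG0 k t y hy]
      · intro t y y' h
        refine intervalIntegral.integral_congr fun σ _ => hHi _ _ _ fun j hj => ?_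
        by_cases hji : j = i
        · subst hji
          simp only [updCoord_same]
        · simp only [updCoord_of_ne hji]
          exact h j (by simp [hji, hj])
      · intro t y
        have h1 : ∀ k, fderiv ℝ (fun z => (G k + if k = i then N else 0) (t, z)) y
            (EuclideanSpace.single k (1:ℝ))
            = fderiv ℝ (fun z => G k (t, z)) y (EuclideanSpace.single k (1:ℝ))
              + if k = i then fderiv ℝ (fun z => N (t, z)) y (EuclideanSpace.single i (1:ℝ))
                else 0 := by
          intro k
          by_cases h : k = i
          · subst h
            simp only [if_true]
            have d1 : DifferentiableAt ℝ (fun z => G k (t, z)) y :=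
              ((hG k).comp (contDiff_const.prodMk contDiff_id)).contDiffAt.differentiableAt (by simp)
            have d2 : DifferentiableAt ℝ (fun z => N (t, z)) y :=
              (hN.comp (contDiff_const.prodMk contDiff_id)).contDiffAt.differentiableAt (by simp)
            have := fderiv_add d1 d2
            exact congrArg (fun L => L (EuclideanSpace.single k (1:ℝ))) this
          · simp only [h, if_false, add_zero]
        rw [Finset.sum_congr rfl fun k _ => h1 k, Finset.sum_add_distrib, ← hsum,
          Finset.sum_ite_eq' Finset.univ i, if_pos (Finset.mem_univ i), hNd,
          Finset.prod_insert his]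
        ring
  obtain ⟨H, G, hH, hG, hG0, -, hHi, hsum⟩ := main Finset.univ
  -- When all coordinates have been integrated out `H` depends on t alone, so its value at the
  -- origin serves as the coefficient.
  refine ⟨G, fun t => H (t, 0), hG, hG0, hH.comp (contDiff_id.prodMk contDiff_const), fun t y => ?_⟩
  rw [← hsum t y, hHi t y 0 fun j hj => absurd (Finset.mem_univ j) hj]

end BoxPrimitives

/-! ### The divergence equation on a compact connected manifold. -/

section DivergenceEquation

/-- The open cube with centre `c` and side `2R`. -/
def openCube {n : ℕ} (c : Model n) (R : ℝ) : Set (Model n) := {y | ∀ j, |y j - c j| < R}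

/-- The closed cube with centre `c` and side `2R`. -/
def closedCube {n : ℕ} (c : Model n) (R : ℝ) : Set (Model n) := {y | ∀ j, |y j - c j| ≤ R}

lemma openCube_subset {n : ℕ} (c : Model n) (R : ℝ) : openCube c R ⊆ closedCube c R :=
  fun _ h j => (h j).le

lemma isOpen_openCube {n : ℕ} (c : Model n) (R : ℝ) : IsOpen (openCube c R) := by
  rw [openCube, ofPred_forall]
  exact isOpen_iInter_of_finite fun j => isOpen_lt (by fun_prop) continuous_const

lemma isCompact_closedCube {n : ℕ} (c : Model n) (R : ℝ) : IsCompact (closedCube c R) := by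
  have h : closedCube c R
      = WithLp.toLp 2 '' (univ.pi fun j : Fin n => Icc (c j - R) (c j + R)) := by
    ext y
    constructor
    · intro hy
      refine ⟨WithLp.ofLp y, fun j _ => ?_, rfl⟩
      obtain ⟨h1, h2⟩ := abs_le.1 (hy j)
      exact ⟨by linarith, by linarith⟩
    · rintro ⟨z, hz, rfl⟩ j
      obtain ⟨h1, h2⟩ := hz j (mem_univ j)
      exact abs_le.2 ⟨by simp only; linarith, by simp only; linarith⟩
  rw [h]
  exact (isCompact_univ_pi fun j => isCompact_Icc).image (PiLp.continuous_toLp 2 _)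

lemma exists_closedCube_subset {n : ℕ} {c : Model n} {U : Set (Model n)} (hU : U ∈ 𝓝 c) :
    ∃ R > 0, closedCube c R ⊆ U := by
  have h1 : WithLp.toLp 2 ⁻¹' U ∈ 𝓝 (WithLp.ofLp c) :=
    (PiLp.continuous_toLp 2 (fun _ : Fin n => ℝ)).continuousAt.preimage_mem_nhds hU
  obtain ⟨R, hR, h2⟩ := Metric.nhds_basis_closedBall.mem_iff.1 h1
  refine ⟨R, hR, fun y hy => ?_⟩
  exact @h2 (WithLp.ofLp y) (Metric.mem_closedBall.2 ((dist_pi_le_iff hR.le).2 fun j => hy j))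

variable {n : ℕ} {M : Type*} [TopologicalSpace M] [ChartedSpace (Model n) M]

variable (n) in
/-- The open cube of side `2R` around `x₀` in the chart at `x₀`. -/
def chartCube (x₀ : M) (R : ℝ) : Set M :=
  (chartAt (Model n) x₀).source ∩ chartAt (Model n) x₀ ⁻¹' openCube (chartAt (Model n) x₀ x₀) R

variable (n) in
/-- The cube `chartCube n x₀ R` is nondegenerate, and the chart contains its closure. -/
def IsChartCube (x₀ : M) (R : ℝ) : Prop :=
  0 < R ∧ closedCube (chartAt (Model n) x₀ x₀) R ⊆ (chartAt (Model n) x₀).target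

lemma isOpen_chartCube (x₀ : M) (R : ℝ) : IsOpen (chartCube n x₀ R) :=
  (chartAt (Model n) x₀).isOpen_inter_preimage (isOpen_openCube _ _)

lemma IsChartCube.mem {x₀ : M} {R : ℝ} (h : IsChartCube n x₀ R) : x₀ ∈ chartCube n x₀ R :=
  ⟨mem_chart_source _ _, fun j => by simpa using h.1⟩

lemma exists_isChartCube (x₀ : M) : ∃ R, IsChartCube n x₀ R := by
  obtain ⟨R, hR, h⟩ := exists_closedCube_subset
    ((chartAt (Model n) x₀).open_target.mem_nhds (mem_chart_target _ x₀))
  exact ⟨R, hR, h⟩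

lemma symm_mem_chartCube {x₀ : M} {R : ℝ} {y : Model n} (hy : y ∈ (chartAt (Model n) x₀).target) :
    (chartAt (Model n) x₀).symm y ∈ chartCube n x₀ R
      ↔ y ∈ openCube (chartAt (Model n) x₀ x₀) R := by
  rw [chartCube, mem_inter_iff, mem_preimage, (chartAt (Model n) x₀).right_inv hy,
    and_iff_right ((chartAt (Model n) x₀).map_target hy)]

lemma fun_sum_apply {ι : Type*} (s : Finset ι) (f : ι → Fun n M) (x : M) :
    (∑ i ∈ s, f i) x = ∑ i ∈ s, f i x := by
  classical
  induction s using Finset.induction_on with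
  | empty => rfl
  | insert i s hi ih =>
    rw [Finset.sum_insert hi, Finset.sum_insert hi, ← ih]
    rfl

variable [IsManifold (𝓡 n) ∞ M]

lemma fieldSmul_smul_one (a : ℝ) (v : VField n M) : fieldSmul (a • 1) v = a • v := by
  ext x : 1
  rw [fieldSmul_apply]
  change (a * 1) • v x = a • v x
  rw [mul_one]

variable [T2Space M] [CompactSpace M] [MeasurableSpace M] [BorelSpace M]
  (μ : Measure M) [IsProbabilityMeasure μ] [IsSmoothVolume n μ]

/-- In a chart with density h the field ∑ (G_i / h) ∂_i has divergence (∑ ∂_i G_i) / h, so the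
statement for cubes in ℝⁿ transfers. The multiple `k` is left open here; integration determines it
in `exists_divergence_eq_cube`. -/
lemma exists_isDiv_cube {x₀ : M} {R : ℝ} (hR : IsChartCube n x₀ R) :
    ∃ β : Fun n M, ∀ f : ℝ → Fun n M, SmoothFun f → (∀ t, ∀ x ∉ chartCube n x₀ R, f t x = 0) →
      ∃ (w : ℝ → VField n M) (k : ℝ → ℝ), SmoothField w ∧
        (∀ t, ∀ x ∉ chartCube n x₀ R, w t x = 0) ∧ ContDiff ℝ ∞ k ∧
        ∀ t, IsDiv μ (w t) (f t - k t • β) := by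
  obtain ⟨h, h1, h2, h3⟩ := IsSmoothVolume.exists_density (n := n) (μ := μ) _
    (IsManifold.chart_mem_maximalAtlas (I := 𝓡 n) (n := ∞) x₀)
  obtain ⟨hR0, hRt⟩ := hR
  set e := chartAt (Model n) x₀ with he
  have ht : (extChartAt (𝓡 n) x₀).target = e.target := by simp [he]
  have hsy : ((extChartAt (𝓡 n) x₀).symm : Model n → M) = e.symm := by ext; simp [he]
  have hfw : (extChartAt (𝓡 n) x₀ : M → Model n) = e := by ext; simp [he]
  set c := e x₀ with hc
  set Q := closedCube c R with hQ
  have hQc : IsCompact Q := isCompact_closedCube c R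
  have out : ∀ {y}, y ∉ openCube c R ↔ ∃ j, R ≤ |y j - c j| := by
    intro y
    simp [openCube]
  have hQout : ∀ {y}, y ∉ Q → ∃ j, R ≤ |y j - c j| := fun hy =>
    out.1 fun h => hy (openCube_subset _ _ h)
  obtain ⟨B, hB, hB0, hbox⟩ := exists_box_primitives c hR0
  have lift : ∀ A : ℝ × Model n → ℝ, ContDiff ℝ ∞ A → (∀ t, ∀ y ∉ Q, A (t, y) = 0) →
      ∃ a : ℝ → Fun n M, SmoothFun a ∧ (∀ t, ∀ x ∈ e.source, a t x = A (t, e x) / h (e x)) ∧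
        ∀ t, ∀ x ∉ e.source, a t x = 0 := by
    intro A hA hA0
    obtain ⟨a, ha, ha1, ha0⟩ := exists_lift x₀ (A := fun p => A p / h p.2) hQc (by rwa [ht])
      (by
        rw [ht]
        exact hA.contDiffOn.div (h1.comp contDiff_snd.contDiffOn fun p hp => hp.2)
          fun p hp => (h2 _ hp.2).ne')
      (fun t y hy => by simp only [hA0 t y hy, zero_div])
    refine ⟨a, ha, fun t x hx => by rw [ha1 t x hx, hfw], fun t x hx => ha0 t x fun hxB => hx ?_⟩
    obtain ⟨y, hy, rfl⟩ := hxB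
    rw [hsy]
    exact e.map_target (hRt hy)
  obtain ⟨η, hη1, hη2⟩ := exists_cutoff (n := n) (K := e.symm '' Q) (U := e.source)
    (hQc.image_of_continuousOn (e.continuousOn_symm.mono hRt)).isClosed e.open_source (by
      rintro _ ⟨y, hy, rfl⟩
      exact e.map_target (hRt hy))
  obtain ⟨E, hE⟩ := exists_coordinate_fields x₀ hη2
  obtain ⟨β, -, hβ1, hβ0⟩ := lift (fun p => B p.2) (hB.comp contDiff_snd)
    fun t y hy => hB0 y (hQout hy)
  refine ⟨β 0, fun f hf hf0 => ?_⟩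
  -- The density times f in coordinates, extended by zero; the factor h compensates the later
  -- division by h.
  let F : ℝ × Model n → ℝ := (univ ×ˢ e.target).indicator fun p => h p.2 * f p.1 (e.symm p.2)
  have hFt : ∀ t, ∀ y ∈ e.target, F (t, y) = h y * f t (e.symm y) := fun t y hy =>
    indicator_of_mem (show (t, y) ∈ univ ×ˢ e.target from ⟨mem_univ _, hy⟩) _
  have hF0 : ∀ t y, (∃ j, R ≤ |y j - c j|) → F (t, y) = 0 := by
    intro t y hy
    by_cases hyt : y ∈ e.target
    · rw [hFt t y hyt, hf0, mul_zero]
      rw [symm_mem_chartCube hyt]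
      exact out.2 hy
    · exact indicator_of_notMem (fun h => hyt h.2) _
  have hF : ContDiff ℝ ∞ F := by
    refine contDiff_of_zero_off (U := univ ×ˢ e.target) (B := univ ×ˢ Q)
      (isOpen_univ.prod e.open_target) (isClosed_univ.prod hQc.isClosed)
      (prod_mono le_rfl hRt) ?_ fun p hp => hF0 _ _ (hQout fun h => hp ⟨mem_univ _, h⟩)
    refine ContDiffOn.congr ?_ fun p hp => indicator_of_mem hp _
    refine ContDiffOn.mul (h1.comp contDiff_snd.contDiffOn fun p hp => hp.2) ?_
    have hs : ContMDiffOn (𝓘(ℝ, ℝ).prod 𝓘(ℝ, Model n)) 𝓘(ℝ, ℝ) ∞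
        (fun p : ℝ × Model n => f p.1 (e.symm p.2)) (univ ×ˢ e.target) := by
      refine ContMDiff.comp_contMDiffOn (g := fun p : ℝ × M => f p.1 p.2)
        (f := fun p : ℝ × Model n => (p.1, e.symm p.2)) hf ?_
      have hs2 : ContMDiffOn (𝓘(ℝ, ℝ).prod 𝓘(ℝ, Model n)) (𝓡 n) ∞
          (fun p : ℝ × Model n => e.symm p.2) (univ ×ˢ e.target) := by
        rw [← hsy, ← ht]
        exact (contMDiffOn_extChartAt_symm x₀).comp contMDiffOn_snd fun p hp => hp.2
      exact contMDiff_fst.contMDiffOn.prodMk hs2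
    rw [← contMDiffOn_iff_contDiffOn, modelWithCornersSelf_prod, ← chartedSpaceSelf_prod]
    exact hs
  obtain ⟨G, k, hG, hG0, hk, hsum⟩ := hbox F hF hF0
  choose a ha ha1 ha0 using fun i => lift (G i) (hG i) fun t y hy => hG0 i t y (hQout hy)
  refine ⟨fun t => ∑ i, fieldSmul (a i t) (E i), k,
    SmoothField.sum fun i _ => SmoothField.fieldSmul (ha i) (smoothField_const _), ?_, hk, ?_⟩
  · intro t x hx
    rw [field_sum_apply]
    refine Finset.sum_eq_zero fun i _ => ?_
    rw [fieldSmul_apply]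
    by_cases hxs : x ∈ e.source
    · rw [ha1 i t x hxs, hG0 i t _ (out.1 fun h => hx ⟨hxs, h⟩), zero_div, zero_smul]
    · rw [ha0 i t x hxs, zero_smul]
  · intro t
    have hGt : ∀ i, ContDiff ℝ ∞ fun z => G i (t, z) := fun i =>
      (hG i).comp (contDiff_const.prodMk contDiff_id)
    have hGt0 : ∀ i, ∀ y ∉ Q, G i (t, y) = 0 := fun i y hy => hG0 i t y (hQout hy)
    choose b _ hb1 hb0 using fun i => lift (fun p => fderiv ℝ (fun z => G i (t, z)) p.2
      (EuclideanSpace.single i (1:ℝ)))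
      ((((hGt i).fderiv_right (m := ∞) (by simp)).comp contDiff_snd).clm_apply contDiff_const)
      (fun _ y hy => by
        simp only
        rw [fderiv_zero_off hQc.isClosed (hGt0 i) hy]
        rfl)
    have hdiv : ∀ i ∈ Finset.univ, IsDiv μ (fieldSmul (a i t) (E i)) (b i 0) := by
      intro i _
      refine isDiv_chart μ h1 h2 h3 (hGt i) hQc hRt (hGt0 i) (EuclideanSpace.single i (1:ℝ))
        (fun x hx => ?_) (fun x hx => ?_) (hb1 i 0) (hb0 i 0)
      · have h5 : chartDeriv x₀ x (fieldSmul (a i t) (E i) x)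
            = a i t x • chartDeriv x₀ x (E i x) := (chartDeriv x₀ x).map_smul _ _
        rw [h5, (hE i).1 x hx, ha1 i t x hx]
        -- The field `E i` is only η ∂_i, but η = 1 on the closed cube, outside which G_i vanishes.
        by_cases hxQ : e x ∈ Q
        · have : η x = 1 := (hη1.self_of_nhdsSet) x ⟨e x, hxQ, e.left_inv hx⟩
          rw [this, one_smul]
        · rw [hGt0 i _ hxQ, zero_div, zero_smul, zero_smul]
      · rw [fieldSmul_apply, ha0 i t x hx, zero_smul]
    have h6 := IsDiv.sum μ hdiv
    convert h6 using 1
    ext x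
    have h7 := fun_sum_apply Finset.univ (fun i => b i 0) x
    change f t x - k t * β 0 x = _
    rw [h7]
    by_cases hx : x ∈ e.source
    · have h8 := hsum t (e x)
      rw [hFt t _ (e.map_source hx), e.left_inv hx] at h8
      rw [hβ1 0 x hx, Finset.sum_congr rfl fun i _ => hb1 i 0 x hx, ← Finset.sum_div, ← h8]
      have := (h2 _ (e.map_source hx)).ne'
      field_simp
    · rw [hβ0 0 x hx, hf0 t x fun h => hx h.1, Finset.sum_eq_zero fun i _ => hb0 i 0 x hx]
      ring

variable {μ} in
lemma contDiff_integ {f : ℝ → Fun n M} (hf : SmoothFun f) :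
    ContDiff ℝ ∞ fun t => integ μ (f t) := by
  rw [contDiff_infty]
  intro m
  induction m generalizing f with
  | zero =>
    exact contDiff_zero.2 (continuous_iff_continuousAt.2 fun t =>
      (hasDerivAt_integral μ hf t).continuousAt)
  | succ m ih =>
    push_cast
    refine contDiff_succ_iff_deriv.2 ⟨fun t => (hasDerivAt_integral μ hf t).differentiableAt,
      fun h => by simp at h, ?_⟩
    rw [funext fun t => (hasDerivAt_integral μ hf t).deriv]
    exact ih hf.dot

variable {μ} in
lemma divergence_sub (v w : VField n M) :
    divergence μ (v - w) = divergence μ v - divergence μ w := by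
  rw [sub_eq_add_neg, divergence_add, divergence_neg, sub_eq_add_neg]

variable {μ} in
lemma divergence_zero : divergence μ (0 : VField n M) = 0 := by
  rw [← sub_self (0 : VField n M), divergence_sub, sub_self]

/-- The square of a bump function, normalized. The square guarantees a nonzero integral. -/
lemma exists_unit_mass {U : Set M} (hU : IsOpen U) {x : M} (hx : x ∈ U) :
    ∃ β : Fun n M, (∀ y ∉ U, β y = 0) ∧ integ μ β = 1 := by
  obtain ⟨χ, h1, h2⟩ := exists_bump (n := n) hU hx
  have hne : integ μ (χ * χ) ≠ 0 := by
    intro h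
    have := isOpenPosMeasure n μ
    have h1' := (integral_eq_zero_iff_of_nonneg (fun x => mul_self_nonneg (χ x))
      (integrable_fun μ (χ * χ))).1 h
    have h2' := (Continuous.ae_eq_iff_eq μ (χ * χ).contMDiff.continuous continuous_zero).1 h1'
    have h3 : χ x = 0 := mul_self_eq_zero.1 (congrFun h2' x)
    rw [h1.self_of_nhds] at h3
    exact one_ne_zero h3
  refine ⟨(integ μ (χ * χ))⁻¹ • (χ * χ), fun y hy => ?_, ?_⟩
  · have : χ y = 0 := by
      by_contra h
      exact hy (h2 (subset_tsupport _ h))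
    change _ * (χ y * χ y) = 0
    rw [this, zero_mul, mul_zero]
  · rw [map_smul, smul_eq_mul, inv_mul_cancel₀ hne]

/-- The divergence equation in a cube. -/
theorem exists_divergence_eq_cube {x₀ : M} {R : ℝ} (hR : IsChartCube n x₀ R) {β : Fun n M}
    (hβ0 : ∀ x ∉ chartCube n x₀ R, β x = 0) (hβ : integ μ β = 1) {f : ℝ → Fun n M}
    (hf : SmoothFun f) (hf0 : ∀ t, ∀ x ∉ chartCube n x₀ R, f t x = 0) :
    ∃ w : ℝ → VField n M, SmoothField w ∧ (∀ t, ∀ x ∉ chartCube n x₀ R, w t x = 0) ∧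
      ∀ t, divergence μ (w t) = f t - integ μ (f t) • β := by
  obtain ⟨b, hb⟩ := exists_isDiv_cube μ hR
  obtain ⟨w, k, hw, hw0, -, hwd⟩ := hb f hf hf0
  obtain ⟨v, l, -, hv0, -, hvd⟩ := hb (fun _ => β) (smoothFun_const β) fun _ => hβ0
  have e1 : ∀ t, integ μ (f t) = k t * integ μ b := fun t => by
    have := integ_divergence (μ := μ) (w t)
    rw [(hwd t).eq_divergence, map_sub, map_smul, sub_eq_zero] at this
    exact this
  have e2 : 1 = l 0 * integ μ b := by
    have := integ_divergence (μ := μ) (v 0)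
    rw [(hvd 0).eq_divergence, map_sub, map_smul, hβ, sub_eq_zero] at this
    exact this
  -- By `e1` and `e2` the multiples of `b` in the equations for `f` and for `β` are proportional to
  -- their masses, so they cancel in this combination.
  refine ⟨fun t => w t - fieldSmul (integ μ (f t) • 1) (v 0),
    hw.sub (SmoothField.fieldSmul ((smoothFun_const 1).smul (contDiff_integ hf))
      (smoothField_const _)), fun t x hx => ?_, fun t => ?_⟩
  · change w t x - fieldSmul _ (v 0) x = 0
    rw [fieldSmul_apply, hw0 t x hx, hv0 0 x hx, smul_zero, sub_zero]
  · simp only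
    rw [fieldSmul_smul_one, divergence_sub, divergence_smul,
      (hwd t).eq_divergence, (hvd 0).eq_divergence]
    have e4 : integ μ (f t) • (l 0 • b) = k t • b := by
      rw [smul_smul, e1, mul_assoc, mul_comm (integ μ b), ← e2, mul_one]
    rw [smul_sub, e4]
    abel

/-- The divergence equation. -/
theorem exists_divergence_sub_eq [PreconnectedSpace M] {β : Fun n M} (hβ : integ μ β = 1)
    {f : ℝ → Fun n M} (hf : SmoothFun f) : ∃ w : ℝ → VField n M, SmoothField w ∧
      ∀ t, divergence μ (w t) = f t - integ μ (f t) • β := by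
  choose R hR using exists_isChartCube (n := n) (M := M)
  choose b hb0 hb using fun x : M => exists_unit_mass (n := n) μ (isOpen_chartCube x (R x)) (hR x).mem
  -- Having unit masses that differ by a divergence is an equivalence relation on base points with
  -- open classes, so connectedness leaves a single class.
  have hconn : ∀ x y, ∃ v, divergence μ v = b x - b y := by
    intro x y
    have hloc : ∀ z, ∀ᶠ y in 𝓝 z, ∃ v, divergence μ v = b y - b z := by
      intro z
      filter_upwards [(isOpen_chartCube z (R z)).mem_nhds (hR z).mem] with y hy
      -- A unit mass in the overlap of the two cubes is comparable with the unit mass of each.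
      obtain ⟨q, hq0, hq⟩ := exists_unit_mass (n := n) μ
        ((isOpen_chartCube z (R z)).inter (isOpen_chartCube y (R y))) ⟨hy, (hR y).mem⟩
      obtain ⟨v, -, -, hv⟩ := exists_divergence_eq_cube μ (hR z) (hb0 z) (hb z)
        (smoothFun_const q) fun _ x hx => hq0 x fun h => hx h.1
      obtain ⟨w, -, -, hw⟩ := exists_divergence_eq_cube μ (hR y) (hb0 y) (hb y)
        (smoothFun_const q) fun _ x hx => hq0 x fun h => hx h.2
      refine ⟨v 0 - w 0, ?_⟩
      rw [divergence_sub, hv, hw, hq]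
      simp only [one_smul]
      abel
    have hopen : IsClopen {z | ∃ v, divergence μ v = b z - b y} := by
      constructor
      · rw [← isOpen_compl_iff, isOpen_iff_mem_nhds]
        intro z hz
        filter_upwards [hloc z] with z' ⟨v, hv⟩ ⟨w, hw⟩
        refine hz ⟨w - v, ?_⟩
        rw [divergence_sub, hv, hw]
        abel
      · rw [isOpen_iff_mem_nhds]
        rintro z ⟨w, hw⟩
        filter_upwards [hloc z] with z' ⟨v, hv⟩
        refine ⟨w + v, ?_⟩
        rw [divergence_add, hv, hw]
        abel
    have h2 := hopen.eq_univ ⟨y, 0, by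
      rw [sub_self, divergence_zero]⟩
    exact (h2 ▸ mem_univ x : x ∈ {z | ∃ v, divergence μ v = b z - b y})
  obtain ⟨s, ψ, hψ, hψ1⟩ := exists_partition (n := n) (fun x : M => isOpen_chartCube x (R x))
    fun x => (hR x).mem
  have one : ∑ i, ψ i = 1 := by
    ext x
    rw [fun_sum_apply, hψ1]
    rfl
  have : Nonempty M := by
    by_contra h
    have := not_nonempty_iff.1 h
    have h0 : β = 0 := by
      ext x
      exact (h ⟨x⟩).elim
    rw [h0, map_zero] at hβ
    exact zero_ne_one hβ
  obtain ⟨p⟩ := this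
  have key : ∀ f : ℝ → Fun n M, SmoothFun f → ∃ w : ℝ → VField n M, SmoothField w ∧
      ∀ t, divergence μ (w t) = f t - integ μ (f t) • b p := by
    intro f hf
    have hψf : ∀ i : s, SmoothFun fun t => ψ i * f t := fun i => (smoothFun_const _).mul hf
    choose w hw _ hwd using fun i : s => exists_divergence_eq_cube μ (hR i) (hb0 i) (hb i) (hψf i)
      fun t x hx => by
        have : ψ i x = 0 := by
          by_contra h
          exact hx (hψ i (subset_tsupport _ h))
        change ψ i x * f t x = 0
        rw [this, zero_mul]
    choose v hv using fun i : s => hconn i p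
    -- Each piece ψ_i f is a divergence up to its mass placed at b_i, and the field v_i moves that
    -- mass to the common reference `b p`.
    refine ⟨fun t => ∑ i, (w i t + fieldSmul (integ μ (ψ i * f t) • 1) (v i)),
      SmoothField.sum fun i _ => (hw i).add (SmoothField.fieldSmul
        ((smoothFun_const 1).smul (contDiff_integ (hψf i))) (smoothField_const _)), fun t => ?_⟩
    have h1 : f t = ∑ i, ψ i * f t := by rw [← Finset.sum_mul, one, one_mul]
    have h2 : integ μ (f t) = ∑ i, integ μ (ψ i * f t) := by rw [← map_sum, ← h1]
    rw [divergence_sum, h2, Finset.sum_smul]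
    nth_rewrite 2 [h1]
    rw [← Finset.sum_sub_distrib]
    refine Finset.sum_congr rfl fun i _ => ?_
    rw [fieldSmul_smul_one, divergence_add, divergence_smul, hwd, hv, smul_sub]
    abel
  obtain ⟨w, hw, hwd⟩ := key f hf
  obtain ⟨u, -, hud⟩ := key (fun _ => β) (smoothFun_const β)
  refine ⟨fun t => w t - fieldSmul (integ μ (f t) • 1) (u 0), hw.sub (SmoothField.fieldSmul
    ((smoothFun_const 1).smul (contDiff_integ hf)) (smoothField_const _)), fun t => ?_⟩
  simp only
  rw [fieldSmul_smul_one, divergence_sub, divergence_smul, hwd, hud, hβ, one_smul, smul_sub]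
  abel

lemma integ_one : integ μ (1 : Fun n M) = 1 := by
  change ∫ _, (1:ℝ) ∂μ = 1
  simp

theorem exists_divergence_eq [PreconnectedSpace M] {f : ℝ → Fun n M} (hf : SmoothFun f)
    (h0 : ∀ t, integ μ (f t) = 0) :
    ∃ w : ℝ → VField n M, SmoothField w ∧ ∀ t, divergence μ (w t) = f t := by
  obtain ⟨w, hw, h⟩ := exists_divergence_sub_eq μ (integ_one μ) hf
  exact ⟨w, hw, fun t => by rw [h, h0, zero_smul, sub_zero]⟩

lemma exists_divergence_eq_const [PreconnectedSpace M] {f : Fun n M} (h0 : integ μ f = 0) :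
    ∃ w : VField n M, divergence μ w = f := by
  obtain ⟨w, -, hw⟩ := exists_divergence_eq μ (smoothFun_const f) fun _ => h0
  exact ⟨w 0, hw 0⟩

end DivergenceEquation

/-! ### Moser's theorem and the orbit map. -/

section Moser

variable {n : ℕ} {M : Type*} [TopologicalSpace M] [ChartedSpace (Model n) M]
  [IsManifold (𝓡 n) ∞ M] [T2Space M] [CompactSpace M] [MeasurableSpace M] [BorelSpace M]
  {μ : Measure M} [IsProbabilityMeasure μ] [IsSmoothVolume n μ]

lemma lie_zero (v : VField n M) : lie v (0 : Fun n M) = 0 := by rw [lie_eq_lieHom, map_zero]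

lemma lie_sub (v : VField n M) (f g : Fun n M) : lie v (f - g) = lie v f - lie v g := by
  simp only [lie_eq_lieHom, map_sub]

lemma lie_neg (v : VField n M) (f : Fun n M) : lie v (-f) = -lie v f := by
  simp only [lie_eq_lieHom, map_neg]

lemma lie_const (v : VField n M) (a : ℝ) : lie v (a • (1 : Fun n M)) = 0 := by
  have h := lie_mul v (1 : Fun n M) 1
  rw [one_mul, one_mul] at h
  rw [lie_smul, left_eq_add.1 h, smul_zero]

lemma lie_field_add (v w : VField n M) (f : Fun n M) : lie (v + w) f = lie v f + lie w f := by
  simp only [lie_eq_lieHom, map_add, LinearMap.add_apply]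

lemma lie_field_neg (v : VField n M) (f : Fun n M) : lie (-v) f = -lie v f := by
  simp only [lie_eq_lieHom, map_neg, LinearMap.neg_apply]

lemma integ_sub_mean (f : Fun n M) : integ μ (f - integ μ f • 1) = 0 := by
  rw [map_sub, map_smul, integ_one, smul_eq_mul, mul_one, sub_self]

variable (μ) in
/-- On a connected manifold a function with zero differential is constant. -/
lemma eq_const_of_lie_eq_zero [PreconnectedSpace M] {θ : Fun n M} (h : ∀ v, lie v θ = 0) :
    θ = integ μ θ • 1 := by
  rw [← sub_eq_zero]
  refine eq_zero_of_integral μ fun g => ?_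
  -- Up to its mean the test function is a divergence. Integration by parts moves the derivative
  -- onto θ, where it vanishes.
  obtain ⟨w, hw⟩ := exists_divergence_eq_const μ (integ_sub_mean (μ := μ) g)
  have h1 := integ_lie (μ := μ) w (θ - integ μ θ • 1)
  rw [lie_sub, h, lie_const, sub_zero, map_zero, hw, mul_sub, map_sub, mul_smul_comm, mul_one,
    map_smul, integ_sub_mean, smul_zero, sub_zero, zero_eq_neg] at h1
  rw [mul_comm]
  exact h1

/-- The pushforward of densities is dual to the pushforward of functions, and duality characterizes
it. -/
lemma eq_densityPush {φ : Dif n M} {r R : Fun n M}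
    (h : ∀ f, integ μ (R * funPush φ f) = integ μ (r * f)) : R = densityPush μ φ r := by
  refine eq_of_integral μ fun f => ?_
  rw [← funPush_push_inv φ f, mul_comm, h, mul_comm _ (densityPush μ φ r), integ_densityPush_mul]

lemma densityPush_mul (φ χ : Dif n M) (r : Fun n M) :
    densityPush μ (φ * χ) r = densityPush μ φ (densityPush μ χ r) :=
  (eq_densityPush fun f => by
    rw [← funPush_funPush, integ_densityPush_mul, integ_densityPush_mul]).symm

lemma densityPush_id (r : Fun n M) : densityPush μ 1 r = r :=
  (eq_densityPush fun _ => rfl).symm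

/-- A curve of densities satisfies the continuity equation for some curve of vector fields. -/
lemma exists_continuity [PreconnectedSpace M] {ρ : ℝ → Fun n M} (hρ : SmoothFun ρ)
    (hd : ∀ t, ρ t ∈ densities μ) : ∃ v : ℝ → VField n M, SmoothField v ∧
      ∀ t, divergence μ (fieldSmul (ρ t) (v t)) = -dot ρ hρ t := by
  have h1 : ∀ t, integ μ (-dot ρ hρ t) = 0 := fun t => by
    have h2 := hasDerivAt_integral μ hρ t
    have h3 : (fun s => integ μ (ρ s)) = fun _ => 1 := funext fun s => (hd s).2
    rw [h3] at h2
    rw [map_neg, h2.unique (hasDerivAt_const t 1), neg_zero]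
  obtain ⟨w, hw, hwd⟩ := exists_divergence_eq μ hρ.dot.neg h1
  -- With div w = -ρ̇, solvable because the total mass is constant, the velocity is w / ρ.
  refine ⟨fun t => fieldSmul (recip (ρ t) (hd t).1) (w t),
    SmoothField.fieldSmul (hρ.recip fun t => (hd t).1) hw, fun t => ?_⟩
  rw [← hwd]
  congr 1
  ext x : 1
  rw [fieldSmul_apply, fieldSmul_apply, smul_smul]
  change (ρ t x * (ρ t x)⁻¹) • w t x = _
  rw [mul_inv_cancel₀ ((hd t).1 x).ne', one_smul]

/-- Solutions of the continuity equation are transported by the flow. -/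
lemma FlowsBy.densityPush_eq {φ : ℝ → Dif n M} {v : ℝ → VField n M} (h : FlowsBy φ v)
    (hφ : SmoothDif φ) (h0 : φ 0 = 1) {ρ : ℝ → Fun n M} (hρ : SmoothFun ρ)
    (hc : ∀ t, divergence μ (fieldSmul (ρ t) (v t)) = -dot ρ hρ t) (t : ℝ) :
    ρ t = densityPush μ (φ t) (ρ 0) := by
  refine eq_densityPush fun f => ?_
  have hf : SmoothFun fun t => funPush (φ t) f := (smoothFun_const f).funPush hφ.inv
  -- A test function carried by the flow has constant integral against ρ_s: the continuity equation
  -- and the transport equation contribute opposite terms.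
  have hd : ∀ s, HasDerivAt (fun s => integ μ (ρ s * funPush (φ s) f)) 0 s := by
    intro s
    refine (hasDerivAt_integral μ (hρ.mul hf) s).congr_deriv ?_
    have h1 : dot _ (hρ.mul hf) s = dot ρ hρ s * funPush (φ s) f
        - ρ s * lie (v s) (funPush (φ s) f) := by
      refine SmoothFun.dot_eq _ fun x => ?_
      refine ((hρ.hasDerivAt s x).mul (hf.hasDerivAt s x)).congr_deriv ?_
      have h2 := h.dot_funPush (smoothFun_const f) hf s
      have h3 : dot (fun _ : ℝ => f) (smoothFun_const f) s = 0 :=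
        SmoothFun.dot_eq _ fun x => hasDerivAt_const _ _
      rw [h3, map_zero, zero_sub] at h2
      rw [h2]
      change _ + ρ s x * -(lie (v s) (funPush (φ s) f) x) = _ - _ * _
      rw [mul_neg, ← sub_eq_add_neg]
      rfl
    have h4 := integ_lie (μ := μ) (fieldSmul (ρ s) (v s)) (funPush (φ s) f)
    rw [lie_fieldSmul, hc, mul_neg, map_neg, neg_neg, mul_comm (funPush (φ s) f)] at h4
    rw [h1, map_sub, h4, sub_self]
  have h3 := is_const_of_deriv_eq_zero (fun s => (hd s).differentiableAt)
    (fun s => (hd s).deriv) t 0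
  simp only [h0, funPush_id] at h3
  exact h3

lemma one_mem_densities : (1 : Fun n M) ∈ densities μ :=
  ⟨fun _ => one_pos, integ_one μ⟩

/-- The path from `f` to `g` which is at rest outside `[0, 1]`. -/
def restPath (f g : Fun n M) (t : ℝ) : Fun n M :=
  (1 - Real.smoothTransition t) • f + Real.smoothTransition t • g

lemma restPath_zero (f g : Fun n M) : restPath f g 0 = f := by simp [restPath]

lemma restPath_one (f g : Fun n M) : restPath f g 1 = g := by simp [restPath]

lemma smoothFun_restPath (f g : Fun n M) : SmoothFun (restPath f g) :=
  ((smoothFun_const f).smul (contDiff_const.sub Real.smoothTransition.contDiff)).add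
    ((smoothFun_const g).smul Real.smoothTransition.contDiff)

/-- `Real.smoothTransition` takes values in [0, 1], so the path is a convex combination at every
real time; a straight line could leave the positive functions. -/
lemma restPath_mem {f g : Fun n M} (hf : f ∈ densities μ) (hg : g ∈ densities μ) (t : ℝ) :
    restPath f g t ∈ densities μ := by
  have h0 := Real.smoothTransition.nonneg t
  have h1 := Real.smoothTransition.le_one t
  refine ⟨fun x => ?_, ?_⟩
  · change 0 < (1 - Real.smoothTransition t) * f x + Real.smoothTransition t * g x
    rcases h0.eq_or_lt with h | h
    · rw [← h]
      simpa using hf.1 x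
    · exact add_pos_of_nonneg_of_pos (mul_nonneg (sub_nonneg.2 h1) (hf.1 x).le)
        (mul_pos h (hg.1 x))
  · change integ μ (restPath f g t) = 1
    have hf' : integ μ f = 1 := hf.2
    have hg' : integ μ g = 1 := hg.2
    rw [restPath, map_add, map_smul, map_smul, hf', hg']
    simp

variable [PreconnectedSpace M]

/-- Moser's theorem. -/
theorem exists_densityPush_eq {ρ σ : Fun n M} (hρ : ρ ∈ densities μ) (hσ : σ ∈ densities μ) :
    ∃ φ : Dif n M, densityPush μ φ ρ = σ := by
  obtain ⟨v, hv, hvd⟩ := exists_continuity (smoothFun_restPath ρ σ) (restPath_mem hρ hσ)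
  obtain ⟨φ, hφ, h0, hφv⟩ := exists_flowsBy hv
  refine ⟨φ 1, ?_⟩
  have := hφv.densityPush_eq hφ h0 (smoothFun_restPath ρ σ) hvd 1
  rw [restPath_zero, restPath_one] at this
  exact this.symm

/-- The flow carries ρ_0 along the curve, and a fixed diffeomorphism from Moser's theorem brings 1
to ρ_0. -/
theorem exists_lift_densities {ρ : ℝ → Fun n M} (hρ : SmoothFun ρ) (hd : ∀ t, ρ t ∈ densities μ) :
    ∃ φ : ℝ → Dif n M, SmoothDif φ ∧ ∀ t, densityPush μ (φ t) 1 = ρ t := by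
  obtain ⟨v, hv, hvd⟩ := exists_continuity hρ hd
  obtain ⟨φ, hφ, h0, hφv⟩ := exists_flowsBy hv
  obtain ⟨χ, hχ⟩ := exists_densityPush_eq one_mem_densities (hd 0)
  refine ⟨fun t => φ t * χ, hφ.mul (smoothDif_const χ), fun t => ?_⟩
  rw [densityPush_mul, hχ]
  exact (hφv.densityPush_eq hφ h0 hρ hvd t).symm

variable (μ) in
lemma orbitMap_mk (φ : Dif n M) : orbitMap μ (QuotientGroup.mk φ) = densityPush μ φ 1 := rfl

variable (μ) in
lemma orbitMap_mk_eq_jac (φ : Dif n M) : orbitMap μ (QuotientGroup.mk φ) = jac μ φ := by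
  rw [orbitMap_mk, densityPush, funPush_one, one_mul]

variable (μ) in
-- Equal Jacobians mean equal image measures, so the two diffeomorphisms differ by a
-- volume-preserving one on the right.
theorem orbitMap_injective : Function.Injective (orbitMap (n := n) μ) := by
  intro a b
  induction a using QuotientGroup.induction_on with | H φ => ?_
  induction b using QuotientGroup.induction_on with | H χ => ?_
  intro h
  rw [orbitMap_mk_eq_jac, orbitMap_mk_eq_jac] at h
  refine QuotientGroup.eq.2 ?_
  have h1 : μ.map φ = μ.map χ := by
    rw [map_eq_withDensity_jac, map_eq_withDensity_jac, h]
  change μ.map (φ.symm ∘ χ) = μ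
  rw [← Measure.map_map φ.symm.continuous.measurable χ.continuous.measurable, ← h1,
    Measure.map_map φ.symm.continuous.measurable φ.continuous.measurable,
    funext φ.symm_apply_apply (f := φ.symm ∘ φ) (g := id)]
  exact Measure.map_id

variable (μ) in
theorem range_orbitMap : range (orbitMap (n := n) μ) = densities μ := by
  ext ρ
  constructor
  · rintro ⟨a, rfl⟩
    induction a using QuotientGroup.induction_on with | H φ => ?_
    exact densityPush_mem μ one_mem_densities
  · intro h
    obtain ⟨φ, hφ⟩ := exists_densityPush_eq one_mem_densities h
    exact ⟨QuotientGroup.mk φ, hφ⟩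

variable (μ) in
theorem orbitMap_smul (φ : Dif n M) (x : Dif n M ⧸ volumePreserving (n := n) μ) :
    orbitMap μ (φ • x) = densityPush μ φ (orbitMap μ x) := by
  induction x using QuotientGroup.induction_on with | H χ => ?_
  exact densityPush_mul φ χ 1

variable (μ) in
theorem smoothFun_orbitMap {φ : ℝ → Dif n M} (hφ : SmoothDif φ) :
    SmoothFun fun t => orbitMap μ (QuotientGroup.mk (φ t)) :=
  (smoothFun_const 1).densityPush hφ

variable (μ) in
theorem semidirectMap_injective : Function.Injective (semidirectMap (n := n) μ) := by
  rintro ⟨a, m⟩ ⟨b, m'⟩ h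
  obtain ⟨h1, h2⟩ := Prod.ext_iff.1 h
  exact Prod.ext (orbitMap_injective μ h2) h1

variable (μ) in
theorem range_semidirectMap : range (semidirectMap (n := n) μ) = {x | x.2 ∈ densities μ} := by
  ext ⟨m, ρ⟩
  constructor
  · rintro ⟨⟨a, m'⟩, h⟩
    obtain ⟨-, h2⟩ := Prod.ext_iff.1 h
    change ρ ∈ densities μ
    rw [← range_orbitMap]
    exact ⟨a, h2⟩
  · intro h
    change ρ ∈ densities μ at h
    rw [← range_orbitMap] at h
    obtain ⟨a, rfl⟩ := h
    exact ⟨(a, m), rfl⟩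

end Moser

/-! ### The adjoint action and curves in the semidirect product. -/

section Adjoint

variable {n : ℕ} {M : Type*} [TopologicalSpace M] [ChartedSpace (Model n) M]
  [IsManifold (𝓡 n) ∞ M]

/-- Naturality of the derivative: the chain rule for f = (f ∘ φ) ∘ φ⁻¹. It turns identities about
pushed fields into identities about functions. -/
lemma lie_push (φ : Dif n M) (v : VField n M) (f : Fun n M) :
    lie (push φ v) f = funPush φ (lie v (funPush φ⁻¹ f)) := by
  ext y
  have hφ : MDifferentiableAt (𝓡 n) (𝓡 n) φ.symm y :=
    (φ.symm.contMDiff y).mdifferentiableAt (by simp)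
  have hf : MDifferentiableAt (𝓡 n) 𝓘(ℝ, ℝ) (funPush φ⁻¹ f) (φ.symm y) :=
    ((funPush φ⁻¹ f).contMDiff _).mdifferentiableAt (by simp)
  have h1 : (funPush φ⁻¹ f : M → ℝ) ∘ φ.symm = f := by
    ext z
    exact congrArg f (φ.apply_symm_apply z)
  have h2 := mfderiv_comp y hf hφ
  rw [h1] at h2
  let A := φ.symm.mfderivToContinuousLinearEquiv (by simp) y
  have hA : (A : TangentSpace (𝓡 n) y →L[ℝ] TangentSpace (𝓡 n) (φ.symm y))
      = mfderiv (𝓡 n) (𝓡 n) φ.symm y := rfl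
  have h3 : push φ v y = A.symm (v (φ.symm y)) := by
    change (mfderiv (𝓡 n) (𝓡 n) φ.symm y).inverse (v (φ.symm y)) = _
    rw [← hA, ContinuousLinearMap.inverse_equiv]
    rfl
  have h4 : A (push φ v y) = v (φ.symm y) := by
    rw [h3, A.apply_symm_apply]
  have h5 : (lie (push φ v) f y : ℝ)
      = (mfderiv (𝓡 n) 𝓘(ℝ, ℝ) (funPush φ⁻¹ f) (φ.symm y)) (A (push φ v y)) :=
    congrArg (fun L : Model n →L[ℝ] ℝ => L (push φ v y)) h2
  rw [h5, h4]
  rfl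

lemma lie_push_funPush (φ : Dif n M) (v : VField n M) (f : Fun n M) :
    lie (push φ v) (funPush φ f) = funPush φ (lie v f) := by
  rw [lie_push, funPush_inv_push]

lemma contract_add_field (m : Form n M) (v w : VField n M) :
    contract m (v + w) = contract m v + contract m w := by
  simp only [contract_eq_contractHom, map_add]

lemma contract_neg_field (m : Form n M) (v : VField n M) : contract m (-v) = -contract m v := by
  simp only [contract_eq_contractHom, map_neg]

lemma contract_add (m m' : Form n M) (v : VField n M) :
    contract (m + m') v = contract m v + contract m' v := by
  simp only [contract_eq_contractHom, map_add, LinearMap.add_apply]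

lemma contract_neg (m : Form n M) (v : VField n M) : contract (-m) v = -contract m v := by
  simp only [contract_eq_contractHom, map_neg, LinearMap.neg_apply]

lemma contract_sub (m m' : Form n M) (v : VField n M) :
    contract (m - m') v = contract m v - contract m' v := by
  simp only [contract_eq_contractHom, map_sub, LinearMap.sub_apply]

lemma contract_smul (a : ℝ) (m : Form n M) (v : VField n M) :
    contract (a • m) v = a • contract m v := by
  simp only [contract_eq_contractHom, map_smul, LinearMap.smul_apply]

/-- The velocity at time `t` of a curve of vector fields. -/
def FieldVelocityAt (v : ℝ → VField n M) (t : ℝ) (v' : VField n M) : Prop :=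
  ∀ f x, HasDerivAt (fun s => lie (v s) f x) (lie v' f x) t

/-- The velocity at time `t` of a curve of one-forms. -/
def FormVelocityAt (m : ℝ → Form n M) (t : ℝ) (m' : Form n M) : Prop :=
  ∀ w x, HasDerivAt (fun s => contract (m s) w x) (contract m' w x) t

variable [T2Space M] [CompactSpace M]

lemma push_push_inv (φ : Dif n M) (v : VField n M) : push φ (push φ⁻¹ v) = v :=
  field_ext fun f => by
    rw [lie_push, lie_push, inv_inv, funPush_push_inv, funPush_push_inv]

lemma SmoothForm.exists_velocity {m : ℝ → Form n M} (hm : SmoothForm m) (t : ℝ) :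
    ∃ m', FormVelocityAt m t m' := by
  have h := fun k => hm.smoothFun ((theFrame n M).X k)
  refine ⟨∑ k, Madelung.scale (Madelung.dot _ (h k) t) (Madelung.differential ((theFrame n M).b k)), fun w x => ?_⟩
  have h1 : Madelung.contract (∑ k, Madelung.scale (Madelung.dot _ (h k) t) (Madelung.differential ((theFrame n M).b k))) w x
      = ∑ k, Madelung.lie w ((theFrame n M).b k) x * Madelung.dot _ (h k) t x := by
    simp only [contract_eq_contractHom, map_sum, LinearMap.sum_apply]
    rw [fun_sum_apply]
    refine Finset.sum_congr rfl fun k _ => ?_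
    rw [← contract_eq_contractHom, contract_scale, contract_differential, mul_comm]
    rfl
  have h2 : (fun s => Madelung.contract (m s) w x) = fun s => ∑ k, Madelung.lie w ((theFrame n M).b k) x
      * Madelung.contract (m s) ((theFrame n M).X k) x := by
    ext s
    rw [contract_frame, fun_sum_apply]
    rfl
  rw [h1, h2]
  exact HasDerivAt.fun_sum fun k _ => ((h k).hasDerivAt t x).const_mul _

/-- The frame writes the contraction as a finite sum of products of real functions, to which the
product rule applies. -/
lemma hasDerivAt_contract {m : ℝ → Form n M} {m' : Form n M} {v : ℝ → VField n M} {v' : VField n M}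
    {t : ℝ} (hm : FormVelocityAt m t m') (hv : FieldVelocityAt v t v') (x : M) :
    HasDerivAt (fun s => contract (m s) (v s) x)
      ((contract m' (v t) + contract (m t) v') x) t := by
  have h2 : (fun s => contract (m s) (v s) x) = fun s => ∑ k, lie (v s) ((theFrame n M).b k) x
      * contract (m s) ((theFrame n M).X k) x := by
    ext s
    rw [contract_frame, fun_sum_apply]
    rfl
  rw [h2, contract_frame m', contract_frame (m t), ← Finset.sum_add_distrib, fun_sum_apply]
  refine HasDerivAt.fun_sum fun k _ => ?_
  refine ((hv ((theFrame n M).b k) x).mul (hm ((theFrame n M).X k) x)).congr_deriv ?_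
  rw [add_comm]
  rfl

section

variable [MeasurableSpace M] [BorelSpace M] (μ : Measure M) [IsProbabilityMeasure μ]
  [IsSmoothVolume n μ]

lemma pairing_eq (x : SDual n M) (ξ : SAlg n M) :
    pairing μ x ξ = integ μ (contract x.1 ξ.1 + x.2 * ξ.2) := rfl

lemma pairing_neg_right (x : SDual n M) (ξ : SAlg n M) :
    pairing μ x (-ξ) = -pairing μ x ξ := by
  simp only [pairing_eq, Prod.fst_neg, Prod.snd_neg, contract_neg_field, mul_neg, ← neg_add,
    map_neg]

lemma algBracket_comm (ξ η : SAlg n M) : algBracket ξ η = -algBracket η ξ := by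
  have h : bracket ξ.1 η.1 = -bracket η.1 ξ.1 := field_ext fun f => by
    rw [lie_field_neg, bracket_lie, bracket_lie, neg_sub]
  refine Prod.ext ?_ ?_
  · simp [algBracket, h]
  · simp [algBracket]

lemma hasDerivAt_pairing {c : ℝ → SDual n M} {ξ : ℝ → SAlg n M} {t : ℝ} {m' : Form n M}
    {r' : Fun n M} {v' : VField n M} {a' : Fun n M} (hc : dualCurves.smooth c) (hξ : SmoothAlg ξ)
    (hm : FormVelocityAt (fun s => (c s).1) t m')
    (hr : ∀ x, HasDerivAt (fun s => (c s).2 x) (r' x) t)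
    (hv : FieldVelocityAt (fun s => (ξ s).1) t v')
    (ha : ∀ x, HasDerivAt (fun s => (ξ s).2 x) (a' x) t) :
    HasDerivAt (fun s => pairing μ (c s) (ξ s))
      (pairing μ (m', r') (ξ t) + pairing μ (c t) (v', a')) t := by
  have hs : SmoothFun fun s => contract (c s).1 (ξ s).1 + (c s).2 * (ξ s).2 :=
    (hc.1.contract hξ.1).add (hc.2.mul hξ.2)
  refine (hasDerivAt_integral μ hs t).congr_deriv ?_
  have h1 : dot _ hs t = (contract m' (ξ t).1 + contract (c t).1 v')
      + (r' * (ξ t).2 + (c t).2 * a') := by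
    refine hs.dot_eq fun x => ?_
    exact (hasDerivAt_contract hm hv x).add ((hr x).mul (ha x))
  rw [h1, pairing_eq, pairing_eq, ← map_add]
  congr 1
  abel

/-- Multiplying a field by an arbitrary function localizes the pairing, so the form is recovered
from its contractions. -/
lemma pairing_nondegenerate {x y : SDual n M} (h : ∀ ξ, pairing μ x ξ = pairing μ y ξ) :
    x = y := by
  refine Prod.ext (form_ext fun v => eq_of_integral μ fun f => ?_) (eq_of_integral μ fun f => ?_)
  · have := h (fieldSmul f v, 0)
    simpa only [pairing_eq, contract_fieldSmul, mul_zero, add_zero] using this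
  · have := h (0, f)
    simp only [pairing_eq, contract_eq_contractHom, map_zero, zero_add] at this
    rw [mul_comm f, mul_comm f, this]

/-- Surjectivity of Ad_g makes the coadjoint image unique: the defining relation then tests against
every element of 𝔰. -/
lemma exists_adjoint_eq (g : SGroup n M) (ζ : SAlg n M) : ∃ ξ, adjoint g ξ = ζ := by
  refine ⟨(push g.right⁻¹ ζ.1, funPush g.right⁻¹ (ζ.2 - lie ζ.1 (phase g))), ?_⟩
  refine Prod.ext (push_push_inv _ _) ?_
  change funPush g.right (funPush g.right⁻¹ _) + lie (push g.right (push g.right⁻¹ ζ.1)) _ = _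
  rw [funPush_push_inv, push_push_inv, sub_add_cancel]

lemma isCoadjoint_unique {g : SGroup n M} {x y z : SDual n M} (h : IsCoadjoint μ g x y)
    (h' : IsCoadjoint μ g x z) : y = z := by
  refine pairing_nondegenerate μ fun ζ => ?_
  obtain ⟨ξ, rfl⟩ := exists_adjoint_eq g ζ
  rw [h, h']

include μ in
-- Time and space derivatives commute. In the weak form the field is integrated by parts onto the
-- test function, and only differentiation under the integral remains.
lemma SmoothFun.dot_lie {f : ℝ → Fun n M} (hf : SmoothFun f) (w : VField n M)
    (hw : SmoothFun fun t => Madelung.lie w (f t)) (t : ℝ) :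
    Madelung.dot _ hw t = Madelung.lie w (Madelung.dot f hf t) := by
  refine eq_of_integral μ fun g => ?_
  have key : ∀ h : Fun n M, integ μ (g * Madelung.lie w h)
      = -integ μ (h * divergence μ (Madelung.fieldSmul g w)) := fun h => by
    rw [← integ_lie, lie_fieldSmul]
  have e1 := hasDerivAt_integral μ ((smoothFun_const g).mul hw) t
  have e2 := (hasDerivAt_integral μ
    (hf.mul (smoothFun_const (divergence μ (Madelung.fieldSmul g w)))) t).neg
  have d1 : Madelung.dot _ ((smoothFun_const g).mul hw) t = g * Madelung.dot _ hw t :=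
    SmoothFun.dot_eq _ fun x => (hw.hasDerivAt t x).const_mul (g x)
  have d2 : Madelung.dot _ (hf.mul (smoothFun_const (divergence μ (Madelung.fieldSmul g w)))) t
      = Madelung.dot f hf t * divergence μ (Madelung.fieldSmul g w) :=
    SmoothFun.dot_eq _ fun x => (hf.hasDerivAt t x).mul_const _
  rw [d1] at e1
  rw [d2, ← key] at e2
  simp only [key] at e1
  exact e1.unique e2

lemma SmoothField.push {v : ℝ → VField n M} (hv : SmoothField v) {φ : ℝ → Dif n M}
    (hφ : SmoothDif φ) : SmoothField fun t => Madelung.push (φ t) (v t) := by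
  refine smoothField_of_lie fun f => ?_
  simp only [lie_push]
  exact SmoothFun.funPush (SmoothFun.lie ((smoothFun_const f).funPull hφ) hv) hφ.inv

include μ in
-- On functions the pushed field is φ_* ∘ w ∘ φ^*. Differentiating the outer factor gives -u(φ_* w)
-- and the inner one (φ_* w)u, hence minus the commutator.
lemma FlowsBy.push_velocityAt {φ : ℝ → Dif n M} {u : ℝ → VField n M} (h : FlowsBy φ u)
    (hφ : SmoothDif φ) (w : VField n M) (t : ℝ) :
    FieldVelocityAt (fun s => push (φ s) w) t (-bracket (u t) (push (φ t) w)) := by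
  intro f x
  have hf := (smoothFun_const f).funPull hφ
  have hl : SmoothFun fun t => lie w (funPush (φ t)⁻¹ f) := hf.lie (smoothField_const w)
  have hp := hl.funPush hφ.inv
  have h0 : dot (fun _ : ℝ => f) (smoothFun_const f) t = 0 :=
    SmoothFun.dot_eq _ fun x => hasDerivAt_const _ _
  have h1 := hp.hasDerivAt t x
  rw [h.dot_funPush hl hp, hf.dot_lie μ w hl, h.dot_funPull (smoothFun_const f) hf, h0, zero_add,
    ← lie_push, ← lie_push, ← neg_sub, ← bracket_lie, ← lie_field_neg] at h1
  simp only [← lie_push] at h1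
  exact h1

/-- The curve `g` in `S` has the (right trivialized) velocities `ξ t`. -/
structure GroupFlow (g : ℝ → SGroup n M) (ξ : ℝ → SAlg n M) : Prop where
  smoothDif : SmoothDif fun t => (g t).right
  smoothFun : SmoothFun fun t => phase (g t)
  flowsBy : FlowsBy (fun t => (g t).right) fun t => (ξ t).1
  dot_phase : ∀ t, dot _ smoothFun t = (ξ t).2 - lie (ξ t).1 (phase (g t))

lemma GroupFlow.smooth_adjoint {g : ℝ → SGroup n M} {ξ : ℝ → SAlg n M} (h : GroupFlow g ξ)
    (η : SAlg n M) : SmoothAlg fun t => adjoint (g t) η :=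
  ⟨(smoothField_const η.1).push h.smoothDif, ((smoothFun_const η.2).funPush h.smoothDif.inv).add
    (h.smoothFun.lie ((smoothField_const η.1).push h.smoothDif))⟩

include μ in
-- The function component of d/dt Ad_{g_t} η = [ξ_t, Ad_{g_t} η]. The field component is
-- `FlowsBy.push_velocityAt`.
lemma GroupFlow.hasDerivAt_adjoint {g : ℝ → SGroup n M} {ξ : ℝ → SAlg n M} (h : GroupFlow g ξ)
    (η : SAlg n M) (t : ℝ) (x : M) : HasDerivAt (fun s => (adjoint (g s) η).2 x)
      ((algBracket (ξ t) (adjoint (g t) η)).2 x) t := by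
  have hp := (smoothFun_const η.2).funPush h.smoothDif.inv
  have h0 : dot (fun _ : ℝ => η.2) (smoothFun_const η.2) t = 0 :=
    SmoothFun.dot_eq _ fun x => hasDerivAt_const _ _
  have h1 := hp.hasDerivAt t x
  rw [h.flowsBy.dot_funPush (smoothFun_const η.2) hp, h0, map_zero, zero_sub] at h1
  have hd : FormVelocityAt (fun s => differential (phase (g s))) t
      (differential (dot _ h.smoothFun t)) := fun w y => by
    have hw : SmoothFun fun s => lie w (phase (g s)) := h.smoothFun.lie (smoothField_const w)
    have := hw.hasDerivAt t y
    rw [h.smoothFun.dot_lie μ w hw] at this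
    exact this
  have h2 := hasDerivAt_contract hd (h.flowsBy.push_velocityAt μ h.smoothDif η.1 t) x
  refine (h1.add h2).congr_deriv ?_
  rw [h.dot_phase]
  have key : (algBracket (ξ t) (adjoint (g t) η)).2
      = -lie (ξ t).1 (funPush (g t).right η.2)
        + (lie (push (g t).right η.1) ((ξ t).2 - lie (ξ t).1 (phase (g t)))
          + lie (-bracket (ξ t).1 (push (g t).right η.1)) (phase (g t))) := by
    rw [lie_field_neg, bracket_lie, lie_sub]
    simp only [algBracket, adjoint, lie_add]
    abel
  rw [key]
  rfl

lemma GroupFlow.hasDerivAt_pairing {g : ℝ → SGroup n M} {ξ : ℝ → SAlg n M} (h : GroupFlow g ξ)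
    {c : ℝ → SDual n M} {t : ℝ} {y : SDual n M} (hc : dualCurves.smooth c)
    (hm : FormVelocityAt (fun s => (c s).1) t y.1)
    (hr : ∀ x, HasDerivAt (fun s => (c s).2 x) (y.2 x) t) (η : SAlg n M) :
    HasDerivAt (fun s => pairing μ (c s) (adjoint (g s) η))
      (pairing μ y (adjoint (g t) η)
        + pairing μ (c t) (algBracket (ξ t) (adjoint (g t) η))) t :=
  Madelung.hasDerivAt_pairing μ hc (h.smooth_adjoint η) hm hr
    (h.flowsBy.push_velocityAt μ h.smoothDif η.1 t) (h.hasDerivAt_adjoint μ η t)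

lemma velocityDif_unique {φ : ℝ → Dif n M} {v w : VField n M} (h : VelocityDif φ v)
    (h' : VelocityDif φ w) : v = w := by
  refine field_ext fun f => ?_
  ext y
  obtain ⟨x, rfl⟩ := (φ 0).surjective y
  exact (HasVelocityAt.comp (hasVelocityAt_iff.2 (h x)) f).unique
    (HasVelocityAt.comp (hasVelocityAt_iff.2 (h' x)) f)

/-- A curve in `S` prescribes its velocity only at time 0; the right-trivialized velocities at all
times are reconstructed from the curve itself. -/
lemma GroupCurve.exists_groupFlow {g : ℝ → SGroup n M} {ξ : SAlg n M} (h : GroupCurve g ξ) :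
    ∃ ζ : ℝ → SAlg n M, SmoothAlg ζ ∧ ζ 0 = ξ ∧ GroupFlow g ζ := by
  obtain ⟨⟨h1, h2⟩, h3, h4, h5⟩ := h
  obtain ⟨v, hv, hφv⟩ := h1.exists_velocity
  refine ⟨fun t => (v t, dot _ h2 t + lie (v t) (phase (g t))), ⟨hv, h2.dot.add (h2.lie hv)⟩,
    Prod.ext (velocityDif_unique hφv.velocityDif h4) ?_, h1, h2, hφv, fun t => ?_⟩
  · change dot _ h2 0 + lie (v 0) (phase (g 0)) = ξ.2
    rw [h3, h2.dot_eq h5]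
    change _ + lie (v 0) (0 : Fun n M) = _
    rw [lie_zero, add_zero]
  · simp only [add_sub_cancel_right]

/-- The element `(φ, a)` of `S`. -/
def mkS (φ : Dif n M) (a : Fun n M) : SGroup n M := ⟨.ofAdd a, φ⟩

/-- Pulled back by the flow, the advection equation for the phase loses its transport term and is
solved by a primitive in time. -/
lemma exists_groupFlow {ξ : ℝ → SAlg n M} (hξ : SmoothAlg ξ) :
    ∃ g : ℝ → SGroup n M, GroupFlow g ξ ∧ g 0 = 1 := by
  obtain ⟨φ, hφ, h0, hφv⟩ := exists_flowsBy hξ.1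
  obtain ⟨I, hI, hI0, hId⟩ := (hξ.2.funPull hφ).exists_primitive
  have ha := hI.funPush hφ.inv
  refine ⟨fun t => mkS (φ t) (funPush (φ t) (I t)), ⟨hφ, ha, hφv, fun t => ?_⟩, ?_⟩
  · refine (hφv.dot_funPush hI ha t).trans ?_
    rw [hId, funPush_push_inv]
    rfl
  · change mkS (φ 0) (funPush (φ 0) (I 0)) = 1
    rw [h0, hI0]
    rfl

lemma GroupFlow.groupCurve {g : ℝ → SGroup n M} {ξ : ℝ → SAlg n M} (h : GroupFlow g ξ)
    (h1 : g 0 = 1) : GroupCurve g (ξ 0) := by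
  refine ⟨⟨h.smoothDif, h.smoothFun⟩, h1, h.flowsBy.velocityDif, ?_⟩
  have h2 := h.smoothFun.velocity
  rw [h.dot_phase, h1] at h2
  change VelocityFun _ (_ - lie _ (0 : Fun n M)) at h2
  rwa [lie_zero, sub_zero] at h2

theorem exists_groupCurve (ξ : SAlg n M) : ∃ g : ℝ → SGroup n M, GroupCurve g ξ := by
  obtain ⟨g, hg, h1⟩ := exists_groupFlow (ξ := fun _ => ξ)
    ⟨smoothField_const ξ.1, smoothFun_const ξ.2⟩
  exact ⟨g, hg.groupCurve h1⟩

end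

end Adjoint

/-! ### A criterion for Poisson maps. -/

section PoissonMaps

variable {n : ℕ} {M : Type*} [TopologicalSpace M] [ChartedSpace (Model n) M]
  [IsManifold (𝓡 n) ∞ M] [T2Space M] [CompactSpace M] [MeasurableSpace M] [BorelSpace M]
  (μ : Measure M) [IsProbabilityMeasure μ] [IsSmoothVolume n μ]

lemma fieldVelocityAt_const (v : VField n M) (t : ℝ) : FieldVelocityAt (fun _ : ℝ => v) t 0 :=
  fun f x => by
    rw [lie_eq_lieHom, map_zero]
    exact hasDerivAt_const _ _

lemma hasDerivAt_pairing_const {c : ℝ → SDual n M} {y : SDual n M} (hc : dualCurves.smooth c)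
    (hy : dualCurves.velocity c y) (ξ : SAlg n M) :
    HasDerivAt (fun s => pairing μ (c s) ξ) (pairing μ y ξ) 0 := by
  refine (hasDerivAt_pairing μ hc (ξ := fun _ => ξ) ⟨smoothField_const _, smoothFun_const _⟩
    (velocityForm_iff.1 hy.1) hy.2 (fieldVelocityAt_const _ _) (a' := 0)
    (fun x => hasDerivAt_const _ _)).congr_deriv ?_
  have h : pairing μ (c 0) (0, 0) = 0 := by
    simp only [pairing_eq, contract_eq_contractHom, map_zero, mul_zero, add_zero]
  rw [h, add_zero]

/-- A criterion for Poisson maps in terms of the Hamiltonian vectors of linear functions. -/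
theorem isPoissonMap_of_hamiltonian {X T : Type*} {C : Curves X T} {Ω : X → T → T → ℝ}
    {J : X → SDual n M} (hJ : ∀ c, C.smooth c → dualCurves.smooth fun t => J (c t))
    (hv : ∀ c, C.smooth c → ∀ Y, C.velocity c Y → ∃ y, dualCurves.velocity (fun t => J (c t)) y)
    (hΩ : ∀ x Y Z, Ω x Y Z = -Ω x Z Y)
    (hreal : ∀ x Y, ∃ c, C.smooth c ∧ c 0 = x ∧ C.velocity c Y) (V : X → SAlg n M → T)
    (hV : ∀ x ξ, IsHamiltonian C (Ω x) (fun y => pairing μ (J y) ξ) x (V x ξ))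
    (hbr : ∀ x ξ η, Ω x (V x η) (V x ξ) = pairing μ (J x) (algBracket ξ η)) :
    IsPoissonMap μ C Ω J := by
  -- Along J ∘ c a function with gradient ξ has the same derivative as the linear function ⟨·, ξ⟩,
  -- so it has the same Hamiltonian vector.
  have key : ∀ x F ξ, HasGradient μ F (J x) ξ →
      IsHamiltonian C (Ω x) (fun y => F (J y)) x (V x ξ) := by
    intro x F ξ hF c hc h0 Y hY
    obtain ⟨y, hy⟩ := hv c hc Y hY
    have h1 := hF (fun t => J (c t)) (hJ c hc) (by rw [h0]) y hy
    have h2 := hasDerivAt_pairing_const μ (hJ c hc) hy ξ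
    exact h1.congr_deriv (h2.unique (hV x ξ c hc h0 Y hY))
  refine ⟨hJ, fun x F H ξ η hF hH => ⟨⟨_, key x F ξ hF⟩, ⟨_, key x H η hH⟩, fun V' W' hV' hW' => ?_⟩⟩
  -- Nondegeneracy is not needed: two Hamiltonian vectors of one function pair equally with every
  -- tangent vector realized by a curve, and `hreal` realizes all of them.
  have uniq : ∀ F ξ V', HasGradient μ F (J x) ξ → IsHamiltonian C (Ω x) (fun y => F (J y)) x V' →
      ∀ Y, Ω x Y V' = Ω x Y (V x ξ) := by
    intro F ξ V' hF hV' Y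
    obtain ⟨c, hc, h0, hY⟩ := hreal x Y
    exact (hV' c hc h0 Y hY).unique (key x F ξ hF c hc h0 Y hY)
  rw [uniq F ξ V' hF hV', hΩ, uniq H η W' hH hW', ← hΩ, hbr]

end PoissonMaps

/-! ### The cotangent bundle of the densities, its leaf and its orbit. -/

section CotangentDens

variable {n : ℕ} {M : Type*} [TopologicalSpace M] [ChartedSpace (Model n) M]

lemma exists_coset_eq (q : Fun n M ⧸ constants n M) : ∃ θ, coset θ = q :=
  (constants n M).mkQ_surjective q

lemma coset_eq_coset_iff {θ θ' : Fun n M} : coset θ = coset θ' ↔ ∃ a : ℝ, a • 1 = θ - θ' := by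
  rw [coset, coset, Submodule.mkQ_apply, Submodule.mkQ_apply, Submodule.Quotient.eq, constants,
    Submodule.mem_span_singleton]

lemma coset_sub (θ θ' : Fun n M) : coset (θ - θ') = coset θ - coset θ' := map_sub _ _ _

variable [IsManifold (𝓡 n) ∞ M]

lemma differentialMod_coset (θ : Fun n M) : differentialMod (coset θ) = differential θ := rfl

lemma lie_eq_of_coset_eq {θ θ' : Fun n M} (h : coset θ = coset θ') (v : VField n M) :
    lie v θ = lie v θ' := by
  rw [← contract_differential, ← differentialMod_coset, h, differentialMod_coset,
    contract_differential]

lemma dot_const {f : Fun n M} (h : SmoothFun fun _ : ℝ => f) (t : ℝ) : dot _ h t = 0 :=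
  h.dot_eq fun _ => hasDerivAt_const _ _

variable [T2Space M] [CompactSpace M] [MeasurableSpace M] [BorelSpace M]
  (μ : Measure M) [IsProbabilityMeasure μ] [IsSmoothVolume n μ]

lemma integ_mul_divergence (f ρ : Fun n M) (v : VField n M) :
    integ μ (f * divergence μ (fieldSmul ρ v)) = -integ μ (ρ * lie v f) := by
  rw [← lie_fieldSmul, integ_lie, neg_neg]

lemma cotangentDensForm_coset (r s : zeroMean (n := n) μ) (a b : Fun n M) :
    cotangentDensForm μ (r, coset a) (s, coset b) = integ μ (a * s.1) - integ μ (b * r.1) := rfl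

lemma cotangentDensForm_comm (Y Z : TangentCotangentDens (n := n) μ) :
    cotangentDensForm μ Y Z = -cotangentDensForm μ Z Y := by
  simp only [cotangentDensForm, neg_sub]

lemma pairing_reductionMap (ρ : densities (n := n) μ) (θ : Fun n M) (ξ : SAlg n M) :
    pairing μ (reductionMap μ (ρ, coset θ)) ξ = integ μ (ρ.1 * (lie ξ.1 θ + ξ.2)) := by
  rw [pairing_eq, reductionMap, differentialMod_coset, contract_scale, contract_differential,
    mul_add]

lemma smooth_reductionMap {c : ℝ → CotangentDens (n := n) μ} (h : (cotangentDensCurves μ).smooth c) :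
    dualCurves.smooth fun t => reductionMap μ (c t) := by
  obtain ⟨h1, θ, hθ, hc⟩ := h
  have h2 : (fun t => (reductionMap μ (c t)).1) = fun t => scale (c t).1.1 (differential (θ t)) := by
    ext1 t
    rw [reductionMap, ← hc, differentialMod_coset]
  exact ⟨by rw [h2]; exact hθ.differential.scale h1, h1⟩

include μ in
lemma SmoothFun.differential_velocityAt {θ : ℝ → Fun n M} (hθ : SmoothFun θ) (t : ℝ) :
    FormVelocityAt (fun s => Madelung.differential (θ s)) t
      (Madelung.differential (Madelung.dot θ hθ t)) := fun w y => by
  have hw : SmoothFun fun s => Madelung.lie w (θ s) := hθ.lie (smoothField_const w)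
  have := hw.hasDerivAt t y
  rw [hθ.dot_lie μ w hw] at this
  exact this

lemma FormVelocityAt.scale {m : ℝ → Form n M} {m' : Form n M} {t : ℝ} (h : FormVelocityAt m t m')
    {ρ : ℝ → Fun n M} {ρ' : Fun n M} (hρ : ∀ x, HasDerivAt (fun s => ρ s x) (ρ' x) t) :
    FormVelocityAt (fun s => scale (ρ s) (m s)) t (scale ρ' (m t) + Madelung.scale (ρ t) m') := by
  intro w x
  simp only [contract_scale, contract_add]
  exact (hρ x).mul (h w x)

lemma velocity_reductionMap {c : ℝ → CotangentDens (n := n) μ} {r : Fun n M} {θ : ℝ → Fun n M}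
    (hr : VelocityFun (fun t => (c t).1.1) r) (hθ : SmoothFun θ) (hc : ∀ t, coset (θ t) = (c t).2) :
    dualCurves.velocity (fun t => reductionMap μ (c t))
      (scale r (differential (θ 0)) + scale (c 0).1.1 (differential (dot θ hθ 0)), r) := by
  have h2 : (fun t => (reductionMap μ (c t)).1) = fun t => scale (c t).1.1 (differential (θ t)) := by
    ext1 t
    rw [reductionMap, ← hc, differentialMod_coset]
  refine ⟨?_, hr⟩
  rw [h2]
  exact velocityForm_iff.2 ((hθ.differential_velocityAt μ 0).scale hr)

lemma neg_divergence_mem (ρ : Fun n M) (v : VField n M) :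
    -divergence μ (fieldSmul ρ v) ∈ zeroMean (n := n) μ := by
  change integ μ _ = 0
  rw [map_neg, integ_divergence, neg_zero]

/-- The infinitesimal action of `ξ = (v, α)` on `T* Dens(M)`, `(-div (ρ v), -[v θ + α])`. -/
def densGenerator (p : CotangentDens (n := n) μ) (ξ : SAlg n M) : TangentCotangentDens (n := n) μ :=
  (⟨-divergence μ (fieldSmul p.1.1 ξ.1), neg_divergence_mem μ _ _⟩,
    coset (-(contract (differentialMod p.2) ξ.1 + ξ.2)))

/-- The derivative is ∫ ρ̇ (vθ + α) + ρ (v θ̇). Integrating the last term by parts pairs θ̇ with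
-div(ρ v). -/
lemma isHamiltonian_densGenerator (p : CotangentDens (n := n) μ) (ξ : SAlg n M) :
    IsHamiltonian (cotangentDensCurves μ) (cotangentDensForm μ)
      (fun q => pairing μ (reductionMap μ q) ξ) p (densGenerator μ p ξ) := by
  rintro c hc rfl Y ⟨hr, θ, hθ, hcθ, θ', hθ', hY⟩
  refine (hasDerivAt_pairing_const μ (smooth_reductionMap μ hc)
    (velocity_reductionMap μ hr hθ hcθ) ξ).congr_deriv ?_
  obtain ⟨r, q⟩ := Y
  rw [hθ.dot_eq hθ']
  change coset θ' = q at hY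
  subst hY
  change _ = cotangentDensForm μ (r, coset θ') (densGenerator μ (c 0) ξ)
  rw [densGenerator, cotangentDensForm_coset, ← hcθ 0, differentialMod_coset, contract_differential,
    pairing_eq]
  simp only [contract_add, contract_scale, contract_differential, mul_neg, neg_mul, map_neg]
  rw [integ_mul_divergence, neg_neg, sub_neg_eq_add, ← map_add]
  congr 1
  ring

/-- Integration by parts puts ρ in front of all terms; the second derivatives of θ then combine to
the derivative along the bracket. -/
lemma cotangentDensForm_densGenerator (p : CotangentDens (n := n) μ) (ξ η : SAlg n M) :
    cotangentDensForm μ (densGenerator μ p η) (densGenerator μ p ξ)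
      = pairing μ (reductionMap μ p) (algBracket ξ η) := by
  obtain ⟨ρ, q⟩ := p
  obtain ⟨θ, rfl⟩ := exists_coset_eq q
  rw [pairing_reductionMap, densGenerator, densGenerator, cotangentDensForm_coset]
  simp only [differentialMod_coset, contract_differential, algBracket, lie_field_neg, bracket_lie,
    neg_mul_neg, integ_mul_divergence, lie_add]
  rw [sub_neg_eq_add, add_comm, ← sub_eq_add_neg, ← map_sub]
  congr 1
  ring

/-- A straight line leaves the positive functions at large times, so time is replaced by a bounded
function with derivative 1 at 0. -/
lemma exists_curve_densities (ρ : densities (n := n) μ) {r : Fun n M} (hr : r ∈ zeroMean μ) :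
    ∃ c : ℝ → densities (n := n) μ, SmoothFun (fun t => (c t).1) ∧ c 0 = ρ ∧
      VelocityFun (fun t => (c t).1) r := by
  have hne : Nonempty M := by
    by_contra h
    have h1 := ρ.2.2
    have := not_nonempty_iff.1 h
    rw [integral_of_isEmpty] at h1
    exact zero_ne_one h1
  obtain ⟨x₀, -, hx₀⟩ := isCompact_univ.exists_isMinOn univ_nonempty
    ρ.1.contMDiff.continuous.continuousOn
  obtain ⟨x₁, -, hx₁⟩ := isCompact_univ.exists_isMaxOn univ_nonempty
    r.contMDiff.continuous.abs.continuousOn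
  set δ := ρ.1 x₀ with hδ
  have hδ0 : 0 < δ := ρ.2.1 x₀
  set K := |r x₁| + 1 with hK
  have hK0 : 0 < K := by positivity
  set ε := δ / K with hε
  have hε0 : 0 < ε := div_pos hδ0 hK0
  -- The bound |s| ≤ ε with ε = min ρ / (max |r| + 1) keeps ρ + s r positive.
  let s : ℝ → ℝ := fun t => ε * Real.sin (t / ε)
  have hs : ContDiff ℝ ∞ s := contDiff_const.mul (Real.contDiff_sin.comp (contDiff_id.div_const ε))
  have hpos : ∀ t x, 0 < (ρ.1 + s t • r) x := by
    intro t x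
    have h1 : |s t| ≤ ε := by
      simp only [s]
      rw [abs_mul, abs_of_pos hε0]
      exact mul_le_of_le_one_right hε0.le (Real.abs_sin_le_one _)
    have h2 : |r x| < K := lt_of_le_of_lt (hx₁ (mem_univ x)) (by rw [hK]; linarith)
    have h3 : |s t * r x| < δ := by
      rw [abs_mul]
      calc |s t| * |r x| ≤ ε * |r x| := by gcongr
        _ < ε * K := by gcongr
        _ = δ := div_mul_cancel₀ _ hK0.ne'
    have h4 : δ ≤ ρ.1 x := hx₀ (mem_univ x)
    change 0 < ρ.1 x + s t * r x
    linarith [(abs_lt.1 h3).1]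
  have hint : ∀ t, integ μ (ρ.1 + s t • r) = 1 := fun t => by
    have h1 : integ μ ρ.1 = 1 := ρ.2.2
    have h2 : integ μ r = 0 := hr
    rw [map_add, map_smul, h1, h2, smul_zero, add_zero]
  refine ⟨fun t => ⟨ρ.1 + s t • r, hpos t, hint t⟩, (smoothFun_const _).add ((smoothFun_const r).smul hs),
    ?_, fun x => ?_⟩
  · refine Subtype.ext ?_
    simp [s]
  · have h1 : HasDerivAt s 1 0 := by
      have h2 : HasDerivAt (fun t => t / ε) (1 / ε) 0 := (hasDerivAt_id (0:ℝ)).div_const ε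
      have h3 := (h2.sin).const_mul ε
      refine h3.congr_deriv ?_
      rw [zero_div, Real.cos_zero, one_mul]
      exact mul_one_div_cancel hε0.ne'
    refine ((h1.mul_const (r x)).const_add (ρ.1 x)).congr_deriv ?_
    rw [one_mul]

lemma hasDerivAt_line (f g : Fun n M) (x : M) (t : ℝ) :
    HasDerivAt (fun s : ℝ => (f + s • g) x) (g x) t := by
  refine (((hasDerivAt_id t).mul_const (g x)).const_add (f x)).congr_deriv ?_
  rw [one_mul]

lemma smoothFun_line (f g : Fun n M) : SmoothFun fun s : ℝ => f + s • g :=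
  (smoothFun_const f).add ((smoothFun_const g).smul contDiff_id)

theorem isPoissonMap_reductionMap : IsPoissonMap μ (cotangentDensCurves (n := n) μ)
    (fun _ => cotangentDensForm μ) (reductionMap μ) := by
  refine isPoissonMap_of_hamiltonian μ (fun c => smooth_reductionMap μ) ?_
    (fun _ => cotangentDensForm_comm μ) ?_ (densGenerator μ) (isHamiltonian_densGenerator μ)
    (cotangentDensForm_densGenerator μ)
  · rintro c - Y ⟨hr, θ, hθ, hcθ, -⟩
    exact ⟨_, velocity_reductionMap μ hr hθ hcθ⟩
  · rintro ⟨ρ, q⟩ ⟨⟨r, hr⟩, q'⟩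
    obtain ⟨θ, rfl⟩ := exists_coset_eq q
    obtain ⟨θ', rfl⟩ := exists_coset_eq q'
    obtain ⟨c, hc, hc0, hcr⟩ := exists_curve_densities μ ρ hr
    refine ⟨fun t => (c t, coset (θ + t • θ')), ⟨hc, _, smoothFun_line θ θ', fun _ => rfl⟩, ?_, hcr,
      _, smoothFun_line θ θ', fun _ => rfl, θ', fun x => hasDerivAt_line θ θ' x 0, rfl⟩
    simp only [hc0, zero_smul, add_zero]

/-- After the change of variables the shift of θ by -a cancels the term (φ_* w) a of the adjoint
action. -/
theorem isCoadjoint_reductionMap (g : SGroup n M) (p : CotangentDens (n := n) μ) :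
    IsCoadjoint μ g (reductionMap μ p) (reductionMap μ (cotangentAct μ g p)) := by
  intro ξ
  obtain ⟨ρ, q⟩ := p
  obtain ⟨θ, rfl⟩ := exists_coset_eq q
  have h1 : cotangentAct μ g (ρ, coset θ) = (⟨densityPush μ g.right ρ.1, densityPush_mem μ ρ.2⟩,
      coset (funPush g.right θ - phase g)) := by
    rw [coset_sub]
    rfl
  rw [h1, pairing_reductionMap, pairing_reductionMap]
  simp only [adjoint, lie_sub, lie_push_funPush]
  rw [← integ_densityPush_mul μ g.right ρ.1, map_add]
  congr 2
  abel

theorem isGenerator_densGenerator (ξ : SAlg n M) (p : CotangentDens (n := n) μ) :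
    IsGenerator (cotangentDensCurves μ) (cotangentAct μ) ξ p (densGenerator μ p ξ) := by
  intro g hg
  obtain ⟨ζ, hζ, rfl, hgf⟩ := hg.exists_groupFlow
  have hg1 : g 0 = 1 := hg.2.1
  obtain ⟨ρ, q⟩ := p
  obtain ⟨θ, rfl⟩ := exists_coset_eq q
  have hρ := (smoothFun_const ρ.1).densityPush (μ := μ) hgf.smoothDif
  have hp := (smoothFun_const θ).funPush hgf.smoothDif.inv
  have hθ := hp.sub hgf.smoothFun
  have hco : ∀ t, coset (funPush (g t).right θ - phase (g t))
      = (cotangentAct μ (g t) (ρ, coset θ)).2 := fun t => coset_sub _ _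
  refine ⟨⟨hρ, _, hθ, hco⟩, ?_, _, hθ, hco, _, hθ.velocity, ?_⟩
  · have h1 := hρ.velocity
    rw [hgf.flowsBy.dot_densityPush hgf.smoothDif hζ.1 (smoothFun_const ρ.1), dot_const, hg1] at h1
    have h2 : densityPush μ (1 : SGroup n M).right (0 : Fun n M)
        - divergence μ (fieldSmul (densityPush μ (1 : SGroup n M).right ρ.1) (ζ 0).1)
        = (densGenerator μ (ρ, coset θ) (ζ 0)).1.1 := by
      rw [show (1 : SGroup n M).right = 1 from rfl, densityPush_id, densityPush_id, zero_sub]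
      rfl
    rw [h2] at h1
    exact h1
  · have h1 : dot _ hθ 0 = dot _ hp 0 - dot _ hgf.smoothFun 0 := hθ.dot_eq fun x =>
      (hp.hasDerivAt 0 x).sub (hgf.smoothFun.hasDerivAt 0 x)
    rw [h1, hgf.flowsBy.dot_funPush (smoothFun_const θ) hp, hgf.dot_phase, dot_const, map_zero,
      zero_sub, hg1]
    change coset (-lie (ζ 0).1 θ - ((ζ 0).2 - lie (ζ 0).1 (0 : Fun n M))) = _
    rw [lie_zero, sub_zero, ← neg_add']
    rfl

/-- The second component is ρ, and division by it leaves dθ, which on a connected manifold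
determines θ up to a constant. -/
theorem reductionMap_injective [PreconnectedSpace M] :
    Function.Injective (reductionMap (n := n) μ) := by
  rintro ⟨ρ, q⟩ ⟨ρ', q'⟩ h
  obtain ⟨θ, rfl⟩ := exists_coset_eq q
  obtain ⟨θ', rfl⟩ := exists_coset_eq q'
  obtain ⟨h1, h2⟩ := Prod.ext_iff.1 h
  have h3 : ρ = ρ' := Subtype.ext h2
  subst h3
  refine Prod.ext rfl (coset_eq_coset_iff.2 ⟨_, (eq_const_of_lie_eq_zero μ fun v => ?_).symm⟩)
  have h4 := congrArg (fun m => contract m v) h1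
  simp only [reductionMap, differentialMod_coset, contract_scale, contract_differential] at h4
  rw [lie_sub, sub_eq_zero]
  ext x
  exact mul_left_cancel₀ (ρ.2.1 x).ne' (congrArg (fun f : Fun n M => f x) h4)

/-- If the image velocity vanishes then ρ̇ = 0 and ρ dθ̇ = 0, so θ̇ is constant. -/
theorem reductionMap_immersion [PreconnectedSpace M] {c : ℝ → CotangentDens (n := n) μ}
    {Y : TangentCotangentDens (n := n) μ} (hY : (cotangentDensCurves (n := n) μ).velocity c Y)
    (h0 : dualCurves.velocity (fun t => reductionMap μ (c t)) 0) : Y.1.1 = 0 ∧ Y.2 = 0 := by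
  obtain ⟨hr, θ, hθ, hcθ, θ', hθ', hq⟩ := hY
  have h1 := velocity_reductionMap μ hr hθ hcθ
  have h2 : Y.1.1 = 0 := velocityFun_unique h1.2 h0.2
  have h3 := velocityForm_unique h1.1 h0.1
  refine ⟨h2, ?_⟩
  rw [hθ.dot_eq hθ', h2] at h3
  have h4 : ∀ v, lie v θ' = 0 := fun v => by
    have h5 := congrArg (fun m => contract m v) h3
    simp only [contract_add, contract_scale, contract_differential, zero_mul, zero_add] at h5
    ext x
    have h6 : (c 0).1.1 x * lie v θ' x = 0 := by
      have := congrArg (fun f : Fun n M => f x) h5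
      simp only [contract_eq_contractHom, Prod.fst_zero, map_zero, LinearMap.zero_apply] at this
      exact this
    exact (mul_eq_zero.1 h6).resolve_left ((c 0).1.2.1 x).ne'
  rw [← hq, ← sub_zero (coset θ'), ← sub_zero (coset θ')]
  have h7 := eq_const_of_lie_eq_zero μ h4
  have h8 : coset θ' = coset 0 := coset_eq_coset_iff.2 ⟨_, by rw [sub_zero]; exact h7.symm⟩
  rw [h8, sub_zero, sub_zero]
  exact map_zero _

/-- Transitivity: Moser's theorem moves the densities, and the function component of `S` corrects θ.
Conversely equivariance and uniqueness keep the orbit inside the image. -/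
lemma coadjointOrbit_eq [PreconnectedSpace M] (p : CotangentDens (n := n) μ) :
    range (reductionMap (n := n) μ) = coadjointOrbit μ (reductionMap μ p) := by
  ext y
  constructor
  · rintro ⟨q, rfl⟩
    obtain ⟨ρ, a⟩ := p
    obtain ⟨σ, b⟩ := q
    obtain ⟨θ, rfl⟩ := exists_coset_eq a
    obtain ⟨η, rfl⟩ := exists_coset_eq b
    obtain ⟨φ, hφ⟩ := exists_densityPush_eq ρ.2 σ.2
    refine ⟨mkS φ (funPush φ θ - η), ?_⟩
    have h1 : cotangentAct μ (mkS φ (funPush φ θ - η)) (ρ, coset θ) = (σ, coset η) := by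
      refine Prod.ext (Subtype.ext hφ) ?_
      change coset (funPush φ θ) - coset (funPush φ θ - η) = coset η
      rw [coset_sub, sub_sub_cancel]
    rw [← h1]
    exact isCoadjoint_reductionMap μ _ _
  · rintro ⟨g, hg⟩
    exact ⟨cotangentAct μ g p, isCoadjoint_unique μ (isCoadjoint_reductionMap μ g p) hg⟩

/-- If g_t has right-trivialized velocities ξ_t, then ⟨c(t), Ad_{g_t} η⟩ is constant, because the
derivatives ⟨c, [·, ξ]⟩ and ⟨c, [ξ, ·]⟩ cancel. So c(1) is the coadjoint image of c(0) under g_1. -/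
theorem symplecticLeaf_subset (x : SDual n M) : symplecticLeaf μ x ⊆ coadjointOrbit μ x := by
  rintro y ⟨c, ξ, hc, hξ, rfl, rfl, hder⟩
  obtain ⟨g, hg, hg1⟩ := exists_groupFlow hξ
  refine ⟨g 1, fun η => ?_⟩
  have hd : ∀ t, HasDerivAt (fun s => pairing μ (c s) (adjoint (g s) η)) 0 t := by
    intro t
    obtain ⟨m', hm'⟩ := hc.1.exists_velocity t
    have h1 := hg.hasDerivAt_pairing μ (y := (m', dot _ hc.2 t)) hc hm' (hc.2.hasDerivAt t) η
    refine h1.congr_deriv ?_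
    have h2 := hasDerivAt_pairing μ hc (ξ := fun _ => adjoint (g t) η)
      ⟨smoothField_const _, smoothFun_const _⟩ hm' (hc.2.hasDerivAt t)
      (fieldVelocityAt_const _ _) (a' := 0) (fun x => hasDerivAt_const _ _)
    have h3 : pairing μ (c t) (0, 0) = 0 := by
      simp only [pairing_eq, contract_eq_contractHom, map_zero, mul_zero, add_zero]
    rw [h3, add_zero] at h2
    rw [h2.unique (hder t (adjoint (g t) η)), algBracket_comm, pairing_neg_right, neg_add_cancel]
  have h3 := is_const_of_deriv_eq_zero (fun s => (hd s).differentiableAt)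
    (fun s => (hd s).deriv) 1 0
  rw [h3, hg1]
  congr 1
  refine Prod.ext (field_ext fun f => ?_) ?_
  · exact lie_push 1 η.1 f
  · change η.2 + lie _ (0 : Fun n M) = _
    rw [lie_zero, add_zero]

/-- Any two points of `T* Dens(M)` are joined by interpolating ρ and θ separately; the path is
Hamiltonian for a suitable time-dependent ξ_t. -/
theorem symplecticLeaf_eq [PreconnectedSpace M] (p : CotangentDens (n := n) μ) :
    range (reductionMap (n := n) μ) = symplecticLeaf μ (reductionMap μ p) := by
  refine Subset.antisymm ?_ ((symplecticLeaf_subset μ _).trans (coadjointOrbit_eq μ p).ge)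
  rintro _ ⟨q, rfl⟩
  obtain ⟨ρ, a⟩ := p
  obtain ⟨σ, b⟩ := q
  obtain ⟨θ, rfl⟩ := exists_coset_eq a
  obtain ⟨η, rfl⟩ := exists_coset_eq b
  have hR := smoothFun_restPath ρ.1 σ.1
  have hT := smoothFun_restPath θ η
  have hmem := restPath_mem (μ := μ) ρ.2 σ.2
  obtain ⟨v, hv, hvd⟩ := exists_continuity hR hmem
  let c : ℝ → CotangentDens (n := n) μ := fun t => (⟨restPath ρ.1 σ.1 t, hmem t⟩,
    coset (restPath θ η t))
  -- The field v solves the continuity equation, and α = -(θ̇ + vθ) is forced by the second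
  -- component θ̇ = -(vθ + α) of the infinitesimal action.
  refine ⟨fun t => reductionMap μ (c t), fun t => (v t, -(dot _ hT t + lie (v t) (restPath θ η t))),
    smooth_reductionMap μ ⟨hR, _, hT, fun _ => rfl⟩, ⟨hv, (hT.dot.add (hT.lie hv)).neg⟩, ?_, ?_, ?_⟩
  · have : c 0 = (ρ, coset θ) := Prod.ext (Subtype.ext (restPath_zero _ _))
      (congrArg coset (restPath_zero _ _))
    simp only [this]
  · have : c 1 = (σ, coset η) := Prod.ext (Subtype.ext (restPath_one _ _))
      (congrArg coset (restPath_one _ _))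
    simp only [this]
  · rintro t ⟨w, β⟩
    simp only [c, pairing_reductionMap]
    have hw : SmoothFun fun t => lie w (restPath θ η t) := hT.lie (smoothField_const w)
    have hs := hR.mul (hw.add (smoothFun_const β))
    refine (hasDerivAt_integral μ hs t).congr_deriv ?_
    have h1 : dot _ hs t = dot _ hR t * (lie w (restPath θ η t) + β)
        + restPath ρ.1 σ.1 t * lie w (dot _ hT t) := by
      refine hs.dot_eq fun x => ?_
      have h2 := hw.hasDerivAt t x
      rw [hT.dot_lie μ w hw] at h2
      exact (hR.hasDerivAt t x).mul (h2.add_const _)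
    have h3 : dot _ hR t = -divergence μ (fieldSmul (restPath ρ.1 σ.1 t) (v t)) := by
      rw [hvd, neg_neg]
    rw [h1, h3, neg_mul, mul_comm (divergence μ _), map_add, map_neg, integ_mul_divergence, neg_neg,
      ← map_add]
    simp only [algBracket, lie_field_neg, bracket_lie, lie_neg, lie_add]
    congr 1
    ring

end CotangentDens

/-! ### Wave functions and the Madelung transform. -/

section Waves

variable {n : ℕ} {M : Type*} [TopologicalSpace M] [ChartedSpace (Model n) M]

/-- The wave function with given real and imaginary parts. -/
def mkWave (p q : Fun n M) : Wave n M :=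
  ⟨fun x => (p x : ℂ) + (q x : ℂ) * Complex.I,
    ContMDiff.comp (g := fun z : ℝ × ℝ => (z.1 : ℂ) + (z.2 : ℂ) * Complex.I)
      ((Complex.ofRealCLM.contDiff.comp contDiff_fst).add
        ((Complex.ofRealCLM.contDiff.comp contDiff_snd).mul contDiff_const)).contMDiff
      (p.contMDiff.prodMk_space q.contMDiff)⟩

lemma rePart_mkWave (p q : Fun n M) : rePart (mkWave p q) = p := by
  ext x
  change ((p x : ℂ) + (q x : ℂ) * Complex.I).re = p x
  simp

lemma imPart_mkWave (p q : Fun n M) : imPart (mkWave p q) = q := by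
  ext x
  change ((p x : ℂ) + (q x : ℂ) * Complex.I).im = q x
  simp

lemma absSq_eq (ψ : Wave n M) : absSq ψ = rePart ψ * rePart ψ + imPart ψ * imPart ψ := by
  ext x
  exact Complex.normSq_apply (ψ x)

/-- The square root of a positive function. -/
def sqrtFun (r : Fun n M) (hr : ∀ x, 0 < r x) : Fun n M :=
  ⟨fun x => Real.sqrt (r x), fun x => ContMDiffAt.comp x (g := Real.sqrt)
    (Real.contDiffAt_sqrt (hr x).ne').contMDiffAt (r.contMDiff x)⟩

def cosHalf (a : Fun n M) : Fun n M :=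
  ⟨fun x => Real.cos (a x / 2),
    (Real.contDiff_cos.comp (contDiff_id.div_const 2)).contMDiff.comp a.contMDiff⟩

def sinHalf (a : Fun n M) : Fun n M :=
  ⟨fun x => Real.sin (a x / 2),
    (Real.contDiff_sin.comp (contDiff_id.div_const 2)).contMDiff.comp a.contMDiff⟩

lemma exp_half (a : ℝ) : Complex.exp (Complex.I * (a : ℂ) / 2)
    = (Real.cos (a / 2) : ℂ) + (Real.sin (a / 2) : ℂ) * Complex.I := by
  rw [show Complex.I * (a : ℂ) / 2 = ((a / 2 : ℝ) : ℂ) * Complex.I by push_cast; ring,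
    Complex.exp_mul_I, Complex.ofReal_cos, Complex.ofReal_sin]

lemma polar_apply (r a : Fun n M) (hr : ∀ x, 0 < r x) (ψ : Wave n M) (x : M) : polar r a hr ψ x
    = (Real.sqrt (r x) : ℂ) * Complex.exp (Complex.I * (a x : ℂ) / 2) * ψ x := rfl

lemma rePart_polar (r a : Fun n M) (hr : ∀ x, 0 < r x) (ψ : Wave n M) : rePart (polar r a hr ψ)
    = sqrtFun r hr * (cosHalf a * rePart ψ - sinHalf a * imPart ψ) := by
  ext x
  change (polar r a hr ψ x).re = Real.sqrt (r x) * (Real.cos (a x / 2) * (ψ x).re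
    - Real.sin (a x / 2) * (ψ x).im)
  rw [polar_apply, exp_half, mul_assoc, Complex.re_ofReal_mul, Complex.mul_re]
  generalize Real.cos (a x / 2) = c
  generalize Real.sin (a x / 2) = d
  simp

lemma imPart_polar (r a : Fun n M) (hr : ∀ x, 0 < r x) (ψ : Wave n M) : imPart (polar r a hr ψ)
    = sqrtFun r hr * (cosHalf a * imPart ψ + sinHalf a * rePart ψ) := by
  ext x
  change (polar r a hr ψ x).im = Real.sqrt (r x) * (Real.cos (a x / 2) * (ψ x).im
    + Real.sin (a x / 2) * (ψ x).re)
  rw [polar_apply, exp_half, mul_assoc, Complex.im_ofReal_mul, Complex.mul_im]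
  generalize Real.cos (a x / 2) = c
  generalize Real.sin (a x / 2) = d
  simp

lemma absSq_polar (r a : Fun n M) (hr : ∀ x, 0 < r x) (ψ : Wave n M) :
    absSq (polar r a hr ψ) = r * absSq ψ := by
  rw [absSq_eq, rePart_polar, imPart_polar, absSq_eq]
  ext x
  have h1 := Real.mul_self_sqrt (hr x).le
  have h2 := Real.cos_sq_add_sin_sq (a x / 2)
  change (√(r x) * (Real.cos (a x / 2) * (ψ x).re - Real.sin (a x / 2) * (ψ x).im))
      * (√(r x) * (Real.cos (a x / 2) * (ψ x).re - Real.sin (a x / 2) * (ψ x).im))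
    + (√(r x) * (Real.cos (a x / 2) * (ψ x).im + Real.sin (a x / 2) * (ψ x).re))
      * (√(r x) * (Real.cos (a x / 2) * (ψ x).im + Real.sin (a x / 2) * (ψ x).re))
    = r x * ((ψ x).re * (ψ x).re + (ψ x).im * (ψ x).im)
  linear_combination ((ψ x).re ^ 2 + (ψ x).im ^ 2) * (√(r x) * √(r x)) * h2
    + ((ψ x).re ^ 2 + (ψ x).im ^ 2) * h1

lemma hasDerivAt_parts {ψ : ℝ → ℂ} {z : ℂ} {t : ℝ} : HasDerivAt ψ z t ↔
    HasDerivAt (fun s => (ψ s).re) z.re t ∧ HasDerivAt (fun s => (ψ s).im) z.im t := by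
  constructor
  · intro h
    exact ⟨Complex.reCLM.hasFDerivAt.comp_hasDerivAt t h,
      Complex.imCLM.hasFDerivAt.comp_hasDerivAt t h⟩
  · rintro ⟨h1, h2⟩
    have h3 := h1.ofReal_comp.add (h2.ofReal_comp.mul_const Complex.I)
    simp only [Complex.re_add_im] at h3
    refine h3.congr_of_eventuallyEq (Filter.Eventually.of_forall fun s => ?_)
    exact (Complex.re_add_im _).symm

lemma velocityFun_wave_iff {ψ : ℝ → Wave n M} {χ : Wave n M} : VelocityFun ψ χ ↔
    VelocityFun (fun t => rePart (ψ t)) (rePart χ) ∧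
      VelocityFun (fun t => imPart (ψ t)) (imPart χ) :=
  ⟨fun h => ⟨fun x => (hasDerivAt_parts.1 (h x)).1, fun x => (hasDerivAt_parts.1 (h x)).2⟩,
    fun h x => hasDerivAt_parts.2 ⟨h.1 x, h.2 x⟩⟩

lemma SmoothFun.rePart {ψ : ℝ → Wave n M} (h : SmoothFun ψ) : SmoothFun fun t => rePart (ψ t) :=
  Complex.reCLM.contDiff.contMDiff.comp h

lemma SmoothFun.imPart {ψ : ℝ → Wave n M} (h : SmoothFun ψ) : SmoothFun fun t => imPart (ψ t) :=
  Complex.imCLM.contDiff.contMDiff.comp h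

lemma SmoothFun.polar {r a : ℝ → Fun n M} (hr : SmoothFun r) (ha : SmoothFun a)
    (hp : ∀ t x, 0 < r t x) {ψ : ℝ → Wave n M} (hψ : SmoothFun ψ) :
    SmoothFun fun t => polar (r t) (a t) (hp t) (ψ t) := by
  intro p
  have e1 : ContDiffAt ℝ ∞ (fun q : ℝ × ℝ × ℂ => (Real.sqrt q.1 : ℂ))
      (r p.1 p.2, a p.1 p.2, ψ p.1 p.2) :=
    Complex.ofRealCLM.contDiff.contDiffAt.comp _ (contDiffAt_fst.sqrt (hp p.1 p.2).ne')
  have e2 : ContDiff ℝ ∞ (fun q : ℝ × ℝ × ℂ => Complex.exp (Complex.I * (q.2.1 : ℂ) / 2)) :=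
    ((contDiff_const.mul (Complex.ofRealCLM.contDiff.comp
      (contDiff_fst.comp contDiff_snd))).div_const 2).cexp
  exact ContMDiffAt.comp p
    (g := fun q : ℝ × ℝ × ℂ => (Real.sqrt q.1 : ℂ) * Complex.exp (Complex.I * (q.2.1 : ℂ) / 2) * q.2.2)
    ((e1.mul e2.contDiffAt).mul (contDiff_snd.comp contDiff_snd).contDiffAt).contMDiffAt
    ((hr p).prodMk_space ((ha p).prodMk_space (hψ p)))

variable [IsManifold (𝓡 n) ∞ M]

lemma lie_comp {f F : Fun n M} {g : ℝ → ℝ} {g' : ℝ} {x : M} (hF : ∀ y, F y = g (f y))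
    (hg : HasDerivAt g g' (f x)) (v : VField n M) : lie v F x = g' * lie v f x := by
  have h1 : (F : M → ℝ) = g ∘ f := funext hF
  have h2 := hg.hasFDerivAt.hasMFDerivAt.comp x (Maps.mdiff f x).hasMFDerivAt
  rw [← h1] at h2
  have h3 : (lie v F x : ℝ) = lie v f x • g' :=
    congrArg (fun L : Model n →L[ℝ] ℝ => L (v x)) h2.mfderiv
  rw [h3, smul_eq_mul, mul_comm]

lemma lie_cosHalf (v : VField n M) (a : Fun n M) (x : M) :
    lie v (cosHalf a) x = -(sinHalf a x / 2) * lie v a x := by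
  refine lie_comp (g := fun s => Real.cos (s / 2)) (fun _ => rfl) ?_ v
  refine (((hasDerivAt_id (a x)).div_const 2).cos).congr_deriv ?_
  change -Real.sin (a x / 2) * (1 / 2) = -(Real.sin (a x / 2) / 2)
  ring

lemma lie_sinHalf (v : VField n M) (a : Fun n M) (x : M) :
    lie v (sinHalf a) x = cosHalf a x / 2 * lie v a x := by
  refine lie_comp (g := fun s => Real.sin (s / 2)) (fun _ => rfl) ?_ v
  refine (((hasDerivAt_id (a x)).div_const 2).sin).congr_deriv ?_
  change Real.cos (a x / 2) * (1 / 2) = Real.cos (a x / 2) / 2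
  ring

lemma momentumForm_eq (ψ : Wave n M) : momentumForm ψ
    = (2 : ℝ) • (scale (rePart ψ) (differential (imPart ψ))
      - scale (imPart ψ) (differential (rePart ψ))) := by
  ext x u
  have hd : MDifferentiableAt (𝓡 n) 𝓘(ℝ, ℂ) ψ x := Maps.mdiff ψ x
  have hre : mfderiv (𝓡 n) 𝓘(ℝ, ℝ) (rePart ψ) x
      = Complex.reCLM ∘L mfderiv (𝓡 n) 𝓘(ℝ, ℂ) ψ x :=
    ((Complex.reCLM.hasFDerivAt (x := ψ x)).hasMFDerivAt.comp x hd.hasMFDerivAt).mfderiv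
  have him : mfderiv (𝓡 n) 𝓘(ℝ, ℝ) (imPart ψ) x
      = Complex.imCLM ∘L mfderiv (𝓡 n) 𝓘(ℝ, ℂ) ψ x :=
    ((Complex.imCLM.hasFDerivAt (x := ψ x)).hasMFDerivAt.comp x hd.hasMFDerivAt).mfderiv
  set L : TangentSpace (𝓡 n) x →L[ℝ] ℂ := mfderiv (𝓡 n) 𝓘(ℝ, ℂ) ψ x
  have hre' : (differential (rePart ψ) x u : ℝ) = (L u).re := congrArg (fun K => K u) hre
  have him' : (differential (imPart ψ) x u : ℝ) = (L u).im := congrArg (fun K => K u) him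
  change (2 : ℝ) * (star (ψ x) * L u).im
    = (2 : ℝ) * ((ψ x).re * (differential (imPart ψ) x u : ℝ)
      - (ψ x).im * (differential (rePart ψ) x u : ℝ))
  rw [hre', him', Complex.mul_im]
  simp
  ring

lemma contract_momentumForm (ψ : Wave n M) (v : VField n M) : contract (momentumForm ψ) v
    = (2 : ℝ) • (rePart ψ * lie v (imPart ψ) - imPart ψ * lie v (rePart ψ)) := by
  rw [momentumForm_eq, contract_smul, contract_sub, contract_scale, contract_scale,
    contract_differential, contract_differential]

/-- In Im(ψ̄ dψ) the derivative of the real amplitude drops out, leaving the factor r, while the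
phase a/2 contributes r |ψ|² da after the factor 2. -/
lemma contract_momentumForm_polar (r a : Fun n M) (hr : ∀ x, 0 < r x) (ψ : Wave n M)
    (v : VField n M) : contract (momentumForm (polar r a hr ψ)) v
      = r * contract (momentumForm ψ) v + r * absSq ψ * lie v a := by
  rw [contract_momentumForm, rePart_polar, imPart_polar, contract_momentumForm, absSq_eq]
  have hsub : lie v (cosHalf a * rePart ψ - sinHalf a * imPart ψ)
      = lie v (cosHalf a * rePart ψ) - lie v (sinHalf a * imPart ψ) := by
    simp only [lie_eq_lieHom, map_sub]
  rw [lie_mul, lie_mul, hsub, lie_add, lie_mul, lie_mul, lie_mul, lie_mul]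
  set s := sqrtFun r hr
  set c := cosHalf a with hc
  set d := sinHalf a with hd
  set p := rePart ψ
  set q := imPart ψ
  ext x
  have h1 : s x * s x = r x := Real.mul_self_sqrt (hr x).le
  have h2 : c x ^ 2 + d x ^ 2 = 1 := Real.cos_sq_add_sin_sq (a x / 2)
  have h3 : lie v c x = -(d x / 2) * lie v a x := lie_cosHalf v a x
  have h4 : lie v d x = c x / 2 * lie v a x := lie_sinHalf v a x
  change 2 * (s x * (c x * p x - d x * q x) * (s x * ((c x * lie v q x + q x * lie v c x)
      + (d x * lie v p x + p x * lie v d x)) + (c x * q x + d x * p x) * lie v s x)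
      - s x * (c x * q x + d x * p x) * (s x * ((c x * lie v p x + p x * lie v c x)
      - (d x * lie v q x + q x * lie v d x)) + (c x * p x - d x * q x) * lie v s x))
    = r x * (2 * (p x * lie v q x - q x * lie v p x))
      + r x * (p x * p x + q x * q x) * lie v a x
  rw [h3, h4, ← h1]
  linear_combination (s x * s x) * (2 * (p x * lie v q x - q x * lie v p x)
    + (p x * p x + q x * q x) * lie v a x) * h2

lemma rePart_wavePush (φ : Dif n M) (ψ : Wave n M) : rePart (wavePush φ ψ) = funPush φ (rePart ψ) :=
  rfl

lemma imPart_wavePush (φ : Dif n M) (ψ : Wave n M) : imPart (wavePush φ ψ) = funPush φ (imPart ψ) :=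
  rfl

lemma absSq_wavePush (φ : Dif n M) (ψ : Wave n M) : absSq (wavePush φ ψ) = funPush φ (absSq ψ) :=
  rfl

lemma contract_momentumForm_wavePush (φ : Dif n M) (ψ : Wave n M) (v : VField n M) :
    contract (momentumForm (wavePush φ ψ)) (push φ v)
      = funPush φ (contract (momentumForm ψ) v) := by
  rw [contract_momentumForm, contract_momentumForm, rePart_wavePush, imPart_wavePush,
    lie_push_funPush, lie_push_funPush]
  rfl

variable [T2Space M] [CompactSpace M] [MeasurableSpace M] [BorelSpace M]
  (μ : Measure M) [IsProbabilityMeasure μ] [IsSmoothVolume n μ]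

/-- The gauge formula with r the Jacobian and phase -a turns both components into pushed-forward
ones times the Jacobian; the added term cancels (φ_* v) a in the adjoint action. -/
theorem isCoadjoint_inverseMadelung (g : SGroup n M) (ψ : Wave n M) :
    IsCoadjoint μ g (inverseMadelung ψ) (inverseMadelung (waveAct μ g ψ)) := by
  intro ξ
  rw [pairing_eq, pairing_eq, ← integ_funPush_mul_jac μ g.right
    (contract (inverseMadelung ψ).1 ξ.1 + (inverseMadelung ψ).2 * ξ.2)]
  simp only [inverseMadelung, waveAct, adjoint, contract_momentumForm_polar,
    contract_momentumForm_wavePush, absSq_polar, absSq_wavePush, lie_neg, map_add, funPush_mul]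
  rw [← map_add, ← map_add]
  congr 1
  ring

lemma waveForm_eq (χ₁ χ₂ : Wave n M) : waveForm μ χ₁ χ₂
    = integ μ (imPart χ₁ * rePart χ₂ - rePart χ₁ * imPart χ₂) := by
  refine integral_congr_ae (Filter.Eventually.of_forall fun x => ?_)
  change (χ₁ x * star (χ₂ x)).im = (χ₁ x).im * (χ₂ x).re - (χ₁ x).re * (χ₂ x).im
  rw [Complex.mul_im]
  simp
  ring

lemma waveForm_comm (χ₁ χ₂ : Wave n M) : waveForm μ χ₁ χ₂ = -waveForm μ χ₂ χ₁ := by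
  rw [waveForm_eq, waveForm_eq, ← map_neg]
  congr 1
  ring

/-- The infinitesimal action `-v ψ - (1/2) (div v) ψ - (i/2) α ψ` on wave functions. -/
def waveGenerator (ψ : Wave n M) (ξ : SAlg n M) : Wave n M :=
  mkWave (-lie ξ.1 (rePart ψ) - (1 / 2 : ℝ) • (divergence μ ξ.1 * rePart ψ)
      + (1 / 2 : ℝ) • (ξ.2 * imPart ψ))
    (-lie ξ.1 (imPart ψ) - (1 / 2 : ℝ) • (divergence μ ξ.1 * imPart ψ)
      - (1 / 2 : ℝ) • (ξ.2 * rePart ψ))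

lemma smooth_inverseMadelung {ψ : ℝ → Wave n M} (h : SmoothFun ψ) :
    dualCurves.smooth fun t => inverseMadelung (ψ t) := by
  constructor
  · refine smoothForm_of_contract fun v => ?_
    simp only [inverseMadelung, contract_momentumForm]
    exact ((h.rePart.mul (h.imPart.lie (smoothField_const v))).sub
      (h.imPart.mul (h.rePart.lie (smoothField_const v)))).const_smul 2
  · simp only [inverseMadelung, absSq_eq]
    exact (h.rePart.mul h.rePart).add (h.imPart.mul h.imPart)

include μ in
lemma velocity_inverseMadelung {ψ : ℝ → Wave n M} {χ : Wave n M} (h : SmoothFun ψ)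
    (hχ : VelocityFun ψ χ) : dualCurves.velocity (fun t => inverseMadelung (ψ t))
      ((2 : ℝ) • ((scale (rePart χ) (differential (imPart (ψ 0)))
          + scale (rePart (ψ 0)) (differential (imPart χ)))
        - (scale (imPart χ) (differential (rePart (ψ 0)))
          + scale (imPart (ψ 0)) (differential (rePart χ)))),
        (2 : ℝ) • (rePart (ψ 0) * rePart χ + imPart (ψ 0) * imPart χ)) := by
  obtain ⟨h1, h2⟩ := velocityFun_wave_iff.1 hχ
  have d1 := (h.imPart.differential_velocityAt μ 0).scale h1
  have d2 := (h.rePart.differential_velocityAt μ 0).scale h2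
  rw [h.imPart.dot_eq h2] at d1
  rw [h.rePart.dot_eq h1] at d2
  constructor
  · refine velocityForm_iff.2 fun v x => ?_
    have h3 := ((d1 v x).sub (d2 v x)).const_mul 2
    simp only [inverseMadelung, momentumForm_eq, contract_smul, contract_sub]
    exact h3
  · intro x
    simp only [inverseMadelung, absSq_eq]
    refine (((h1 x).mul (h1 x)).add ((h2 x).mul (h2 x))).congr_deriv ?_
    change _ = 2 * (rePart (ψ 0) x * rePart χ x + imPart (ψ 0) x * imPart χ x)
    ring

/-- The factor 4 is the product of the 2 from differentiating a quadratic map and the 2 that undoes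
the half-density and half-phase of the action. -/
lemma hasDerivAt_pairing_inverseMadelung {ψ : ℝ → Wave n M} {χ : Wave n M} (h : SmoothFun ψ)
    (hχ : VelocityFun ψ χ) (ξ : SAlg n M) :
    HasDerivAt (fun t => pairing μ (inverseMadelung (ψ t)) ξ)
      (4 * waveForm μ χ (waveGenerator μ (ψ 0) ξ)) 0 := by
  refine (hasDerivAt_pairing_const μ (smooth_inverseMadelung h)
    (velocity_inverseMadelung μ h hχ) ξ).congr_deriv ?_
  rw [pairing_eq, waveForm_eq, ← smul_eq_mul (4 : ℝ), ← map_smul, waveGenerator, rePart_mkWave,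
    imPart_mkWave]
  -- With ψ = p + iq and χ = P + iQ the two integrands differ by twice the divergence of (pQ - qP)
  -- v.
  have hd := integ_divergence (μ := μ)
    (fieldSmul (rePart (ψ 0) * imPart χ - imPart (ψ 0) * rePart χ) ξ.1)
  rw [divergence_fieldSmul, lie_sub, lie_mul, lie_mul] at hd
  rw [← sub_eq_zero, ← map_sub]
  refine Eq.trans ?_ ((map_smul (integ μ) (2 : ℝ) _).trans
    ((congrArg ((2 : ℝ) • ·) hd).trans (smul_zero _)))
  congr 1
  simp only [contract_smul, contract_sub, contract_add, contract_scale, contract_differential]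
  ext x
  set p := rePart (ψ 0)
  set q := imPart (ψ 0)
  set P := rePart χ
  set Q := imPart χ
  set v := ξ.1
  set α := ξ.2
  set δ := divergence μ v
  change (2 * ((P x * lie v q x + p x * lie v Q x) - (Q x * lie v p x + q x * lie v P x))
      + 2 * (p x * P x + q x * Q x) * α x)
    - 4 * (Q x * (-lie v p x - 1 / 2 * (δ x * p x) + 1 / 2 * (α x * q x))
      - P x * (-lie v q x - 1 / 2 * (δ x * q x) - 1 / 2 * (α x * p x)))
    = 2 * ((p x * Q x - q x * P x) * δ x
      + ((p x * lie v Q x + Q x * lie v p x) - (q x * lie v P x + P x * lie v q x)))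
  ring

lemma jac_id : jac μ (1 : Dif n M) = 1 := by
  have := densityPush_id (μ := μ) (1 : Fun n M)
  rwa [densityPush, funPush_one, one_mul] at this

/-- The square root of the Jacobian contributes -(div v)/2 and the half-phase -iα/2; both factors
are 1 at time 0, so the product rule simply adds the terms. -/
theorem isGenerator_waveGenerator (ξ : SAlg n M) (ψ : Wave n M) :
    IsGenerator waveCurves (waveAct μ) ξ ψ (waveGenerator μ ψ ξ) := by
  intro g hg
  obtain ⟨ζ, hζ, rfl, h⟩ := hg.exists_groupFlow
  have hg1 : g 0 = 1 := hg.2.1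
  have hψ : SmoothFun fun t => wavePush (g t).right ψ := (smoothFun_const ψ).comp_dif h.smoothDif.inv
  have hJ := h.smoothDif.jac (μ := μ)
  have hs : SmoothFun fun t => waveAct μ (g t) ψ :=
    hJ.polar h.smoothFun.neg (fun t => jac_pos μ (g t).right) hψ
  refine ⟨hs, velocityFun_wave_iff.2 ?_⟩
  have hp := (smoothFun_const (rePart ψ)).funPush h.smoothDif.inv
  have hq := (smoothFun_const (imPart ψ)).funPush h.smoothDif.inv
  have hp0 : dot _ hp 0 = -lie (ζ 0).1 (rePart ψ) := by
    rw [h.flowsBy.dot_funPush (smoothFun_const _) hp, dot_const, map_zero, zero_sub, hg1]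
    rfl
  have hq0 : dot _ hq 0 = -lie (ζ 0).1 (imPart ψ) := by
    rw [h.flowsBy.dot_funPush (smoothFun_const _) hq, dot_const, map_zero, zero_sub, hg1]
    rfl
  have hJ1 : jac μ (g 0).right = 1 := by
    rw [hg1]
    exact jac_id μ
  have hJ0 : dot _ hJ 0 = -divergence μ (ζ 0).1 := by
    rw [h.flowsBy.dot_jac h.smoothDif hζ.1, divergence_fieldSmul, hJ1, one_mul, ← one_smul ℝ (1 : Fun n M),
      lie_const, add_zero]
  have ha1 : phase (g 0) = 0 := by
    rw [hg1]
    rfl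
  have ha0 : dot _ h.smoothFun 0 = (ζ 0).2 := by
    rw [h.dot_phase, ha1, lie_zero, sub_zero]
  have parts : ∀ x,
      HasDerivAt (fun t => Real.sqrt (jac μ (g t).right x)) (-(1 / 2) * divergence μ (ζ 0).1 x) 0 ∧
      HasDerivAt (fun t => Real.cos ((-phase (g t)) x / 2)) 0 0 ∧
      HasDerivAt (fun t => Real.sin ((-phase (g t)) x / 2)) (-(1 / 2) * (ζ 0).2 x) 0 := by
    intro x
    have e1 := hJ.hasDerivAt 0 x
    have e2 : HasDerivAt (fun t => (-phase (g t)) x / 2) (-(ζ 0).2 x / 2) 0 := by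
      have := h.smoothFun.hasDerivAt 0 x
      rw [ha0] at this
      exact this.neg.div_const 2
    have e3 : (-phase (g 0)) x / 2 = 0 := by
      rw [ha1]
      change -(0:ℝ) / 2 = 0
      simp
    have e4 : jac μ (g 0).right x = 1 := by
      rw [hJ1]
      rfl
    refine ⟨(e1.sqrt (by rw [e4]; exact one_ne_zero)).congr_deriv ?_, e2.cos.congr_deriv ?_,
      e2.sin.congr_deriv ?_⟩
    · rw [hJ0, e4, Real.sqrt_one]
      change -divergence μ (ζ 0).1 x / (2 * 1) = _
      ring
    · rw [e3, Real.sin_zero, neg_zero, zero_mul]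
    · rw [e3, Real.cos_zero]
      ring
  have v0 : ∀ x, Real.sqrt (jac μ (g 0).right x) = 1 ∧ Real.cos ((-phase (g 0)) x / 2) = 1 ∧
      Real.sin ((-phase (g 0)) x / 2) = 0 := by
    intro x
    rw [hJ1, ha1]
    change Real.sqrt 1 = 1 ∧ Real.cos (-(0:ℝ) / 2) = 1 ∧ Real.sin (-(0:ℝ) / 2) = 0
    simp
  have p0 : ∀ f : Fun n M, ∀ x, funPush (g 0).right f x = f x := fun f x => by
    rw [hg1]
    rfl
  constructor
  · intro x
    obtain ⟨e1, e2, e3⟩ := parts x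
    obtain ⟨f1, f2, f3⟩ := v0 x
    have e4 := hp.hasDerivAt 0 x
    have e5 := hq.hasDerivAt 0 x
    rw [hp0] at e4
    rw [hq0] at e5
    simp only [waveAct, rePart_polar, waveGenerator, rePart_mkWave, rePart_wavePush, imPart_wavePush]
    refine (e1.mul ((e2.mul e4).sub (e3.mul e5))).congr_deriv ?_
    simp only [Pi.mul_apply, Pi.sub_apply, f1, f2, f3, p0]
    change _ = (-lie (ζ 0).1 (rePart ψ) x - 1 / 2 * (divergence μ (ζ 0).1 x * rePart ψ x)
      + 1 / 2 * ((ζ 0).2 x * imPart ψ x))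
    change -(1 / 2) * divergence μ (ζ 0).1 x * (1 * rePart ψ x - 0 * imPart ψ x)
      + 1 * (0 * rePart ψ x + 1 * -lie (ζ 0).1 (rePart ψ) x - (-(1 / 2) * (ζ 0).2 x * imPart ψ x
        + 0 * -lie (ζ 0).1 (imPart ψ) x)) = _
    ring
  · intro x
    obtain ⟨e1, e2, e3⟩ := parts x
    obtain ⟨f1, f2, f3⟩ := v0 x
    have e4 := hp.hasDerivAt 0 x
    have e5 := hq.hasDerivAt 0 x
    rw [hp0] at e4
    rw [hq0] at e5
    simp only [waveAct, imPart_polar, waveGenerator, imPart_mkWave, rePart_wavePush, imPart_wavePush]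
    refine (e1.mul ((e2.mul e5).add (e3.mul e4))).congr_deriv ?_
    simp only [Pi.mul_apply, Pi.add_apply, f1, f2, f3, p0]
    change _ = (-lie (ζ 0).1 (imPart ψ) x - 1 / 2 * (divergence μ (ζ 0).1 x * imPart ψ x)
      - 1 / 2 * ((ζ 0).2 x * rePart ψ x))
    change -(1 / 2) * divergence μ (ζ 0).1 x * (1 * imPart ψ x + 0 * rePart ψ x)
      + 1 * (0 * imPart ψ x + 1 * -lie (ζ 0).1 (imPart ψ) x + (-(1 / 2) * (ζ 0).2 x * rePart ψ x
        + 0 * -lie (ζ 0).1 (rePart ψ) x)) = _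
    ring

/-- Equivariant momentum maps intertwine the brackets. -/
lemma form_generator_eq {X T : Type*} {C : Curves X T} {Ω : X → T → T → ℝ}
    {J : X → SDual n M} {act : SGroup n M → X → X} (hone : ∀ x, act 1 x = x)
    (hJ : ∀ c, C.smooth c → dualCurves.smooth fun t => J (c t))
    (hv : ∀ c, C.smooth c → ∀ Y, C.velocity c Y → ∃ y, dualCurves.velocity (fun t => J (c t)) y)
    (heq : ∀ g x, IsCoadjoint μ g (J x) (J (act g x))) {V : X → SAlg n M → T}
    (hgen : ∀ ξ x, IsGenerator C act ξ x (V x ξ))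
    (hV : ∀ x ξ, IsHamiltonian C (Ω x) (fun y => pairing μ (J y) ξ) x (V x ξ)) (x : X)
    (ξ η : SAlg n M) : Ω x (V x η) (V x ξ) = pairing μ (J x) (algBracket ξ η) := by
  obtain ⟨g, hg⟩ := exists_groupCurve η
  obtain ⟨ζ, hζ, rfl, h⟩ := hg.exists_groupFlow
  have hg1 : g 0 = 1 := hg.2.1
  have had : adjoint (1 : SGroup n M) ξ = ξ := by
    refine Prod.ext (field_ext fun f => lie_push 1 ξ.1 f) ?_
    change ξ.2 + lie _ (0 : Fun n M) = _
    rw [lie_zero, add_zero]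
  obtain ⟨hs, hvel⟩ := hgen (ζ 0) x g hg
  obtain ⟨y, hy⟩ := hv _ hs _ hvel
  have e1 := h.hasDerivAt_pairing μ (hJ _ hs) (velocityForm_iff.1 hy.1) hy.2 ξ
  have h0 : act (g 0) x = x := by rw [hg1, hone]
  -- Equivariance makes ⟨J(g_s x), Ad_{g_s} ξ⟩ constant in s, so the two terms of its derivative
  -- cancel.
  simp only [heq (g _) x ξ, hg1, hone, had] at e1
  have e2 := e1.unique (hasDerivAt_const (0:ℝ) (pairing μ (J x) ξ))
  have e3 := (hasDerivAt_pairing_const μ (hJ _ hs) hy ξ).unique (hV x ξ _ hs h0 _ hvel)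
  change _ = Ω x (V x (ζ 0)) (V x ξ) at e3
  rw [← e3, algBracket_comm, pairing_neg_right]
  exact eq_neg_of_add_eq_zero_left e2

/-- The bracket identity is taken from equivariance and the generators through `form_generator_eq`,
which avoids computing the form on two generators. -/
theorem isPoissonMap_inverseMadelung : IsPoissonMap μ waveCurves
    (fun (_ : Wave n M) χ₁ χ₂ => 4 * waveForm μ χ₁ χ₂) inverseMadelung := by
  have hV : ∀ (ψ : Wave n M) ξ, IsHamiltonian waveCurves (fun χ₁ χ₂ => 4 * waveForm μ χ₁ χ₂)
      (fun y => pairing μ (inverseMadelung y) ξ) ψ (waveGenerator μ ψ ξ) := by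
    rintro _ ξ c hc rfl χ hχ
    exact hasDerivAt_pairing_inverseMadelung μ hc hχ ξ
  have hJ : ∀ c : ℝ → Wave n M, waveCurves.smooth c →
    dualCurves.smooth fun t => inverseMadelung (c t) := fun c hc => smooth_inverseMadelung hc
  have hv : ∀ c : ℝ → Wave n M, waveCurves.smooth c → ∀ Y, waveCurves.velocity c Y →
      ∃ y, dualCurves.velocity (fun t => inverseMadelung (c t)) y :=
    fun c hc Y hY => ⟨_, velocity_inverseMadelung μ hc hY⟩
  refine isPoissonMap_of_hamiltonian μ hJ hv
    (fun _ Y Z => by rw [waveForm_comm, mul_neg]) ?_ (waveGenerator μ) hV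
    (form_generator_eq μ (act := waveAct μ) ?_ hJ hv (isCoadjoint_inverseMadelung μ)
      (isGenerator_waveGenerator μ) hV)
  · intro ψ χ
    refine ⟨fun t => ψ + t • χ, ?_, by simp, fun x => ?_⟩
    · change SmoothFun fun t : ℝ => ψ + t • χ
      exact (smoothFun_const (F := ℂ) ψ).add (SmoothFun.smul (F := ℂ) (a := fun t => t) contDiff_id (smoothFun_const (F := ℂ) χ))
    · refine (((hasDerivAt_id (0:ℝ)).smul_const (χ x)).const_add (ψ x)).congr_deriv ?_
      rw [one_smul]
  · intro ψ
    ext x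
    change polar (jac μ 1) (-(0 : Fun n M)) _ (wavePush 1 ψ) x = ψ x
    rw [polar_apply, jac_id]
    change ((Real.sqrt 1 : ℝ) : ℂ) * Complex.exp (Complex.I * ((-0 : ℝ) : ℂ) / 2) * ψ x = ψ x
    simp

theorem waveAct_momentumMap (ξ : SAlg n M) (ψ : Wave n M) : ∃ V,
    IsGenerator waveCurves (waveAct μ) ξ ψ V ∧ IsHamiltonian waveCurves (waveForm μ)
      (fun χ => pairing μ (inverseMadelung χ) ξ) ψ ((4 : ℝ) • V) := by
  refine ⟨_, isGenerator_waveGenerator μ ξ ψ, ?_⟩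
  rintro c hc rfl χ hχ
  refine (hasDerivAt_pairing_inverseMadelung μ hc hχ ξ).congr_deriv ?_
  change 4 * waveForm μ χ _ = waveForm μ χ ((4 : ℝ) • waveGenerator μ (c 0) ξ)
  rw [waveForm_eq, waveForm_eq, ← smul_eq_mul (4 : ℝ), ← map_smul]
  congr 1
  set V := waveGenerator μ (c 0) ξ
  ext x
  change 4 * ((χ x).im * (V x).re - (χ x).re * (V x).im)
    = (χ x).im * ((4:ℝ) • V x).re - (χ x).re * ((4:ℝ) • V x).im
  simp only [Complex.real_smul, Complex.re_ofReal_mul, Complex.im_ofReal_mul]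
  ring

/-- The Madelung wave is a gauge transform of the constant wave 1, whose momentum vanishes and whose
density is 1. -/
theorem inverseMadelung_madelung (ρ : densities (n := n) μ) (θ : Fun n M) :
    inverseMadelung (madelung μ ρ θ) = reductionMap μ (ρ, coset θ) := by
  have hre : rePart (1 : Wave n M) = 1 := by
    ext x
    exact Complex.one_re
  have him : imPart (1 : Wave n M) = 0 := by
    ext x
    exact Complex.one_im
  have habs : absSq (1 : Wave n M) = 1 := by
    rw [absSq_eq, hre, him]
    simp
  refine Prod.ext (form_ext fun v => ?_) ?_
  · change contract (momentumForm (polar _ _ _ _)) v = contract (scale ρ.1 (differential θ)) v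
    rw [contract_momentumForm_polar, contract_momentumForm, hre, him, habs, lie_zero, contract_scale,
      contract_differential]
    simp
  · change absSq (polar _ _ _ _) = ρ.1
    rw [absSq_polar, habs, mul_one]

theorem waveAct_madelung (g : SGroup n M) (ρ : densities (n := n) μ) (θ : Fun n M) :
    waveAct μ g (madelung μ ρ θ)
      = madelung μ (cotangentAct μ g (ρ, coset θ)).1 (funPush g.right θ - phase g) := by
  ext x
  change (Real.sqrt (jac μ g.right x) : ℂ) * Complex.exp (Complex.I * ((-phase g x : ℝ) : ℂ) / 2)
      * ((Real.sqrt (ρ.1 (g.right.symm x)) : ℂ)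
        * Complex.exp (Complex.I * (θ (g.right.symm x) : ℂ) / 2) * 1)
    = (Real.sqrt (ρ.1 (g.right.symm x) * jac μ g.right x) : ℂ)
      * Complex.exp (Complex.I * ((θ (g.right.symm x) - phase g x : ℝ) : ℂ) / 2) * 1
  rw [Real.sqrt_mul (ρ.2.1 _).le]
  have : Complex.exp (Complex.I * ((θ (g.right.symm x) - phase g x : ℝ) : ℂ) / 2)
      = Complex.exp (Complex.I * ((-phase g x : ℝ) : ℂ) / 2)
        * Complex.exp (Complex.I * (θ (g.right.symm x) : ℂ) / 2) := by
    rw [← Complex.exp_add]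
    congr 1
    push_cast
    ring
  rw [this]
  push_cast
  ring

/-- Gauging ψ by 1/ρ and -θ removes amplitude and phase. The result has modulus 1 and zero momentum,
so it is constant on a connected manifold. -/
theorem inverseMadelung_eq_iff [PreconnectedSpace M] (ψ : Wave n M) (ρ : densities (n := n) μ)
    (θ : Fun n M) : inverseMadelung ψ = reductionMap μ (ρ, coset θ) ↔
      ∃ τ : ℝ, ∀ x, ψ x = Complex.exp (Complex.I * τ) * madelung μ ρ θ x := by
  constructor
  · intro h
    obtain ⟨h1, h2⟩ := Prod.ext_iff.1 h
    have h2' : absSq ψ = ρ.1 := h2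
    have hrp : ∀ x, 0 < recip ρ.1 ρ.2.1 x := fun x => inv_pos.2 (ρ.2.1 x)
    set χ := polar (recip ρ.1 ρ.2.1) (-θ) hrp ψ with hχ
    have habs : rePart χ * rePart χ + imPart χ * imPart χ = 1 := by
      rw [← absSq_eq, hχ, absSq_polar, h2', recip_mul]
    have hmom : ∀ v, rePart χ * lie v (imPart χ) - imPart χ * lie v (rePart χ) = 0 := by
      intro v
      have h3 := contract_momentumForm χ v
      have h4 : contract (momentumForm ψ) v = ρ.1 * lie v θ := by
        have := congrArg (fun m => contract m v) h1
        simp only [inverseMadelung, reductionMap, differentialMod_coset, contract_scale,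
          contract_differential] at this
        exact this
      rw [hχ, contract_momentumForm_polar, ← hχ, h4, h2', lie_neg, ← mul_assoc, recip_mul, one_mul,
        one_mul, add_neg_cancel] at h3
      exact ((smul_eq_zero.1 h3.symm).resolve_left two_ne_zero)
    have hab : ∀ v, rePart χ * lie v (rePart χ) + imPart χ * lie v (imPart χ) = 0 := by
      intro v
      have h3 := congrArg (lie v) habs
      rw [lie_add, lie_mul, lie_mul, ← one_smul ℝ (1 : Fun n M), lie_const] at h3
      have h4 : (2:ℝ) • (rePart χ * lie v (rePart χ) + imPart χ * lie v (imPart χ)) = 0 := by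
        rw [← h3, two_smul]
        abel
      exact (smul_eq_zero.1 h4).resolve_left two_ne_zero
    -- `hmom` and `hab` form a linear system for the derivatives of the real and imaginary parts;
    -- its determinant is |χ|² = 1.
    have hQ : ∀ v, lie v (imPart χ) = 0 := fun v => by
      linear_combination rePart χ * hmom v + imPart χ * hab v - lie v (imPart χ) * habs
    have hP : ∀ v, lie v (rePart χ) = 0 := fun v => by
      linear_combination -imPart χ * hmom v + rePart χ * hab v - lie v (rePart χ) * habs
    have cP := eq_const_of_lie_eq_zero μ hP
    have cQ := eq_const_of_lie_eq_zero μ hQ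
    set a := integ μ (rePart χ)
    set b := integ μ (imPart χ)
    have hab1 : a * a + b * b = 1 := by
      have h3 := congrArg (integ μ) habs
      rw [cP, cQ, map_add, smul_mul_smul_comm, smul_mul_smul_comm, map_smul, map_smul, mul_one,
        integ_one] at h3
      simpa using h3
    have hz : ‖(⟨a, b⟩ : ℂ)‖ = 1 := by
      rw [Complex.norm_def, Complex.normSq_mk, hab1, Real.sqrt_one]
    refine ⟨Complex.arg ⟨a, b⟩, fun x => ?_⟩
    have e1 : Complex.exp (Complex.I * (Complex.arg ⟨a, b⟩ : ℝ)) = ⟨a, b⟩ := by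
      have := Complex.norm_mul_exp_arg_mul_I ⟨a, b⟩
      rwa [hz, Complex.ofReal_one, one_mul, mul_comm] at this
    have e2 : χ x = ⟨a, b⟩ := by
      apply Complex.ext
      · have := congrArg (fun f : Fun n M => f x) cP
        exact this.trans (mul_one a)
      · have := congrArg (fun f : Fun n M => f x) cQ
        exact this.trans (mul_one b)
    rw [e1, ← e2]
    change ψ x = (Real.sqrt ((ρ.1 x)⁻¹) : ℂ) * Complex.exp (Complex.I * ((-θ x : ℝ) : ℂ) / 2) * ψ x
      * ((Real.sqrt (ρ.1 x) : ℂ) * Complex.exp (Complex.I * (θ x : ℂ) / 2) * 1)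
    have e3 : (Real.sqrt ((ρ.1 x)⁻¹) : ℂ) * (Real.sqrt (ρ.1 x) : ℂ) = 1 := by
      rw [← Complex.ofReal_mul, Real.sqrt_inv, inv_mul_cancel₀ (Real.sqrt_pos.2 (ρ.2.1 x)).ne',
        Complex.ofReal_one]
    have e4 : Complex.exp (Complex.I * ((-θ x : ℝ) : ℂ) / 2)
        * Complex.exp (Complex.I * (θ x : ℂ) / 2) = 1 := by
      rw [← Complex.exp_add, ← Complex.exp_zero]
      congr 1
      push_cast
      ring
    linear_combination -(ψ x) * (Complex.exp (Complex.I * ((-θ x : ℝ) : ℂ) / 2)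
      * Complex.exp (Complex.I * (θ x : ℂ) / 2)) * e3 - ψ x * e4
  · rintro ⟨τ, hτ⟩
    -- The phase of the Madelung wave is θ/2, so the factor e^{iτ} amounts to adding the constant 2τ
    -- to θ.
    have h1 : ψ = madelung μ ρ (θ + (2 * τ) • 1) := by
      ext x
      rw [hτ]
      change Complex.exp (Complex.I * τ) * ((Real.sqrt (ρ.1 x) : ℂ)
          * Complex.exp (Complex.I * (θ x : ℂ) / 2) * 1)
        = (Real.sqrt (ρ.1 x) : ℂ) * Complex.exp (Complex.I * ((θ x + (2 * τ) * 1 : ℝ) : ℂ) / 2) * 1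
      have : Complex.exp (Complex.I * ((θ x + (2 * τ) * 1 : ℝ) : ℂ) / 2)
          = Complex.exp (Complex.I * τ) * Complex.exp (Complex.I * (θ x : ℂ) / 2) := by
        rw [← Complex.exp_add]
        congr 1
        push_cast
        ring
      rw [this]
      ring
    rw [h1, inverseMadelung_madelung]
    congr 2
    exact coset_eq_coset_iff.2 ⟨2 * τ, by simp⟩

end Waves

/-! ### The cotangent bundle of the diffeomorphism group. -/

section CotangentGroup

variable {n : ℕ} {M : Type*} [TopologicalSpace M] [ChartedSpace (Model n) M]
  [IsManifold (𝓡 n) ∞ M] [T2Space M] [CompactSpace M]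

/-- The Lie derivative `L_v m` of a one-form. -/
def lieForm (v : VField n M) (m : Form n M) : Form n M :=
  ∑ k, (scale (lie v (contract m ((theFrame n M).X k))) (differential ((theFrame n M).b k))
    + scale (contract m ((theFrame n M).X k)) (differential (lie v ((theFrame n M).b k))))

/-- The frame expansion of the form is differentiated by the Leibniz rule. The result does not
depend on the frame. -/
lemma contract_lieForm (v w : VField n M) (m : Form n M) :
    contract (lieForm v m) w = lie v (contract m w) - contract m (bracket v w) := by
  have h1 : contract (lieForm v m) w = ∑ k, (lie v (contract m ((theFrame n M).X k))
      * lie w ((theFrame n M).b k)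
      + contract m ((theFrame n M).X k) * lie w (lie v ((theFrame n M).b k))) := by
    rw [lieForm, contract_eq_contractHom, map_sum, LinearMap.sum_apply]
    refine Finset.sum_congr rfl fun k _ => ?_
    rw [← contract_eq_contractHom, contract_add, contract_scale, contract_scale,
      contract_differential, contract_differential]
  rw [h1, contract_frame m w, contract_frame m (bracket v w), lie_eq_lieHom v, map_sum,
    ← Finset.sum_sub_distrib]
  refine Finset.sum_congr rfl fun k _ => ?_
  rw [← lie_eq_lieHom, lie_mul, bracket_lie]
  ring

lemma contract_bracket_comm (m : Form n M) (v w : VField n M) :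
    contract m (bracket v w) = -contract m (bracket w v) := by
  rw [← contract_neg_field]
  congr 1
  refine field_ext fun f => ?_
  rw [lie_eq_lieHom (-_), map_neg, LinearMap.neg_apply, ← lie_eq_lieHom, bracket_lie, bracket_lie, neg_sub]

variable [MeasurableSpace M] [BorelSpace M] (μ : Measure M) [IsProbabilityMeasure μ]
  [IsSmoothVolume n μ]

/-- With the added divergence term the Lie derivative is the transpose of the bracket under the L²
pairing. -/
lemma integ_contract_lieForm (v w : VField n M) (m : Form n M) :
    integ μ (contract (lieForm v m + scale (divergence μ v) m) w)
      = -integ μ (contract m (bracket v w)) := by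
  rw [contract_add, contract_lieForm, contract_scale, map_add, map_sub, integ_lie,
    mul_comm (divergence μ v)]
  ring

lemma cotangentGroupForm_eq (z : Dif n M × Form n M) (X Y : VField n M × Form n M) :
    cotangentGroupForm μ z X Y
      = integ μ (contract X.2 Y.1 - contract Y.2 X.1 - contract z.2 (bracket X.1 Y.1)) := rfl

lemma cotangentGroupForm_comm (z : Dif n M × Form n M) (X Y : VField n M × Form n M) :
    cotangentGroupForm μ z X Y = -cotangentGroupForm μ z Y X := by
  rw [cotangentGroupForm_eq, cotangentGroupForm_eq, contract_bracket_comm z.2 X.1, ← map_neg]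
  congr 1
  ring

/-- The Hamiltonian vector of a linear function on `𝔰*`, pulled back to `T*G`. -/
def groupGenerator (z : Dif n M × Form n M) (ξ : SAlg n M) : VField n M × Form n M :=
  (ξ.1, -(scale (jac μ z.1) (differential ξ.2)) - (lieForm ξ.1 z.2 + scale (divergence μ ξ.1) z.2))

/-- The first argument on the right is the velocity in 𝔰* of the image of a curve with velocity `X`.
So the statement says that `groupGenerator` is the Hamiltonian vector of a pulled-back linear
function. -/
lemma cotangentGroupForm_groupGenerator (z : Dif n M × Form n M) (X : VField n M × Form n M)
    (ξ : SAlg n M) : cotangentGroupForm μ z X (groupGenerator μ z ξ)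
      = pairing μ (X.2, -divergence μ (fieldSmul (jac μ z.1) X.1)) ξ := by
  have h1 := integ_contract_lieForm μ ξ.1 X.1 z.2
  have h2 := integ_mul_divergence μ ξ.2 (jac μ z.1) X.1
  rw [cotangentGroupForm_eq, pairing_eq, groupGenerator]
  simp only [contract_sub (-_), contract_neg, contract_scale, contract_differential, map_sub,
    map_add, map_neg, neg_mul]
  rw [h1, contract_bracket_comm z.2 X.1, map_neg, mul_comm (divergence μ _) ξ.2, h2]
  ring

variable [PreconnectedSpace M]

lemma smooth_semidirectMap {c : ℝ → Dif n M × Form n M} (hc : cotangentGroupCurves.smooth c) :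
    dualCurves.smooth fun t => semidirectMap μ (QuotientGroup.mk (c t).1, (c t).2) :=
  ⟨hc.2, smoothFun_orbitMap μ hc.1⟩

lemma velocity_semidirectMap {c : ℝ → Dif n M × Form n M} (hc : cotangentGroupCurves.smooth c)
    {X : VField n M × Form n M} (hX : cotangentGroupCurves.velocity c X) :
    dualCurves.velocity (fun t => semidirectMap μ (QuotientGroup.mk (c t).1, (c t).2))
      (X.2, -divergence μ (fieldSmul (jac μ (c 0).1) X.1)) := by
  obtain ⟨v, hv, hφ⟩ := hc.1.exists_velocity
  have hv0 : v 0 = X.1 := velocityDif_unique hφ.velocityDif hX.1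
  refine ⟨hX.2, ?_⟩
  simp only [semidirectMap, orbitMap_mk_eq_jac]
  have h := (hc.1.jac (μ := μ)).velocity
  rwa [hφ.dot_jac hc.1 hv, hv0] at h

/-- Tangent vectors are realized by the flow of a fixed field and a straight line of forms. The
bracket follows from the same two integrations by parts as the Hamiltonian property. -/
theorem isPoissonMap_semidirectMap : IsPoissonMap μ cotangentGroupCurves
    (cotangentGroupForm (n := n) μ) (fun z => semidirectMap μ (QuotientGroup.mk z.1, z.2)) := by
  refine isPoissonMap_of_hamiltonian μ (fun c => smooth_semidirectMap μ)
    (fun c hc X hX => ⟨_, velocity_semidirectMap μ hc hX⟩) (cotangentGroupForm_comm μ) ?_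
    (groupGenerator μ) ?_ ?_
  · rintro ⟨φ, m⟩ ⟨u, m'⟩
    obtain ⟨χ, hχ, hχ0, hu⟩ := exists_flowsBy (smoothField_const u)
    refine ⟨fun t => (χ t * φ, m + t • m'), ⟨hχ.mul (smoothDif_const φ),
      (smoothForm_const m).add ((smoothForm_const m').smul contDiff_id)⟩, ?_,
      (hu.mul_right φ).velocityDif, velocityForm_iff.2 fun v x => ?_⟩
    · refine Prod.ext (by simp only [hχ0, one_mul]) (form_ext fun v => ?_)
      rw [contract_add, contract_smul, zero_smul, add_zero]
    · simp only [contract_add, contract_smul]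
      exact hasDerivAt_line _ _ x 0
  · rintro _ ξ c hc rfl X hX
    simp only [cotangentGroupForm_groupGenerator]
    exact hasDerivAt_pairing_const μ (smooth_semidirectMap μ hc) (velocity_semidirectMap μ hc hX) ξ
  · intro z ξ η
    have h1 := integ_contract_lieForm μ η.1 ξ.1 z.2
    have h2 := integ_mul_divergence μ ξ.2 (jac μ z.1) η.1
    rw [cotangentGroupForm_groupGenerator, pairing_eq, pairing_eq, groupGenerator, algBracket]
    simp only [semidirectMap, orbitMap_mk_eq_jac, contract_sub (-_), contract_neg, contract_scale,
      contract_differential, map_sub, map_add, map_neg, neg_mul, contract_neg_field, mul_neg, mul_sub]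
    rw [h1, mul_comm (divergence μ _) ξ.2, h2, contract_bracket_comm z.2 η.1, map_neg]
    ring

/-- On the zero level the symplectic form of `T*G` is the pullback of that of `T* Dens(M)`. -/
theorem cotangentGroupForm_eq_cotangentDensForm
    {c₁ c₂ : ℝ → Dif n M × Form n M} {p₁ p₂ : ℝ → CotangentDens (n := n) μ}
    {X₁ X₂ : VField n M × Form n M} {Y₁ Y₂ : TangentCotangentDens (n := n) μ}
    (hc₁ : cotangentGroupCurves.smooth c₁) (hc₂ : cotangentGroupCurves.smooth c₂)
    (h0 : c₁ 0 = c₂ 0)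
    (h₁ : ∀ t, reductionMap μ (p₁ t) = semidirectMap μ (QuotientGroup.mk (c₁ t).1, (c₁ t).2))
    (h₂ : ∀ t, reductionMap μ (p₂ t) = semidirectMap μ (QuotientGroup.mk (c₂ t).1, (c₂ t).2))
    (hX₁ : cotangentGroupCurves.velocity c₁ X₁) (hX₂ : cotangentGroupCurves.velocity c₂ X₂)
    (hY₁ : (cotangentDensCurves μ).velocity p₁ Y₁) (hY₂ : (cotangentDensCurves μ).velocity p₂ Y₂) :
    cotangentGroupForm μ (c₁ 0) X₁ X₂ = cotangentDensForm μ Y₁ Y₂ := by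
  have hp : p₁ 0 = p₂ 0 := reductionMap_injective μ (by rw [h₁, h₂, h0])
  -- Comparing the velocities of the two equal curves in 𝔰* gives m = ρ dθ, ṁ = ρ̇ dθ + ρ dθ̇ and
  -- the continuity equation.
  have key : ∀ {c : ℝ → Dif n M × Form n M} {p : ℝ → CotangentDens (n := n) μ}
      {X : VField n M × Form n M} {Y : TangentCotangentDens (n := n) μ},
      cotangentGroupCurves.smooth c →
      (∀ t, reductionMap μ (p t) = semidirectMap μ (QuotientGroup.mk (c t).1, (c t).2)) →
      cotangentGroupCurves.velocity c X → (cotangentDensCurves μ).velocity p Y →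
      ∃ θ θ' : Fun n M, coset θ = (p 0).2 ∧ coset θ' = Y.2 ∧
        (c 0).2 = scale (p 0).1.1 (differential θ) ∧
        X.2 = scale Y.1.1 (differential θ) + scale (p 0).1.1 (differential θ') ∧
        Y.1.1 = -divergence μ (fieldSmul (p 0).1.1 X.1) := by
    rintro c p X Y hc h hX ⟨hr, θ, hθ, hcθ, θ', hθ', hY⟩
    have e1 := velocity_reductionMap μ hr hθ hcθ
    have e2 := velocity_semidirectMap μ hc hX
    simp only [← h] at e2
    have e3 := velocityForm_unique e1.1 e2.1
    have e4 := velocityFun_unique e1.2 e2.2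
    obtain ⟨e5, e6⟩ := Prod.ext_iff.1 (h 0)
    rw [hθ.dot_eq hθ'] at e3
    simp only [semidirectMap, orbitMap_mk_eq_jac, reductionMap, ← hcθ, differentialMod_coset]
      at e5 e6
    refine ⟨θ 0, θ', hcθ 0, hY, e5.symm, e3.symm, ?_⟩
    rw [e6]
    exact e4
  obtain ⟨θ, a, hθ, ha, hm, hX₁2, hd₁⟩ := key hc₁ h₁ hX₁ hY₁
  obtain ⟨η, b, hη, hb, -, hX₂2, hd₂⟩ := key hc₂ h₂ hX₂ hY₂
  rw [← hp] at hη hX₂2 hd₂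
  set ρ := (p₁ 0).1.1
  -- The terms ρ̇ dθ become iterated derivatives of θ and cancel against m([v₁, v₂]); the terms ρ
  -- dθ̇ give the form on `T* Dens(M)`.
  have e1 := integ_mul_divergence μ a ρ X₂.1
  have e2 := integ_mul_divergence μ b ρ X₁.1
  have e3 := integ_mul_divergence μ (lie X₂.1 θ) ρ X₁.1
  have e4 := integ_mul_divergence μ (lie X₁.1 θ) ρ X₂.1
  have hform : cotangentDensForm μ Y₁ Y₂ = integ μ (a * Y₂.1.1) - integ μ (b * Y₁.1.1) := by
    rw [← cotangentDensForm_coset, ha, hb]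
  rw [hform, cotangentGroupForm_eq, hm, hX₁2, hX₂2]
  simp only [contract_add, contract_scale, contract_differential, bracket_lie,
    lie_eq_of_coset_eq (hη.trans hθ.symm)]
  rw [hd₁, hd₂, mul_neg, mul_neg, map_neg, map_neg, e1, e2]
  simp only [map_sub, map_add, mul_sub, neg_mul, map_neg]
  rw [mul_comm (divergence μ (fieldSmul ρ X₁.1)), mul_comm (divergence μ (fieldSmul ρ X₂.1)), e3, e4]
  ring

end CotangentGroup

/-! ### The Poincaré lemma and closedness of annihilating forms. -/

section Potentials

/-- The Poincaré lemma with parameters. -/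
lemma exists_potential_ball {n : ℕ} {a : Fin n → ℝ × Model n → ℝ} (ha : ∀ j, ContDiff ℝ ∞ (a j))
    {c : Model n} {r : ℝ} (hr : 0 < r)
    (hsym : ∀ t, ∀ y ∈ Metric.ball c r, ∀ i j,
      fderiv ℝ (fun z => a j (t, z)) y (EuclideanSpace.single i (1:ℝ))
        = fderiv ℝ (fun z => a i (t, z)) y (EuclideanSpace.single j (1:ℝ))) :
    ∃ g : ℝ × Model n → ℝ, ContDiff ℝ ∞ g ∧ ∀ t, ∀ y ∈ Metric.ball c r,
      HasFDerivAt (fun z => g (t, z))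
        (∑ j, a j (t, y) • (EuclideanSpace.proj j : Model n →L[ℝ] ℝ)) y := by
  set A : ℝ → Model n → Model n →L[ℝ] ℝ :=
    fun t y => ∑ j, a j (t, y) • (EuclideanSpace.proj j : Model n →L[ℝ] ℝ) with hA
  have hat : ∀ t j, ContDiff ℝ ∞ fun z => a j (t, z) := fun t j =>
    (ha j).comp (contDiff_const.prodMk contDiff_id)
  have hAc : ContDiff ℝ ∞ fun p : ℝ × Model n => A p.1 p.2 :=
    ContDiff.sum fun j _ => (ha j).smul contDiff_const
  have hAt : ∀ t y, HasFDerivAt (A t) (∑ j, (fderiv ℝ (fun z => a j (t, z)) y).smulRight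
      (EuclideanSpace.proj j : Model n →L[ℝ] ℝ)) y := fun t y => by
    refine HasFDerivAt.fun_sum fun j _ => ?_
    exact (((hat t j).differentiable (by simp)) y).hasFDerivAt.smul_const
      (EuclideanSpace.proj j : Model n →L[ℝ] ℝ)
  have hexp : ∀ (L : Model n →L[ℝ] ℝ) (u : Model n),
      L u = ∑ i, u i * L (EuclideanSpace.single i (1:ℝ)) := by
    intro L u
    conv_lhs => rw [← (EuclideanSpace.basisFun (Fin n) ℝ).sum_repr u]
    rw [map_sum]
    refine Finset.sum_congr rfl fun i _ => ?_
    rw [map_smul, EuclideanSpace.basisFun_apply, EuclideanSpace.basisFun_repr, smul_eq_mul]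
  have hsym' : ∀ t, ∀ y ∈ Metric.ball c r, ∀ u v : Model n,
      fderiv ℝ (A t) y u v = fderiv ℝ (A t) y v u := by
    intro t y hy u v
    rw [(hAt t y).fderiv]
    have hproj : ∀ j (w : Model n), (EuclideanSpace.proj j : Model n →L[ℝ] ℝ) w = w j :=
      fun _ _ => rfl
    simp only [sum_apply, ContinuousLinearMap.smulRight_apply, smul_apply, hproj, smul_eq_mul]
    simp only [hexp (fderiv ℝ (fun z => a _ (t, z)) y) u, hexp (fderiv ℝ (fun z => a _ (t, z)) y) v,
      Finset.sum_mul]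
    rw [Finset.sum_comm]
    refine Finset.sum_congr rfl fun i _ => Finset.sum_congr rfl fun j _ => ?_
    rw [hsym t y hy i j]
    ring
  -- The radial integral is smooth in time and space together. That it is a potential is seen
  -- separately at each time, by comparison with any primitive G.
  refine ⟨fun p => ∫ s in (0:ℝ)..1, A p.1 (c + s • (p.2 - c)) (p.2 - c), ?_, fun t y hy => ?_⟩
  · refine contDiff_integral_unit (F := fun q : (ℝ × Model n) × ℝ =>
      A q.1.1 (c + q.2 • (q.1.2 - c)) (q.1.2 - c)) ?_
    refine ContDiff.clm_apply (hAc.comp (contDiff_fst.fst.prodMk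
      (contDiff_const.add (contDiff_snd.smul (contDiff_fst.snd.sub contDiff_const)))))
      (contDiff_fst.snd.sub contDiff_const)
  · obtain ⟨G, hG⟩ := (convex_ball c r).exists_forall_hasFDerivAt_of_fderiv_symmetric
      Metric.isOpen_ball (fun y _ => (hAt t y).differentiableAt.differentiableWithinAt) (hsym' t)
    have key : ∀ z ∈ Metric.ball c r,
        ∫ s in (0:ℝ)..1, A t (c + s • (z - c)) (z - c) = G z - G c := by
      intro z hz
      have hseg : ∀ s ∈ uIcc (0:ℝ) 1, c + s • (z - c) ∈ Metric.ball c r := by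
        intro s hs
        rw [uIcc_of_le zero_le_one] at hs
        exact (convex_ball c r).add_smul_sub_mem (Metric.mem_ball_self hr) hz hs
      have h1 : ∀ s ∈ uIcc (0:ℝ) 1, HasDerivAt (fun s : ℝ => G (c + s • (z - c)))
          (A t (c + s • (z - c)) (z - c)) s := by
        intro s hs
        have h2 : HasDerivAt (fun s : ℝ => c + s • (z - c)) (z - c) s := by
          refine (((hasDerivAt_id s).smul_const (z - c)).const_add c).congr_deriv ?_
          rw [one_smul]
        exact (hG _ (hseg s hs)).comp_hasDerivAt s h2
      rw [intervalIntegral.integral_eq_sub_of_hasDerivAt h1]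
      · simp
      · refine Continuous.intervalIntegrable ?_ _ _
        have h3 : Continuous fun s : ℝ => A t (c + s • (z - c)) :=
          hAc.continuous.comp (f := fun s : ℝ => (t, c + s • (z - c))) (by fun_prop)
        exact h3.clm_apply continuous_const
    refine ((hG y hy).sub_const (G c)).congr_of_eventuallyEq ?_
    filter_upwards [Metric.isOpen_ball.mem_nhds hy] with z hz
    exact key z hz

variable {n : ℕ} {M : Type*} [TopologicalSpace M] [ChartedSpace (Model n) M]
  [IsManifold (𝓡 n) ∞ M] [T2Space M] [CompactSpace M] [MeasurableSpace M] [BorelSpace M]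
  {μ : Measure M} [IsProbabilityMeasure μ] [IsSmoothVolume n μ]

/-- Testing against f and integrating by parts twice, the symmetric products of divergences cancel.
-/
lemma divergence_bracket (v w : VField n M) :
    divergence μ (bracket v w) = lie v (divergence μ w) - lie w (divergence μ v) := by
  refine IsDiv.eq_divergence fun f => ?_
  have e1 := integ_lie (μ := μ) v (lie w f)
  have e2 := integ_lie (μ := μ) w (lie v f)
  have e3 := integ_lie (μ := μ) v (f * divergence μ w)
  have e4 := integ_lie (μ := μ) w (f * divergence μ v)
  rw [lie_mul, map_add] at e3 e4
  rw [bracket_lie, mul_sub, map_sub, map_sub, e1, e2]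
  have e5 : integ μ (f * divergence μ w * divergence μ v)
      = integ μ (f * divergence μ v * divergence μ w) := by
    congr 1
    ring
  rw [mul_comm (lie w f), mul_comm (lie v f)]
  linarith

lemma bracket_fieldSmul_left (a : Fun n M) (v w : VField n M) :
    bracket (fieldSmul a v) w = fieldSmul a (bracket v w) + -fieldSmul (lie w a) v := by
  refine field_ext fun f => ?_
  rw [bracket_lie, lie_field_add, lie_field_neg, lie_fieldSmul, lie_fieldSmul, lie_fieldSmul,
    lie_fieldSmul, bracket_lie, lie_mul]
  ring

/-- A one-form which annihilates the divergence-free fields is closed. -/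
lemma closed_of_annihilates {α : Form n M}
    (h : ∀ w, divergence μ w = 0 → integ μ (contract α w) = 0) (u v : VField n M) :
    lie u (contract α v) - lie v (contract α u) = contract α (bracket u v) := by
  refine eq_of_integral μ fun χ => ?_
  set U := fieldSmul χ u with hU
  -- The combination (div U) v - (div v) U + [U, v] is divergence-free for any two fields; it is the
  -- divergence of a bivector U ∧ v, up to sign.
  have h1 := h (fieldSmul (divergence μ U) v + -fieldSmul (divergence μ v) U + bracket U v) (by
    rw [divergence_add, divergence_add, divergence_neg, divergence_fieldSmul (divergence μ U),
      divergence_fieldSmul (divergence μ v),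
      divergence_bracket]
    ring)
  have e1 := integ_lie (μ := μ) U (contract α v)
  have e2 := integ_lie (μ := μ) v (χ * contract α u)
  rw [hU, lie_fieldSmul, ← hU] at e1
  rw [lie_mul, map_add] at e2
  rw [hU, bracket_fieldSmul_left, ← hU] at h1
  simp only [contract_add_field, contract_neg_field, contract_fieldSmul, map_add, map_neg] at h1
  rw [hU, contract_fieldSmul, ← hU] at h1
  rw [mul_sub, map_sub]
  rw [mul_comm (contract α v)] at e1
  rw [mul_comm (χ * _)] at e2
  rw [mul_comm (contract α u)] at e2
  linarith

end Potentials

/-! ### Local potentials of families of closed forms. -/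

section LocalPotentials

variable {n : ℕ} {M : Type*} [TopologicalSpace M] [ChartedSpace (Model n) M]
  [IsManifold (𝓡 n) ∞ M]

lemma extChartAt_eq_chartAt (x₀ : M) :
    (extChartAt (𝓡 n) x₀ : M → Model n) = chartAt (Model n) x₀ := by
  ext
  simp

lemma extChartAt_symm_eq_chartAt (x₀ : M) :
    ((extChartAt (𝓡 n) x₀).symm : Model n → M) = (chartAt (Model n) x₀).symm := by
  ext
  simp

lemma extChartAt_target_eq_chartAt (x₀ : M) :
    (extChartAt (𝓡 n) x₀).target = (chartAt (Model n) x₀).target := by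
  simp

lemma lie_eq_chart (v : VField n M) (f : Fun n M) {x₀ x : M}
    (hx : x ∈ (chartAt (Model n) x₀).source) :
    lie v f x = fderiv ℝ (f ∘ (chartAt (Model n) x₀).symm) (chartAt (Model n) x₀ x)
      (chartDeriv x₀ x (v x)) := by
  have h := mfderiv_eq_chart f.contMDiff hx (v x)
  rw [extChartAt_eq_chartAt, extChartAt_symm_eq_chartAt] at h
  exact h

lemma contDiffOn_comp_chart_symm {f : ℝ → Fun n M} (hf : SmoothFun f) (x₀ : M) :
    ContDiffOn ℝ ∞ (fun p : ℝ × Model n => f p.1 ((chartAt (Model n) x₀).symm p.2))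
      (univ ×ˢ (chartAt (Model n) x₀).target) := by
  have hs : ContMDiffOn (𝓘(ℝ, ℝ).prod 𝓘(ℝ, Model n)) 𝓘(ℝ, ℝ) ∞
      (fun p : ℝ × Model n => f p.1 ((chartAt (Model n) x₀).symm p.2))
      (univ ×ˢ (chartAt (Model n) x₀).target) := by
    refine ContMDiff.comp_contMDiffOn (g := fun p : ℝ × M => f p.1 p.2)
      (f := fun p : ℝ × Model n => (p.1, (chartAt (Model n) x₀).symm p.2)) hf ?_
    refine contMDiff_fst.contMDiffOn.prodMk ?_
    rw [← extChartAt_symm_eq_chartAt, ← extChartAt_target_eq_chartAt]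
    exact (contMDiffOn_extChartAt_symm x₀).comp contMDiffOn_snd fun p hp => hp.2
  rw [← contMDiffOn_iff_contDiffOn, modelWithCornersSelf_prod, ← chartedSpaceSelf_prod]
  exact hs

/-- A family of functions supported in a chart, extended by zero in the chart. -/
lemma exists_chart_extension {f : ℝ → Fun n M} (hf : SmoothFun f) {x₀ : M} {B : Set (Model n)}
    (hB : IsCompact B) (hBt : B ⊆ (chartAt (Model n) x₀).target)
    (h0 : ∀ t, ∀ x ∉ (chartAt (Model n) x₀).symm '' B, f t x = 0) :
    ∃ F : ℝ × Model n → ℝ, ContDiff ℝ ∞ F ∧ ∀ t, ∀ y ∈ (chartAt (Model n) x₀).target,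
      F (t, y) = f t ((chartAt (Model n) x₀).symm y) := by
  set e := chartAt (Model n) x₀
  refine ⟨(univ ×ˢ e.target).indicator fun p => f p.1 (e.symm p.2), ?_, fun t y hy =>
    indicator_of_mem (show (t, y) ∈ univ ×ˢ e.target from ⟨mem_univ _, hy⟩) _⟩
  refine contDiff_of_zero_off (U := univ ×ˢ e.target) (B := univ ×ˢ B)
    (isOpen_univ.prod e.open_target) (isClosed_univ.prod hB.isClosed) (prod_mono le_rfl hBt)
    ((contDiffOn_comp_chart_symm hf x₀).congr fun p hp => indicator_of_mem hp _) fun p hp => ?_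
  by_cases hpt : p.2 ∈ e.target
  · rw [indicator_of_mem (show p ∈ univ ×ˢ e.target from ⟨mem_univ _, hpt⟩)]
    refine h0 _ _ ?_
    rintro ⟨y, hy, hye⟩
    have : y = p.2 := e.symm.injOn (hBt hy) hpt hye
    exact hp ⟨mem_univ _, this ▸ hy⟩
  · exact indicator_of_notMem (fun h => hpt h.2) _

variable [T2Space M] [CompactSpace M]

/-- Families of closed one-forms are locally exact. -/
lemma exists_local_potential {α : ℝ → Form n M} (hα : SmoothForm α)
    (hcl : ∀ t u v, lie u (contract (α t) v) - lie v (contract (α t) u)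
      = contract (α t) (bracket u v)) (x₀ : M) :
    ∃ R, IsChartCube n x₀ R ∧ ∃ θ : ℝ → Fun n M, SmoothFun θ ∧
      ∀ t, ∀ x ∈ chartCube n x₀ R, ∀ v, contract (α t) v x = lie v (θ t) x := by
  set e := chartAt (Model n) x₀ with he
  set c := e x₀ with hc
  obtain ⟨r, hr, hrt⟩ : ∃ r > 0, Metric.closedBall c r ⊆ e.target :=
    Metric.nhds_basis_closedBall.mem_iff.1 (e.open_target.mem_nhds (mem_chart_target _ x₀))
  have hbt : ∀ {y}, y ∈ Metric.ball c r → y ∈ e.target := fun hy =>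
    hrt (Metric.ball_subset_closedBall hy)
  obtain ⟨η, hη1, hη2⟩ := exists_cutoff (n := n) (K := e.symm '' Metric.closedBall c r)
    (U := e.source) ((isCompact_closedBall c r).image_of_continuousOn
      (e.continuousOn_symm.mono hrt)).isClosed e.open_source (by
      rintro _ ⟨y, hy, rfl⟩
      exact e.map_target (hrt hy))
  obtain ⟨E, hE⟩ := exists_coordinate_fields x₀ hη2
  have hE1 : ∀ i, ∀ y ∈ Metric.ball c r,
      chartDeriv x₀ (e.symm y) (E i (e.symm y)) = EuclideanSpace.single i (1:ℝ) := by
    intro i y hy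
    have h1 : η (e.symm y) = 1 :=
      hη1.self_of_nhdsSet _ ⟨y, Metric.ball_subset_closedBall hy, rfl⟩
    rw [(hE i).1 _ (e.map_target (hbt hy)), h1, one_smul]
  have hlie : ∀ i (f : Fun n M), ∀ y ∈ Metric.ball c r,
      lie (E i) f (e.symm y) = fderiv ℝ (f ∘ e.symm) y (EuclideanSpace.single i (1:ℝ)) := by
    intro i f y hy
    rw [lie_eq_chart (E i) f (e.map_target (hbt hy)), hE1 i y hy, e.right_inv (hbt hy)]
  -- the coordinate fields commute on the ball
  have hcomm : ∀ t i j, ∀ y ∈ Metric.ball c r,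
      contract (α t) (bracket (E i) (E j)) (e.symm y) = 0 := by
    intro t i j y hy
    rw [contract_frame, fun_sum_apply]
    refine Finset.sum_eq_zero fun k _ => ?_
    set b := (theFrame n M).b k
    have hb : ContDiffAt ℝ ∞ (b ∘ e.symm) y := by
      have h1 := contDiffOn_chart b.contMDiff x₀
      rw [extChartAt_symm_eq_chartAt, extChartAt_target_eq_chartAt] at h1
      exact h1.contDiffAt (e.open_target.mem_nhds (hbt hy))
    have hb2 : DifferentiableAt ℝ (fderiv ℝ (b ∘ e.symm)) y :=
      (hb.fderiv_right (m := ∞) (by simp)).differentiableAt (by simp)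
    have h2 : ∀ i j, lie (E i) (lie (E j) b) (e.symm y) = fderiv ℝ (fderiv ℝ (b ∘ e.symm)) y
        (EuclideanSpace.single i (1:ℝ)) (EuclideanSpace.single j (1:ℝ)) := by
      intro i j
      have h3 : (lie (E j) b ∘ e.symm : Model n → ℝ)
          =ᶠ[𝓝 y] fun z => fderiv ℝ (b ∘ e.symm) z (EuclideanSpace.single j (1:ℝ)) := by
        filter_upwards [Metric.isOpen_ball.mem_nhds hy] with z hz
        exact hlie j b z hz
      rw [hlie i _ y hy, h3.fderiv_eq,
        (hb2.hasFDerivAt.clm_apply (hasFDerivAt_const _ y)).fderiv]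
      simp
    have h4 : lie (bracket (E i) (E j)) b (e.symm y) = 0 := by
      rw [bracket_lie]
      change lie (E i) (lie (E j) b) (e.symm y) - lie (E j) (lie (E i) b) (e.symm y) = 0
      rw [h2, h2, (hb.isSymmSndFDerivAt (by
        simp only [minSmoothness_of_isRCLikeNormedField]
        exact WithTop.coe_le_coe.2 (le_top : (2 : ℕ∞) ≤ ⊤))).eq, sub_self]
    change lie (bracket (E i) (E j)) b (e.symm y) * _ = 0
    rw [h4, zero_mul]
  -- the components of the form
  have hcomp : ∀ j, ∃ F : ℝ × Model n → ℝ, ContDiff ℝ ∞ F ∧ ∀ t, ∀ y ∈ e.target,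
      F (t, y) = contract (α t) (E j) (e.symm y) := by
    intro j
    refine exists_chart_extension (hα.smoothFun (E j)) (B := e '' tsupport η)
      ((isClosed_tsupport η).isCompact.image_of_continuousOn (e.continuousOn.mono hη2)) ?_ ?_
    · rintro _ ⟨x, hx, rfl⟩
      exact e.map_source (hη2 hx)
    · intro t x hx
      have h1 : E j x = 0 := by
        by_cases hxs : x ∈ e.source
        · have h2 : η x = 0 := by
            by_contra h
            refine hx ⟨e x, ⟨x, subset_tsupport _ h, rfl⟩, e.left_inv hxs⟩
          obtain ⟨D, hD⟩ := chartDeriv_isInvertible (n := n) hxs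
          refine D.injective ?_
          have h3 := (hE j).1 x hxs
          rw [h2, zero_smul, ← hD] at h3
          exact h3.trans (map_zero D).symm
        · exact (hE j).2 x hxs
      rw [contract_apply, h1, map_zero]
  choose a ha hae using hcomp
  have hae' : ∀ t j, ∀ y ∈ Metric.ball c r,
      (fun z => a j (t, z)) =ᶠ[𝓝 y] contract (α t) (E j) ∘ e.symm := by
    intro t j y hy
    filter_upwards [Metric.isOpen_ball.mem_nhds hy] with z hz
    exact hae j t z (hbt hz)
  -- The symmetry of the derivatives of the components is closedness evaluated on the commuting
  -- coordinate fields.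
  obtain ⟨g, hg, hgd⟩ := exists_potential_ball ha hr (c := c) fun t y hy i j => by
    rw [(hae' t j y hy).fderiv_eq, (hae' t i y hy).fderiv_eq, ← hlie i _ y hy, ← hlie j _ y hy,
      ← sub_eq_zero]
    have h1 := congrArg (fun f : Fun n M => f (e.symm y)) (hcl t (E i) (E j))
    exact h1.trans (hcomm t i j y hy)
  -- The potential is cut off between radii r/3 and r/2 to become a global function; it is left
  -- unchanged on the inner ball, which contains the final cube.
  let b : ContDiffBump c := ⟨r / 3, r / 2, by linarith, by linarith⟩
  have hbB : Metric.closedBall c (r / 2) ⊆ e.target :=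
    (Metric.closedBall_subset_closedBall (by linarith)).trans hrt
  obtain ⟨θ, hθ, hθe, -⟩ := exists_lift x₀ (A := fun p => b p.2 * g p)
    (isCompact_closedBall c (r / 2)) (by rwa [extChartAt_target_eq_chartAt])
    ((b.contDiff.comp contDiff_snd).mul hg).contDiffOn (fun t y hy => by
      have h1 : b y = 0 := b.zero_of_le_dist (by
        rw [Metric.mem_closedBall, not_le] at hy
        exact hy.le)
      simp only [h1, zero_mul])
  obtain ⟨R, hR, hRb⟩ := exists_closedCube_subset (Metric.ball_mem_nhds c (by linarith : 0 < r / 3))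
  have hsub : Metric.ball c (r / 3) ⊆ Metric.ball c r := Metric.ball_subset_ball (by linarith)
  refine ⟨R, ⟨hR, fun y hy => hbt (hsub (hRb hy))⟩, θ, hθ, fun t x hx v => ?_⟩
  have hx3 : e x ∈ Metric.ball c (r / 3) := hRb (openCube_subset _ _ hx.2)
  have h1 : (θ t ∘ e.symm : Model n → ℝ) =ᶠ[𝓝 (e x)] fun z => g (t, z) := by
    filter_upwards [Metric.isOpen_ball.mem_nhds hx3] with z hz
    have hz2 : z ∈ e.target := hbt (hsub hz)
    have h2 : b z = 1 := b.one_of_mem_closedBall (Metric.ball_subset_closedBall hz)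
    change θ t (e.symm z) = _
    rw [hθe t _ (e.map_target hz2), extChartAt_eq_chartAt, e.right_inv hz2, h2, one_mul]
  rw [lie_eq_chart v (θ t) hx.1, h1.fderiv_eq, (hgd t _ (hsub hx3)).fderiv]
  have h3 : v x = ∑ j, (chartDeriv x₀ x (v x)) j • E j x := by
    obtain ⟨D, hD⟩ := chartDeriv_isInvertible (n := n) hx.1
    refine D.injective ?_
    have h4 : ∀ u, D u = chartDeriv x₀ x u := fun u => by rw [← hD]; rfl
    rw [map_sum]
    simp only [map_smul, h4]
    have h5 : ∀ j, chartDeriv x₀ x (E j x) = EuclideanSpace.single j (1:ℝ) := fun j => by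
      have := hE1 j (e x) (hsub hx3)
      rwa [e.left_inv hx.1] at this
    simp only [h5]
    conv_lhs => rw [← (EuclideanSpace.basisFun (Fin n) ℝ).sum_repr (chartDeriv x₀ x (v x))]
    simp only [EuclideanSpace.basisFun_apply, EuclideanSpace.basisFun_repr]
  have h6 : contract (α t) v x = ∑ j, (chartDeriv x₀ x (v x)) j * contract (α t) (E j) x := by
    rw [contract_apply]
    conv_lhs => rw [h3]
    rw [map_sum]
    refine Finset.sum_congr rfl fun j _ => ?_
    rw [map_smul]
    rfl
  rw [h6, sum_apply]
  refine Finset.sum_congr rfl fun j _ => ?_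
  rw [hae j t _ (e.map_source hx.1), e.left_inv hx.1]
  exact mul_comm _ _

end LocalPotentials

/-! ### Global potentials, smoothness of lifts and the zero level. -/

section GlobalPotentials

variable {n : ℕ} {M : Type*} [TopologicalSpace M] [ChartedSpace (Model n) M]
  [IsManifold (𝓡 n) ∞ M] [T2Space M] [CompactSpace M] [PreconnectedSpace M]
  [MeasurableSpace M] [BorelSpace M]
  (μ : Measure M) [IsProbabilityMeasure μ] [IsSmoothVolume n μ]

/-- A family of one-forms which annihilate the divergence-free fields has a family of potentials. -/
theorem exists_potential {α : ℝ → Form n M} (hα : SmoothForm α)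
    (h : ∀ t w, divergence μ w = 0 → integ μ (contract (α t) w) = 0) :
    ∃ θ : ℝ → Fun n M, SmoothFun θ ∧ ∀ t, α t = differential (θ t) := by
  have hex : ∀ f : Fun n M, ∃ w, divergence μ w = f - integ μ f • 1 := fun f =>
    exists_divergence_eq_const μ (integ_sub_mean f)
  choose W hW using hex
  -- Since α annihilates divergence-free fields, ∫ α(w) depends only on div w. If α = dθ with θ of
  -- mean zero, this functional is -∫ θ f, so finding θ means representing L.
  set L : ℝ → Fun n M → ℝ := fun t f => integ μ (contract (α t) (W f)) with hLdef
  have hL : ∀ t f w, divergence μ w = f - integ μ f • 1 → integ μ (contract (α t) w) = L t f := by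
    intro t f w hw
    have h1 := h t (w + -W f) (by rw [divergence_add, divergence_neg, hw, hW, add_neg_cancel])
    rw [contract_add_field, contract_neg_field, map_add, map_neg] at h1
    exact eq_of_sub_eq_zero (by rw [sub_eq_add_neg]; exact h1)
  have hLsum : ∀ t {ι : Type _} (s : Finset ι) (f : ι → Fun n M),
      L t (∑ i ∈ s, f i) = ∑ i ∈ s, L t (f i) := by
    intro t ι s f
    rw [← hL t (∑ i ∈ s, f i) (∑ i ∈ s, W (f i)), contract_eq_contractHom, map_sum, map_sum]
    · rfl
    · simp only [divergence_sum, hW, Finset.sum_sub_distrib, map_sum, Finset.sum_smul]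
  have hloc : ∀ x₀ : M, ∃ U : Set M, IsOpen U ∧ x₀ ∈ U ∧ ∃ θ : ℝ → Fun n M, SmoothFun θ ∧
      ∀ t f, (∀ x ∉ U, f x = 0) → L t f = -integ μ (θ t * f) := by
    intro x₀
    obtain ⟨R, hR, θ, hθ, hθα⟩ := exists_local_potential hα
      (fun t => closed_of_annihilates (μ := μ) (h t)) x₀
    obtain ⟨β, hβ0, hβ⟩ := exists_unit_mass (n := n) μ (isOpen_chartCube (n := n) x₀ R) hR.mem
    -- A local potential represents L only on functions of mean zero supported in the cube.
    -- Subtracting this constant makes it correct on the unit mass β too, hence on all functions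
    -- supported there, so a partition of unity can glue.
    have hk : ContDiff ℝ ∞ fun t => L t β + integ μ (θ t * β) :=
      (contDiff_integ (hα.smoothFun (W β))).add (contDiff_integ (hθ.mul (smoothFun_const β)))
    refine ⟨_, isOpen_chartCube (n := n) x₀ R, hR.mem,
      fun t => θ t - (L t β + integ μ (θ t * β)) • 1, hθ.sub ((smoothFun_const 1).smul hk),
      fun t f hf => ?_⟩
    obtain ⟨w, -, hw0, hw⟩ := exists_divergence_eq_cube μ hR hβ0 hβ (smoothFun_const f) fun _ => hf
    have h1 : integ μ (contract (α t) (w 0)) = -integ μ (θ t * (f - integ μ f • β)) := by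
      rw [← hw 0, ← integ_lie]
      congr 1
      ext x
      by_cases hx : x ∈ chartCube n x₀ R
      · exact hθα t x hx (w 0)
      · rw [contract_apply, lie_apply, hw0 0 x hx, map_zero, map_zero]
    have h2 := hL t f (w 0 + integ μ f • W β) (by
      rw [divergence_add, divergence_smul, hw, hW, hβ, one_smul, smul_sub]
      abel)
    have h3 : contract (α t) (integ μ f • W β) = integ μ f • contract (α t) (W β) := by
      rw [contract_eq_contractHom, map_smul, ← contract_eq_contractHom]
    rw [← h2, contract_add_field, map_add, h1, h3, map_smul, mul_sub, sub_mul, map_sub, map_sub,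
      mul_smul_comm, smul_mul_assoc, one_mul, map_smul, map_smul]
    change _ + _ * L t β = _
    simp only [smul_eq_mul]
    ring
  choose U hUo hUx θ hθ hθL using hloc
  obtain ⟨s, ψ, hψU, hψ⟩ := exists_partition (n := n) hUo hUx
  have hψ1 : ∑ i, ψ i = 1 := by
    ext x
    rw [fun_sum_apply]
    exact hψ x
  refine ⟨fun t => ∑ i, ψ i * θ i t, SmoothFun.sum fun i _ => (smoothFun_const _).mul (hθ i),
    fun t => form_ext fun v => eq_of_integral μ fun χ => ?_⟩
  have hLf : ∀ f, L t f = -integ μ ((∑ i, ψ i * θ i t) * f) := by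
    intro f
    have h1 : f = ∑ i, ψ i * f := by rw [← Finset.sum_mul, hψ1, one_mul]
    conv_lhs => rw [h1]
    rw [hLsum, Finset.sum_mul, map_sum, ← Finset.sum_neg_distrib]
    refine Finset.sum_congr rfl fun i _ => ?_
    rw [hθL i t]
    · congr 2
      ring
    · intro x hx
      change ψ i x * f x = 0
      rw [image_eq_zero_of_notMem_tsupport fun hxt => hx (hψU i hxt), zero_mul]
  -- Testing L on the divergence of χ v recovers ∫ χ α(v), which identifies α with the differential
  -- of the glued potential.
  have h2 := hL t (divergence μ (fieldSmul χ v)) (fieldSmul χ v)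
    (by rw [integ_divergence, zero_smul, sub_zero])
  rw [hLf, integ_mul_divergence, neg_neg, contract_fieldSmul] at h2
  rw [h2, contract_differential]

include μ in
lemma coset_eq_of_differential_eq {θ η : Fun n M} (h : differential θ = differential η) :
    coset θ = coset η := by
  refine coset_eq_coset_iff.2 ⟨integ μ (θ - η), (eq_const_of_lie_eq_zero μ (fun v => ?_)).symm⟩
  rw [lie_sub, ← contract_differential, h, contract_differential, sub_self]

/-- Division by ρ turns a smooth image curve into a smooth curve of exact forms; the parametric
potential theorem supplies smooth representatives of the cosets. -/
theorem smooth_iff_reductionMap {c : ℝ → CotangentDens (n := n) μ} :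
    (cotangentDensCurves μ).smooth c ↔ dualCurves.smooth fun t => reductionMap μ (c t) := by
  refine ⟨smooth_reductionMap μ, fun ⟨h1, h2⟩ => ⟨h2, ?_⟩⟩
  have hp : ∀ t x, 0 < (c t).1.1 x := fun t => (c t).1.2.1
  have h3 : SmoothForm fun t => differentialMod (c t).2 := by
    have h4 := h1.scale (SmoothFun.recip h2 hp)
    refine (congrArg SmoothForm (funext fun t => form_ext fun v => ?_)).mp h4
    change contract (scale (recip _ (hp t)) (scale (c t).1.1 _)) v = _
    rw [contract_scale, contract_scale, ← mul_assoc, recip_mul, one_mul]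
  choose η hη using fun t => exists_coset_eq (c t).2
  obtain ⟨θ, hθ, hθd⟩ := exists_potential μ h3 fun t w hw => by
    rw [← hη, differentialMod_coset, contract_differential, integ_lie, hw, mul_zero, map_zero,
      neg_zero]
  refine ⟨θ, hθ, fun t => ?_⟩
  rw [← hη]
  refine coset_eq_of_differential_eq μ ?_
  rw [← hθd, ← hη, differentialMod_coset]

/-- With ρ the Jacobian, ρμ = φ_* μ, so the pushforwards of divergence-free fields are the fields
u/ρ with div u = 0. Zero momentum thus says that m/ρ annihilates the divergence-free fields, hence
is exact. -/
theorem mem_zeroLevel_iff (φ : Dif n M) (m : Form n M) : (φ, m) ∈ zeroLevel μ ↔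
    ∃ p, reductionMap μ p = semidirectMap μ (QuotientGroup.mk φ, m) := by
  have hp := jac_pos μ φ
  have hpush : ∀ (w : VField n M) (f : Fun n M),
      integ μ (jac μ φ * lie (push φ w) (funPush φ f)) = integ μ (lie w f) := fun w f => by
    rw [lie_push_funPush, mul_comm, integ_funPush_mul_jac]
  constructor
  · intro h
    obtain ⟨θ, -, hθ⟩ := exists_potential μ (smoothForm_const (scale (recip (jac μ φ) hp) m))
      fun _ u hu => by
        have hw := push_push_inv φ (fieldSmul (recip (jac μ φ) hp) u)
        have h1 := h (push φ⁻¹ (fieldSmul (recip (jac μ φ) hp) u)) fun f => by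
          change integ μ (lie _ f) = 0
          rw [← hpush, hw, lie_fieldSmul, ← mul_assoc, mul_recip, one_mul, integ_lie, hu, mul_zero,
            map_zero, neg_zero]
        simp only [hw, contract_fieldSmul] at h1
        rw [contract_scale]
        exact h1
    have hρ : jac μ φ ∈ densities (n := n) μ := by
      rw [← orbitMap_mk_eq_jac, ← range_orbitMap μ]
      exact ⟨_, rfl⟩
    refine ⟨(⟨jac μ φ, hρ⟩, coset (θ 0)), Prod.ext (form_ext fun v => ?_)
      (orbitMap_mk_eq_jac μ φ).symm⟩
    change contract (scale (jac μ φ) (differentialMod (coset (θ 0)))) v = contract m v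
    rw [differentialMod_coset, ← hθ 0, contract_scale, contract_scale, ← mul_assoc, mul_recip,
      one_mul]
  · rintro ⟨⟨ρ, q⟩, h⟩ w hw
    obtain ⟨θ, rfl⟩ := exists_coset_eq q
    obtain ⟨h1, h2⟩ := Prod.ext_iff.1 h
    simp only [reductionMap, semidirectMap, differentialMod_coset, orbitMap_mk_eq_jac] at h1 h2
    change integ μ (contract m (push φ w)) = 0
    rw [← h1, h2, contract_scale, contract_differential, ← funPush_push_inv φ θ, hpush]
    exact hw _

end GlobalPotentials

end Madelung

end

open Madelung in
theorem theorem4p8 (n : ℕ) (M : Type*) [TopologicalSpace M] [T2Space M] [CompactSpace M]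
    [ConnectedSpace M] [ChartedSpace (EuclideanSpace ℝ (Fin n)) M] [IsManifold (𝓡 n) ∞ M]
    [MeasurableSpace M] [BorelSpace M]
    (μ : Measure M) [IsProbabilityMeasure μ] [IsSmoothVolume n μ] :
    -- the orbit map embeds `G/N` in `V` as the orbit `Dens(M)` of the constant density `1`
    (Function.Injective (orbitMap (n := n) μ) ∧
      range (orbitMap (n := n) μ) = densities μ ∧
      (∀ (φ : Dif n M) (x : Dif n M ⧸ volumePreserving (n := n) μ),
        orbitMap μ (φ • x) = densityPush μ φ (orbitMap μ x)) ∧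
      (∀ φ : ℝ → Dif n M, SmoothDif φ →
        SmoothFun (fun t => orbitMap μ (QuotientGroup.mk (φ t)))) ∧
      (∀ ρ : ℝ → Fun n M, SmoothFun ρ → (∀ t, ρ t ∈ densities μ) →
        ∃ φ : ℝ → Dif n M, SmoothDif φ ∧ ∀ t, orbitMap μ (QuotientGroup.mk (φ t)) = ρ t)) ∧
    -- Poisson embedding of the quotient `T*G/N` in `𝔰*`
    (Function.Injective (semidirectMap (n := n) μ) ∧
      range (semidirectMap (n := n) μ) = {x | x.2 ∈ densities μ} ∧
      IsPoissonMap μ cotangentGroupCurves (cotangentGroupForm (n := n) μ)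
        (fun z => semidirectMap μ (QuotientGroup.mk z.1, z.2))) ∧
    -- `T*(G/N)` is the zero-momentum symplectic reduction of `T*G` by `N`
    ((∀ (φ : Dif n M) (m : Form n M), (φ, m) ∈ zeroLevel μ ↔
        ∃ p, reductionMap μ p = semidirectMap μ (QuotientGroup.mk φ, m)) ∧
      (∀ (c₁ c₂ : ℝ → Dif n M × Form n M) (p₁ p₂ : ℝ → CotangentDens (n := n) μ)
        (X₁ X₂ : VField n M × Form n M) (Y₁ Y₂ : TangentCotangentDens (n := n) μ),
        cotangentGroupCurves.smooth c₁ → cotangentGroupCurves.smooth c₂ → c₁ 0 = c₂ 0 →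
        (∀ t, reductionMap μ (p₁ t) = semidirectMap μ (QuotientGroup.mk (c₁ t).1, (c₁ t).2)) →
        (∀ t, reductionMap μ (p₂ t) = semidirectMap μ (QuotientGroup.mk (c₂ t).1, (c₂ t).2)) →
        cotangentGroupCurves.velocity c₁ X₁ → cotangentGroupCurves.velocity c₂ X₂ →
        (cotangentDensCurves μ).velocity p₁ Y₁ → (cotangentDensCurves μ).velocity p₂ Y₂ →
        cotangentGroupForm μ (c₁ 0) X₁ X₂ = cotangentDensForm μ Y₁ Y₂)) ∧
    -- Poisson embedding of `T*(G/N)` in `𝔰*` as a symplectic leaf and coadjoint orbit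
    (Function.Injective (reductionMap (n := n) μ) ∧
      (∀ c, (cotangentDensCurves (n := n) μ).smooth c ↔
        dualCurves.smooth (fun t => reductionMap μ (c t))) ∧
      (∀ c Y, (cotangentDensCurves (n := n) μ).smooth c →
        (cotangentDensCurves (n := n) μ).velocity c Y →
        dualCurves.velocity (fun t => reductionMap μ (c t)) 0 → Y.1.1 = 0 ∧ Y.2 = 0) ∧
      IsPoissonMap μ (cotangentDensCurves (n := n) μ) (fun _ => cotangentDensForm μ)
        (reductionMap μ) ∧
      (∀ p, range (reductionMap (n := n) μ) = symplecticLeaf μ (reductionMap μ p)) ∧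
      (∀ p, range (reductionMap (n := n) μ) = coadjointOrbit μ (reductionMap μ p))) ∧
    -- it is the momentum map of the action of `S` on `T*(G/N)`
    ((∀ (g : SGroup n M) (p : CotangentDens (n := n) μ),
        IsCoadjoint μ g (reductionMap μ p) (reductionMap μ (cotangentAct μ g p))) ∧
      (∀ ξ : SAlg n M, ∃ g : ℝ → SGroup n M, GroupCurve g ξ) ∧
      (∀ (ξ : SAlg n M) (p : CotangentDens (n := n) μ), ∃ V,
        IsGenerator (cotangentDensCurves μ) (cotangentAct μ) ξ p V ∧
        IsHamiltonian (cotangentDensCurves μ) (cotangentDensForm μ)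
          (fun q => pairing μ (reductionMap μ q) ξ) p V)) ∧
    -- the inverse Madelung transform is a momentum map, up to scaling by `4`
    ((∀ (g : SGroup n M) (ψ : Wave n M),
        IsCoadjoint μ g (inverseMadelung ψ) (inverseMadelung (waveAct μ g ψ))) ∧
      (∀ (ξ : SAlg n M) (ψ : Wave n M), ∃ V,
        IsGenerator waveCurves (waveAct μ) ξ ψ V ∧
        IsHamiltonian waveCurves (waveForm μ)
          (fun χ => pairing μ (inverseMadelung χ) ξ) ψ ((4 : ℝ) • V)) ∧
      IsPoissonMap μ waveCurves (fun (_ : Wave n M) χ₁ χ₂ => 4 * waveForm μ χ₁ χ₂)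
        inverseMadelung) ∧
    -- it is the inverse of the Madelung transform, and agrees with the map `T*(G/N) → 𝔰*`
    ((∀ (ρ : densities (n := n) μ) (θ : Fun n M),
        inverseMadelung (madelung μ ρ θ) = reductionMap μ (ρ, coset θ)) ∧
      (∀ (ψ : Wave n M) (ρ : densities (n := n) μ) (θ : Fun n M),
        inverseMadelung ψ = reductionMap μ (ρ, coset θ) ↔
          ∃ τ : ℝ, ∀ x, ψ x = Complex.exp (Complex.I * τ) * madelung μ ρ θ x) ∧
      (∀ (g : SGroup n M) (ρ : densities (n := n) μ) (θ : Fun n M),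
        waveAct μ g (madelung μ ρ θ) =
          madelung μ (cotangentAct μ g (ρ, coset θ)).1 (funPush g.right θ - phase g))) := by
  exact ⟨⟨orbitMap_injective μ, range_orbitMap μ, orbitMap_smul μ, fun _ => smoothFun_orbitMap μ,
      fun _ => exists_lift_densities⟩,
    ⟨semidirectMap_injective μ, range_semidirectMap μ, isPoissonMap_semidirectMap μ⟩,
    ⟨mem_zeroLevel_iff μ, fun _ _ _ _ _ _ _ _ => cotangentGroupForm_eq_cotangentDensForm μ⟩,
    ⟨reductionMap_injective μ, fun _ => smooth_iff_reductionMap μ,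
      fun _ _ _ => reductionMap_immersion μ, isPoissonMap_reductionMap μ, symplecticLeaf_eq μ,
      coadjointOrbit_eq μ⟩,
    ⟨isCoadjoint_reductionMap μ, exists_groupCurve, fun ξ p =>
      ⟨_, isGenerator_densGenerator μ ξ p, isHamiltonian_densGenerator μ p ξ⟩⟩,
    ⟨isCoadjoint_inverseMadelung μ, waveAct_momentumMap μ, isPoissonMap_inverseMadelung μ⟩,
    inverseMadelung_madelung μ, inverseMadelung_eq_iff μ, waveAct_madelung μ⟩
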